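/- **Setting.** Write $\Pi(z)=I-\frac{z}{|z|}\otimes\frac{z}{|z|}$, $a(z)=\frac{k(|z|)}{|z|}\Pi(z)$, $\sqrt{a(z)}=\sqrt{\tfrac{k(|z|)}{|z|}}\,\Pi(z)$ for $z\in\mathbb R^3\setminus\{0\}$, where $k\in C^1((0,\infty))$ is positive and nondecreasing, $k(r)/r$ is nonincreasing, and $k'(|z|)/|z|^2\in L^{1+\iota}(B_1)$ for some $\iota>0$. Let $B_r(v)$ be the open ball of $\mathbb R^3$, $Q_r(t,v)=(t-r^2,t]\times B_r(v)$, $B_r=B_r(0)$, $Q_r=Q_r(0,0)$, $\ln_+=\max(\ln,0)$ and $h_+^\kappa(r)=r\ln_+(r/\kappa)-(r-\kappa)_+$. Gradients $\nabla_v$ are weak gradients, and $\nabla_v\ln f=\nabla_vf/f$. Let $0<m_0<M_0$, $E_0,H_0>0$, and let $f_{\rm in}:\mathbb R^3\to[0,\infty)$ be measurable with $$m_0\le\int f_{\rm in}\,dv\le M_0,\qquad \int|v|^2f_{\rm in}\,dv\le E_0,\qquad \int f_{\rm in}|\ln f_{\rm in}|\,dv\le H_0 .\tag{1}$$ An *H-solution*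 on $[0,T)\times\mathbb R^3$ of the Landau equation $\partial_tf=\nabla_v\cdot\int a(v-w)\big(f(t,w)\nabla_vf(t,v)-f(t,v)\nabla_wf(t,w)\big)dw$ with initial condition $f_{\rm in}$ is a function $f\ge0$ in $C([0,T);\mathcal D'(\mathbb R^3))\cap L^1((0,T);L^1(\mathbb R^3,\frac{dv}{1+|v|}))$, whose weak gradient $\nabla_vf$ is a locally integrable function on $(0,T)\times\mathbb R^3$, such that $F(t,v,w)=\sqrt{a(v-w)}\sqrt{f(t,v)f(t,w)}\,(\nabla_v\ln f(t,v)-\nabla_w\ln f(t,w))$ belongs to $L^2((0,T)\times\mathbb R^3\times\mathbb R^3)$; for a.e. $t$ the mass, momentum and energy of $f(t,\cdot)$ equal those of $f_{\rm in}$ and $\int f\ln f(t,v)\,dv\le\int f_{\rm in}\ln f_{\rm in}\,dv$; and, for all $\phi\in C^1_c([0,T)\times\mathbb R^3)$, $$\int f_{\rm in}\phi(0,\cdot)\,dv+\int_0^T\!\!\int f\,\partial_t\phi\,dv\,dt=\tfrac12\int_0^T\!\!\iint F\cdot\sqrt{a(v-w)}\sqrt{f(t,v)f(t,w)}\,(\nabla_v\phi(t,v)-\nabla_w\phi(t,w))\,dv\,dw\,dt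 .$$ An H-solution is a *suitable weak solution* if (i) there is $I_0>0$ such that $\|F\|_{L^2}+\|F_+^\kappa\|_{L^2}\le I_0$ for all rational $\kappa\ge1$, where $F_+^\kappa$ is obtained from $F$ by replacing $\nabla\ln f$ with $\nabla\ln_+(f/\kappa)$; and (ii) for all $\Psi\in C_c^\infty((0,T)\times\mathbb R^3)$ and rational $\kappa\ge1$ there is a negligible set $\mathcal N$ such that, with $\varphi=\Psi^2$ and $A(t,v)=\int a(v-w)f(t,w)\,dw$, for all $t_1<t_2$ in $(0,T)\setminus\mathcal N$, $$\int h_+^\kappa(f)\varphi(t_2,v)\,dv\le\int h_+^\kappa(f)\varphi(t_1,v)\,dv+\int_{t_1}^{t_2}\!\!\int h_+^\kappa(f)\,\partial_t\varphi\,dv\,dt-\int_{t_1}^{t_2}\!\!\int\big(A\nabla_vf-f\,\nabla_v\!\cdot\!A\big)\cdot\Big(\varphi\tfrac{\nabla_v(f-\kappa)_+}{f}+\ln_+\!\big(\tfrac f\kappa\big)\nabla_v\varphi\Big)dv\,dt .$$ Because $a$ is singular at $0$, the last integral is understood as the (existing) limit as $n\to\infty$ of the same integrals with $a$ replaced by $a_n(z)=X(n|z|)\,a(z)$,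 where $X$ is a smooth nondecreasing cutoff vanishing on $(-\infty,\frac12]$ and equal to $1$ on $[1,\infty)$. **Lemma (De Giorgi).** Let $\delta_0\in(0,1)$ and $R_0>0$. There exists $\eta_{\rm DG}\in(0,1)$, depending only on $m_0,M_0,E_0,H_0,|v_0|,\delta_0,R_0$ and the values $k(\delta_0),k(1),k(R_0)$, with the following property. Let $f_{\rm in}$ satisfy (1), let $f$ be a suitable weak solution on $[0,T)\times\mathbb R^3$ with initial condition $f_{\rm in}$, let $t_0\in(0,T)$, $v_0\in\mathbb R^3$, let $\varepsilon\in(0,1)$ satisfy $4\varepsilon^2\le t_0$, and let $$f_\varepsilon(t,v)=\varepsilon^2f(t_0+\varepsilon^2t,v_0+\varepsilon v).$$ Assume that, for some $Z_\varepsilon\ge1$, $$\operatorname*{ess\,sup}_{Q_1}\Big(f_\varepsilon*_v\frac{k(\varepsilon|\cdot|)\mathbf 1_{B_1^c}}{|\cdot|}\Big)\le Z_\varepsilon .$$ If $$\operatorname*{ess\,sup}_{t\in(-4,0]}\int_{B_2}(f_\varepsilon-1)_+(t,v)\,dv+\iint_{Q_2}\big|\nabla_v\sqrt{f_\varepsilon}\big|^2\mathbf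 1_{\{f_\varepsilon\ge1\}}\,dt\,dv\le\eta_{\rm DG}\,Z_\varepsilon^{-3/2},$$ then $f_\varepsilon\le2$ a.e. in $Q_{1/2}$. -/

import Mathlib

open MeasureTheory Set Filter Topology
open scoped ContDiff ENNReal RealInnerProductSpace Gradient

noncomputable section

namespace Landau

/-- The velocity space `ℝ³` with its Euclidean structure. -/
abbrev E : Type := EuclideanSpace ℝ (Fin 3)

/-! ### The collision kernel -/

/-- The assumptions on the radial profile `k` of the collision kernel: `k` is `C¹` on `(0,∞)`,
positive, nondecreasing, `k(r)/r` is nonincreasing, and `k'(|z|)/|z|²` belongs to `L^{1+ι}(B₁)` for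
some `ι > 0`. -/
structure IsCollisionKernel (k : ℝ → ℝ) : Prop where
  contDiffOn : ContDiffOn ℝ 1 k (Ioi 0)
  pos : ∀ r, 0 < r → 0 < k r
  mono : MonotoneOn k (Ioi 0)
  anti : AntitoneOn (fun r => k r / r) (Ioi 0)
  integrability : ∃ ι : ℝ, 0 < ι ∧
    MemLp (fun z : E => deriv k ‖z‖ / ‖z‖ ^ 2) (ENNReal.ofReal (1 + ι))
      (volume.restrict (Metric.ball (0 : E) 1))

/-- `Π(z) = I - (z/|z|) ⊗ (z/|z|)`, the orthogonal projection on `(ℝ z)^⊥` (for `z ≠ 0`). -/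
def proj (z : E) : E →L[ℝ] E :=
  ContinuousLinearMap.id ℝ E - (‖z‖ ^ 2)⁻¹ • (innerSL ℝ z).smulRight z

/-- `a(z) = (k(|z|)/|z|) Π(z)`. -/
def kernel (k : ℝ → ℝ) (z : E) : E →L[ℝ] E := (k ‖z‖ / ‖z‖) • proj z

/-- `√a(z) = √(k(|z|)/|z|) Π(z)`, the square root of the matrix `a(z)`. -/
def kernelSqrt (k : ℝ → ℝ) (z : E) : E →L[ℝ] E := √(k ‖z‖ / ‖z‖) • proj z

/-- A smooth cutoff `X : ℝ → [0,1]`, nondecreasing, equal to `1` on `[1,∞)` and to `0` on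
`(-∞,1/2]`. -/
def cutoff (r : ℝ) : ℝ := Real.smoothTransition (2 * r - 1)

/-- The kernel with its singularity at the origin removed: `a_n(z) = X(n|z|) a(z)`. -/
def kernelCut (k : ℝ → ℝ) (n : ℕ) (z : E) : E →L[ℝ] E := cutoff (n * ‖z‖) • kernel k z

/-! ### Weak gradient in velocity -/

/-- `G` is the gradient `∇_v u` of the function `u` in the sense of distributions on `I × ℝ³`, both
being locally integrable there. -/
def HasWeakGradV (I : Set ℝ) (u : ℝ → E → ℝ) (G : ℝ → E → E) : Prop :=
  LocallyIntegrableOn (fun p : ℝ × E => u p.1 p.2) (I ×ˢ univ) ∧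
  LocallyIntegrableOn (fun p : ℝ × E => G p.1 p.2) (I ×ˢ univ) ∧
  ∀ φ : ℝ × E → ℝ, ContDiff ℝ ∞ φ → HasCompactSupport φ → tsupport φ ⊆ I ×ˢ univ →
    ∫ p in I ×ˢ univ, u p.1 p.2 • gradient (fun v => φ (p.1, v)) p.2
      = - ∫ p in I ×ˢ univ, φ p • G p.1 p.2

open Classical in
/-- The weak gradient `∇_v u` on `I × ℝ³` (determined a.e.; only meaningful if it exists). -/
def gradV (I : Set ℝ) (u : ℝ → E → ℝ) : ℝ → E → E :=
  if h : ∃ G, HasWeakGradV I u G then h.choose else 0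

/-! ### Truncations of the entropy -/

/-- `ln₊ z = max (ln z) 0`. -/
def lnPlus (z : ℝ) : ℝ := max (Real.log z) 0

/-- `h₊^κ(r) = κ h₊(r/κ) = r ln₊(r/κ) - (r-κ)₊`. -/
def hPlus (κ r : ℝ) : ℝ := r * lnPlus (r / κ) - max (r - κ) 0

/-! ### H-solutions -/

/-- `√a(v-w) √(f(t,v) f(t,w)) (L(t,v) - L(t,w))`, to be used with `L = ∇_v ln f` and
`L = ∇_v ln₊(f/κ)`. -/
def dissipField (k : ℝ → ℝ) (f : ℝ → E → ℝ) (L : ℝ → E → E) (q : ℝ × E × E) : E :=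
  kernelSqrt k (q.2.1 - q.2.2)
    (√(f q.1 q.2.1 * f q.1 q.2.2) • (L q.1 q.2.1 - L q.1 q.2.2))

/-- `∇_v ln f = ∇_v f / f` on `(0,T) × ℝ³` (with value `0` where `f` vanishes). -/
def gradLog (T : ℝ) (f : ℝ → E → ℝ) : ℝ → E → E :=
  fun t v => (f t v)⁻¹ • gradV (Ioo 0 T) f t v

/-- `F(t,v,w) = √a(v-w) √(f(t,v)f(t,w)) (∇_v ln f(t,v) - ∇_w ln f(t,w))`. -/
def dissipF (k : ℝ → ℝ) (T : ℝ) (f : ℝ → E → ℝ) : ℝ × E × E → E :=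
  dissipField k f (gradLog T f)

/-- `F₊^κ(t,v,w) = √a(v-w) √(f(t,v)f(t,w)) (∇_v ln₊(f/κ)(t,v) - ∇_w ln₊(f/κ)(t,w))`. -/
def dissipFPlus (k : ℝ → ℝ) (T κ : ℝ) (f : ℝ → E → ℝ) : ℝ × E × E → E :=
  dissipField k f (gradV (Ioo 0 T) fun t v => lnPlus (f t v / κ))

/-- H-solutions on `[0,T) × ℝ³` of the Landau equation `∂_t f = Q(f,f)` with collision kernel
`a(z) = (k(|z|)/|z|) Π(z)` and initial condition `fin`. -/
structure IsHSolution (k : ℝ → ℝ) (T : ℝ) (fin : E → ℝ) (f : ℝ → E → ℝ) : Prop where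
  nonneg : ∀ t ∈ Ico 0 T, ∀ v, 0 ≤ f t v
  /-- `f ∈ C([0,T); 𝓓'(ℝ³))`. -/
  locallyIntegrable : ∀ t ∈ Ico 0 T, LocallyIntegrable (f t)
  continuous : ∀ ψ : E → ℝ, ContDiff ℝ ∞ ψ → HasCompactSupport ψ →
    ContinuousOn (fun t => ∫ v, f t v * ψ v) (Ico 0 T)
  /-- `f ∈ L¹((0,T); L¹(ℝ³, dv/(1+|v|)))`. -/
  integrable : IntegrableOn (fun p : ℝ × E => f p.1 p.2 / (1 + ‖p.2‖)) (Ioo 0 T ×ˢ univ)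
  /-- The gradient `∇_v f` entering the definition of `F` exists. -/
  hasGrad : ∃ G, HasWeakGradV (Ioo 0 T) f G
  /-- `F ∈ L²`. -/
  dissipation : MemLp (dissipF k T f) 2 (volume.restrict (Ioo 0 T ×ˢ (univ ×ˢ univ)))
  /-- Conservation of mass, momentum and energy. -/
  conservation : ∀ᵐ t ∂(volume.restrict (Ioo 0 T)),
    Integrable (f t) ∧ Integrable (fun v => f t v * ‖v‖ ^ 2) ∧
    ∫ v, f t v = ∫ v, fin v ∧
    ∫ v, f t v • v = ∫ v, fin v • v ∧
    ∫ v, f t v * ‖v‖ ^ 2 = ∫ v, fin v * ‖v‖ ^ 2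
  /-- The entropy does not exceed its initial value. -/
  entropy : ∀ᵐ t ∂(volume.restrict (Ioo 0 T)),
    Integrable (fun v => f t v * Real.log (f t v)) ∧
    ∫ v, f t v * Real.log (f t v) ≤ ∫ v, fin v * Real.log (fin v)
  /-- The weak formulation, for all `φ ∈ C¹_c([0,T) × ℝ³)`. -/
  weak : ∀ φ : ℝ × E → ℝ, ContDiff ℝ 1 φ → HasCompactSupport φ → tsupport φ ⊆ Iio T ×ˢ univ →
    (∫ v, fin v * φ (0, v)) +
        ∫ p in Ioo 0 T ×ˢ univ, f p.1 p.2 * deriv (fun s => φ (s, p.2)) p.1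
      = (1 / 2) * ∫ q in Ioo 0 T ×ˢ (univ ×ˢ univ),
          ⟪dissipF k T f q, kernelSqrt k (q.2.1 - q.2.2)
            (√(f q.1 q.2.1 * f q.1 q.2.2) •
              (gradient (fun v => φ (q.1, v)) q.2.1 - gradient (fun v => φ (q.1, v)) q.2.2))⟫

/-! ### Suitable weak solutions -/

/-- `A_n(t,v) = ∫ a_n(v-w) f(t,w) dw`. -/
def diffMatrix (k : ℝ → ℝ) (n : ℕ) (f : ℝ → E → ℝ) (t : ℝ) (v : E) : E →L[ℝ] E :=
  ∫ w, f t w • kernelCut k n (v - w)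

/-- The divergence `∇_v · B`, i.e. `(∇·B)_j = ∑ᵢ ∂ᵢ B_{ji}`, of a matrix field `B`. -/
def matDiv (B : E → E →L[ℝ] E) (v : E) : E :=
  ∑ i : Fin 3, fderiv ℝ (fun u => B u (EuclideanSpace.single i 1)) v (EuclideanSpace.single i 1)

/-- The integral
`∬_{[t₁,t₂]×ℝ³} (A_n∇_v f - f ∇_v·A_n)·(φ ∇_v(f-κ)₊/f + ln₊(f/κ) ∇_v φ) dt dv`. -/
def entropyFlux (k : ℝ → ℝ) (T κ : ℝ) (f : ℝ → E → ℝ) (φ : ℝ × E → ℝ) (t₁ t₂ : ℝ) (n : ℕ) : ℝ :=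
  ∫ p in Icc t₁ t₂ ×ˢ (univ : Set E),
    ⟪diffMatrix k n f p.1 p.2 (gradV (Ioo 0 T) f p.1 p.2)
        - f p.1 p.2 • matDiv (diffMatrix k n f p.1) p.2,
      φ p • ((f p.1 p.2)⁻¹ • gradV (Ioo 0 T) (fun t v => max (f t v - κ) 0) p.1 p.2)
        + lnPlus (f p.1 p.2 / κ) • gradient (fun v => φ (p.1, v)) p.2⟫

/-- Suitable weak solutions: H-solutions with a bound on the (truncated) entropy dissipation,
uniform in the truncation level, that satisfy the local truncated entropy inequalities.
The kernel `a` is singular at the origin: in the last integral of the local truncated entropy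
inequality, the kernel is understood as the limit of its truncations `a_n(z) = X(n|z|) a(z)`. -/
structure IsSuitable (k : ℝ → ℝ) (T : ℝ) (fin : E → ℝ) (f : ℝ → E → ℝ) : Prop
    extends IsHSolution k T fin f where
  dissipationBound : ∃ I₀ : ℝ, 0 < I₀ ∧ ∀ κ : ℚ, 1 ≤ κ →
    eLpNorm (dissipF k T f) 2 (volume.restrict (Ioo 0 T ×ˢ (univ ×ˢ univ))) +
      eLpNorm (dissipFPlus k T κ f) 2 (volume.restrict (Ioo 0 T ×ˢ (univ ×ˢ univ)))
      ≤ ENNReal.ofReal I₀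
  localEntropy : ∀ Ψ : ℝ × E → ℝ, ContDiff ℝ ∞ Ψ → HasCompactSupport Ψ →
    tsupport Ψ ⊆ Ioo 0 T ×ˢ univ → ∀ κ : ℚ, 1 ≤ κ →
    ∃ N : Set ℝ, volume N = 0 ∧ ∀ t₁ ∈ Ioo 0 T \ N, ∀ t₂ ∈ Ioo 0 T \ N, t₁ < t₂ →
      ∃ D : ℝ, Tendsto (entropyFlux k T κ f (fun p => Ψ p ^ 2) t₁ t₂) atTop (𝓝 D) ∧
        ∫ v, hPlus κ (f t₂ v) * Ψ (t₂, v) ^ 2 ≤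
          (∫ v, hPlus κ (f t₁ v) * Ψ (t₁, v) ^ 2)
          + (∫ p in Icc t₁ t₂ ×ˢ (univ : Set E),
              hPlus κ (f p.1 p.2) * deriv (fun s => Ψ (s, p.2) ^ 2) p.1)
          - D

/-! ### Initial data, scaling and parabolic cylinders -/

/-- Bounds on the mass, energy and entropy of the measurable function `fin ≥ 0`. -/
structure HydroBounds (m₀ M₀ E₀ H₀ : ℝ) (fin : E → ℝ) : Prop where
  measurable : Measurable fin
  nonneg : ∀ v, 0 ≤ fin v
  integrable_mass : Integrable fin
  le_mass : m₀ ≤ ∫ v, fin v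
  mass_le : ∫ v, fin v ≤ M₀
  integrable_energy : Integrable fun v => ‖v‖ ^ 2 * fin v
  energy_le : ∫ v, ‖v‖ ^ 2 * fin v ≤ E₀
  integrable_entropy : Integrable fun v => fin v * |Real.log (fin v)|
  entropy_le : ∫ v, fin v * |Real.log (fin v)| ≤ H₀

/-- The parabolic cylinder `Q_r(t,v) = (t-r²,t] × B_r(v)`. -/
def cylinder (r t : ℝ) (v : E) : Set (ℝ × E) := Ioc (t - r ^ 2) t ×ˢ Metric.ball v r

/-- The scaled function `f_ε(t,v) = ε² f(t₀+ε²t, v₀+εv)`. -/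
def scaled (ε t₀ : ℝ) (v₀ : E) (f : ℝ → E → ℝ) (t : ℝ) (v : E) : ℝ :=
  ε ^ 2 * f (t₀ + ε ^ 2 * t) (v₀ + ε • v)

/-- The times `t` such that `t₀ + ε² t ∈ (0,T)`. -/
def scaledTimes (ε t₀ T : ℝ) : Set ℝ := {t | t₀ + ε ^ 2 * t ∈ Ioo 0 T}

/-- The long-range interaction term `(g(t,·) ∗_v (k(ε|·|) 1_{B₁ᶜ} / |·|))(v)`. -/
def longRange (k : ℝ → ℝ) (ε : ℝ) (g : ℝ → E → ℝ) (p : ℝ × E) : ℝ≥0∞ :=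
  ∫⁻ w, ENNReal.ofReal
    (g p.1 w * (Metric.ball (0 : E) 1)ᶜ.indicator (fun z => k (ε * ‖z‖) / ‖z‖) (p.2 - w))

/-- `ess sup_{t ∈ (-4,0]} ∫_{B₂} (g-1)₊ dv + ∬_{Q₂} |∇_v √g|² 1_{g ≥ 1} dt dv`, for a function `g`
defined on `I × ℝ³`. -/
def localQuantity (I : Set ℝ) (g : ℝ → E → ℝ) : ℝ≥0∞ :=
  essSup (fun t => ∫⁻ v in Metric.ball (0 : E) 2, ENNReal.ofReal (max (g t v - 1) 0))
    (volume.restrict (Ioc (-4 : ℝ) 0))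
  + ∫⁻ p in cylinder 2 0 0,
      {p : ℝ × E | 1 ≤ g p.1 p.2}.indicator
        (fun p => ‖gradV I (fun t v => √(g t v)) p.1 p.2‖ₑ ^ 2) p

end Landau

end

set_option linter.unusedSectionVars false

/-! The argument is a De Giorgi iteration for g = f_ε on the cylinders Q_r, with radii decreasing
from 1 to 1/2 and levels λ increasing from 1 to 2. The quantity followed is a common bound U
(`LevelBound`) for the essential supremum in time of ∫(g-λ)₊ and for the Fisher information ∬
1_{g>λ}|∇g|²/g. One step (`exists_step`) gives up 2θ in radius and 4θ in level and replaces U by K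
θ⁻¹³ W U^{5/3}, where W is comparable with Z. As 5/3 > 1, a geometric choice of θ drives U to 0 once
W U^{2/3} is small at the start. This is where the power Z^{-3/2} comes from. A vanishing U at the
limiting level 2 and radius 1/2 is the conclusion.

The exponent 5/3 is a Sobolev gain (`exists_gain`). The function (√g-√λ)₊ is bounded by U in L^∞_t
L²_v and its gradient in L²; in dimension three this gives L^{10/3}. Above a slightly larger level
g^{5/3} is comparable, up to powers of θ, with the 10/3 power of that function, so that ∬ g^{5/3} is
at most a power of 1/θ times U^{5/3}.

The local truncated entropy inequality must then bound the new mass and Fisher information by S = ∬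
g^{5/3} and by products of order U². All rests on a lower bound for the entropy flux at a fixed time
(`exists_fluxDensity_lower`). The coefficient A = a * g is itself an unknown and a is singular at 0,
so A has no a priori bound. The kernel is cut at a distance δ proportional to θ.

The far part is bounded through the long-range hypothesis and the local mass
(`IsProfile.integral_cutW_le`). It is also uniformly elliptic: bounds on mass, energy and entropy
prevent concentration near a line (`exists_coercive_set`, `coercive_of_mass`). Its drift is
integrated by parts and costs only powers of 1/δ times S.

In the near part, the low values of g have a bounded convolution with the kernel, because |z|⁻² is
locally integrable. Their diffusion is nonnegative up to lower order terms and their drift is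
absorbed by the ellipticity.

For the high values, the drift is integrated by parts inside the convolution. Diffusion and drift
then combine into a double integral which is symmetrized in (v, w). By `quadratic_lower_bound` the
integrand is nonnegative up to errors in which differences of the cutoff at v and w compensate the
singularity 1/|v-w|. What remains is lower order, or a product of the mass and the Fisher
information of the high values, at most of order U² (`interaction_lower`). No bound depends on the
regularization parameter n of the kernel, so the limit n → ∞ is harmless.

Two preparations are needed. First, rescaling turns the equation for f into the same one for g with
profile k(ε·) and level ε²κ (`IsHSolution.entropyFlux_rescale`); its properties are collected in
`IsScaledSolution`. Second, the hypothesis speaks of ∇√g, and the chosen weak gradient is meaningful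
only if √f is weakly differentiable. This follows from the L² bound on F: it controls the projection
of the difference of logarithmic gradients, and averaging over w in a set of positive mass away from
a line recovers the whole gradient (`exists_gradient_sqrt_le`, `IsHSolution.hasWeakGradV_sqrt`). -/

noncomputable section

namespace Landau

/-! ### Mollification -/

section Mollify

variable {F : Type*} [NormedAddCommGroup F] [NormedSpace ℝ F] [CompleteSpace F]

/-- A sequence of bump functions concentrating at the origin. -/
def moll (n : ℕ) : ContDiffBump (0 : E) :=
  ⟨1 / (2 * ((n : ℝ) + 1)), 1 / ((n : ℝ) + 1), by positivity, by
    apply one_div_lt_one_div_of_lt <;> linarith [Nat.cast_nonneg (α := ℝ) n]⟩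

/-- The standard mollifier. -/
def molK (n : ℕ) : E → ℝ := (moll n).normed volume

def mollify (n : ℕ) (u : E → F) (x : E) : F := ∫ y, molK n (x - y) • u y

lemma moll_rOut_tendsto : Tendsto (fun n => (moll n).rOut) atTop (𝓝 0) := by
  change Tendsto (fun n : ℕ => 1 / ((n : ℝ) + 1)) atTop (𝓝 0)
  exact tendsto_one_div_add_atTop_nhds_zero_nat

lemma moll_rOut_le (n : ℕ) : (moll n).rOut ≤ 1 := by
  change 1 / ((n : ℝ) + 1) ≤ 1
  rw [div_le_one (by positivity)]
  linarith [Nat.cast_nonneg (α := ℝ) n]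

lemma molK_nonneg (n : ℕ) (x : E) : 0 ≤ molK n x := (moll n).nonneg_normed x

lemma molK_contDiff (n : ℕ) : ContDiff ℝ ∞ (molK n) := (moll n).contDiff_normed

lemma molK_hasCompactSupport (n : ℕ) : HasCompactSupport (molK n) :=
  (moll n).hasCompactSupport_normed

lemma integral_molK (n : ℕ) : ∫ x, molK n x = 1 := (moll n).integral_normed

lemma molK_eq_zero {n : ℕ} {x : E} (hx : 1 ≤ ‖x‖) : molK n x = 0 := by
  have : x ∉ Function.support (molK n) := by
    unfold molK
    rw [(moll n).support_normed_eq]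
    simp only [Metric.mem_ball, dist_zero_right, not_lt]
    exact (moll_rOut_le n).trans hx
  simpa using this

lemma mollify_eq_convolution (n : ℕ) (u : E → F) :
    mollify n u = MeasureTheory.convolution (molK n) u (ContinuousLinearMap.lsmul ℝ ℝ) volume := by
  funext x
  rw [convolution_lsmul_swap]
  rfl

lemma mollify_contDiff (n : ℕ) {u : E → F} (hu : LocallyIntegrable u) :
    ContDiff ℝ ∞ (mollify n u) := by
  rw [mollify_eq_convolution]
  exact (molK_hasCompactSupport n).contDiff_convolution_left _ (molK_contDiff n) hu

lemma mollify_ae_tendsto {u : E → F} (hu : LocallyIntegrable u) :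
    ∀ᵐ x, Tendsto (fun n => mollify n u x) atTop (𝓝 (u x)) := by
  -- The outer radius of the bumps is twice the inner one, uniformly in n. This doubling ratio gives
  -- convergence at Lebesgue points.
  have := ContDiffBump.ae_convolution_tendsto_right_of_locallyIntegrable (φ := moll) (K := 2)
    moll_rOut_tendsto (Eventually.of_forall fun n => by
      change 1 / ((n : ℝ) + 1) ≤ 2 * (1 / (2 * ((n : ℝ) + 1)))
      apply le_of_eq
      field_simp) hu
  filter_upwards [this] with x hx
  simp only [mollify_eq_convolution]
  exact hx

lemma lintegral_molK (n : ℕ) (x : E) : ∫⁻ y, ‖molK n (x - y)‖ₑ = 1 := by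
  have h : ∫⁻ y, ‖molK n (x - y)‖ₑ = ∫⁻ y, ‖molK n y‖ₑ :=
    lintegral_sub_left_eq_self (fun y => ‖molK n y‖ₑ) x
  rw [h, ← ofReal_integral_norm_eq_lintegral_enorm]
  · simp only [Real.norm_of_nonneg (molK_nonneg n _), integral_molK, ENNReal.ofReal_one]
  · exact (molK_contDiff n).continuous.integrable_of_hasCompactSupport (molK_hasCompactSupport n)

lemma lintegral_molK' (n : ℕ) (y : E) : ∫⁻ x, ‖molK n (x - y)‖ₑ = 1 := by
  have h : ∫⁻ x, ‖molK n (x - y)‖ₑ = ∫⁻ y, ‖molK n y‖ₑ :=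
    lintegral_sub_right_eq_self (fun y => ‖molK n y‖ₑ) y
  rw [h, ← lintegral_molK n 0, ← lintegral_sub_left_eq_self (fun y => ‖molK n y‖ₑ) 0]

lemma molK_enorm_measurable (n : ℕ) : Measurable fun p : E × E => ‖molK n (p.1 - p.2)‖ₑ := by
  have := (molK_contDiff n).continuous
  exact (Continuous.measurable (by fun_prop))

lemma enorm_mollify_le (n : ℕ) (u : E → F) (x : E) :
    ‖mollify n u x‖ₑ ≤ ∫⁻ y, ‖molK n (x - y)‖ₑ * ‖u y‖ₑ := by
  refine (enorm_integral_le_lintegral_enorm _).trans (le_of_eq ?_)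
  simp only [enorm_smul]

/-- Jensen's inequality for the probability density y ↦ K(x-y), obtained from Cauchy–Schwarz by
splitting K = K^{1/2} K^{1/2}. -/
lemma enorm_mollify_sq_le (n : ℕ) {u : E → F} (hu : AEStronglyMeasurable u) (x : E) :
    ‖mollify n u x‖ₑ ^ 2 ≤ ∫⁻ y, ‖molK n (x - y)‖ₑ * ‖u y‖ₑ ^ 2 := by
  have hm : AEMeasurable (fun y => ‖molK n (x - y)‖ₑ) :=
    ((molK_enorm_measurable n).comp (measurable_const.prodMk measurable_id)).aemeasurable
  have h1 := enorm_mollify_le n u x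
  have h2 := ENNReal.lintegral_mul_le_Lp_mul_Lq volume (p := 2) (q := 2)
    (Real.HolderConjugate.two_two) (f := fun y => ‖molK n (x - y)‖ₑ ^ (1 / 2 : ℝ))
    (g := fun y => ‖molK n (x - y)‖ₑ ^ (1 / 2 : ℝ) * ‖u y‖ₑ)
    (hm.pow_const _) ((hm.pow_const _).mul hu.enorm)
  have h3 : ∀ y, ((fun y => ‖molK n (x - y)‖ₑ ^ (1 / 2 : ℝ)) * fun y =>
      ‖molK n (x - y)‖ₑ ^ (1 / 2 : ℝ) * ‖u y‖ₑ) y = ‖molK n (x - y)‖ₑ * ‖u y‖ₑ := by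
    intro y
    simp only [Pi.mul_apply]
    rw [← mul_assoc, ← ENNReal.rpow_add_of_nonneg _ _ (by norm_num) (by norm_num)]
    norm_num
  simp only [h3] at h2
  have h4 : ∀ y, (‖molK n (x - y)‖ₑ ^ (1 / 2 : ℝ)) ^ (2 : ℝ) = ‖molK n (x - y)‖ₑ := by
    intro y
    rw [← ENNReal.rpow_mul]; norm_num
  simp only [ENNReal.mul_rpow_of_nonneg _ _ (show (0 : ℝ) ≤ 2 by norm_num), h4, lintegral_molK,
    ENNReal.one_rpow, one_mul] at h2
  calc ‖mollify n u x‖ₑ ^ 2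
      ≤ ((∫⁻ y, ‖molK n (x - y)‖ₑ * ‖u y‖ₑ ^ (2 : ℝ)) ^ (1 / 2 : ℝ)) ^ 2 := by
        gcongr; exact h1.trans h2
    _ = ∫⁻ y, ‖molK n (x - y)‖ₑ * ‖u y‖ₑ ^ 2 := by
        rw [← ENNReal.rpow_natCast, ← ENNReal.rpow_mul]
        norm_num

lemma lintegral_molK_mul (n : ℕ) {h : E → ℝ≥0∞} (hh : AEMeasurable h) :
    ∫⁻ x, ∫⁻ y, ‖molK n (x - y)‖ₑ * h y = ∫⁻ y, h y := by
  rw [lintegral_lintegral_swap]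
  · refine lintegral_congr fun y => ?_
    rw [lintegral_mul_const'' _ ?_, lintegral_molK', one_mul]
    exact ((molK_enorm_measurable n).comp (measurable_id.prodMk measurable_const)).aemeasurable
  · exact (molK_enorm_measurable n).aemeasurable.mul hh.comp_snd

lemma lintegral_enorm_mollify_le (n : ℕ) {u : E → F} (hu : AEStronglyMeasurable u) :
    ∫⁻ x, ‖mollify n u x‖ₑ ≤ ∫⁻ y, ‖u y‖ₑ := by
  rw [← lintegral_molK_mul n hu.enorm]
  exact lintegral_mono fun x => enorm_mollify_le n u x

lemma lintegral_enorm_mollify_sq_le (n : ℕ) {u : E → F} (hu : AEStronglyMeasurable u) :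
    ∫⁻ x, ‖mollify n u x‖ₑ ^ 2 ≤ ∫⁻ y, ‖u y‖ₑ ^ 2 := by
  rw [← lintegral_molK_mul n (hu.enorm.pow_const 2)]
  exact lintegral_mono fun x => enorm_mollify_sq_le n hu x

/-- A Scheffé argument: convergence holds a.e. and the L¹ norm does not increase, so Fatou's lemma
applied to |u| + |uₙ| - |uₙ - u| ≥ 0 forces ∫|uₙ - u| → 0. -/
lemma mollify_tendsto_of_integrable {u : E → F} (hu : Integrable u) :
    Tendsto (fun n => ∫⁻ x, ‖mollify n u x - u x‖ₑ) atTop (𝓝 0) := by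
  have hm : ∀ n, AEStronglyMeasurable (mollify n u) := fun n =>
    (mollify_contDiff n hu.locallyIntegrable).continuous.aestronglyMeasurable
  have hfin : ∫⁻ x, ‖u x‖ₑ ≠ ⊤ := hu.2.ne
  set I := ∫⁻ x, ‖u x‖ₑ
  let h : ℕ → E → ℝ≥0∞ := fun n x => ‖u x‖ₑ + ‖mollify n u x‖ₑ - ‖mollify n u x - u x‖ₑ
  have hmeas : ∀ n, AEMeasurable (h n) := fun n =>
    (hu.1.enorm.add (hm n).enorm).sub ((hm n).sub hu.1).enorm
  have hsum : ∀ n, (∫⁻ x, h n x) + ∫⁻ x, ‖mollify n u x - u x‖ₑ ≤ 2 * I := by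
    intro n
    rw [← lintegral_add_left' (hmeas n)]
    calc ∫⁻ x, (h n x + ‖mollify n u x - u x‖ₑ) = ∫⁻ x, (‖u x‖ₑ + ‖mollify n u x‖ₑ) := by
          refine lintegral_congr fun x => ?_
          refine tsub_add_cancel_of_le ?_
          rw [add_comm]
          exact enorm_sub_le
      _ = I + ∫⁻ x, ‖mollify n u x‖ₑ := lintegral_add_left' hu.1.enorm _
      _ ≤ 2 * I := by
          rw [two_mul]
          gcongr
          exact lintegral_enorm_mollify_le n hu.1
  have hlim : 2 * I ≤ liminf (fun n => ∫⁻ x, h n x) atTop := by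
    have hF := lintegral_liminf_le' (u := atTop) hmeas
    refine le_trans (le_of_eq ?_) hF
    rw [← lintegral_const_mul'' _ hu.1.enorm]
    refine lintegral_congr_ae ?_
    filter_upwards [mollify_ae_tendsto hu.locallyIntegrable] with x hx
    have : Tendsto (fun n => h n x) atTop (𝓝 (‖u x‖ₑ + ‖u x‖ₑ - ‖u x - u x‖ₑ)) := by
      refine ENNReal.Tendsto.sub ?_ ?_ (Or.inl (by simp))
      · exact tendsto_const_nhds.add hx.enorm
      · exact (hx.sub tendsto_const_nhds).enorm
    rw [this.liminf_eq]
    simp [two_mul]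
  have h2I : 2 * I ≠ ⊤ := ENNReal.mul_ne_top (by simp) hfin
  have hle : ∀ n, ∫⁻ x, ‖mollify n u x - u x‖ₑ ≤ 2 * I - ∫⁻ x, h n x := fun n => by
    have hn : ∫⁻ x, h n x ≠ ⊤ := ne_top_of_le_ne_top h2I (le_self_add.trans (hsum n))
    refine ENNReal.le_sub_of_add_le_left hn (hsum n)
  have hls : limsup (fun n => ∫⁻ x, ‖mollify n u x - u x‖ₑ) atTop ≤ 0 := by
    refine (limsup_le_limsup (Eventually.of_forall hle)).trans ?_
    rw [ENNReal.limsup_const_sub _ _ h2I]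
    exact (tsub_eq_zero_of_le hlim).le
  exact tendsto_of_le_liminf_of_limsup_le zero_le hls

/-- The mollifiers live in the unit ball, so on K only the values of u on the thickening of K by 1
matter, and u may be truncated there to an integrable function. -/
lemma mollify_tendsto {u : E → F} (hu : LocallyIntegrable u) {K : Set E} (hK : IsCompact K) :
    Tendsto (fun n => ∫⁻ x in K, ‖mollify n u x - u x‖ₑ) atTop (𝓝 0) := by
  set K' := Metric.cthickening 1 K
  have hK' : IsCompact K' := hK.cthickening
  have hi : Integrable (K'.indicator u) :=
    (hu.integrableOn_isCompact hK').integrable_indicator hK'.measurableSet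
  refine tendsto_of_tendsto_of_tendsto_of_le_of_le tendsto_const_nhds
    (mollify_tendsto_of_integrable hi) (fun _ => zero_le) fun n => ?_
  refine le_trans (le_of_eq ?_) (setLIntegral_le_lintegral K _)
  refine setLIntegral_congr_fun hK.measurableSet fun x hx => ?_
  have h1 : mollify n u x = mollify n (K'.indicator u) x := by
    refine integral_congr_ae (Eventually.of_forall fun y => ?_)
    by_cases hy : y ∈ K'
    · simp [hy]
    · have : molK n (x - y) = 0 := by
        apply molK_eq_zero
        by_contra hlt
        apply hy
        apply Metric.mem_cthickening_of_dist_le y x 1 K hx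
        rw [dist_comm, dist_eq_norm]
        linarith
      simp [this]
  have h2 : K'.indicator u x = u x := indicator_of_mem (Metric.self_subset_cthickening K hx) u
  simp only [h1, h2]

end Mollify

/-! ### Weak gradients on `ℝ³` -/

/-- `G` is the weak gradient of `u : ℝ³ → ℝ`. -/
structure HasWeakGrad (u : E → ℝ) (G : E → E) : Prop where
  locInt : LocallyIntegrable u
  locIntGrad : LocallyIntegrable G
  -- The condition tests only translates of a sequence of bumps. By continuity in x it can be
  -- checked on a dense sequence of centres, which allows passing to almost every time slice with a
  -- single null set.
  hasGradientAt_mollify : ∀ n x, HasGradientAt (mollify n u) (mollify n G x) x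

lemma continuous_gradient {w : E → ℝ} (hw : ContDiff ℝ 1 w) : Continuous (gradient w) :=
  (InnerProductSpace.toDual ℝ E).symm.continuous.comp (hw.continuous_fderiv one_ne_zero)

lemma hasCompactSupport_gradient {ψ : E → ℝ} (hc : HasCompactSupport ψ) :
    HasCompactSupport (gradient ψ) :=
  (hc.fderiv ℝ).comp_left (g := (InnerProductSpace.toDual ℝ E).symm) (map_zero _)

lemma integral_mul_gradient_eq_neg {u ψ : E → ℝ} (hu : ContDiff ℝ 1 u) (hψ : ContDiff ℝ 1 ψ)
    (hc : HasCompactSupport ψ) :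
    ∫ x, u x • gradient ψ x = -∫ x, ψ x • gradient u x := by
  have hgs := hasCompactSupport_gradient hc
  have hi1 : Integrable fun x => u x • gradient ψ x :=
    (hu.continuous.smul (continuous_gradient hψ)).integrable_of_hasCompactSupport hgs.smul_left
  have hi2 : Integrable fun x => ψ x • gradient u x :=
    (hψ.continuous.smul (continuous_gradient hu)).integrable_of_hasCompactSupport hc.smul_right
  refine ext_inner_left ℝ fun e => ?_
  rw [inner_neg_right, ← integral_inner hi1, ← integral_inner hi2]
  have h1 : ∀ (w : E → ℝ) x, ⟪e, gradient w x⟫ = fderiv ℝ w x e := fun w x => by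
    rw [inner_gradient_right]; simp
  simp only [inner_smul_right, h1]
  rw [integral_mul_fderiv_eq_neg_fderiv_mul_of_integrable]
  · simp only [mul_comm]
  · refine (hi2.const_inner e).congr (Eventually.of_forall fun x => ?_)
    simp only [inner_smul_right, h1, mul_comm]
  · refine (hi1.const_inner e).congr (Eventually.of_forall fun x => ?_)
    simp only [inner_smul_right, h1]
  · exact (hu.continuous.mul hψ.continuous).integrable_of_hasCompactSupport hc.mul_left
  · exact fun x _ => hu.differentiable one_ne_zero x
  · exact fun x _ => hψ.differentiable one_ne_zero x

/-- Convergence in `L¹_loc`. -/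
def TendstoLoc {F : Type*} [NormedAddCommGroup F] (u : ℕ → E → F) (v : E → F) : Prop :=
  ∀ K : Set E, IsCompact K → Tendsto (fun n => ∫⁻ x in K, ‖u n x - v x‖ₑ) atTop (𝓝 0)

lemma TendstoLoc.tendsto_integral {F F' : Type*} [NormedAddCommGroup F] [NormedSpace ℝ F]
    [NormedAddCommGroup F'] [NormedSpace ℝ F']
    {u : ℕ → E → F} {v : E → F} (h : TendstoLoc u v)
    (hu : ∀ n, LocallyIntegrable (u n)) (hv : LocallyIntegrable v)
    {B : E → F →L[ℝ] F'} (hB : Continuous B) (hc : HasCompactSupport B) :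
    Tendsto (fun n => ∫ x, B x (u n x)) atTop (𝓝 (∫ x, B x (v x))) := by
  obtain ⟨C, hC⟩ := hc.exists_bound_of_continuous hB
  have hint : ∀ {w : E → F}, LocallyIntegrable w → Integrable fun x => B x (w x) := by
    intro w hw
    have h1 : IntegrableOn (fun x => B x (w x)) (tsupport B) := by
      refine Integrable.mono' ((hw.integrableOn_isCompact hc).norm.const_mul C) ?_ ?_
      · exact (ContinuousLinearMap.id ℝ (F →L[ℝ] F')).aestronglyMeasurable_comp₂
          hB.aestronglyMeasurable (hw.integrableOn_isCompact hc).1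
      · refine Eventually.of_forall fun x => ((B x).le_opNorm _).trans ?_
        gcongr
        exact hC x
    refine (integrableOn_iff_integrable_of_support_subset ?_).1 h1
    intro x hx
    apply subset_tsupport
    intro h0
    exact hx (by simp [h0])
  refine tendsto_integral_of_L1 _ (hint hv).1 (Eventually.of_forall fun n => hint (hu n)) ?_
  have hlim := ENNReal.Tendsto.const_mul (a := ENNReal.ofReal C) (h (tsupport B) hc)
    (Or.inr ENNReal.ofReal_ne_top)
  rw [mul_zero] at hlim
  refine tendsto_of_tendsto_of_tendsto_of_le_of_le tendsto_const_nhds hlim (fun _ => zero_le)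
    fun n => ?_
  rw [← lintegral_const_mul' _ _ ENNReal.ofReal_ne_top,
    ← lintegral_indicator hc.measurableSet]
  refine lintegral_mono fun x => ?_
  by_cases hx : x ∈ tsupport B
  · rw [indicator_of_mem hx, ← map_sub]
    refine (ContinuousLinearMap.le_opENorm _ _).trans ?_
    gcongr
    rw [← ofReal_norm]
    exact ENNReal.ofReal_le_ofReal (hC x)
  · have : B x = 0 := image_eq_zero_of_notMem_tsupport hx
    simp [this]

lemma integrable_smul_of_hasCompactSupport {F : Type*} [NormedAddCommGroup F] [NormedSpace ℝ F]
    {u : E → F} (hu : LocallyIntegrable u) {ψ : E → ℝ} (hψ : Continuous ψ)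
    (hc : HasCompactSupport ψ) : Integrable fun x => ψ x • u x :=
  hu.integrable_smul_left_of_hasCompactSupport hψ hc

lemma locallyIntegrable_of_contDiff {F : Type*} [NormedAddCommGroup F] [NormedSpace ℝ F]
    {u : E → F} {n : WithTop ℕ∞} (hu : ContDiff ℝ n u) : LocallyIntegrable u :=
  hu.continuous.locallyIntegrable

namespace HasWeakGrad

variable {u v : E → ℝ} {G H : E → E}

lemma gradient_mollify (h : HasWeakGrad u G) (n : ℕ) :
    gradient (mollify n u) = mollify n G := gradient_eq fun x => h.hasGradientAt_mollify n x

lemma integral_smul_gradient (h : HasWeakGrad u G) {ψ : E → ℝ} (hψ : ContDiff ℝ 1 ψ)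
    (hc : HasCompactSupport ψ) : ∫ x, u x • gradient ψ x = -∫ x, ψ x • G x := by
  have h1 : Tendsto (fun n => ∫ x, mollify n u x • gradient ψ x) atTop
      (𝓝 (∫ x, u x • gradient ψ x)) :=
    TendstoLoc.tendsto_integral (fun K hK => mollify_tendsto h.locInt hK)
      (fun n => locallyIntegrable_of_contDiff (mollify_contDiff n h.locInt)) h.locInt
      (B := fun x => ContinuousLinearMap.toSpanSingleton ℝ (gradient ψ x))
      ((ContinuousLinearMap.toSpanSingletonCLE (𝕜 := ℝ) (E := E)).continuous.comp
        (continuous_gradient hψ))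
      ((hasCompactSupport_gradient hc).comp_left
        (g := fun x => ContinuousLinearMap.toSpanSingleton ℝ x) (by ext; simp))
  have h2 : Tendsto (fun n => -∫ x, ψ x • mollify n G x) atTop (𝓝 (-∫ x, ψ x • G x)) :=
    (TendstoLoc.tendsto_integral (fun K hK => mollify_tendsto h.locIntGrad hK)
      (fun n => locallyIntegrable_of_contDiff (mollify_contDiff n h.locIntGrad)) h.locIntGrad
      (B := fun x => ψ x • ContinuousLinearMap.id ℝ E) (hψ.continuous.smul continuous_const)
      hc.smul_right).neg
  refine tendsto_nhds_unique h1 (h2.congr fun n => ?_)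
  rw [← h.gradient_mollify]
  exact (integral_mul_gradient_eq_neg ((mollify_contDiff n h.locInt).of_le (by simp)) hψ hc).symm

lemma gradient_molK_sub (n : ℕ) (x y : E) :
    gradient (fun y => molK n (x - y)) y = - gradient (molK n) (x - y) := by
  have h := ((molK_contDiff n).differentiable (by simp) (x - y)).hasGradientAt.hasFDerivAt.comp y
    ((hasFDerivAt_id y).const_sub x)
  have h' : HasGradientAt (fun y => molK n (x - y)) (- gradient (molK n) (x - y)) y := by
    refine hasGradientAt_iff_hasFDerivAt.2 (h.congr_fderiv ?_)
    ext e
    simp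
  exact h'.gradient

lemma hasGradientAt_mollify_of_locInt (hu : LocallyIntegrable u) (n : ℕ) (x : E) :
    HasGradientAt (mollify n u) (∫ y, u y • gradient (molK n) (x - y)) x := by
  have h := (molK_hasCompactSupport n).hasFDerivAt_convolution_right
    (ContinuousLinearMap.lsmul ℝ ℝ).flip hu ((molK_contDiff n).of_le (by simp)) x
  rw [convolution_flip, ← mollify_eq_convolution] at h
  refine hasGradientAt_iff_hasFDerivAt.2 (h.congr_fderiv ?_)
  have hcg : Continuous (gradient (molK n)) :=
    continuous_gradient ((molK_contDiff n).of_le (by simp))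
  have hi : Integrable fun y => u y • gradient (molK n) (x - y) := by
    obtain ⟨C, hC⟩ := (hasCompactSupport_gradient
      (molK_hasCompactSupport n)).exists_bound_of_continuous hcg
    have hs : HasCompactSupport fun y => gradient (molK n) (x - y) :=
      (hasCompactSupport_gradient (molK_hasCompactSupport n)).comp_homeomorph
        (Homeomorph.subLeft x)
    exact hu.integrable_smul_right_of_hasCompactSupport (by fun_prop) hs
  ext e
  rw [convolution_precompR_apply _ hu ((molK_hasCompactSupport n).fderiv ℝ)
    ((molK_contDiff n).continuous_fderiv (by simp)), InnerProductSpace.toDual_apply_apply, real_inner_comm, ← integral_inner hi]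
  refine integral_congr_ae (Eventually.of_forall fun y => ?_)
  simp [inner_smul_right, mul_comm]

/-- It suffices to test a weak gradient with the translates of the mollifiers by the points of a
dense set. -/
lemma of_dense (hu : LocallyIntegrable u) (hG : LocallyIntegrable G) {D : Set E} (hD : Dense D)
    (h : ∀ n, ∀ x ∈ D, ∫ y, u y • gradient (fun y => molK n (x - y)) y
      = -∫ y, molK n (x - y) • G y) : HasWeakGrad u G := by
  refine ⟨hu, hG, fun n => ?_⟩
  have hc1 : Continuous (gradient (mollify n u)) :=
    continuous_gradient ((mollify_contDiff n hu).of_le (by simp))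
  have hc2 : Continuous (mollify n G) := (mollify_contDiff n hG).continuous
  have heq : gradient (mollify n u) = mollify n G := by
    refine hc1.ext_on hD hc2 fun x hx => ?_
    rw [(hasGradientAt_mollify_of_locInt hu n x).gradient]
    have := h n x hx
    simp only [gradient_molK_sub, smul_neg, integral_neg, neg_inj] at this
    exact this
  intro x
  rw [← heq]
  exact ((mollify_contDiff n hu).differentiable (by simp) x).hasGradientAt

lemma of_smooth (hu : LocallyIntegrable u) (hG : LocallyIntegrable G)
    (h : ∀ ψ : E → ℝ, ContDiff ℝ ∞ ψ → HasCompactSupport ψ →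
      ∫ x, u x • gradient ψ x = -∫ x, ψ x • G x) : HasWeakGrad u G := by
  refine of_dense hu hG dense_univ fun n x _ => h _ ?_ ?_
  · exact (molK_contDiff n).comp (contDiff_const.sub contDiff_id)
  · exact (molK_hasCompactSupport n).comp_homeomorph (Homeomorph.subLeft x)

lemma of_contDiff (hu : ContDiff ℝ 1 u) : HasWeakGrad u (gradient u) :=
  of_smooth hu.continuous.locallyIntegrable (continuous_gradient hu).locallyIntegrable
    fun _ hψ hc => integral_mul_gradient_eq_neg hu (hψ.of_le (by simp)) hc

lemma ae_unique (h : HasWeakGrad u G) (h' : HasWeakGrad u H) : G =ᵐ[volume] H := by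
  refine ae_eq_of_integral_contDiff_smul_eq h.locIntGrad h'.locIntGrad fun ψ hψ hc => ?_
  rw [← neg_inj, ← h.integral_smul_gradient (hψ.of_le (by simp)) hc,
    h'.integral_smul_gradient (hψ.of_le (by simp)) hc]

lemma of_tendsto {un : ℕ → E → ℝ} {Gn : ℕ → E → E} (h : ∀ n, HasWeakGrad (un n) (Gn n))
    (hu : LocallyIntegrable u) (hG : LocallyIntegrable G) (h1 : TendstoLoc un u)
    (h2 : TendstoLoc Gn G) : HasWeakGrad u G := by
  refine of_smooth hu hG fun ψ hψ hc => ?_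
  have hψ1 : ContDiff ℝ 1 ψ := hψ.of_le (by simp)
  have h1 : Tendsto (fun n => ∫ x, un n x • gradient ψ x) atTop
      (𝓝 (∫ x, u x • gradient ψ x)) :=
    h1.tendsto_integral (fun n => (h n).locInt) hu
      (B := fun x => ContinuousLinearMap.toSpanSingleton ℝ (gradient ψ x))
      ((ContinuousLinearMap.toSpanSingletonCLE (𝕜 := ℝ) (E := E)).continuous.comp
        (continuous_gradient hψ1))
      ((hasCompactSupport_gradient hc).comp_left
        (g := fun x => ContinuousLinearMap.toSpanSingleton ℝ x) (by ext; simp))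
  have h2 : Tendsto (fun n => -∫ x, ψ x • Gn n x) atTop (𝓝 (-∫ x, ψ x • G x)) :=
    (h2.tendsto_integral (fun n => (h n).locIntGrad) hG
      (B := fun x => ψ x • ContinuousLinearMap.id ℝ E) (hψ.continuous.smul continuous_const)
      hc.smul_right).neg
  exact tendsto_nhds_unique h1 (h2.congr fun n => ((h n).integral_smul_gradient hψ1 hc).symm)

end HasWeakGrad

lemma _root_.MeasureTheory.LocallyIntegrable.norm' {F : Type*} [NormedAddCommGroup F] {u : E → F}
    (hu : LocallyIntegrable u) : LocallyIntegrable fun x => ‖u x‖ :=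
  fun x => (hu x).norm

lemma TendstoLoc.of_dominated {F : Type*} [NormedAddCommGroup F] {u : ℕ → E → F} {v : E → F}
    {b : E → ℝ} (hu : ∀ n, AEStronglyMeasurable (u n)) (hv : AEStronglyMeasurable v)
    (hb : LocallyIntegrable b) (hle : ∀ n, ∀ᵐ x, ‖u n x - v x‖ ≤ b x)
    (hlim : ∀ᵐ x, Tendsto (fun n => u n x) atTop (𝓝 (v x))) : TendstoLoc u v := by
  intro K hK
  have h := tendsto_lintegral_of_dominated_convergence' (μ := volume.restrict K)
    (F := fun n x => ‖u n x - v x‖ₑ) (f := fun _ => 0) (fun x => ‖b x‖ₑ)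
    (fun n => ((hu n).sub hv).enorm.restrict)
    (fun n => ae_restrict_of_ae ((hle n).mono fun x hx => ?_))
    (hb.integrableOn_isCompact hK).2.ne
    (ae_restrict_of_ae (hlim.mono fun x hx => ?_))
  · simpa using h
  · exact enorm_le_iff_norm_le.2 (hx.trans (le_abs_self _))
  · have := (hx.sub (tendsto_const_nhds (x := v x))).enorm
    simpa using this

/-- Comparison principle for nonlinear expressions: the new error is at most a multiple of an error
already known to vanish plus a remainder, usually treated by dominated convergence. -/
lemma TendstoLoc.of_le {F F' : Type*} [NormedAddCommGroup F] [NormedAddCommGroup F']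
    {u : ℕ → E → F} {v : E → F} {u' : ℕ → E → F'} {v' : E → F'} (C : ℝ≥0∞) (hC : C ≠ ⊤)
    {e : ℕ → E → ℝ≥0∞} (hem : ∀ n, AEMeasurable (e n))
    (he : ∀ K : Set E, IsCompact K → Tendsto (fun n => ∫⁻ x in K, e n x) atTop (𝓝 0))
    (h : TendstoLoc u v) (hle : ∀ n, ∀ᵐ x, ‖u' n x - v' x‖ₑ ≤ C * ‖u n x - v x‖ₑ + e n x) :
    TendstoLoc u' v' := by
  intro K hK
  have h1 := (ENNReal.Tendsto.const_mul (a := C) (h K hK) (Or.inr hC)).add (he K hK)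
  simp only [mul_zero, add_zero] at h1
  refine tendsto_of_tendsto_of_tendsto_of_le_of_le tendsto_const_nhds h1 (fun _ => zero_le)
    fun n => ?_
  rw [← lintegral_const_mul' _ _ hC, ← lintegral_add_right' _ (hem n).restrict]
  exact lintegral_mono_ae (ae_restrict_of_ae (hle n))

lemma mollify_nonneg {u : E → ℝ} (hu : ∀ x, 0 ≤ u x) (n : ℕ) (x : E) : 0 ≤ mollify n u x :=
  integral_nonneg fun y => mul_nonneg (molK_nonneg n _) (hu y)

namespace HasWeakGrad

variable {u v : E → ℝ} {G H : E → E}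

/-- Chain rule for nonnegative functions. -/
lemma comp_of_nonneg (h : HasWeakGrad u G) (hu : ∀ x, 0 ≤ u x) {Φ Φ' : ℝ → ℝ} {C : ℝ}
    (hΦ : ∀ x, 0 ≤ x → HasDerivAt Φ (Φ' x) x) (hc : Continuous Φ') (hC : ∀ x, |Φ' x| ≤ C) :
    HasWeakGrad (fun x => Φ (u x)) (fun x => Φ' (u x) • G x) := by
  have hC0 : 0 ≤ C := (abs_nonneg _).trans (hC 0)
  -- Mollification preserves nonnegativity, so Φ is only ever evaluated on [0,∞), where its
  -- derivative is known.
  have hun := fun n => mollify_nonneg hu n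
  have hlip : ∀ x y, 0 ≤ x → 0 ≤ y → |Φ x - Φ y| ≤ C * |x - y| := fun x y hx hy =>
    (convex_Ici (0 : ℝ)).norm_image_sub_le_of_norm_hasDerivWithin_le
      (fun z hz => (hΦ z hz).hasDerivWithinAt) (fun z _ => hC z) hy hx
  have hΦc : ContinuousOn Φ (Ici 0) := fun x hx => (hΦ x hx).continuousAt.continuousWithinAt
  have hsm : ∀ n, ContDiff ℝ 1 (mollify n u) := fun n => (mollify_contDiff n h.locInt).of_le
    (by simp)
  have hgr : ∀ n x, HasGradientAt (fun x => Φ (mollify n u x))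
      (Φ' (mollify n u x) • mollify n G x) x := fun n x => by
    have h1 := (hΦ _ (hun n x)).comp_hasFDerivAt x (h.hasGradientAt_mollify n x).hasFDerivAt
    refine hasGradientAt_iff_hasFDerivAt.2 (h1.congr_fderiv ?_)
    ext; simp
  have hn : ∀ n, HasWeakGrad (fun x => Φ (mollify n u x))
      (fun x => Φ' (mollify n u x) • mollify n G x) := fun n => by
    have hcd : ContDiff ℝ 1 (fun x => Φ (mollify n u x)) := by
      rw [contDiff_one_iff_fderiv]
      refine ⟨fun x => (hgr n x).differentiableAt, ?_⟩
      have : fderiv ℝ (fun x => Φ (mollify n u x)) = fun x => InnerProductSpace.toDual ℝ E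
          (Φ' (mollify n u x) • mollify n G x) :=
        funext fun x => (hgr n x).hasFDerivAt.fderiv
      rw [this]
      have h1 := (hsm n).continuous
      have h2 := (mollify_contDiff n h.locIntGrad).continuous
      exact (InnerProductSpace.toDual ℝ E).continuous.comp ((hc.comp h1).smul h2)
    have := of_contDiff hcd
    rwa [gradient_eq (hgr n)] at this
  have hm1 : AEStronglyMeasurable (fun x => Φ (u x)) := by
    have hmon : Continuous fun x : ℝ => Φ (max x 0) :=
      hΦc.comp_continuous (by fun_prop) fun x => mem_Ici.2 (le_max_right _ _)
    refine (hmon.comp_aestronglyMeasurable h.locInt.aestronglyMeasurable).congr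
      (Eventually.of_forall fun x => ?_)
    simp [max_eq_left (hu x)]
  have hm2 : AEStronglyMeasurable (fun x => Φ' (u x)) :=
    hc.comp_aestronglyMeasurable h.locInt.aestronglyMeasurable
  have hi1 : LocallyIntegrable (fun x => Φ (u x)) := by
    have hb : LocallyIntegrable fun x => C * u x + |Φ 0| :=
      (h.locInt.smul C).add (locallyIntegrable_const _)
    refine hb.mono hm1 (Eventually.of_forall fun x => ?_)
    have h0 := hlip (u x) 0 (hu x) le_rfl
    rw [sub_zero, abs_of_nonneg (hu x)] at h0
    have h1 := abs_sub_abs_le_abs_sub (Φ (u x)) (Φ 0)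
    rw [Real.norm_eq_abs, Real.norm_eq_abs]
    exact le_trans (by linarith) (le_abs_self _)
  have hi2 : LocallyIntegrable (fun x => Φ' (u x) • G x) := by
    refine (h.locIntGrad.smul C).mono (hm2.smul h.locIntGrad.aestronglyMeasurable)
      (Eventually.of_forall fun x => ?_)
    rw [norm_smul, Pi.smul_apply, norm_smul, Real.norm_eq_abs, Real.norm_eq_abs, abs_of_nonneg hC0]
    gcongr
    exact hC _
  have hCe : ENNReal.ofReal C ≠ ⊤ := ENNReal.ofReal_ne_top
  refine of_tendsto hn hi1 hi2 ?_ ?_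
  · refine TendstoLoc.of_le (ENNReal.ofReal C) hCe (e := fun _ _ => 0) (fun _ => aemeasurable_const)
      (fun K hK => by simp) (fun K hK => mollify_tendsto h.locInt hK)
      fun n => Eventually.of_forall fun x => ?_
    rw [add_zero, ← ofReal_norm, ← ofReal_norm, ← ENNReal.ofReal_mul hC0]
    exact ENNReal.ofReal_le_ofReal (hlip _ _ (hun n x) (hu x))
  · refine TendstoLoc.of_le (ENNReal.ofReal C) hCe
      (e := fun n x => ‖Φ' (mollify n u x) • G x - Φ' (u x) • G x‖ₑ) (fun n => ?_) ?_
      (fun K hK => mollify_tendsto h.locIntGrad hK) fun n => Eventually.of_forall fun x => ?_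
    · exact (((hc.comp (hsm n).continuous).aestronglyMeasurable.smul
        h.locIntGrad.aestronglyMeasurable).sub hi2.aestronglyMeasurable).enorm
    · refine TendstoLoc.of_dominated (b := fun x => 2 * C * ‖G x‖) (fun n => ?_)
        hi2.aestronglyMeasurable (h.locIntGrad.norm'.smul (2 * C)) ?_ ?_
      · exact (hc.comp (hsm n).continuous).aestronglyMeasurable.smul
          h.locIntGrad.aestronglyMeasurable
      · refine fun n => Eventually.of_forall fun x => ?_
        rw [← sub_smul, norm_smul]
        gcongr
        refine (norm_sub_le _ _).trans ?_
        have := hC (mollify n u x)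
        have := hC (u x)
        rw [Real.norm_eq_abs, Real.norm_eq_abs]
        linarith
      · filter_upwards [mollify_ae_tendsto h.locInt] with x hx
        exact ((hc.tendsto _).comp hx).smul_const _
    -- Write uₙ, Gₙ for the mollifications. The term Φ'(uₙ)(Gₙ - G) is small because Φ' is bounded,
    -- and (Φ'(uₙ) - Φ'(u))G by dominated convergence, as uₙ → u a.e.
    · have h1 : Φ' (mollify n u x) • mollify n G x - Φ' (u x) • G x
          = Φ' (mollify n u x) • (mollify n G x - G x)
            + (Φ' (mollify n u x) • G x - Φ' (u x) • G x) := by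
        rw [smul_sub]; abel
      rw [h1]
      refine (enorm_add_le _ _).trans ?_
      gcongr
      rw [enorm_smul]
      gcongr
      rw [← ofReal_norm]
      exact ENNReal.ofReal_le_ofReal (hC _)

/-- The square of the positive part is differentiable even at the threshold. It is the smooth
ingredient in the regularization of the positive part. -/
lemma hasDerivAt_max_sq (κ x : ℝ) :
    HasDerivAt (fun x : ℝ => (max (x - κ) 0) ^ 2) (2 * max (x - κ) 0) x := by
  rcases lt_trichotomy x κ with hx | hx | hx
  · have h1 : max (x - κ) 0 = 0 := max_eq_right (by linarith)
    rw [h1, mul_zero]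
    refine (hasDerivAt_const x (0 : ℝ)).congr_of_eventuallyEq ?_
    filter_upwards [gt_mem_nhds hx] with y hy
    simp [max_eq_right (show y - κ ≤ 0 by linarith)]
  · subst hx
    rw [sub_self, max_self, mul_zero, hasDerivAt_iff_isLittleO]
    have : (fun y : ℝ => y - x) =o[𝓝 x] fun _ => (1 : ℝ) := by
      rw [Asymptotics.isLittleO_one_iff]
      have := (continuous_id.sub continuous_const).tendsto (f := fun y : ℝ => y - x) x
      simpa using this
    have h2 : (fun y : ℝ => (y - x) * (y - x)) =o[𝓝 x] fun y => (1 : ℝ) * (y - x) :=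
      this.mul_isBigO (Asymptotics.isBigO_refl _ _)
    simp only [one_mul] at h2
    refine (Asymptotics.IsBigO.of_bound 1 (Eventually.of_forall fun y => ?_)).trans_isLittleO h2
    simp only [sub_self, max_self, smul_zero, sub_zero, ne_eq, OfNat.ofNat_ne_zero,
      not_false_eq_true, zero_pow, norm_pow, norm_mul, one_mul, Real.norm_eq_abs]
    rw [← sq]
    refine pow_le_pow_left₀ (abs_nonneg _) ?_ 2
    rcases le_total (y - x) 0 with h | h
    · rw [max_eq_right h, abs_zero]; exact abs_nonneg _
    · rw [max_eq_left h]
  · have h1 : max (x - κ) 0 = x - κ := max_eq_left (by linarith)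
    rw [h1]
    have h2 : HasDerivAt (fun x : ℝ => (x - κ) ^ 2) (2 * (x - κ)) x := by
      have := ((hasDerivAt_id x).sub_const κ).fun_pow 2
      simpa using this
    refine h2.congr_of_eventuallyEq ?_
    filter_upwards [lt_mem_nhds hx] with y hy
    simp [max_eq_left (show 0 ≤ y - κ by linarith)]

/-- With p = (x-κ)₊, the functions √(p²+d²) - d converge uniformly to p as d → 0. Their derivatives
p/√(p²+d²) are at most 1 and converge everywhere to the indicator of x > κ, with value 0 at x = κ;
hence the strict inequality in the limit. -/
lemma posPart (h : HasWeakGrad u G) (hu : ∀ x, 0 ≤ u x) (κ : ℝ) :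
    HasWeakGrad (fun x => max (u x - κ) 0) ({x | κ < u x}.indicator G) := by
  have hum := h.locInt.aestronglyMeasurable
  have hGm := h.locIntGrad.aestronglyMeasurable
  set p : ℝ → ℝ := fun x => max (x - κ) 0
  have hp0 : ∀ x, 0 ≤ p x := fun x => le_max_right _ _
  have hpc : Continuous p := by fun_prop
  let d : ℕ → ℝ := fun n => 1 / ((n : ℝ) + 1)
  have hd : ∀ n, 0 < d n := fun n => by positivity
  have hdt : Tendsto d atTop (𝓝 0) := tendsto_one_div_add_atTop_nhds_zero_nat
  have hd1 : ∀ n, d n ≤ 1 := fun n => by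
    change 1 / ((n : ℝ) + 1) ≤ 1
    rw [div_le_one (by positivity)]
    linarith [Nat.cast_nonneg (α := ℝ) n]
  have hpos : ∀ n x, 0 < p x ^ 2 + d n ^ 2 := fun n x => by have := hd n; positivity
  have hsq : ∀ n x, p x ≤ √(p x ^ 2 + d n ^ 2) := fun n x =>
    Real.le_sqrt_of_sq_le (by nlinarith [hd n])
  have hder : ∀ n x, HasDerivAt (fun x => √(p x ^ 2 + d n ^ 2) - d n)
      (p x / √(p x ^ 2 + d n ^ 2)) x := fun n x => by
    have h1 := (((hasDerivAt_max_sq κ x).add_const (d n ^ 2)).sqrt (hpos n x).ne').sub_const (d n)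
    refine h1.congr_deriv ?_
    rw [mul_div_mul_left _ _ (two_ne_zero)]
  have hbd : ∀ n x, |p x / √(p x ^ 2 + d n ^ 2)| ≤ 1 := fun n x => by
    rw [abs_of_nonneg (div_nonneg (hp0 x) (Real.sqrt_nonneg _))]
    exact div_le_one_of_le₀ (hsq n x) (Real.sqrt_nonneg _)
  have hcont : ∀ n, Continuous fun x => p x / √(p x ^ 2 + d n ^ 2) := fun n =>
    hpc.div (by fun_prop) fun x => (Real.sqrt_pos.2 (hpos n x)).ne'
  have hn := fun n => h.comp_of_nonneg hu (fun x _ => hder n x) (hcont n) (hbd n)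
  have hms : NullMeasurableSet {x | κ < u x} := by
    exact nullMeasurableSet_lt aemeasurable_const hum.aemeasurable
  have hGi : LocallyIntegrable ({x | κ < u x}.indicator G) := by
    refine h.locIntGrad.mono (hGm.indicator₀ hms) (Eventually.of_forall fun x => ?_)
    exact norm_indicator_le_norm_self _ _
  have hui : LocallyIntegrable (fun x => p (u x)) := by
    refine (h.locInt.add (locallyIntegrable_const |κ|)).mono
      (hpc.comp_aestronglyMeasurable hum) (Eventually.of_forall fun x => ?_)
    have := neg_abs_le κ
    have hx := hu x
    simp only [Pi.add_apply, Real.norm_eq_abs]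
    rw [abs_of_nonneg (hp0 _), abs_of_nonneg (by positivity)]
    exact max_le (by linarith) (by positivity)
  refine of_tendsto hn hui hGi ?_ ?_
  · refine TendstoLoc.of_dominated (b := fun _ => 1) (fun n => (hn n).locInt.aestronglyMeasurable)
      hui.aestronglyMeasurable (locallyIntegrable_const _) ?_ ?_
    · refine fun n => Eventually.of_forall fun x => ?_
      have h1 : √(p (u x) ^ 2 + d n ^ 2) ≤ p (u x) + d n :=
        Real.sqrt_le_iff.2 ⟨by linarith [hp0 (u x), hd n], by nlinarith [hp0 (u x), hd n]⟩
      have h2 := hsq n (u x)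
      have := hd1 n
      have := hd n
      rw [Real.norm_eq_abs, abs_le]
      constructor <;> linarith
    · refine Eventually.of_forall fun x => ?_
      have h1 : Tendsto (fun n => √(p (u x) ^ 2 + d n ^ 2) - d n) atTop
          (𝓝 (√(p (u x) ^ 2 + 0 ^ 2) - 0)) :=
        ((tendsto_const_nhds.add (hdt.pow 2)).sqrt).sub hdt
      simpa [Real.sqrt_sq (hp0 (u x))] using h1
  · refine TendstoLoc.of_dominated (b := fun x => 2 * ‖G x‖)
      (fun n => (hn n).locIntGrad.aestronglyMeasurable)
      hGi.aestronglyMeasurable (h.locIntGrad.norm'.smul (2 : ℝ)) ?_ ?_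
    · refine fun n => Eventually.of_forall fun x => (norm_sub_le _ _).trans ?_
      have h1 := norm_indicator_le_norm_self (s := {x | κ < u x}) G x
      have h2 : ‖(p (u x) / √(p (u x) ^ 2 + d n ^ 2)) • G x‖ ≤ ‖G x‖ := by
        rw [norm_smul]
        exact mul_le_of_le_one_left (norm_nonneg _) (hbd n _)
      linarith
    · refine Eventually.of_forall fun x => ?_
      by_cases hx : κ < u x
      · have hpx : 0 < p (u x) := lt_max_of_lt_left (by linarith)
        rw [indicator_of_mem (show x ∈ {x | κ < u x} from hx)]
        have h1 : Tendsto (fun n => (p (u x) / √(p (u x) ^ 2 + d n ^ 2)) • G x) atTop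
            (𝓝 ((p (u x) / √(p (u x) ^ 2 + 0 ^ 2)) • G x)) := by
          refine (tendsto_const_nhds.div ((tendsto_const_nhds.add (hdt.pow 2)).sqrt) ?_).smul_const _
          simp [Real.sqrt_sq (hp0 (u x)), hpx.ne']
        simpa [Real.sqrt_sq (hp0 (u x)), hpx.ne'] using h1
      · rw [indicator_of_notMem (show x ∉ {x | κ < u x} from hx)]
        have hpx : p (u x) = 0 := max_eq_right (by linarith)
        simp [hpx]

/-- The weak gradient vanishes a.e. where the function does. -/
lemma ae_eq_zero_of_eq_zero (h : HasWeakGrad u G) (hu : ∀ x, 0 ≤ u x) :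
    ∀ᵐ x, u x = 0 → G x = 0 := by
  -- Truncation at level 0 leaves u unchanged but replaces G by its restriction to {u > 0};
  -- uniqueness of weak gradients concludes.
  have h1 := h.posPart hu 0
  have h2 : (fun x => max (u x - 0) 0) = u := by
    funext x
    simp [hu x]
  rw [h2] at h1
  filter_upwards [h.ae_unique h1] with x hx hx0
  rw [hx, indicator_of_notMem]
  simp [hx0]

/-- The weak gradient of the square root. -/
lemma sqrt (h : HasWeakGrad u G) (hu : ∀ x, 0 ≤ u x)
    (hi : LocallyIntegrable fun x => (√(u x))⁻¹ • G x) :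
    HasWeakGrad (fun x => √(u x)) (fun x => (2 * √(u x))⁻¹ • G x) := by
  have hum := h.locInt.aestronglyMeasurable
  let d : ℕ → ℝ := fun n => 1 / ((n : ℝ) + 1)
  have hd : ∀ n, 0 < d n := fun n => by positivity
  have hdt : Tendsto d atTop (𝓝 0) := tendsto_one_div_add_atTop_nhds_zero_nat
  have hpos : ∀ n x, 0 < max x 0 + d n := fun n x => by
    have := hd n; have := le_max_right x 0; linarith
  -- √(x+d) has a bounded derivative on [0,∞). As d → 0 the gradients are dominated by multiples of
  -- |G|/√u, since G = 0 a.e. where u = 0.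
  have hn := fun n => h.comp_of_nonneg hu (Φ := fun x => √(x + d n))
    (Φ' := fun x => 1 / (2 * √(max x 0 + d n))) (C := 1 / (2 * √(d n)))
    (fun x hx => by
      have h1 := ((hasDerivAt_id x).add_const (d n)).sqrt (by have := hd n; simp; positivity)
      simpa [max_eq_left hx] using h1)
    (continuous_const.div (by fun_prop) fun x => by
      have := Real.sqrt_pos.2 (hpos n x); positivity)
    (fun x => by
      have h0 := Real.sqrt_pos.2 (hd n)
      have h2 := Real.sqrt_le_sqrt (show d n ≤ max x 0 + d n by linarith [le_max_right x 0])
      rw [abs_of_nonneg (by positivity)]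
      apply one_div_le_one_div_of_le (by positivity)
      linarith)
  have hsi : LocallyIntegrable fun x => √(u x) := by
    refine (h.locInt.add (locallyIntegrable_const 1)).mono
      (Real.continuous_sqrt.comp_aestronglyMeasurable hum) (Eventually.of_forall fun x => ?_)
    have hx := hu x
    simp only [Pi.add_apply, Real.norm_eq_abs]
    rw [abs_of_nonneg (Real.sqrt_nonneg _), abs_of_nonneg (by positivity)]
    nlinarith [Real.sq_sqrt hx, sq_nonneg (√(u x) - 1)]
  have hgi : LocallyIntegrable fun x => (2 * √(u x))⁻¹ • G x := by
    refine (hi.smul (2⁻¹ : ℝ)).congr (Eventually.of_forall fun x => ?_)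
    simp [smul_smul, mul_comm]
  refine of_tendsto hn hsi hgi ?_ ?_
  · refine TendstoLoc.of_dominated (b := fun _ => 1) (fun n => (hn n).locInt.aestronglyMeasurable)
      hsi.aestronglyMeasurable (locallyIntegrable_const _) ?_ ?_
    · refine fun n => Eventually.of_forall fun x => ?_
      have h0 := Real.sqrt_le_sqrt (show u x ≤ u x + d n by linarith [hd n])
      have hd1 : d n ≤ 1 := by
        change 1 / ((n : ℝ) + 1) ≤ 1
        rw [div_le_one (by positivity)]
        linarith [Nat.cast_nonneg (α := ℝ) n]
      have h1 : √(u x + d n) ≤ √(u x) + 1 :=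
        Real.sqrt_le_iff.2 ⟨by positivity, by nlinarith [Real.sq_sqrt (hu x), Real.sqrt_nonneg (u x)]⟩
      rw [Real.norm_eq_abs, abs_le]
      constructor <;> linarith
    · refine Eventually.of_forall fun x => ?_
      have h1 : Tendsto (fun n => √(u x + d n)) atTop (𝓝 (√(u x + 0))) :=
        (tendsto_const_nhds.add hdt).sqrt
      simpa using h1
  · refine TendstoLoc.of_dominated (b := fun x => 2 * ‖(√(u x))⁻¹ • G x‖)
      (fun n => (hn n).locIntGrad.aestronglyMeasurable)
      hgi.aestronglyMeasurable (hi.norm'.smul (2 : ℝ)) ?_ ?_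
    · intro n
      filter_upwards [h.ae_eq_zero_of_eq_zero hu] with x hx0
      rcases (hu x).eq_or_lt' with hx | hx
      · simp [hx0 hx]
      · have hs := Real.sqrt_pos.2 hx
        have hs' := Real.sqrt_le_sqrt (show u x ≤ max (u x) 0 + d n by
          linarith [hd n, le_max_left (u x) 0])
        refine (norm_sub_le _ _).trans ?_
        rw [norm_smul, norm_smul, norm_smul, Real.norm_of_nonneg (by positivity),
          Real.norm_of_nonneg (by positivity), Real.norm_of_nonneg (by positivity)]
        have h1 : 1 / (2 * √(max (u x) 0 + d n)) ≤ (√(u x))⁻¹ := by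
          rw [one_div]
          exact inv_anti₀ hs (by linarith)
        have h2 : (2 * √(u x))⁻¹ ≤ (√(u x))⁻¹ := inv_anti₀ hs (by linarith)
        exact (add_le_add (mul_le_mul_of_nonneg_right h1 (norm_nonneg (G x)))
          (mul_le_mul_of_nonneg_right h2 (norm_nonneg (G x)))).trans_eq (two_mul _).symm
    · filter_upwards [h.ae_eq_zero_of_eq_zero hu] with x hx0
      rcases (hu x).eq_or_lt' with hx | hx
      · simp [hx0 hx]
      · have hs := Real.sqrt_pos.2 hx
        rw [← one_div]
        have h1 : Tendsto (fun n => (1 / (2 * √(max (u x) 0 + d n))) • G x) atTop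
            (𝓝 ((1 / (2 * √(max (u x) 0 + 0))) • G x)) := by
          refine (tendsto_const_nhds.div ((tendsto_const_nhds.add hdt).sqrt.const_mul 2)
            ?_).smul_const _
          simp only [max_eq_left hx.le, add_zero]
          positivity
        simpa [max_eq_left hx.le] using h1

/-- The weak gradient of the truncated square root. -/
lemma sqrt_sub (h : HasWeakGrad u G) (hu : ∀ x, 0 ≤ u x) {κ : ℝ} (hκ : 0 < κ) :
    HasWeakGrad (fun x => max (√(u x) - √κ) 0)
      ({x | κ < u x}.indicator fun x => (2 * √(u x))⁻¹ • G x) := by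
  have hpos : ∀ x : ℝ, 0 < max x 0 + κ := fun x => by
    have := le_max_right x 0; linarith
  -- The identity behind this is (√u - √κ)₊ = √((u-κ)₊ + κ) - √κ, a smooth function of a truncation
  -- already handled. No local integrability of G/√u is needed.
  have h1 := (h.posPart hu κ).comp_of_nonneg (fun x => le_max_right _ _)
    (Φ := fun x => √(x + κ) - √κ)
    (Φ' := fun x => 1 / (2 * √(max x 0 + κ))) (C := 1 / (2 * √κ))
    (fun x hx => by
      have h1 := (((hasDerivAt_id x).add_const κ).sqrt (by simp; positivity)).sub_const (√κ)
      simpa [max_eq_left hx] using h1)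
    (continuous_const.div (by fun_prop) fun x => by
      have := Real.sqrt_pos.2 (hpos x); positivity)
    (fun x => by
      have h0 := Real.sqrt_pos.2 hκ
      have h2 := Real.sqrt_le_sqrt (show κ ≤ max x 0 + κ by linarith [le_max_right x 0])
      rw [abs_of_nonneg (by positivity)]
      apply one_div_le_one_div_of_le (by positivity)
      linarith)
  convert h1 using 1
  · funext x
    rcases le_total (u x) κ with hx | hx
    · rw [max_eq_right (by linarith [Real.sqrt_le_sqrt hx] : √(u x) - √κ ≤ 0),
        max_eq_right (by linarith : u x - κ ≤ 0)]
      simp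
    · rw [max_eq_left (by linarith [Real.sqrt_le_sqrt hx] : 0 ≤ √(u x) - √κ),
        max_eq_left (by linarith : 0 ≤ u x - κ)]
      simp
  · funext x
    by_cases hx : κ < u x
    · rw [indicator_of_mem (show x ∈ {x | κ < u x} from hx),
        indicator_of_mem (show x ∈ {x | κ < u x} from hx), max_eq_left (by linarith : 0 ≤ u x - κ)]
      simp [max_eq_left (show 0 ≤ u x - κ by linarith)]
    · rw [indicator_of_notMem (show x ∉ {x | κ < u x} from hx),
        indicator_of_notMem (show x ∉ {x | κ < u x} from hx), smul_zero]

end HasWeakGrad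

/-! ### Product rule, divergence and integration by parts -/

lemma gradient_mul' {χ ψ : E → ℝ} {x : E} (hχ : DifferentiableAt ℝ χ x)
    (hψ : DifferentiableAt ℝ ψ x) :
    gradient (fun x => χ x * ψ x) x = χ x • gradient ψ x + ψ x • gradient χ x := by
  have h := hχ.hasGradientAt.hasFDerivAt.mul hψ.hasGradientAt.hasFDerivAt
  have h' : HasGradientAt (fun x => χ x * ψ x) (χ x • gradient ψ x + ψ x • gradient χ x) x := by
    refine hasGradientAt_iff_hasFDerivAt.2 (h.congr_fderiv ?_)
    simp
  exact h'.gradient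

lemma inner_single (i : Fin 3) (v : E) : ⟪(EuclideanSpace.single i (1 : ℝ) : E), v⟫ = v i := by
  rw [EuclideanSpace.inner_single_left]
  simp

/-- The divergence of a vector field. -/
def divg (Φ : E → E) (x : E) : ℝ := ∑ i : Fin 3, (fderiv ℝ Φ x (EuclideanSpace.single i 1)) i

lemma abs_divg_le (Φ : E → E) (x : E) : |divg Φ x| ≤ 3 * ‖fderiv ℝ Φ x‖ := by
  unfold divg
  refine (Finset.abs_sum_le_sum_abs _ _).trans ?_
  have : ∀ i ∈ (Finset.univ : Finset (Fin 3)),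
      |(fderiv ℝ Φ x (EuclideanSpace.single i 1)) i| ≤ ‖fderiv ℝ Φ x‖ := fun i _ => by
    refine (PiLp.norm_apply_le (fderiv ℝ Φ x (EuclideanSpace.single i 1)) i).trans ?_
    refine ((fderiv ℝ Φ x).le_opNorm _).trans ?_
    simp
  refine (Finset.sum_le_sum this).trans ?_
  simp

namespace HasWeakGrad

variable {u : E → ℝ} {G : E → E}

lemma smooth_mul (h : HasWeakGrad u G) {χ : E → ℝ} (hχ : ContDiff ℝ 1 χ) :
    HasWeakGrad (fun x => χ x * u x) (fun x => χ x • G x + u x • gradient χ x) := by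
  have hgc := continuous_gradient hχ
  have hi : LocallyIntegrable fun x => u x • gradient χ x := by
    exact locallyIntegrableOn_univ.1 ((locallyIntegrableOn_univ.2 h.locInt).smul_continuousOn
      isOpen_univ.isLocallyClosed hgc.continuousOn)
  have hi2 : LocallyIntegrable fun x => χ x • G x :=
    locallyIntegrableOn_univ.1 ((locallyIntegrableOn_univ.2 h.locIntGrad).continuousOn_smul
      isOpen_univ.isLocallyClosed hχ.continuous.continuousOn)
  have hi3 : LocallyIntegrable fun x => χ x * u x :=
    locallyIntegrableOn_univ.1 ((locallyIntegrableOn_univ.2 h.locInt).continuousOn_smul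
      isOpen_univ.isLocallyClosed hχ.continuous.continuousOn)
  refine of_smooth hi3 (hi2.add hi) fun ψ hψ hc => ?_
  have hψ1 : ContDiff ℝ 1 ψ := hψ.of_le (by simp)
  have h1 := h.integral_smul_gradient (hχ.mul hψ1) hc.mul_left
  have h2 : ∀ x, u x • gradient (fun x => χ x * ψ x) x
      = (χ x * u x) • gradient ψ x + ψ x • u x • gradient χ x := fun x => by
    rw [gradient_mul' (hχ.differentiable one_ne_zero x) (hψ1.differentiable one_ne_zero x), smul_add,
      smul_smul, smul_smul, smul_smul, mul_comm (u x), mul_comm (u x)]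
  have e1 : Integrable fun x => (χ x * u x) • gradient ψ x :=
    hi3.integrable_smul_right_of_hasCompactSupport (continuous_gradient hψ1)
      (hasCompactSupport_gradient hc)
  have e2 : Integrable fun x => ψ x • u x • gradient χ x :=
    integrable_smul_of_hasCompactSupport hi hψ1.continuous hc
  have e3 : Integrable fun x => ψ x • χ x • G x :=
    integrable_smul_of_hasCompactSupport hi2 hψ1.continuous hc
  simp only [h2] at h1
  rw [integral_add e1 e2] at h1
  simp only [smul_add]
  rw [integral_add e3 e2, eq_sub_of_add_eq h1]
  simp only [smul_smul, mul_comm]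
  abel

/-- Integration by parts against a vector field. -/
lemma integral_mul_divg (h : HasWeakGrad u G) {Φ : E → E} (hΦ : ContDiff ℝ 1 Φ)
    (hc : HasCompactSupport Φ) : ∫ x, u x * divg Φ x = -∫ x, ⟪Φ x, G x⟫ := by
  have hd : ∀ i x, ⟪EuclideanSpace.single i (1 : ℝ), gradient (fun x => Φ x i) x⟫
      = (fderiv ℝ Φ x (EuclideanSpace.single i 1)) i := fun i x => by
    have h1 : HasFDerivAt (fun x => Φ x i)
        ((EuclideanSpace.proj i : E →L[ℝ] ℝ).comp (fderiv ℝ Φ x)) x :=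
      (EuclideanSpace.proj i : E →L[ℝ] ℝ).hasFDerivAt.comp x
        (hΦ.differentiable one_ne_zero x).hasFDerivAt
    rw [inner_gradient_right, h1.fderiv]
    simp
  have hs : ∀ i : Fin 3, ContDiff ℝ 1 fun x => Φ x i := fun i =>
    (EuclideanSpace.proj i : E →L[ℝ] ℝ).contDiff.comp hΦ
  have hcs : ∀ i : Fin 3, HasCompactSupport fun x => Φ x i := fun i =>
    hc.comp_left (g := fun v : E => v i) rfl
  have e1 : ∀ i : Fin 3, Integrable fun x => u x • gradient (fun x => Φ x i) x := fun i =>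
    h.locInt.integrable_smul_right_of_hasCompactSupport (continuous_gradient (hs i))
      (hasCompactSupport_gradient (hcs i))
  have e2 : ∀ i : Fin 3, Integrable fun x => Φ x i • G x := fun i =>
    integrable_smul_of_hasCompactSupport h.locIntGrad (hs i).continuous (hcs i)
  have key : ∀ i : Fin 3, ∫ x, u x * (fderiv ℝ Φ x (EuclideanSpace.single i 1)) i
      = -∫ x, Φ x i * G x i := fun i => by
    have h1 := congrArg (fun z => ⟪EuclideanSpace.single i (1 : ℝ), z⟫)
      (h.integral_smul_gradient (hs i) (hcs i))
    simp only [inner_neg_right] at h1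
    rw [← integral_inner (e1 i), ← integral_inner (e2 i)] at h1
    simp only [inner_smul_right, hd] at h1
    rw [h1]
    simp only [inner_single]
  have f1 : ∀ i : Fin 3, Integrable fun x => u x * (fderiv ℝ Φ x (EuclideanSpace.single i 1)) i :=
    fun i => by
      refine ((e1 i).const_inner (EuclideanSpace.single i (1 : ℝ))).congr
        (Eventually.of_forall fun x => ?_)
      simp only [inner_smul_right, hd]
  have f2 : ∀ i : Fin 3, Integrable fun x => Φ x i * G x i :=
    fun i => by
      refine ((e2 i).const_inner (EuclideanSpace.single i (1 : ℝ))).congr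
        (Eventually.of_forall fun x => ?_)
      simp only [inner_single, PiLp.smul_apply, smul_eq_mul]
  unfold divg
  simp only [Finset.mul_sum]
  rw [integral_finsetSum _ fun i _ => f1 i]
  simp only [key, Finset.sum_neg_distrib]
  rw [← integral_finsetSum _ fun i _ => f2 i]
  congr 2
  funext x
  simp [PiLp.inner_apply, mul_comm]

end HasWeakGrad

/-- Gagliardo–Nirenberg–Sobolev in dimension three, 1/6 = 1/2 - 1/3, for the mollifications, which
are smooth and compactly supported and whose gradients have no larger L² norm than H. Fatou's lemma
passes to the limit. -/
lemma exists_sobolev_const : ∃ C : NNReal, ∀ (w : E → ℝ) (H : E → E), HasWeakGrad w H →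
    HasCompactSupport w → ∫⁻ x, ‖w x‖ₑ ^ 6 ≤ C * (∫⁻ x, ‖H x‖ₑ ^ 2) ^ 3 := by
  set C₀ : NNReal := SNormLESNormFDerivOfEqConst ℝ (volume : Measure E) (2 : NNReal)
  refine ⟨C₀ ^ 6, fun w H h hc => ?_⟩
  have hn : ∀ n, ∫⁻ x, ‖mollify n w x‖ₑ ^ 6 ≤ (C₀ : ℝ≥0∞) ^ 6 * (∫⁻ x, ‖H x‖ₑ ^ 2) ^ 3 := by
    intro n
    have hcs : HasCompactSupport (mollify n w) := by
      rw [mollify_eq_convolution]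
      exact HasCompactSupport.convolution _ (molK_hasCompactSupport n) hc
    have h1 := eLpNorm_le_eLpNorm_fderiv_of_eq (μ := (volume : Measure E)) (p := (2 : NNReal))
      (p' := (6 : NNReal)) ((mollify_contDiff n h.locInt).of_le (by simp)) hcs (by norm_num) (by simp)
      (by norm_num)
    have h6 := eLpNorm_nnreal_pow_eq_lintegral (f := mollify n w) (μ := volume)
      (p := (6 : NNReal)) (by norm_num)
    have h2 := eLpNorm_nnreal_pow_eq_lintegral (f := fderiv ℝ (mollify n w)) (μ := volume)
      (p := (2 : NNReal)) (by norm_num)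
    have hf : ∀ x, ‖fderiv ℝ (mollify n w) x‖ₑ = ‖mollify n H x‖ₑ := fun x => by
      rw [(h.hasGradientAt_mollify n x).hasFDerivAt.fderiv, LinearIsometryEquiv.enorm_map]
    have e6 : ((6 : NNReal) : ℝ) = ((6 : ℕ) : ℝ) := by norm_num
    have e2 : ((2 : NNReal) : ℝ) = ((2 : ℕ) : ℝ) := by norm_num
    simp only [e6, e2, ENNReal.rpow_natCast, hf] at h6 h2
    rw [← h6]
    calc _ ≤ ((C₀ : ℝ≥0∞) * eLpNorm (fderiv ℝ (mollify n w)) (2 : NNReal) volume) ^ 6 := by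
          gcongr
      _ = (C₀ : ℝ≥0∞) ^ 6 * (∫⁻ x, ‖mollify n H x‖ₑ ^ 2) ^ 3 := by
          rw [mul_pow, ← h2, ← pow_mul]
      _ ≤ _ := by
          gcongr (C₀ : ℝ≥0∞) ^ 6 * ?_ ^ 3
          exact lintegral_enorm_mollify_sq_le n h.locIntGrad.aestronglyMeasurable
  have hF := lintegral_liminf_le' (μ := volume) (u := atTop)
    (f := fun n x => ‖mollify n w x‖ₑ ^ 6) (fun n =>
      ((mollify_contDiff n h.locInt).continuous.aestronglyMeasurable.enorm.pow_const 6))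
  push_cast
  refine le_trans ?_ (hF.trans (liminf_le_of_le (by isBoundedDefault) fun b hb => ?_))
  · refine lintegral_mono_ae ?_
    filter_upwards [mollify_ae_tendsto h.locInt] with x hx
    exact ((((ENNReal.continuous_pow 6).tendsto _).comp hx.enorm).liminf_eq).ge
  · obtain ⟨n, hbn⟩ := hb.exists
    exact hbn.trans (hn n)

/-- A local Sobolev inequality, interpolated with the `L²` norm. -/
lemma exists_local_sobolev_const : ∃ C : NNReal, ∀ (y : E → ℝ) (H : E → E), HasWeakGrad y H →
    ∀ (χ : E → ℝ) (B : Set E) (Λ : NNReal), ContDiff ℝ 1 χ → HasCompactSupport χ →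
    MeasurableSet B → (∀ x, |χ x| ≤ 1) → (∀ x, ‖gradient χ x‖ ≤ Λ) → (∀ x ∉ B, χ x = 0) →
    (∀ x ∉ B, gradient χ x = 0) →
    ∫⁻ x, ‖χ x * y x‖ₑ ^ (10 / 3 : ℝ) ≤ C * (∫⁻ x in B, ‖y x‖ₑ ^ 2) ^ (2 / 3 : ℝ) *
      ((∫⁻ x in B, ‖H x‖ₑ ^ 2) + Λ ^ 2 * ∫⁻ x in B, ‖y x‖ₑ ^ 2) := by
  obtain ⟨C, hC⟩ := exists_sobolev_const
  refine ⟨C ^ (1 / 3 : ℝ) * 2, fun y H h χ B Λ hχ hc hB h1 hΛ h0 hg0 => ?_⟩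
  have hw := h.smooth_mul hχ
  have hws : HasCompactSupport fun x => χ x * y x := hc.mul_right
  have hS := hC _ _ hw hws
  have hm : AEMeasurable (fun x => ‖χ x * y x‖ₑ) :=
    (hχ.continuous.aestronglyMeasurable.mul h.locInt.aestronglyMeasurable).enorm
  -- Interpolation 10/3 = 4/3 + 2 with Hölder exponents 3/2 and 3: ∫|χy|^{10/3} ≤ (∫|χy|²)^{2/3}
  -- (∫|χy|⁶)^{1/3}.
  have hH := ENNReal.lintegral_mul_le_Lp_mul_Lq volume (p := 3 / 2) (q := 3)
    (Real.holderConjugate_iff.2 ⟨by norm_num, by norm_num⟩)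
    (f := fun x => ‖χ x * y x‖ₑ ^ (4 / 3 : ℝ)) (g := fun x => ‖χ x * y x‖ₑ ^ (2 : ℝ))
    (hm.pow_const _) (hm.pow_const _)
  have e1 : ∀ x, ((fun x => ‖χ x * y x‖ₑ ^ (4 / 3 : ℝ)) * fun x => ‖χ x * y x‖ₑ ^ (2 : ℝ)) x
      = ‖χ x * y x‖ₑ ^ (10 / 3 : ℝ) := fun x => by
    simp only [Pi.mul_apply]
    rw [← ENNReal.rpow_add_of_nonneg _ _ (by norm_num) (by norm_num)]
    norm_num
  have e2 : ∀ x, (‖χ x * y x‖ₑ ^ (4 / 3 : ℝ)) ^ (3 / 2 : ℝ) = ‖χ x * y x‖ₑ ^ 2 := fun x => by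
    rw [← ENNReal.rpow_mul, ← ENNReal.rpow_natCast]
    norm_num
  have e3 : ∀ x, (‖χ x * y x‖ₑ ^ (2 : ℝ)) ^ (3 : ℝ) = ‖χ x * y x‖ₑ ^ 6 := fun x => by
    rw [← ENNReal.rpow_mul, ← ENNReal.rpow_natCast]
    norm_num
  simp only [e1, e2, e3] at hH
  have b1 : ∫⁻ x, ‖χ x * y x‖ₑ ^ 2 ≤ ∫⁻ x in B, ‖y x‖ₑ ^ 2 := by
    rw [← lintegral_indicator hB]
    refine lintegral_mono fun x => ?_
    by_cases hx : x ∈ B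
    · rw [indicator_of_mem hx]
      gcongr
      refine enorm_le_iff_norm_le.2 ?_
      rw [norm_mul]
      exact mul_le_of_le_one_left (norm_nonneg _) (h1 x)
    · simp [h0 x hx]
  have b2 : ∫⁻ x, ‖χ x • H x + y x • gradient χ x‖ₑ ^ 2
      ≤ 2 * ((∫⁻ x in B, ‖H x‖ₑ ^ 2) + Λ ^ 2 * ∫⁻ x in B, ‖y x‖ₑ ^ 2) := by
    rw [← lintegral_const_mul' _ _ (by simp), ← lintegral_add_left'
      (h.locIntGrad.aestronglyMeasurable.enorm.pow_const 2).restrict,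
      ← lintegral_const_mul' _ _ (by simp), ← lintegral_indicator hB]
    refine lintegral_mono fun x => ?_
    by_cases hx : x ∈ B
    · rw [indicator_of_mem hx]
      have n1 : ‖χ x • H x + y x • gradient χ x‖ₑ ≤ ‖H x‖ₑ + Λ * ‖y x‖ₑ := by
        refine (enorm_add_le _ _).trans ?_
        gcongr
        · refine enorm_le_iff_norm_le.2 ?_
          rw [norm_smul]
          exact mul_le_of_le_one_left (norm_nonneg _) (h1 x)
        · rw [enorm_smul, mul_comm]
          gcongr
          rw [enorm_le_coe]
          exact hΛ x
      calc _ ≤ (‖H x‖ₑ + Λ * ‖y x‖ₑ) ^ 2 := by gcongr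
        _ ≤ 2 * (‖H x‖ₑ ^ 2 + (Λ * ‖y x‖ₑ) ^ 2) := by
            have := ENNReal.rpow_add_le_mul_rpow_add_rpow (‖H x‖ₑ) (Λ * ‖y x‖ₑ) (p := 2)
              (by norm_num)
            norm_num at this
            exact this
        _ = _ := by rw [mul_pow]
    · simp [h0 x hx, hg0 x hx]
  calc ∫⁻ x, ‖χ x * y x‖ₑ ^ (10 / 3 : ℝ)
      ≤ (∫⁻ x, ‖χ x * y x‖ₑ ^ 2) ^ (1 / (3 / 2) : ℝ) * (∫⁻ x, ‖χ x * y x‖ₑ ^ 6) ^ (1 / 3 : ℝ) := hH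
    _ ≤ (∫⁻ x in B, ‖y x‖ₑ ^ 2) ^ (2 / 3 : ℝ) * ((C : ℝ≥0∞) ^ (1 / 3 : ℝ) *
        (2 * ((∫⁻ x in B, ‖H x‖ₑ ^ 2) + Λ ^ 2 * ∫⁻ x in B, ‖y x‖ₑ ^ 2))) := by
        have : (1 / (3 / 2) : ℝ) = 2 / 3 := by norm_num
        rw [this]
        gcongr
        calc (∫⁻ x, ‖χ x * y x‖ₑ ^ 6) ^ (1 / 3 : ℝ)
            ≤ (C * (∫⁻ x, ‖χ x • H x + y x • gradient χ x‖ₑ ^ 2) ^ 3) ^ (1 / 3 : ℝ) := by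
              gcongr
          _ = (C : ℝ≥0∞) ^ (1 / 3 : ℝ) * ∫⁻ x, ‖χ x • H x + y x • gradient χ x‖ₑ ^ 2 := by
              rw [ENNReal.mul_rpow_of_nonneg _ _ (by norm_num), ← ENNReal.rpow_natCast,
                ← ENNReal.rpow_mul]
              norm_num
          _ ≤ _ := by gcongr
    _ = _ := by
        rw [ENNReal.coe_mul, ← ENNReal.coe_rpow_of_nonneg _ (by norm_num)]
        push_cast
        ring

/-! ### Radial kernels -/

lemma cutoff_nonneg (r : ℝ) : 0 ≤ cutoff r := Real.smoothTransition.nonneg _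

lemma cutoff_le_one (r : ℝ) : cutoff r ≤ 1 := Real.smoothTransition.le_one _

lemma cutoff_eq_one {r : ℝ} (h : 1 ≤ r) : cutoff r = 1 :=
  Real.smoothTransition.one_of_one_le (by linarith)

lemma cutoff_eq_zero {r : ℝ} (h : r ≤ 1 / 2) : cutoff r = 0 :=
  Real.smoothTransition.zero_of_nonpos (by linarith)

lemma cutoff_contDiff : ContDiff ℝ ∞ cutoff :=
  Real.smoothTransition.contDiff.comp (by fun_prop)

lemma cutoff_mono : Monotone cutoff := fun x y h =>
  Real.smoothTransition.monotone (by linarith)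

/-- The derivative is continuous on [0,1] and vanishes outside, where the transition is constant. -/
lemma exists_smoothTransition_deriv_bound :
    ∃ C : ℝ, 1 ≤ C ∧ ∀ r, |deriv Real.smoothTransition r| ≤ C := by
  have hc : Continuous (deriv Real.smoothTransition) :=
    (Real.smoothTransition.contDiff (n := 1)).continuous_deriv le_rfl
  obtain ⟨C, hC⟩ := (isCompact_Icc (a := (0 : ℝ)) (b := 1)).exists_bound_of_continuousOn
    hc.continuousOn
  refine ⟨max C 1, le_max_right _ _, fun r => ?_⟩
  by_cases hr : r ∈ Icc (0 : ℝ) 1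
  · exact (hC r hr).trans (le_max_left _ _)
  · have : deriv Real.smoothTransition r = 0 := by
      simp only [mem_Icc, not_and_or, not_le] at hr
      rcases hr with hr | hr
      · have : Real.smoothTransition =ᶠ[𝓝 r] fun _ => 0 := by
          filter_upwards [gt_mem_nhds hr] with s hs
          exact Real.smoothTransition.zero_of_nonpos hs.le
        rw [this.deriv_eq, deriv_const]
      · have : Real.smoothTransition =ᶠ[𝓝 r] fun _ => 1 := by
          filter_upwards [lt_mem_nhds hr] with s hs
          exact Real.smoothTransition.one_of_one_le hs.le
        rw [this.deriv_eq, deriv_const]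
    rw [this, abs_zero]
    positivity

lemma deriv_cutoff (r : ℝ) : deriv cutoff r = 2 * deriv Real.smoothTransition (2 * r - 1) := by
  have h1 : HasDerivAt (fun r : ℝ => 2 * r - 1) 2 r := by
    simpa using ((hasDerivAt_id r).const_mul 2).sub_const 1
  have h2 := ((Real.smoothTransition.contDiff (n := 1)).differentiable one_ne_zero
    (2 * r - 1)).hasDerivAt.comp r h1
  have h3 : deriv cutoff r = deriv Real.smoothTransition (2 * r - 1) * 2 := h2.deriv
  rw [h3, mul_comm]

/-! ### Profiles and radial coefficients -/

/-- The properties of the profile `k` that do not involve integrability. -/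
structure IsProfile (q : ℝ → ℝ) : Prop where
  contDiffOn : ContDiffOn ℝ 1 q (Ioi 0)
  pos : ∀ r, 0 < r → 0 < q r
  mono : MonotoneOn q (Ioi 0)
  anti : AntitoneOn (fun r => q r / r) (Ioi 0)

lemma IsCollisionKernel.isProfile_scaled {k : ℝ → ℝ} (h : IsCollisionKernel k) {ε : ℝ}
    (hε : 0 < ε) : IsProfile fun r => k (ε * r) := by
  have hm : ∀ r ∈ Ioi (0 : ℝ), ε * r ∈ Ioi (0 : ℝ) := fun r hr => mul_pos hε hr
  refine ⟨h.contDiffOn.comp (by fun_prop) hm, fun r hr => h.pos _ (hm r hr), ?_, ?_⟩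
  · intro r hr s hs hrs
    exact h.mono (hm r hr) (hm s hs) (by gcongr)
  · intro r hr s hs hrs
    have h1 := h.anti (hm r hr) (hm s hs) (mul_le_mul_of_nonneg_left hrs hε.le)
    have hr' : (0 : ℝ) < r := hr
    have hs' : (0 : ℝ) < s := hs
    simp only at h1 ⊢
    have e : ∀ x : ℝ, 0 < x → k (ε * x) / x = ε * (k (ε * x) / (ε * x)) := fun x hx => by
      field_simp
    rw [e s hs', e r hr']
    gcongr

namespace IsProfile

variable {q : ℝ → ℝ}

lemma differentiableAt (h : IsProfile q) {r : ℝ} (hr : 0 < r) : DifferentiableAt ℝ q r :=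
  (h.contDiffOn.differentiableOn one_ne_zero).differentiableAt (Ioi_mem_nhds hr)

/-- Monotonicity of q gives q' ≥ 0, and the sign of the derivative of q/r gives r q' ≤ q. So every
derivative falling on the profile costs only a factor 1/r. -/
lemma abs_deriv_le (h : IsProfile q) {r : ℝ} (hr : 0 < r) : |deriv q r| ≤ q r / r := by
  have hd := (h.differentiableAt hr).hasDerivAt
  have h0 : 0 ≤ deriv q r := by
    have := h.mono.derivWithin_nonneg (x := r)
    rwa [derivWithin_of_isOpen isOpen_Ioi hr] at this
  have hd2 := hd.div (hasDerivAt_id r) hr.ne'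
  have h1 : deriv (fun r => q r / r) r ≤ 0 := by
    have := h.anti.derivWithin_nonpos (x := r)
    rwa [derivWithin_of_isOpen isOpen_Ioi hr] at this
  have h2 : deriv (fun r => q r / r) r = (deriv q r * r - q r * 1) / r ^ 2 := hd2.deriv
  rw [h2] at h1
  have h3 : deriv q r * r - q r * 1 ≤ 0 := by
    by_contra hlt
    push Not at hlt
    exact absurd h1 (not_le.2 (by positivity))
  rw [abs_of_nonneg h0, le_div_iff₀ hr]
  linarith

lemma le_of_lt_one (h : IsProfile q) {r : ℝ} (hr : 0 < r) (hr1 : r ≤ 1) : q r ≤ q 1 :=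
  h.mono hr (mem_Ioi.2 one_pos) hr1

end IsProfile

/-- A radial coefficient: `C¹` on `(0,∞)` and vanishing near the origin. -/
structure IsRadial (c : ℝ → ℝ) : Prop where
  contDiffOn : ContDiffOn ℝ 1 c (Ioi 0)
  zero_near : ∃ a, 0 < a ∧ ∀ r, r ≤ a → c r = 0

namespace IsRadial

variable {c : ℝ → ℝ}

lemma differentiableAt (h : IsRadial c) {r : ℝ} (hr : 0 < r) : DifferentiableAt ℝ c r :=
  (h.contDiffOn.differentiableOn one_ne_zero).differentiableAt (Ioi_mem_nhds hr)

/-- The norm is smooth away from 0, and near 0 the coefficient vanishes identically. -/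
lemma contDiff_norm (h : IsRadial c) : ContDiff ℝ 1 fun z : E => c ‖z‖ := by
  rw [contDiff_iff_contDiffAt]
  intro z
  by_cases hz : z = 0
  · obtain ⟨a, ha, h0⟩ := h.zero_near
    have : (fun z : E => c ‖z‖) =ᶠ[𝓝 z] fun _ => 0 := by
      filter_upwards [Metric.ball_mem_nhds z ha] with y hy
      subst hz
      exact h0 _ (by simpa using (Metric.mem_ball.1 hy).le)
    exact contDiffAt_const.congr_of_eventuallyEq this
  · have h1 : ContDiffAt ℝ 1 c ‖z‖ := h.contDiffOn.contDiffAt (Ioi_mem_nhds (norm_pos_iff.2 hz))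
    exact h1.comp z (contDiffAt_norm ℝ hz)

lemma mul (h : IsRadial c) {d : ℝ → ℝ} (hd : ContDiffOn ℝ 1 d (Ioi 0)) :
    IsRadial fun r => c r * d r := by
  refine ⟨h.contDiffOn.mul hd, ?_⟩
  obtain ⟨a, ha, h0⟩ := h.zero_near
  exact ⟨a, ha, fun r hr => by rw [h0 r hr, zero_mul]⟩

lemma sub (h : IsRadial c) {d : ℝ → ℝ} (hd : IsRadial d) : IsRadial fun r => c r - d r := by
  refine ⟨h.contDiffOn.sub hd.contDiffOn, ?_⟩
  obtain ⟨a, ha, h0⟩ := h.zero_near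
  obtain ⟨b, hb, h1⟩ := hd.zero_near
  exact ⟨min a b, lt_min ha hb, fun r hr => by
    rw [h0 r (hr.trans (min_le_left _ _)), h1 r (hr.trans (min_le_right _ _)), sub_zero]⟩

lemma div_pow (h : IsRadial c) (n : ℕ) : IsRadial fun r => c r / r ^ n := by
  have := h.mul (d := fun r => (r ^ n)⁻¹) (ContDiffOn.inv (by fun_prop) fun r hr =>
    pow_ne_zero _ (ne_of_gt hr))
  simpa only [div_eq_mul_inv] using this

end IsRadial

lemma hasFDerivAt_comp_norm {c : ℝ → ℝ} {z : E} (hz : z ≠ 0) (hc : DifferentiableAt ℝ c ‖z‖) :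
    HasFDerivAt (fun z : E => c ‖z‖) ((deriv c ‖z‖ / ‖z‖) • innerSL ℝ z) z := by
  have h1 : HasFDerivAt (fun z : E => ‖z‖) ((1 / ‖z‖) • innerSL ℝ z) z := by
    have h2 : HasFDerivAt (fun z : E => √(‖z‖ ^ 2)) _ z :=
      (hasStrictFDerivAt_norm_sq z).hasFDerivAt.sqrt (by simpa using hz)
    simp only [Real.sqrt_sq (norm_nonneg _)] at h2
    refine h2.congr_fderiv ?_
    ext e
    simp
    field_simp
  refine (hc.hasDerivAt.comp_hasFDerivAt z h1).congr_fderiv ?_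
  ext e
  simp
  ring

/-! ### The matrix field c(|z|) Π(z) and its divergence -/

/-- The matrix field `c(|z|) Π(z)`. -/
def radK (c : ℝ → ℝ) (z : E) : E →L[ℝ] E := c ‖z‖ • proj z

/-- The divergence of the matrix field `c(|z|) Π(z)`. -/
def radD (c : ℝ → ℝ) (z : E) : E := (-2 * (c ‖z‖ / ‖z‖ ^ 2)) • z

lemma proj_apply (z e : E) : proj z e = e - ((‖z‖ ^ 2)⁻¹ * ⟪z, e⟫) • z := by
  simp [proj, smul_smul]

lemma proj_neg (z : E) : proj (-z) = proj z := by
  ext1 e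
  simp [proj_apply]

lemma inner_proj_self (z e : E) : ⟪proj z e, e⟫ = ‖e‖ ^ 2 - (‖z‖ ^ 2)⁻¹ * ⟪z, e⟫ ^ 2 := by
  rw [proj_apply, inner_sub_left, inner_smul_left, real_inner_self_eq_norm_sq]
  simp only [conj_trivial]
  ring

lemma inner_proj_nonneg (z e : E) : 0 ≤ ⟪proj z e, e⟫ := by
  rw [inner_proj_self]
  by_cases hz : z = 0
  · simp [hz]
  · have hz' : 0 < ‖z‖ ^ 2 := by positivity
    have h1 := abs_real_inner_le_norm z e
    have h2 : ⟪z, e⟫ ^ 2 ≤ ‖z‖ ^ 2 * ‖e‖ ^ 2 := by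
      rw [← sq_abs, ← mul_pow]
      gcongr
    have h3 : (‖z‖ ^ 2)⁻¹ * ⟪z, e⟫ ^ 2 ≤ (‖z‖ ^ 2)⁻¹ * (‖z‖ ^ 2 * ‖e‖ ^ 2) := by gcongr
    rw [← mul_assoc, inv_mul_cancel₀ hz'.ne', one_mul] at h3
    linarith

lemma inner_proj_le (z e : E) : ⟪proj z e, e⟫ ≤ ‖e‖ ^ 2 := by
  rw [inner_proj_self]
  have : 0 ≤ (‖z‖ ^ 2)⁻¹ * ⟪z, e⟫ ^ 2 := by positivity
  linarith

lemma inner_proj_comm (z x y : E) : ⟪proj z x, y⟫ = ⟪x, proj z y⟫ := by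
  rw [proj_apply, proj_apply, inner_sub_left, inner_sub_right, inner_smul_left, inner_smul_right,
    real_inner_comm x z]
  simp only [conj_trivial]
  ring

lemma norm_proj_apply_sq (z e : E) : ‖proj z e‖ ^ 2 = ⟪proj z e, e⟫ := by
  have h : proj z (proj z e) = proj z e := by
    by_cases hz : z = 0
    · simp [proj_apply, hz]
    · have hz' : ‖z‖ ^ 2 ≠ 0 := by positivity
      have h0 : ⟪z, proj z e⟫ = 0 := by
        rw [proj_apply, inner_sub_right, inner_smul_right, real_inner_self_eq_norm_sq]
        field_simp
        ring
      rw [proj_apply z (proj z e), h0]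
      simp
  rw [← real_inner_self_eq_norm_sq, inner_proj_comm, h, real_inner_comm]

lemma norm_proj_apply_le (z e : E) : ‖proj z e‖ ≤ ‖e‖ := by
  have h1 := norm_proj_apply_sq z e
  have h2 := inner_proj_le z e
  exact le_of_sq_le_sq (by linarith) (norm_nonneg e) |> fun h => h

lemma norm_proj_le (z : E) : ‖proj z‖ ≤ 1 :=
  ContinuousLinearMap.opNorm_le_bound _ zero_le_one fun e => by
    rw [one_mul]; exact norm_proj_apply_le z e

lemma radK_neg (c : ℝ → ℝ) (z : E) : radK c (-z) = radK c z := by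
  simp [radK, proj_neg]

lemma norm_radK_le (c : ℝ → ℝ) (z : E) : ‖radK c z‖ ≤ |c ‖z‖| := by
  rw [radK, norm_smul, Real.norm_eq_abs]
  exact mul_le_of_le_one_right (abs_nonneg _) (norm_proj_le z)

lemma norm_radD_le (c : ℝ → ℝ) (z : E) : ‖radD c z‖ ≤ 2 * (|c ‖z‖| / ‖z‖) := by
  rw [radD, norm_smul, Real.norm_eq_abs, abs_mul, abs_div]
  by_cases hz : z = 0
  · simp [hz]
  · have : 0 < ‖z‖ := norm_pos_iff.2 hz
    rw [abs_of_pos (show (0 : ℝ) < ‖z‖ ^ 2 by positivity)]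
    simp only [abs_neg, Nat.abs_ofNat]
    apply le_of_eq
    field_simp

namespace IsRadial

variable {c : ℝ → ℝ}

lemma contDiff_radK_apply (h : IsRadial c) (e : E) : ContDiff ℝ 1 fun z => radK c z e := by
  have h1 := h.contDiff_norm
  have h2 := (h.div_pow 2).contDiff_norm
  have : (fun z => radK c z e) = fun z : E => c ‖z‖ • e - (c ‖z‖ / ‖z‖ ^ 2 * ⟪z, e⟫) • z := by
    funext z
    rw [radK, smul_apply, proj_apply, smul_sub, smul_smul]
    congr 2
    ring
  rw [this]
  have h3 : ContDiff ℝ 1 fun z : E => ⟪z, e⟫ := contDiff_id.inner ℝ contDiff_const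
  exact (h1.smul contDiff_const).sub ((h2.mul h3).smul contDiff_id)

lemma continuous_radK (h : IsRadial c) : Continuous (radK c) := by
  have h1 := h.contDiff_norm.continuous
  have h2 := (h.div_pow 2).contDiff_norm.continuous
  have : radK c = fun z : E => c ‖z‖ • ContinuousLinearMap.id ℝ E
      - (c ‖z‖ / ‖z‖ ^ 2) • (innerSL ℝ z).smulRight z := by
    funext z
    rw [radK, proj, smul_sub, smul_smul]
    congr 2
  rw [this]
  have h3 : Continuous fun z : E => (innerSL ℝ z).smulRight z := by
    have : (fun z : E => (innerSL ℝ z).smulRight z) = fun z : E =>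
        ContinuousLinearMap.smulRightL ℝ E E (innerSL ℝ z) z := rfl
    rw [this]
    fun_prop
  exact (h1.smul continuous_const).sub (h2.smul h3)

lemma contDiff_radD (h : IsRadial c) : ContDiff ℝ 1 (radD c) := by
  have h2 := (h.div_pow 2).contDiff_norm
  unfold radD
  fun_prop

lemma hasFDerivAt_radK (h : IsRadial c) {z : E} (hz : z ≠ 0) (e : E) :
    HasFDerivAt (fun z => radK c z e)
      (((deriv c ‖z‖ / ‖z‖) • innerSL ℝ z).smulRight e
        - ((c ‖z‖ / ‖z‖ ^ 2 * ⟪z, e⟫) • ContinuousLinearMap.id ℝ E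
          + ((c ‖z‖ / ‖z‖ ^ 2) • innerSL ℝ e
            + (⟪z, e⟫ * ((deriv c ‖z‖ * ‖z‖ ^ 2 - c ‖z‖ * (2 * ‖z‖)) / (‖z‖ ^ 2) ^ 2 / ‖z‖))
              • innerSL ℝ z).smulRight z)) z := by
  have hn : 0 < ‖z‖ := norm_pos_iff.2 hz
  have hd := h.differentiableAt hn
  have h1 := (hasFDerivAt_comp_norm hz hd).smul_const e
  have hd2 : HasDerivAt (fun r => c r / r ^ 2)
      ((deriv c ‖z‖ * ‖z‖ ^ 2 - c ‖z‖ * (2 * ‖z‖)) / (‖z‖ ^ 2) ^ 2) ‖z‖ := by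
    have := hd.hasDerivAt.fun_div (hasDerivAt_pow 2 ‖z‖) (by positivity)
    simpa using this
  have h2 := hasFDerivAt_comp_norm hz hd2.differentiableAt
  rw [hd2.deriv] at h2
  have h3 : HasFDerivAt (fun z : E => ⟪z, e⟫) (innerSL ℝ e) z := by
    have := (innerSL ℝ e).hasFDerivAt (x := z)
    refine this.congr_of_eventuallyEq (Eventually.of_forall fun y => ?_)
    simp [real_inner_comm]
  have h4 := (h2.mul h3).smul (hasFDerivAt_id z)
  have : (fun z => radK c z e) = fun z : E => c ‖z‖ • e - (c ‖z‖ / ‖z‖ ^ 2 * ⟪z, e⟫) • z := by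
    funext z
    rw [radK, smul_apply, proj_apply, smul_sub, smul_smul]
    congr 2
    ring
  rw [this]
  refine (h1.sub h4).congr_fderiv ?_
  ext1 y
  simp [smul_smul]

lemma eventuallyEq_zero (h : IsRadial c) (e : E) : (fun z => radK c z e) =ᶠ[𝓝 0] fun _ => 0 := by
  obtain ⟨a, ha, h0⟩ := h.zero_near
  filter_upwards [Metric.ball_mem_nhds (0 : E) ha] with y hy
  rw [radK, h0 _ (by simpa using (Metric.mem_ball.1 hy).le)]
  simp

lemma sum_sq (z : E) : ∑ i : Fin 3, z i * z i = ‖z‖ ^ 2 := by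
  rw [EuclideanSpace.norm_sq_eq]
  simp [sq]

lemma sum_single (z : E) : ∑ i : Fin 3, z i • (EuclideanSpace.single i (1 : ℝ) : E) = z := by
  ext j
  fin_cases j <;> simp [Fin.sum_univ_three]

/-- The radial derivative of c is multiplied by Π(z)z = 0 and drops out; what remains is c times ∇·Π
= -2z/|z|² in dimension three. The divergence therefore contains no derivative of the profile and is
only one order more singular than the kernel. -/
lemma matDiv_radK (h : IsRadial c) (z : E) : matDiv (radK c) z = radD c z := by
  unfold matDiv
  by_cases hz : z = 0
  · subst hz
    have : ∀ i : Fin 3, fderiv ℝ (fun u => radK c u (EuclideanSpace.single i 1)) 0 = 0 := fun i => by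
      rw [(h.eventuallyEq_zero _).fderiv_eq]
      simp
    simp [this, radD]
  · have hn : 0 < ‖z‖ := norm_pos_iff.2 hz
    simp only [(h.hasFDerivAt_radK hz _).fderiv]
    have hs : ∀ i : Fin 3, ⟪z, (EuclideanSpace.single i (1 : ℝ) : E)⟫ = z i := fun i => by
      rw [real_inner_comm, inner_single]
    have hss : ∀ i : Fin 3, ⟪(EuclideanSpace.single i (1 : ℝ) : E), EuclideanSpace.single i (1 : ℝ)⟫
        = 1 := fun i => by
      rw [inner_single]; simp
    simp only [sub_apply, add_apply,
      ContinuousLinearMap.smulRight_apply, smul_apply, innerSL_apply_apply, hs, hss,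
      ContinuousLinearMap.id_apply, smul_eq_mul, mul_one]
    set A := deriv c ‖z‖ with hA
    set B := (A * ‖z‖ ^ 2 - c ‖z‖ * (2 * ‖z‖)) / (‖z‖ ^ 2) ^ 2 / ‖z‖ with hB
    have e1 : ∀ i : Fin 3, ((A / ‖z‖ * z i) • (EuclideanSpace.single i (1 : ℝ) : E)
        - ((c ‖z‖ / ‖z‖ ^ 2 * z i) • (EuclideanSpace.single i (1 : ℝ) : E)
          + (c ‖z‖ / ‖z‖ ^ 2 + z i * B * z i) • z))
        = (A / ‖z‖ - c ‖z‖ / ‖z‖ ^ 2) • (z i • (EuclideanSpace.single i (1 : ℝ) : E))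
          - (c ‖z‖ / ‖z‖ ^ 2) • z - (B * (z i * z i)) • z := fun i => by
      module
    simp only [e1, Finset.sum_sub_distrib, ← Finset.smul_sum, ← Finset.sum_smul, sum_single,
      ← Finset.mul_sum, sum_sq]
    rw [radD, hB]
    simp only [Finset.sum_const, Finset.card_univ, Fintype.card_fin, ← Nat.cast_smul_eq_nsmul ℝ,
      smul_smul, ← sub_smul]
    congr 1
    field_simp
    push_cast
    ring

/-- The same computation for the vector field obtained by applying the matrix to a fixed ξ, the form
required when integrating by parts inside the convolution. -/
lemma divg_radK_apply (h : IsRadial c) (z ξ : E) :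
    divg (fun z => radK c z ξ) z = ⟪radD c z, ξ⟫ := by
  unfold divg
  by_cases hz : z = 0
  · subst hz
    have : fderiv ℝ (fun u => radK c u ξ) 0 = 0 := by
      rw [(h.eventuallyEq_zero _).fderiv_eq]
      simp
    simp [this, radD]
  · have hn : 0 < ‖z‖ := norm_pos_iff.2 hz
    simp only [(h.hasFDerivAt_radK hz _).fderiv]
    have hs : ∀ (y : E) (i : Fin 3), ⟪y, (EuclideanSpace.single i (1 : ℝ) : E)⟫ = y i :=
      fun y i => by
        rw [real_inner_comm, inner_single]
    have hss : ∀ i : Fin 3, (EuclideanSpace.single i (1 : ℝ) : E).ofLp i = 1 := fun i => by simp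
    simp only [sub_apply, add_apply,
      ContinuousLinearMap.smulRight_apply, smul_apply, innerSL_apply_apply, hs,
      ContinuousLinearMap.id_apply, smul_eq_mul, PiLp.sub_apply, PiLp.add_apply, PiLp.smul_apply,
      hss, mul_one]
    set A := deriv c ‖z‖ with hA
    set B := (A * ‖z‖ ^ 2 - c ‖z‖ * (2 * ‖z‖)) / (‖z‖ ^ 2) ^ 2 / ‖z‖ with hB
    have hi : ⟪z, ξ⟫ = ∑ i : Fin 3, z i * ξ i := by
      simp [PiLp.inner_apply, mul_comm]
    have e1 : ∀ i : Fin 3, (A / ‖z‖ * z i * ξ i - (c ‖z‖ / ‖z‖ ^ 2 * ⟪z, ξ⟫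
        + (c ‖z‖ / ‖z‖ ^ 2 * ξ i + ⟪z, ξ⟫ * B * z i) * z i))
        = (A / ‖z‖ - c ‖z‖ / ‖z‖ ^ 2) * (z i * ξ i) - c ‖z‖ / ‖z‖ ^ 2 * ⟪z, ξ⟫
          - ⟪z, ξ⟫ * B * (z i * z i) := fun i => by
      ring
    simp only [e1, Finset.sum_sub_distrib, ← Finset.mul_sum, sum_sq, ← hi]
    rw [radD, inner_smul_left, hB]
    simp only [Finset.sum_const, Finset.card_univ, Fintype.card_fin, conj_trivial, nsmul_eq_mul]
    field_simp
    push_cast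
    ring

end IsRadial

/-! ### The kernel cut off near the origin -/

/-- The radial coefficient `X(N r) q(r) / r` of the kernel without its singularity. -/
def cutC (q : ℝ → ℝ) (N r : ℝ) : ℝ := cutoff (N * r) * (q r / r)

/-- A bound for `cutC`. -/
def cutW (q : ℝ → ℝ) (N r : ℝ) : ℝ := if 1 / 2 ≤ N * r then q r / r else 0

lemma cutC_of_lt {q : ℝ → ℝ} {N r : ℝ} (h : N * r ≤ 1 / 2) : cutC q N r = 0 := by
  rw [cutC, cutoff_eq_zero h, zero_mul]

namespace IsProfile

variable {q : ℝ → ℝ} {N r : ℝ}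

lemma div_nonneg (h : IsProfile q) (hr : 0 < r) : 0 ≤ q r / r :=
  _root_.div_nonneg (h.pos r hr).le hr.le

lemma pos_of_half_le (hN : 0 < N) (h : 1 / 2 ≤ N * r) : 0 < r := by
  by_contra hr
  push Not at hr
  nlinarith

lemma isRadial_cutC (h : IsProfile q) (hN : 0 < N) : IsRadial (cutC q N) := by
  refine ⟨?_, 1 / (2 * N), by positivity, fun r hr => cutC_of_lt ?_⟩
  · refine ContDiffOn.mul ?_ (h.contDiffOn.div contDiffOn_id fun r hr => ne_of_gt hr)
    exact ((cutoff_contDiff.of_le (by simp)).comp (contDiff_const.mul contDiff_id)).contDiffOn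
  · calc N * r ≤ N * (1 / (2 * N)) := by gcongr
      _ = 1 / 2 := by field_simp

lemma cutW_nonneg (h : IsProfile q) (hN : 0 < N) : 0 ≤ cutW q N r := by
  unfold cutW
  split_ifs with h1
  · exact h.div_nonneg (pos_of_half_le hN h1)
  · exact le_rfl

lemma cutC_nonneg (h : IsProfile q) (hN : 0 < N) : 0 ≤ cutC q N r := by
  by_cases h1 : 1 / 2 ≤ N * r
  · exact mul_nonneg (cutoff_nonneg _) (h.div_nonneg (pos_of_half_le hN h1))
  · rw [cutC_of_lt (not_le.1 h1).le]

lemma cutC_le_cutW (h : IsProfile q) (hN : 0 < N) : cutC q N r ≤ cutW q N r := by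
  unfold cutW
  split_ifs with h1
  · exact mul_le_of_le_one_left (h.div_nonneg (pos_of_half_le hN h1)) (cutoff_le_one _)
  · rw [cutC_of_lt (not_le.1 h1).le]

lemma cutW_le (h : IsProfile q) (hN : 0 < N) :
    cutW q N r ≤ q (1 / (2 * N)) / (1 / (2 * N)) := by
  have hp : (0 : ℝ) < 1 / (2 * N) := by positivity
  unfold cutW
  split_ifs with h1
  · refine h.anti hp (pos_of_half_le hN h1) ?_
    rw [div_le_iff₀ (by positivity)]
    linarith
  · exact h.div_nonneg hp

/-- On the support 1/2 ≤ N r, so each factor 1/r is traded for 2N. -/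
lemma cutW_div_le (h : IsProfile q) (hN : 0 < N) : cutW q N r / r ≤ 2 * N * cutW q N r := by
  have h0 := h.cutW_nonneg hN (r := r)
  by_cases h1 : 1 / 2 ≤ N * r
  · have hr := pos_of_half_le hN h1
    rw [div_le_iff₀ hr]
    nlinarith
  · rw [cutW, if_neg h1]
    simp

end IsProfile

/-- The constant is independent of q and N. The derivative of the cutoff lives where N r ≤ 1, so its
factor N is at most 1/r there, and differentiating q/r costs another 1/r by `abs_deriv_le`. -/
lemma exists_deriv_cutC_bound : ∃ D : ℝ, 1 ≤ D ∧ ∀ (q : ℝ → ℝ) (N r : ℝ), IsProfile q → 0 < N →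
    0 < r → |deriv (cutC q N) r| ≤ D * (cutW q N r / r) := by
  obtain ⟨C, hC1, hC⟩ := exists_smoothTransition_deriv_bound
  refine ⟨2 * C + 2, by linarith, fun q N r h hN hr => ?_⟩
  have hq := h.pos r hr
  by_cases h1 : 1 / 2 ≤ N * r
  · have hW : cutW q N r = q r / r := if_pos h1
    have hd1 : HasDerivAt (fun r => cutoff (N * r)) (deriv cutoff (N * r) * N) r := by
      have := ((cutoff_contDiff.differentiable (by simp)) (N * r)).hasDerivAt.comp r
        ((hasDerivAt_id r).const_mul N)
      rw [mul_one] at this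
      exact this
    have hd2 : HasDerivAt (fun r => q r / r) ((deriv q r * r - q r * 1) / r ^ 2) r :=
      (h.differentiableAt hr).hasDerivAt.fun_div (hasDerivAt_id r) hr.ne'
    have hd : deriv (cutC q N) r = _ := (hd1.mul hd2).deriv
    rw [hd, hW]
    have b1 : |deriv cutoff (N * r) * N| ≤ 2 * C / r := by
      rw [abs_mul, abs_of_pos hN]
      by_cases h2 : N * r ≤ 1
      · have : |deriv cutoff (N * r)| ≤ 2 * C := by
          rw [deriv_cutoff, abs_mul]
          simpa using hC _
        rw [le_div_iff₀ hr, mul_assoc]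
        nlinarith [abs_nonneg (deriv cutoff (N * r))]
      · have : cutoff =ᶠ[𝓝 (N * r)] fun _ => 1 := by
          filter_upwards [lt_mem_nhds (not_le.1 h2)] with s hs
          exact cutoff_eq_one hs.le
        rw [this.deriv_eq, deriv_const]
        simp
        positivity
    have b2 : |(deriv q r * r - q r * 1) / r ^ 2| ≤ 2 * (q r / r / r) := by
      rw [abs_div, abs_of_pos (show 0 < r ^ 2 by positivity), div_le_iff₀ (by positivity)]
      have h3 := h.abs_deriv_le hr
      rw [le_div_iff₀ hr] at h3
      have h4 : 2 * (q r / r / r) * r ^ 2 = 2 * q r := by field_simp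
      rw [h4]
      calc _ ≤ |deriv q r * r| + |q r * 1| := abs_sub _ _
        _ ≤ _ := by
          rw [abs_mul, abs_of_pos hr, mul_one, abs_of_pos hq]
          linarith
    calc _ ≤ |deriv cutoff (N * r) * N * (q r / r)|
          + |cutoff (N * r) * ((deriv q r * r - q r * 1) / r ^ 2)| := abs_add_le _ _
      _ ≤ 2 * C / r * (q r / r) + 1 * (2 * (q r / r / r)) := by
          rw [abs_mul, abs_mul (cutoff (N * r)), abs_of_nonneg (h.div_nonneg hr),
            abs_of_nonneg (cutoff_nonneg (N * r))]
          have := cutoff_nonneg (N * r)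
          have := h.div_nonneg hr
          gcongr
          exact cutoff_le_one _
      _ = _ := by ring
  · have : cutC q N =ᶠ[𝓝 r] fun _ => 0 := by
      have : ∀ᶠ s in 𝓝 r, N * s < 1 / 2 :=
        ContinuousAt.eventually_lt (by fun_prop) continuousAt_const (not_le.1 h1)
      filter_upwards [this] with s hs
      exact cutC_of_lt hs.le
    rw [this.deriv_eq, deriv_const, abs_zero]
    have := h.cutW_nonneg hN (r := r)
    positivity

namespace IsRadial

variable {c : ℝ → ℝ}

lemma norm_fderiv_radK_le (h : IsRadial c) (z e : E) :
    ‖fderiv ℝ (fun z => radK c z e) z‖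
      ≤ (2 * |deriv c ‖z‖| + 4 * (|c ‖z‖| / ‖z‖)) * ‖e‖ := by
  by_cases hz : z = 0
  · subst hz
    rw [(h.eventuallyEq_zero _).fderiv_eq]
    simp only [fderiv_fun_const, Pi.zero_apply, norm_zero]
    positivity
  · have hn : 0 < ‖z‖ := norm_pos_iff.2 hz
    rw [(h.hasFDerivAt_radK hz e).fderiv]
    refine ContinuousLinearMap.opNorm_le_bound _ (by positivity) fun y => ?_
    set A := deriv c ‖z‖
    set r := ‖z‖
    simp only [sub_apply, add_apply, ContinuousLinearMap.smulRight_apply, smul_apply,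
      innerSL_apply_apply, ContinuousLinearMap.id_apply, smul_eq_mul]
    have i1 : |⟪z, y⟫| ≤ r * ‖y‖ := abs_real_inner_le_norm z y
    have i2 : |⟪z, e⟫| ≤ r * ‖e‖ := abs_real_inner_le_norm z e
    have i3 : |⟪e, y⟫| ≤ ‖e‖ * ‖y‖ := abs_real_inner_le_norm e y
    have g1 : ‖(A / r * ⟪z, y⟫) • e‖ ≤ |A| * ‖e‖ * ‖y‖ := by
      rw [norm_smul, Real.norm_eq_abs, abs_mul, abs_div, abs_of_pos hn]
      calc |A| / r * |⟪z, y⟫| * ‖e‖ ≤ |A| / r * (r * ‖y‖) * ‖e‖ := by gcongr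
        _ = _ := by field_simp
    have g2 : ‖(c r / r ^ 2 * ⟪z, e⟫) • y‖ ≤ |c r| / r * ‖e‖ * ‖y‖ := by
      rw [norm_smul, Real.norm_eq_abs, abs_mul, abs_div, abs_of_pos (show 0 < r ^ 2 by positivity)]
      calc |c r| / r ^ 2 * |⟪z, e⟫| * ‖y‖ ≤ |c r| / r ^ 2 * (r * ‖e‖) * ‖y‖ := by gcongr
        _ = _ := by field_simp
    have g3 : ‖(c r / r ^ 2 * ⟪e, y⟫ + ⟪z, e⟫ * ((A * r ^ 2 - c r * (2 * r)) / (r ^ 2) ^ 2 / r)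
        * ⟪z, y⟫) • z‖ ≤ (|A| + 3 * (|c r| / r)) * ‖e‖ * ‖y‖ := by
      rw [norm_smul, Real.norm_eq_abs]
      have k1 : |c r / r ^ 2 * ⟪e, y⟫| ≤ |c r| / r ^ 2 * (‖e‖ * ‖y‖) := by
        rw [abs_mul, abs_div, abs_of_pos (show 0 < r ^ 2 by positivity)]
        gcongr
      have k2 : |A * r ^ 2 - c r * (2 * r)| ≤ |A| * r ^ 2 + |c r| * (2 * r) := by
        refine (abs_sub _ _).trans ?_
        rw [abs_mul, abs_mul, abs_of_pos (show 0 < r ^ 2 by positivity),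
          abs_of_pos (show 0 < 2 * r by positivity)]
      have k3 : |⟪z, e⟫ * ((A * r ^ 2 - c r * (2 * r)) / (r ^ 2) ^ 2 / r) * ⟪z, y⟫|
          ≤ (r * ‖e‖) * ((|A| * r ^ 2 + |c r| * (2 * r)) / (r ^ 2) ^ 2 / r) * (r * ‖y‖) := by
        rw [abs_mul, abs_mul, abs_div, abs_div, abs_of_pos hn,
          abs_of_pos (show 0 < (r ^ 2) ^ 2 by positivity)]
        gcongr
      calc _ ≤ (|c r| / r ^ 2 * (‖e‖ * ‖y‖)
            + (r * ‖e‖) * ((|A| * r ^ 2 + |c r| * (2 * r)) / (r ^ 2) ^ 2 / r) * (r * ‖y‖)) * r := by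
            gcongr
            exact (abs_add_le _ _).trans (add_le_add k1 k3)
        _ = _ := by
            field_simp
            ring
    calc _ ≤ |A| * ‖e‖ * ‖y‖ + (|c r| / r * ‖e‖ * ‖y‖ + (|A| + 3 * (|c r| / r)) * ‖e‖ * ‖y‖) :=
          (norm_sub_le _ _).trans (add_le_add g1 ((norm_add_le _ _).trans (add_le_add g2 g3)))
      _ = _ := by ring

lemma norm_fderiv_radD_le (h : IsRadial c) (z : E) :
    ‖fderiv ℝ (radD c) z‖ ≤ 2 * (|deriv c ‖z‖| / ‖z‖ + 3 * (|c ‖z‖| / ‖z‖ ^ 2)) := by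
  by_cases hz : z = 0
  · subst hz
    have : radD c =ᶠ[𝓝 0] fun _ => 0 := by
      obtain ⟨a, ha, h0⟩ := h.zero_near
      filter_upwards [Metric.ball_mem_nhds (0 : E) ha] with y hy
      rw [radD, h0 _ (by simpa using (Metric.mem_ball.1 hy).le)]
      simp
    rw [this.fderiv_eq]
    simp only [fderiv_fun_const, Pi.zero_apply, norm_zero]
    positivity
  · have hn : 0 < ‖z‖ := norm_pos_iff.2 hz
    have hd := h.differentiableAt hn
    have hd2 : HasDerivAt (fun r => c r / r ^ 2)
        ((deriv c ‖z‖ * ‖z‖ ^ 2 - c ‖z‖ * (2 * ‖z‖)) / (‖z‖ ^ 2) ^ 2) ‖z‖ := by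
      have := hd.hasDerivAt.fun_div (hasDerivAt_pow 2 ‖z‖) (by positivity)
      simpa using this
    have h2 := hasFDerivAt_comp_norm hz hd2.differentiableAt
    rw [hd2.deriv] at h2
    have h3 : HasFDerivAt (radD c) _ z := (h2.const_mul (-2)).smul (hasFDerivAt_id z)
    rw [h3.fderiv]
    refine ContinuousLinearMap.opNorm_le_bound _ (by positivity) fun y => ?_
    set A := deriv c ‖z‖
    set r := ‖z‖
    simp only [add_apply, ContinuousLinearMap.smulRight_apply, smul_apply,
      innerSL_apply_apply, ContinuousLinearMap.id_apply, smul_eq_mul]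
    have i1 : |⟪z, y⟫| ≤ r * ‖y‖ := abs_real_inner_le_norm z y
    have k2 : |A * r ^ 2 - c r * (2 * r)| ≤ |A| * r ^ 2 + |c r| * (2 * r) := by
      refine (abs_sub _ _).trans ?_
      rw [abs_mul, abs_mul, abs_of_pos (show 0 < r ^ 2 by positivity),
        abs_of_pos (show 0 < 2 * r by positivity)]
    have g1 : ‖(-2 * (c r / r ^ 2)) • y‖ ≤ 2 * (|c r| / r ^ 2) * ‖y‖ := by
      rw [norm_smul, Real.norm_eq_abs, abs_mul, abs_div, abs_of_pos (show 0 < r ^ 2 by positivity)]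
      simp
    have g2 : ‖(-2 * ((A * r ^ 2 - c r * (2 * r)) / (r ^ 2) ^ 2 / r * ⟪z, y⟫)) • z‖
        ≤ 2 * (|A| / r + 2 * (|c r| / r ^ 2)) * ‖y‖ := by
      rw [norm_smul, Real.norm_eq_abs, abs_mul, abs_mul, abs_div, abs_div, abs_of_pos hn,
        abs_of_pos (show 0 < (r ^ 2) ^ 2 by positivity)]
      calc _ ≤ |(-2 : ℝ)| * ((|A| * r ^ 2 + |c r| * (2 * r)) / (r ^ 2) ^ 2 / r * (r * ‖y‖)) * r := by
            gcongr
        _ = _ := by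
            simp only [abs_neg, Nat.abs_ofNat]
            field_simp
    calc _ ≤ 2 * (|c r| / r ^ 2) * ‖y‖ + 2 * (|A| / r + 2 * (|c r| / r ^ 2)) * ‖y‖ :=
          (norm_add_le _ _).trans (add_le_add g1 g2)
      _ = _ := by ring

end IsRadial

/-! ### Differentiation of convolutions with bounded kernels -/

lemma integrable_smul_comp_sub {F : Type*} [NormedAddCommGroup F] [NormedSpace ℝ F]
    {f : E → ℝ} (hf : Integrable f) {Φ : E → F} (hΦ : Continuous Φ) {C : ℝ} (hC : ∀ z, ‖Φ z‖ ≤ C)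
    (v : E) : Integrable fun w => f w • Φ (v - w) :=
  hf.smul_bdd C (by fun_prop) (Eventually.of_forall fun w => hC (v - w))

lemma hasFDerivAt_integral_smul_comp_sub {F : Type*} [NormedAddCommGroup F] [NormedSpace ℝ F]
    {f : E → ℝ} (hf : Integrable f) {Φ : E → F} (hΦ : ContDiff ℝ 1 Φ) {C C' : ℝ}
    (hC : ∀ z, ‖Φ z‖ ≤ C) (hC' : ∀ z, ‖fderiv ℝ Φ z‖ ≤ C') (v : E) :
    HasFDerivAt (fun v => ∫ w, f w • Φ (v - w)) (∫ w, f w • fderiv ℝ Φ (v - w)) v := by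
  have hcf := hΦ.continuous_fderiv one_ne_zero
  refine hasFDerivAt_integral_of_dominated_of_fderiv_le (s := univ)
    (F := fun v w => f w • Φ (v - w)) (F' := fun v w => f w • fderiv ℝ Φ (v - w))
    (bound := fun w => ‖f w‖ * C') Filter.univ_mem ?_
    (integrable_smul_comp_sub hf hΦ.continuous hC v) ?_ ?_ (hf.norm.mul_const _) ?_
  · exact Eventually.of_forall fun v => (integrable_smul_comp_sub hf hΦ.continuous hC v).1
  · exact (integrable_smul_comp_sub hf hcf hC' v).1
  · refine Eventually.of_forall fun w x _ => ?_
    rw [norm_smul]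
    gcongr
    exact hC' _
  · refine Eventually.of_forall fun w x _ => HasFDerivAt.const_smul ?_ (f w)
    have h1 := (hΦ.differentiable one_ne_zero (x - w)).hasFDerivAt.comp x
      ((hasFDerivAt_id x).sub_const w)
    rw [ContinuousLinearMap.comp_id] at h1
    exact h1

/-- `∫ c(|v-w|) Π(v-w) g(w) dw`. -/
def convK (c : ℝ → ℝ) (g : E → ℝ) (v : E) : E →L[ℝ] E := ∫ w, g w • radK c (v - w)

/-- The convolution of `g` with the divergence of `c(|z|) Π(z)`. -/
def convD (c : ℝ → ℝ) (g : E → ℝ) (v : E) : E := ∫ w, g w • radD c (v - w)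

/-- A radial coefficient with the bounds that are needed to differentiate under the integral. -/
structure IsBddRadial (c : ℝ → ℝ) : Prop extends IsRadial c where
  bdd : ∃ C, ∀ r, |c r| ≤ C
  bdd_div : ∃ C, ∀ r, 0 ≤ r → |c r| / r ≤ C
  bdd_deriv : ∃ C, ∀ r, 0 ≤ r → |deriv c r| ≤ C

namespace IsBddRadial

variable {c : ℝ → ℝ} {g : E → ℝ}

lemma sub (h : IsBddRadial c) {d : ℝ → ℝ} (hd : IsBddRadial d) :
    IsBddRadial fun r => c r - d r := by
  obtain ⟨C1, h1⟩ := h.bdd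
  obtain ⟨C2, h2⟩ := h.bdd_div
  obtain ⟨C3, h3⟩ := h.bdd_deriv
  obtain ⟨D1, k1⟩ := hd.bdd
  obtain ⟨D2, k2⟩ := hd.bdd_div
  obtain ⟨D3, k3⟩ := hd.bdd_deriv
  refine ⟨h.toIsRadial.sub hd.toIsRadial, ⟨C1 + D1, fun r => ?_⟩, ⟨C2 + D2, fun r hr => ?_⟩,
    ⟨max (C3 + D3) |deriv (fun r => c r - d r) 0|, fun r hr => ?_⟩⟩
  · exact (abs_sub _ _).trans (add_le_add (h1 r) (k1 r))
  · calc |c r - d r| / r ≤ (|c r| + |d r|) / r := by gcongr; exact abs_sub _ _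
      _ = |c r| / r + |d r| / r := add_div _ _ _
      _ ≤ _ := add_le_add (h2 r hr) (k2 r hr)
  · rcases hr.eq_or_lt with hr0 | hr0
    · rw [← hr0]; exact le_max_right _ _
    · have : deriv (fun r => c r - d r) r = deriv c r - deriv d r :=
        ((h.toIsRadial.differentiableAt hr0).hasDerivAt.sub
          (hd.toIsRadial.differentiableAt hr0).hasDerivAt).deriv
      rw [this]
      exact ((abs_sub _ _).trans (add_le_add (h3 r hr) (k3 r hr))).trans (le_max_left _ _)

lemma exists_norm_radK_le (h : IsBddRadial c) : ∃ C, ∀ z, ‖radK c z‖ ≤ C := by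
  obtain ⟨C1, h1⟩ := h.bdd
  exact ⟨C1, fun z => (norm_radK_le c z).trans (h1 _)⟩

lemma exists_norm_radD_le (h : IsBddRadial c) : ∃ C, ∀ z, ‖radD c z‖ ≤ C := by
  obtain ⟨C1, h1⟩ := h.bdd_div
  exact ⟨2 * C1, fun z => (norm_radD_le c z).trans (by have := h1 _ (norm_nonneg z); linarith)⟩

lemma integrable_radK (h : IsBddRadial c) (hg : Integrable g) (v : E) :
    Integrable fun w => g w • radK c (v - w) := by
  obtain ⟨C, hC⟩ := h.exists_norm_radK_le
  exact integrable_smul_comp_sub hg h.toIsRadial.continuous_radK hC v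

lemma integrable_radD (h : IsBddRadial c) (hg : Integrable g) (v : E) :
    Integrable fun w => g w • radD c (v - w) := by
  obtain ⟨C, hC⟩ := h.exists_norm_radD_le
  exact integrable_smul_comp_sub hg h.toIsRadial.contDiff_radD.continuous hC v

lemma convK_apply (h : IsBddRadial c) (hg : Integrable g) (v e : E) :
    convK c g v e = ∫ w, g w • radK c (v - w) e := by
  rw [convK, ContinuousLinearMap.integral_apply (h.integrable_radK hg v)]
  rfl

lemma integrable_radK_apply (h : IsBddRadial c) (hg : Integrable g) (v e : E) :
    Integrable fun w => g w • radK c (v - w) e :=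
  (h.integrable_radK hg v).apply_continuousLinearMap e

/-- The regularized kernel is C¹ with bounded derivatives, so differentiation under the integral is
legitimate against any integrable g. This turns the divergence of A_n in the entropy inequality into
an explicit convolution. -/
lemma matDiv_convK (h : IsBddRadial c) (hg : Integrable g) (v : E) :
    matDiv (convK c g) v = convD c g v := by
  obtain ⟨C1, h1⟩ := h.bdd
  obtain ⟨C2, h2⟩ := h.bdd_div
  obtain ⟨C3, h3⟩ := h.bdd_deriv
  have hk : ∀ e z, ‖radK c z e‖ ≤ C1 * ‖e‖ := fun e z =>
    ((radK c z).le_opNorm e).trans (by gcongr; exact (norm_radK_le c z).trans (h1 _))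
  have hk' : ∀ e z, ‖fderiv ℝ (fun z => radK c z e) z‖ ≤ (2 * C3 + 4 * C2) * ‖e‖ := fun e z =>
    (h.toIsRadial.norm_fderiv_radK_le z e).trans (by
      have := h3 _ (norm_nonneg z)
      have := h2 _ (norm_nonneg z)
      gcongr)
  have hf : ∀ e, fderiv ℝ (fun u => convK c g u e) v
      = ∫ w, g w • fderiv ℝ (fun z => radK c z e) (v - w) := fun e => by
    simp only [h.convK_apply hg]
    exact (hasFDerivAt_integral_smul_comp_sub hg (h.toIsRadial.contDiff_radK_apply e)
      (hk e) (hk' e) v).fderiv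
  have hi : ∀ e, Integrable fun w => g w • fderiv ℝ (fun z => radK c z e) (v - w) := fun e =>
    integrable_smul_comp_sub hg
      ((h.toIsRadial.contDiff_radK_apply e).continuous_fderiv one_ne_zero) (hk' e) v
  unfold matDiv convD
  simp only [hf]
  simp only [fun e => ContinuousLinearMap.integral_apply (hi e)]
  rw [← integral_finsetSum _ fun i _ => (hi _).apply_continuousLinearMap _]
  refine integral_congr_ae (Eventually.of_forall fun w => ?_)
  simp only [← h.toIsRadial.matDiv_radK, matDiv, smul_apply, Finset.smul_sum]

end IsBddRadial

lemma IsProfile.isBddRadial_cutC {q : ℝ → ℝ} (h : IsProfile q) {N : ℝ} (hN : 0 < N) :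
    IsBddRadial (cutC q N) := by
  obtain ⟨D, hD1, hD⟩ := exists_deriv_cutC_bound
  set B := q (1 / (2 * N)) / (1 / (2 * N))
  have hB : ∀ r, cutW q N r ≤ B := fun r => h.cutW_le hN
  have hd : ∀ r, cutW q N r / r ≤ 2 * N * B := fun r =>
    (h.cutW_div_le hN).trans (by gcongr; exact hB r)
  refine ⟨h.isRadial_cutC hN, ⟨B, fun r => ?_⟩, ⟨2 * N * B, fun r hr => ?_⟩,
    ⟨max (D * (2 * N * B)) |deriv (cutC q N) 0|, fun r hr => ?_⟩⟩
  · rw [abs_of_nonneg (h.cutC_nonneg hN)]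
    exact (h.cutC_le_cutW hN).trans (hB r)
  · rw [abs_of_nonneg (h.cutC_nonneg hN)]
    refine le_trans ?_ (hd r)
    gcongr
    exact h.cutC_le_cutW hN
  · rcases hr.eq_or_lt with hr0 | hr0
    · rw [← hr0]; exact le_max_right _ _
    · exact ((hD q N r h hN hr0).trans (by gcongr; exact hd r)).trans (le_max_left _ _)

/-! ### Truncation at a level -/

/-- The function `1_{g>κ} ∇g / g`. -/
def gradTrunc (g : E → ℝ) (G : E → E) (κ : ℝ) : E → E :=
  {x | κ < g x}.indicator fun x => (g x)⁻¹ • G x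

/-- The function `g 1_{g>κ}`. -/
def highPart (g : E → ℝ) (κ : ℝ) : E → ℝ := {x | κ < g x}.indicator g

/-- The function `g^p 1_{g>κ}`. -/
def highPow (g : E → ℝ) (κ p : ℝ) : E → ℝ := {x | κ < g x}.indicator fun x => g x ^ p

/-- The density `1_{g>κ} |∇g|² / g` of the Fisher information. -/
def fisher (g : E → ℝ) (G : E → E) (κ : ℝ) : E → ℝ :=
  {x | κ < g x}.indicator fun x => ‖G x‖ ^ 2 / g x

section Trunc

variable {g : E → ℝ} {G : E → E} {κ : ℝ} {x : E}

lemma lnPlus_nonneg (z : ℝ) : 0 ≤ lnPlus z := le_max_right _ _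

lemma lnPlus_of_le {r : ℝ} (hκ : 0 < κ) (h : r ≤ κ) (hr : 0 ≤ r) : lnPlus (r / κ) = 0 :=
  max_eq_right (Real.log_nonpos (by positivity) ((div_le_one hκ).2 h))

lemma lnPlus_mono {r s : ℝ} (hκ : 0 < κ) (hr : 0 ≤ r) (h : r ≤ s) :
    lnPlus (r / κ) ≤ lnPlus (s / κ) := by
  rcases le_or_gt r κ with h1 | h1
  · rw [lnPlus_of_le hκ h1 hr]; exact lnPlus_nonneg _
  · have h0 : 0 < r := hκ.trans h1
    exact max_le_max (Real.log_le_log (by positivity) (by gcongr)) le_rfl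

/-- The power 1/6 is the gap 5/3 - 3/2, so that r^{3/2} ln₊² is still controlled by r^{5/3}. The
constant 144 = 12² comes from ln r ≤ 12 r^{1/12}. -/
lemma lnPlus_sq_le (hκ : 1 ≤ κ) {r : ℝ} (h : κ < r) : lnPlus (r / κ) ^ 2 ≤ 144 * r ^ (1 / 6 : ℝ) := by
  have hr : 1 ≤ r := hκ.trans h.le
  have hr0 : 0 < r := by linarith
  have h1 : lnPlus (r / κ) ≤ 12 * r ^ (1 / 12 : ℝ) := by
    refine max_le ?_ (by positivity)
    calc Real.log (r / κ) ≤ Real.log r := by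
          apply Real.log_le_log (by positivity)
          exact div_le_self hr0.le hκ
      _ ≤ r ^ (1 / 12 : ℝ) / (1 / 12) := Real.log_le_rpow_div hr0.le (by norm_num)
      _ = _ := by ring
  calc lnPlus (r / κ) ^ 2 ≤ (12 * r ^ (1 / 12 : ℝ)) ^ 2 := by
        have := lnPlus_nonneg (r / κ)
        gcongr
    _ = 144 * (r ^ (1 / 12 : ℝ)) ^ 2 := by ring
    _ = _ := by
        rw [← Real.rpow_natCast, ← Real.rpow_mul hr0.le]
        norm_num

lemma highPow_nonneg (hg : ∀ x, 0 ≤ g x) (p : ℝ) (x : E) : 0 ≤ highPow g κ p x :=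
  indicator_nonneg (fun x _ => Real.rpow_nonneg (hg x) p) x

lemma highPart_nonneg (hg : ∀ x, 0 ≤ g x) (x : E) : 0 ≤ highPart g κ x :=
  indicator_nonneg (fun x _ => hg x) x

lemma fisher_nonneg (hg : ∀ x, 0 ≤ g x) (x : E) : 0 ≤ fisher g G κ x :=
  indicator_nonneg (fun x _ => div_nonneg (sq_nonneg _) (hg x)) x

lemma highPart_le (hκ : 1 ≤ κ) : highPart g κ x ≤ highPow g κ (5 / 3) x := by
  unfold highPart highPow
  by_cases h : κ < g x
  · rw [indicator_of_mem (show x ∈ {x | κ < g x} from h),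
      indicator_of_mem (show x ∈ {x | κ < g x} from h)]
    nth_rw 1 [← Real.rpow_one (g x)]
    exact Real.rpow_le_rpow_of_exponent_le (by linarith) (by norm_num)
  · rw [indicator_of_notMem (show x ∉ {x | κ < g x} from h),
      indicator_of_notMem (show x ∉ {x | κ < g x} from h)]

lemma highPow_mul_sq_le (hκ : 1 ≤ κ) :
    highPow g κ (3 / 2) x * lnPlus (g x / κ) ^ 2 ≤ 144 * highPow g κ (5 / 3) x := by
  unfold highPow
  by_cases h : κ < g x
  · rw [indicator_of_mem (show x ∈ {x | κ < g x} from h),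
      indicator_of_mem (show x ∈ {x | κ < g x} from h)]
    have h0 : 0 < g x := by linarith
    calc _ ≤ g x ^ (3 / 2 : ℝ) * (144 * g x ^ (1 / 6 : ℝ)) := by
          gcongr; exact lnPlus_sq_le hκ h
      _ = 144 * (g x ^ (3 / 2 : ℝ) * g x ^ (1 / 6 : ℝ)) := by ring
      _ = _ := by rw [← Real.rpow_add h0]; norm_num
  · rw [indicator_of_notMem (show x ∉ {x | κ < g x} from h),
      indicator_of_notMem (show x ∉ {x | κ < g x} from h)]
    simp

lemma highPart_mul_sq_le (hκ : 1 ≤ κ) :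
    highPart g κ x * lnPlus (g x / κ) ^ 2 ≤ 144 * highPow g κ (5 / 3) x := by
  refine le_trans ?_ (highPow_mul_sq_le hκ)
  gcongr
  unfold highPart highPow
  by_cases h : κ < g x
  · rw [indicator_of_mem (show x ∈ {x | κ < g x} from h),
      indicator_of_mem (show x ∈ {x | κ < g x} from h)]
    nth_rw 1 [← Real.rpow_one (g x)]
    exact Real.rpow_le_rpow_of_exponent_le (by linarith) (by norm_num)
  · rw [indicator_of_notMem (show x ∉ {x | κ < g x} from h),
      indicator_of_notMem (show x ∉ {x | κ < g x} from h)]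

lemma highPart_mul_le (hκ : 1 ≤ κ) (hg : ∀ x, 0 ≤ g x) :
    highPart g κ x * lnPlus (g x / κ) ≤ 144 * highPow g κ (5 / 3) x := by
  have h1 := highPart_mul_sq_le (g := g) (x := x) hκ
  have h2 := highPart_le (g := g) (x := x) hκ
  have h3 := highPart_nonneg (κ := κ) hg x
  nlinarith [mul_nonneg h3 (sq_nonneg (lnPlus (g x / κ) - 1))]

lemma posPart_le_highPart (hκ : 0 ≤ κ) (hg : ∀ x, 0 ≤ g x) : max (g x - κ) 0 ≤ highPart g κ x := by
  unfold highPart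
  by_cases h : κ < g x
  · rw [indicator_of_mem (show x ∈ {x | κ < g x} from h)]
    exact max_le (by linarith) (hg x)
  · rw [indicator_of_notMem (show x ∉ {x | κ < g x} from h), max_eq_right (by linarith)]

lemma highPart_mul_norm_sq (hκ : 0 < κ) :
    highPart g κ x * ‖gradTrunc g G κ x‖ ^ 2 = fisher g G κ x := by
  unfold highPart gradTrunc fisher
  by_cases h : κ < g x
  · rw [indicator_of_mem (show x ∈ {x | κ < g x} from h),
      indicator_of_mem (show x ∈ {x | κ < g x} from h),
      indicator_of_mem (show x ∈ {x | κ < g x} from h)]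
    have h0 : 0 < g x := by linarith
    rw [norm_smul, norm_inv, Real.norm_of_nonneg h0.le]
    field_simp
  · rw [indicator_of_notMem (show x ∉ {x | κ < g x} from h),
      indicator_of_notMem (show x ∉ {x | κ < g x} from h),
      indicator_of_notMem (show x ∉ {x | κ < g x} from h), zero_mul]

lemma highPart_smul_gradTrunc (hκ : 0 < κ) :
    highPart g κ x • gradTrunc g G κ x = {x | κ < g x}.indicator G x := by
  unfold highPart gradTrunc
  by_cases h : κ < g x
  · rw [indicator_of_mem (show x ∈ {x | κ < g x} from h),
      indicator_of_mem (show x ∈ {x | κ < g x} from h),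
      indicator_of_mem (show x ∈ {x | κ < g x} from h)]
    have h0 : 0 < g x := by linarith
    rw [smul_smul, mul_inv_cancel₀ h0.ne', one_smul]
  · rw [indicator_of_notMem (show x ∉ {x | κ < g x} from h),
      indicator_of_notMem (show x ∉ {x | κ < g x} from h),
      indicator_of_notMem (show x ∉ {x | κ < g x} from h), smul_zero]

lemma gradTrunc_of_le (h : g x ≤ κ) : gradTrunc g G κ x = 0 :=
  indicator_of_notMem (show x ∉ {x | κ < g x} from not_lt.2 h) _

lemma highPart_of_le (h : g x ≤ κ) : highPart g κ x = 0 :=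
  indicator_of_notMem (show x ∉ {x | κ < g x} from not_lt.2 h) _

lemma highPart_of_lt (h : κ < g x) : highPart g κ x = g x :=
  indicator_of_mem (show x ∈ {x | κ < g x} from h) _

/-- Trading powers between two points. -/
lemma highPart_mul_sq_mul_le (hκ : 1 ≤ κ) (hg : ∀ x, 0 ≤ g x) (x y : E) :
    highPart g κ x * lnPlus (g x / κ) ^ 2 * highPart g κ y
      ≤ highPow g κ (3 / 2) x * lnPlus (g x / κ) ^ 2 * √(highPart g κ y)
        + highPow g κ (3 / 2) y * lnPlus (g y / κ) ^ 2 * √(highPart g κ x) := by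
  have hκ0 : 0 < κ := by linarith
  have n1 := highPow_nonneg (κ := κ) hg (3 / 2) x
  have n2 := highPow_nonneg (κ := κ) hg (3 / 2) y
  rcases le_or_gt (g x) κ with hx | hx
  · rw [highPart_of_le hx, zero_mul, zero_mul]; positivity
  rcases le_or_gt (g y) κ with hy | hy
  · rw [highPart_of_le hy, mul_zero]; positivity
  have hx0 : 0 < g x := by linarith
  have hy0 : 0 < g y := by linarith
  have e1 : highPow g κ (3 / 2) x = g x * √(g x) := by
    unfold highPow
    rw [indicator_of_mem (show x ∈ {x | κ < g x} from hx), Real.sqrt_eq_rpow]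
    nth_rw 2 [← Real.rpow_one (g x)]
    rw [← Real.rpow_add hx0]
    norm_num
  have e2 : highPow g κ (3 / 2) y = g y * √(g y) := by
    unfold highPow
    rw [indicator_of_mem (show y ∈ {x | κ < g x} from hy), Real.sqrt_eq_rpow]
    nth_rw 2 [← Real.rpow_one (g y)]
    rw [← Real.rpow_add hy0]
    norm_num
  rw [e1, e2, highPart_of_lt hx, highPart_of_lt hy]
  set L := lnPlus (g x / κ)
  set L' := lnPlus (g y / κ)
  have s1 := Real.mul_self_sqrt hx0.le
  have s2 := Real.mul_self_sqrt hy0.le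
  have p1 := Real.sqrt_nonneg (g x)
  have p2 := Real.sqrt_nonneg (g y)
  -- Half a power is moved from the smaller value to the larger one. When g y is the larger, the
  -- logarithm moves with it by monotonicity.
  rcases le_total (g y) (g x) with h | h
  · have hs := Real.sqrt_le_sqrt h
    have : g x * L ^ 2 * g y ≤ g x * √(g x) * L ^ 2 * √(g y) := by
      calc g x * L ^ 2 * g y = g x * L ^ 2 * (√(g y) * √(g y)) := by rw [s2]
        _ ≤ g x * L ^ 2 * (√(g x) * √(g y)) := by gcongr
        _ = _ := by ring
    have : 0 ≤ g y * √(g y) * L' ^ 2 * √(g x) := by positivity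
    linarith
  · have hs := Real.sqrt_le_sqrt h
    have hL : L ≤ L' := lnPlus_mono hκ0 hx0.le h
    have hL0 : 0 ≤ L := lnPlus_nonneg _
    have : g x * L ^ 2 * g y ≤ g y * √(g y) * L' ^ 2 * √(g x) := by
      calc g x * L ^ 2 * g y = (√(g x) * √(g x)) * L ^ 2 * g y := by rw [s1]
        _ ≤ (√(g y) * √(g x)) * L' ^ 2 * g y := by gcongr
        _ = _ := by ring
    have : 0 ≤ g x * √(g x) * L ^ 2 * √(g y) := by positivity
    linarith

end Trunc

/-! ### Cutoff functions -/

/-- A smooth cutoff function, supported in the ball of radius `ρ`, with gradient bounded by `Λ`. -/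
structure IsCut (Ψ : E → ℝ) (ρ Λ : ℝ) : Prop where
  contDiff : ContDiff ℝ 1 Ψ
  nonneg : ∀ x, 0 ≤ Ψ x
  le_one : ∀ x, Ψ x ≤ 1
  zero : ∀ x, ρ ≤ ‖x‖ → Ψ x = 0
  grad_zero : ∀ x, ρ ≤ ‖x‖ → gradient Ψ x = 0
  grad_le : ∀ x, ‖gradient Ψ x‖ ≤ Λ
  lip : ∀ x y, |Ψ x - Ψ y| ≤ Λ * ‖x - y‖

/-- The test field `Ψ² ∇g/g 1_{g>κ} + 2 Ψ ln₊(g/κ) ∇Ψ`. -/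
def testField (g : E → ℝ) (G : E → E) (κ : ℝ) (Ψ : E → ℝ) (x : E) : E :=
  (Ψ x ^ 2) • gradTrunc g G κ x + (2 * lnPlus (g x / κ) * Ψ x) • gradient Ψ x

/-! ### A symmetrized lower bound for the singular part of the collision operator -/

/-- The algebraic identity behind the symmetrization. -/
lemma quadratic_lower_bound {K : E →L[ℝ] E} {b : ℝ} (hsymm : ∀ x y, ⟪K x, y⟫ = ⟪x, K y⟫)
    (hnn : ∀ x, 0 ≤ ⟪K x, x⟫) (hb : ‖K‖ ≤ b) (X Y p r : E) (s t L M Λ d : ℝ) (hL : 0 ≤ L)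
    (hM : 0 ≤ M) (hp : ‖p‖ ≤ Λ) (hr : ‖r‖ ≤ Λ) (hd : |s - t| ≤ Λ * d) (hd0 : 0 ≤ d) :
    -(2 * b * Λ ^ 2 * (L ^ 2 + M ^ 2) + b * d ^ 2 * Λ ^ 2 * (‖X‖ ^ 2 + ‖Y‖ ^ 2) / 2
      + b * d * Λ ^ 2 * (L ^ 2 + M ^ 2 + ‖X‖ ^ 2 + ‖Y‖ ^ 2))
    ≤ ⟪K (X - Y), (s ^ 2 • X + (2 * L * s) • p) - (t ^ 2 • Y + (2 * M * t) • r)⟫ := by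
  have hb0 : 0 ≤ b := (norm_nonneg K).trans hb
  have hΛ : 0 ≤ Λ := (norm_nonneg p).trans hp
  have hKb : ∀ x y, |⟪K x, y⟫| ≤ b * (‖x‖ * ‖y‖) := fun x y => by
    refine (abs_real_inner_le_norm _ _).trans ?_
    calc ‖K x‖ * ‖y‖ ≤ (‖K‖ * ‖x‖) * ‖y‖ := by gcongr; exact K.le_opNorm x
      _ ≤ (b * ‖x‖) * ‖y‖ := by gcongr
      _ = _ := by ring
  -- The pairing equals K(P+Q)·(P+Q), which is nonnegative, minus K Q·Q and minus terms carrying s -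
  -- t. Since |s-t| ≤ Λd, every term in X or Y contains b d or b d², and b d stays bounded for b of
  -- order 1/d. Only L² and M² meet the bare singular factor b.
  set P := s • X - t • Y with hP
  set Q := L • p - M • r with hQ
  have hid : ⟪K (X - Y), (s ^ 2 • X + (2 * L * s) • p) - (t ^ 2 • Y + (2 * M * t) • r)⟫
      = ⟪K (P + Q), P + Q⟫ - ⟪K Q, Q⟫ - (s - t) ^ 2 * ⟪K X, Y⟫
        - 2 * (s - t) * (L * ⟪K Y, p⟫ - M * ⟪K X, r⟫) := by
    have c1 : ⟪K Y, X⟫ = ⟪K X, Y⟫ := by rw [hsymm, real_inner_comm]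
    have c2 : ⟪K p, X⟫ = ⟪K X, p⟫ := by rw [hsymm, real_inner_comm]
    have c3 : ⟪K p, Y⟫ = ⟪K Y, p⟫ := by rw [hsymm, real_inner_comm]
    have c4 : ⟪K r, X⟫ = ⟪K X, r⟫ := by rw [hsymm, real_inner_comm]
    have c5 : ⟪K r, Y⟫ = ⟪K Y, r⟫ := by rw [hsymm, real_inner_comm]
    rw [hP, hQ]
    simp only [map_sub, map_add, map_smul, inner_sub_left, inner_sub_right, inner_add_left,
      inner_add_right, inner_smul_left, inner_smul_right, conj_trivial, c1, c2, c3, c4, c5]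
    ring
  rw [hid]
  have h1 := hnn (P + Q)
  have h2 : ⟪K Q, Q⟫ ≤ 2 * b * Λ ^ 2 * (L ^ 2 + M ^ 2) := by
    have hQn : ‖Q‖ ≤ Λ * (L + M) := by
      calc ‖Q‖ ≤ ‖L • p‖ + ‖M • r‖ := norm_sub_le _ _
        _ ≤ L * Λ + M * Λ := by
          rw [norm_smul, norm_smul, Real.norm_of_nonneg hL, Real.norm_of_nonneg hM]
          gcongr
        _ = _ := by ring
    calc ⟪K Q, Q⟫ ≤ b * (‖Q‖ * ‖Q‖) := (le_abs_self _).trans (hKb Q Q)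
      _ ≤ b * ((Λ * (L + M)) * (Λ * (L + M))) := by gcongr
      _ ≤ _ := by nlinarith [mul_nonneg (mul_nonneg hb0 (sq_nonneg Λ)) (sq_nonneg (L - M))]
  have h3 : (s - t) ^ 2 * ⟪K X, Y⟫ ≤ b * d ^ 2 * Λ ^ 2 * (‖X‖ ^ 2 + ‖Y‖ ^ 2) / 2 := by
    have e1 : (s - t) ^ 2 ≤ (Λ * d) ^ 2 := by
      rw [← sq_abs (s - t)]
      gcongr
    calc (s - t) ^ 2 * ⟪K X, Y⟫ ≤ (s - t) ^ 2 * (b * (‖X‖ * ‖Y‖)) := by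
          gcongr; exact (le_abs_self _).trans (hKb X Y)
      _ ≤ (Λ * d) ^ 2 * (b * (‖X‖ * ‖Y‖)) := by gcongr
      _ ≤ _ := by
        nlinarith [mul_nonneg (mul_nonneg hb0 (sq_nonneg (Λ * d))) (sq_nonneg (‖X‖ - ‖Y‖))]
  have h4 : 2 * (s - t) * (L * ⟪K Y, p⟫ - M * ⟪K X, r⟫)
      ≤ b * d * Λ ^ 2 * (L ^ 2 + M ^ 2 + ‖X‖ ^ 2 + ‖Y‖ ^ 2) := by
    have e2 : |L * ⟪K Y, p⟫ - M * ⟪K X, r⟫| ≤ b * Λ * (L * ‖Y‖ + M * ‖X‖) := by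
      calc _ ≤ |L * ⟪K Y, p⟫| + |M * ⟪K X, r⟫| := abs_sub _ _
        _ ≤ L * (b * (‖Y‖ * Λ)) + M * (b * (‖X‖ * Λ)) := by
          rw [abs_mul, abs_mul, abs_of_nonneg hL, abs_of_nonneg hM]
          have := hKb Y p
          have := hKb X r
          gcongr
          · exact (hKb Y p).trans (by gcongr)
          · exact (hKb X r).trans (by gcongr)
        _ = _ := by ring
    calc _ ≤ |2 * (s - t) * (L * ⟪K Y, p⟫ - M * ⟪K X, r⟫)| := le_abs_self _
      _ ≤ 2 * (Λ * d) * (b * Λ * (L * ‖Y‖ + M * ‖X‖)) := by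
          rw [abs_mul, abs_mul]
          simp only [Nat.abs_ofNat]
          gcongr
      _ = b * d * Λ ^ 2 * (2 * (L * ‖Y‖ + M * ‖X‖)) := by ring
      _ ≤ _ := by
          gcongr
          nlinarith [sq_nonneg (L - ‖Y‖), sq_nonneg (M - ‖X‖)]
  linarith

/-- The singular weight `|z|⁻² 1_{|z|<1}`. -/
def singW : E → ℝ := (Metric.ball (0 : E) 1).indicator fun z => (‖z‖ ^ 2)⁻¹

lemma singW_nonneg (z : E) : 0 ≤ singW z := indicator_nonneg (fun _ _ => by positivity) z

/-- In polar coordinates of ℝ³ the Jacobian r² cancels the singularity. -/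
lemma integrable_singW : Integrable singW := by
  refine IntegrableOn.integrable_indicator ?_ Metric.isOpen_ball.measurableSet
  have := (integrableOn_fun_norm_addHaar (E := E) (volume : Measure E)
    (f := fun r : ℝ => (r ^ 2)⁻¹) (r := 1)).2 ?_
  · exact this
  · refine (integrableOn_const (C := (1 : ℝ)) (by simp) (by simp)).congr_fun
      (fun y hy => ?_) measurableSet_Ioo
    have : y ≠ 0 := ne_of_gt hy.1
    simp
    field_simp

/-- `∫_{B₁} |z|⁻² dz`. -/
def singI : ℝ := ∫ z, singW z

lemma singI_nonneg : 0 ≤ singI := integral_nonneg singW_nonneg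

/-- The densities entering the estimates, restricted to a ball. -/
lemma integrableOn_truncations {g : E → ℝ} {κ ρ : ℝ} (hκ : 1 ≤ κ)
    (hg : ∀ x, 0 ≤ g x) (hgm : AEStronglyMeasurable g)
    (hS : IntegrableOn (highPow g κ (5 / 3)) (Metric.ball 0 ρ)) :
    IntegrableOn (highPart g κ) (Metric.ball 0 ρ) ∧
    IntegrableOn (fun x => highPart g κ x * lnPlus (g x / κ)) (Metric.ball 0 ρ) ∧
    IntegrableOn (fun x => highPart g κ x * lnPlus (g x / κ) ^ 2) (Metric.ball 0 ρ) ∧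
    IntegrableOn (fun x => highPow g κ (3 / 2) x * lnPlus (g x / κ) ^ 2) (Metric.ball 0 ρ) := by
  have hT : NullMeasurableSet {x | κ < g x} :=
    nullMeasurableSet_lt aemeasurable_const hgm.aemeasurable
  have m1 : AEStronglyMeasurable (highPart g κ) := hgm.indicator₀ hT
  have m2 : AEStronglyMeasurable fun x => lnPlus (g x / κ) := by
    have : Measurable fun r : ℝ => lnPlus (r / κ) := by unfold lnPlus; fun_prop
    exact (this.comp_aemeasurable hgm.aemeasurable).aestronglyMeasurable
  have m3 : AEStronglyMeasurable (highPow g κ (3 / 2)) :=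
    (hgm.aemeasurable.pow_const (3 / 2 : ℝ)).aestronglyMeasurable.indicator₀ hT
  have hS' := hS.const_mul 144
  refine ⟨hS.mono' m1.restrict (Eventually.of_forall fun x => ?_),
    hS'.mono' (m1.mul m2).restrict (Eventually.of_forall fun x => ?_),
    hS'.mono' (m1.mul (m2.pow 2)).restrict (Eventually.of_forall fun x => ?_),
    hS'.mono' (m3.mul (m2.pow 2)).restrict (Eventually.of_forall fun x => ?_)⟩
  · rw [Real.norm_of_nonneg (highPart_nonneg hg x)]; exact highPart_le hκ
  · rw [Real.norm_of_nonneg (mul_nonneg (highPart_nonneg hg x) (lnPlus_nonneg _))]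
    exact highPart_mul_le hκ hg
  · rw [Real.norm_of_nonneg (mul_nonneg (highPart_nonneg hg x) (sq_nonneg _))]
    exact highPart_mul_sq_le hκ
  · rw [Real.norm_of_nonneg (mul_nonneg (highPow_nonneg hg _ x) (sq_nonneg _))]
    exact highPow_mul_sq_le hκ

/-- A singular radial coefficient supported in the ball of radius `δ`. -/
structure IsNear (c : ℝ → ℝ) (k₁ δ : ℝ) : Prop extends IsBddRadial c where
  nonneg : ∀ r, 0 ≤ c r
  mul_le : ∀ r, 0 < r → r * c r ≤ k₁
  zero : ∀ r, δ ≤ r → c r = 0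

/-- The integrand of the interaction between high values. -/
def interaction (c : ℝ → ℝ) (g : E → ℝ) (G : E → E) (κ : ℝ) (Ψ : E → ℝ) (p : E × E) : ℝ :=
  (highPart g κ p.1 * highPart g κ p.2) *
    ⟪radK c (p.1 - p.2) (gradTrunc g G κ p.1 - gradTrunc g G κ p.2), testField g G κ Ψ p.1⟫

section Near

variable {c : ℝ → ℝ} {k₁ δ κ ρ ρ' Λ : ℝ} {g : E → ℝ} {G : E → E} {Ψ : E → ℝ}

lemma testField_eq_zero (hΨ : IsCut Ψ ρ Λ) {x : E} (hx : ρ ≤ ‖x‖) : testField g G κ Ψ x = 0 := by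
  rw [testField, hΨ.zero x hx]
  simp

lemma norm_testField_le (hΨ : IsCut Ψ ρ Λ) (x : E) :
    ‖testField g G κ Ψ x‖ ≤ ‖gradTrunc g G κ x‖ + 2 * lnPlus (g x / κ) * Λ := by
  have h0 := hΨ.nonneg x
  have h1 := hΨ.le_one x
  have hL := lnPlus_nonneg (g x / κ)
  have hΛ := hΨ.grad_le x
  refine (norm_add_le _ _).trans ?_
  rw [norm_smul, norm_smul, Real.norm_of_nonneg (by positivity), Real.norm_of_nonneg (by positivity)]
  refine add_le_add (mul_le_of_le_one_left (norm_nonneg _) (pow_le_one₀ h0 h1))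
    (mul_le_mul (mul_le_of_le_one_right (by positivity) h1) hΛ (norm_nonneg _) (by positivity))

/-- Either the interaction vanishes or both points are in the larger ball, close to each other. -/
lemma near_cases (hc : IsNear c k₁ δ) (hρ : ρ + δ ≤ ρ') (x y : E) :
    c ‖x - y‖ = 0 ∨ (ρ ≤ ‖x‖ ∧ ρ ≤ ‖y‖) ∨
      (x ∈ Metric.ball (0 : E) ρ' ∧ y ∈ Metric.ball (0 : E) ρ' ∧ 0 < ‖x - y‖ ∧ ‖x - y‖ < δ) := by
  by_cases h1 : δ ≤ ‖x - y‖
  · exact Or.inl (hc.zero _ h1)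
  push Not at h1
  rcases (norm_nonneg (x - y)).eq_or_lt with h0 | h0
  · left
    obtain ⟨a, ha, h⟩ := hc.zero_near
    exact h _ (by linarith)
  by_cases h2 : ρ ≤ ‖x‖ ∧ ρ ≤ ‖y‖
  · exact Or.inr (Or.inl h2)
  refine Or.inr (Or.inr ?_)
  simp only [Metric.mem_ball, dist_zero_right]
  have t1 : ‖x‖ ≤ ‖y‖ + ‖x - y‖ := by
    have := norm_add_le y (x - y)
    rwa [add_sub_cancel] at this
  have t2 : ‖y‖ ≤ ‖x‖ + ‖x - y‖ := by
    have := norm_sub_le x (x - y)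
    rwa [sub_sub_cancel] at this
  rw [not_and_or, not_le, not_le] at h2
  refine ⟨?_, ?_, h0, h1⟩ <;> rcases h2 with h2 | h2 <;> linarith

lemma interaction_eq_zero {x y : E} (h : c ‖x - y‖ = 0) :
    interaction c g G κ Ψ (x, y) = 0 := by
  simp [interaction, radK, h]

/-- This bound serves integrability only: C is the supremum of the regularized coefficient,
degenerates as the regularization is removed, and enters no quantitative estimate. -/
lemma interaction_bound (hc : IsNear c k₁ δ) (hκ : 1 ≤ κ) (hg : ∀ x, 0 ≤ g x)
    (hΨ : IsCut Ψ ρ Λ) (hρ : ρ + δ ≤ ρ') {C : ℝ} (hC : ∀ r, |c r| ≤ C) (x y : E) :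
    |interaction c g G κ Ψ (x, y)| ≤ C * (2 + 4 * Λ ^ 2) *
      ((Metric.ball 0 ρ').indicator (fisher g G κ) x * (Metric.ball 0 ρ').indicator (highPart g κ) y
      + (Metric.ball 0 ρ').indicator (highPart g κ) x * (Metric.ball 0 ρ').indicator (fisher g G κ) y
      + (Metric.ball 0 ρ').indicator (fun x => highPart g κ x * lnPlus (g x / κ) ^ 2) x
        * (Metric.ball 0 ρ').indicator (highPart g κ) y) := by
  have hC0 : 0 ≤ C := (abs_nonneg _).trans (hC 0)
  have n1 : ∀ z, 0 ≤ (Metric.ball (0 : E) ρ').indicator (fisher g G κ) z := fun z =>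
    indicator_nonneg (fun x _ => fisher_nonneg hg x) z
  have n2 : ∀ z, 0 ≤ (Metric.ball (0 : E) ρ').indicator (highPart g κ) z := fun z =>
    indicator_nonneg (fun x _ => highPart_nonneg hg x) z
  have n3 : ∀ z, 0 ≤ (Metric.ball (0 : E) ρ').indicator
      (fun x => highPart g κ x * lnPlus (g x / κ) ^ 2) z := fun z =>
    indicator_nonneg (fun x _ => mul_nonneg (highPart_nonneg hg x) (sq_nonneg _)) z
  have hR : 0 ≤ C * (2 + 4 * Λ ^ 2) *
      ((Metric.ball 0 ρ').indicator (fisher g G κ) x * (Metric.ball 0 ρ').indicator (highPart g κ) y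
      + (Metric.ball 0 ρ').indicator (highPart g κ) x * (Metric.ball 0 ρ').indicator (fisher g G κ) y
      + (Metric.ball 0 ρ').indicator (fun x => highPart g κ x * lnPlus (g x / κ) ^ 2) x
        * (Metric.ball 0 ρ').indicator (highPart g κ) y) := by
    have := n1 x; have := n1 y; have := n2 x; have := n2 y; have := n3 x
    positivity
  rcases near_cases hc hρ x y with h | h | h
  · rw [interaction_eq_zero h, abs_zero]; exact hR
  · rw [interaction, testField_eq_zero hΨ h.1, inner_zero_right, mul_zero, abs_zero]
    exact hR
  · obtain ⟨hx, hy, -, -⟩ := h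
    rw [indicator_of_mem hx, indicator_of_mem hy, indicator_of_mem hx, indicator_of_mem hy,
      indicator_of_mem hx]
    have hκ0 : 0 < κ := by linarith
    rw [← highPart_mul_norm_sq hκ0, ← highPart_mul_norm_sq hκ0, interaction]
    have a1 := highPart_nonneg (κ := κ) hg x
    have a2 := highPart_nonneg (κ := κ) hg y
    set X := gradTrunc g G κ x
    set Y := gradTrunc g G κ y
    set L := lnPlus (g x / κ)
    have hL : 0 ≤ L := lnPlus_nonneg _
    have hΛ : 0 ≤ Λ := (norm_nonneg _).trans (hΨ.grad_le 0)
    have i1 : |⟪radK c (x - y) (X - Y), testField g G κ Ψ x⟫|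
        ≤ C * (2 * ‖X‖ ^ 2 + ‖Y‖ ^ 2 + 4 * Λ ^ 2 * L ^ 2) := by
      calc _ ≤ ‖radK c (x - y) (X - Y)‖ * ‖testField g G κ Ψ x‖ := abs_real_inner_le_norm _ _
        _ ≤ (C * (‖X‖ + ‖Y‖)) * (‖X‖ + 2 * L * Λ) := by
            gcongr
            · refine ((radK c (x - y)).le_opNorm _).trans ?_
              gcongr
              · exact (norm_radK_le _ _).trans (hC _)
              · exact norm_sub_le _ _
            · exact norm_testField_le hΨ x
        _ = C * ((‖X‖ + ‖Y‖) * (‖X‖ + 2 * L * Λ)) := by ring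
        _ ≤ _ := by
            gcongr
            nlinarith [sq_nonneg (‖X‖ + ‖Y‖ - (‖X‖ + 2 * L * Λ)), sq_nonneg (‖X‖ - ‖Y‖),
              sq_nonneg (‖X‖ - 2 * L * Λ)]
    rw [abs_mul, abs_of_nonneg (mul_nonneg a1 a2)]
    calc _ ≤ (highPart g κ x * highPart g κ y) * (C * (2 * ‖X‖ ^ 2 + ‖Y‖ ^ 2 + 4 * Λ ^ 2 * L ^ 2)) := by
          gcongr
      _ ≤ (highPart g κ x * highPart g κ y) * (C * ((2 + 4 * Λ ^ 2) * (‖X‖ ^ 2 + ‖Y‖ ^ 2 + L ^ 2))) := by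
          gcongr
          nlinarith [sq_nonneg (‖X‖), sq_nonneg ‖Y‖, sq_nonneg L, mul_nonneg (sq_nonneg Λ) (sq_nonneg ‖X‖),
            mul_nonneg (sq_nonneg Λ) (sq_nonneg ‖Y‖)]
      _ = _ := by ring

/-- Here w is the coefficient at distance r, with r w ≤ k. Terms with w r or w r² are bounded by k
directly. In the term with the bare w, trading half a power between the two points leaves √a, and
w√a ≤ (k/r)√a ≤ k(a + r⁻²)/2 produces only the integrable singularity r⁻². -/
lemma interaction_scalar {ax ay bx b' lx ly mx my X Y Lx Ly r w k Λ : ℝ} (hax : 0 ≤ ax)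
    (hay : 0 ≤ ay) (hmx : 0 ≤ mx) (hmy : 0 ≤ my) (hbx : bx = ax * X ^ 2) (hby : b' = ay * Y ^ 2)
    (hlx : lx = ax * Lx ^ 2) (hly : ly = ay * Ly ^ 2) (hr : 0 < r) (hr1 : r ≤ 1) (hw : 0 ≤ w)
    (hk : 0 ≤ k) (hwk : r * w ≤ k)
    (h1 : lx * ay ≤ mx * √ay + my * √ax) (h2 : ly * ax ≤ my * √ax + mx * √ay) :
    ax * ay * (2 * w * Λ ^ 2 * (Lx ^ 2 + Ly ^ 2) + w * r ^ 2 * Λ ^ 2 * (X ^ 2 + Y ^ 2) / 2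
        + w * r * Λ ^ 2 * (Lx ^ 2 + Ly ^ 2 + X ^ 2 + Y ^ 2))
      ≤ 2 * Λ ^ 2 * k * (mx * ay + mx * (r ^ 2)⁻¹ + (my * ax + my * (r ^ 2)⁻¹))
      + 2 * k * Λ ^ 2 * (bx * ay + ax * b' + lx * ay + ax * ly) := by
  have c2 : w * r ^ 2 ≤ k := by nlinarith [mul_nonneg hr.le hw]
  have hsq : ∀ z, 0 ≤ z → w * √z ≤ k * ((z + (r ^ 2)⁻¹) / 2) := fun z hz => by
    have h1 : w ≤ k * r⁻¹ := by
      rw [← div_eq_mul_inv, le_div_iff₀ hr]; linarith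
    calc w * √z ≤ (k * r⁻¹) * √z := by gcongr
      _ = k * (r⁻¹ * √z) := by ring
      _ ≤ _ := by
          gcongr
          have h2 := Real.sq_sqrt hz
          have h3 : (r⁻¹) ^ 2 = (r ^ 2)⁻¹ := inv_pow _ _
          nlinarith [sq_nonneg (r⁻¹ - √z)]
  have hkey : w * (lx * ay + ax * ly)
      ≤ k * (mx * ay + mx * (r ^ 2)⁻¹ + (my * ax + my * (r ^ 2)⁻¹)) := by
    have e1 := hsq ax hax
    have e2 := hsq ay hay
    calc w * (lx * ay + ax * ly) ≤ w * (2 * (mx * √ay + my * √ax)) := by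
          gcongr
          linarith
      _ = 2 * (mx * (w * √ay) + my * (w * √ax)) := by ring
      _ ≤ 2 * (mx * (k * ((ay + (r ^ 2)⁻¹) / 2)) + my * (k * ((ax + (r ^ 2)⁻¹) / 2))) := by
          gcongr
      _ = _ := by ring
  have hbx0 : 0 ≤ bx := by rw [hbx]; positivity
  have hby0 : 0 ≤ b' := by rw [hby]; positivity
  have hlx0 : 0 ≤ lx := by rw [hlx]; positivity
  have hly0 : 0 ≤ ly := by rw [hly]; positivity
  have p1 : ax * ay * (X ^ 2 + Y ^ 2) = bx * ay + ax * b' := by rw [hbx, hby]; ring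
  have p2 : ax * ay * (Lx ^ 2 + Ly ^ 2) = lx * ay + ax * ly := by rw [hlx, hly]; ring
  have n1 : 0 ≤ bx * ay + ax * b' := by positivity
  have n2 : 0 ≤ lx * ay + ax * ly := by positivity
  have s1 := mul_le_mul_of_nonneg_right c2 n1
  have s2 := mul_le_mul_of_nonneg_right hwk (add_nonneg n1 n2)
  have e : ax * ay * (2 * w * Λ ^ 2 * (Lx ^ 2 + Ly ^ 2) + w * r ^ 2 * Λ ^ 2 * (X ^ 2 + Y ^ 2) / 2
        + w * r * Λ ^ 2 * (Lx ^ 2 + Ly ^ 2 + X ^ 2 + Y ^ 2))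
      = Λ ^ 2 * ((w * r ^ 2) * (bx * ay + ax * b') / 2
        + (r * w) * ((bx * ay + ax * b') + (lx * ay + ax * ly))
        + 2 * (w * (lx * ay + ax * ly))) := by rw [← p1, ← p2]; ring
  rw [e]
  have n3 := mul_nonneg hk n1
  have n4 := mul_nonneg hk n2
  calc _ ≤ Λ ^ 2 * (2 * (k * (mx * ay + mx * (r ^ 2)⁻¹ + (my * ax + my * (r ^ 2)⁻¹)))
        + 2 * (k * ((bx * ay + ax * b') + (lx * ay + ax * ly)))) := by
        apply mul_le_mul_of_nonneg_left _ (sq_nonneg Λ)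
        linarith
    _ = _ := by ring

lemma interaction_add_swap (x y : E) :
    interaction c g G κ Ψ (x, y) + interaction c g G κ Ψ (y, x)
      = (highPart g κ x * highPart g κ y) *
        ⟪radK c (x - y) (gradTrunc g G κ x - gradTrunc g G κ y),
          testField g G κ Ψ x - testField g G κ Ψ y⟫ := by
  have hneg : radK c (y - x) = radK c (x - y) := by rw [← radK_neg, neg_sub]
  rw [interaction, interaction]
  simp only [hneg, map_sub, inner_sub_left, inner_sub_right]
  ring

/-- After symmetrization the pointwise error consists of products of separate functions of x and y,
and of convolutions with |z|⁻². All of them integrate to quantities independent of the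
regularization of the kernel. -/
lemma interaction_symm_bound (hc : IsNear c k₁ δ) (hκ : 1 ≤ κ) (hg : ∀ x, 0 ≤ g x)
    (hΨ : IsCut Ψ ρ Λ) (hρ : ρ + δ ≤ ρ') (hδ1 : δ ≤ 1) (hk : 0 ≤ k₁) (x y : E)
    {a b l m : E → ℝ} (ha : a = (Metric.ball 0 ρ').indicator (highPart g κ))
    (hb : b = (Metric.ball 0 ρ').indicator (fisher g G κ))
    (hl : l = (Metric.ball 0 ρ').indicator (fun x => highPart g κ x * lnPlus (g x / κ) ^ 2))
    (hm : m = (Metric.ball 0 ρ').indicator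
      (fun x => highPow g κ (3 / 2) x * lnPlus (g x / κ) ^ 2)) :
    -(2 * Λ ^ 2 * k₁ * (m x * a y + m x * singW (x - y) + (m y * a x + m y * singW (x - y)))
      + 2 * k₁ * Λ ^ 2 * (b x * a y + a x * b y + l x * a y + a x * l y))
    ≤ interaction c g G κ Ψ (x, y) + interaction c g G κ Ψ (y, x) := by
  have n1 : ∀ z, 0 ≤ b z := fun z => by
    rw [hb]; exact indicator_nonneg (fun x _ => fisher_nonneg hg x) z
  have n2 : ∀ z, 0 ≤ a z := fun z => by
    rw [ha]; exact indicator_nonneg (fun x _ => highPart_nonneg hg x) z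
  have n3 : ∀ z, 0 ≤ l z := fun z => by
    rw [hl]
    exact indicator_nonneg (fun x _ => mul_nonneg (highPart_nonneg hg x) (sq_nonneg _)) z
  have n4 : ∀ z, 0 ≤ m z := fun z => by
    rw [hm]
    exact indicator_nonneg (fun x _ => mul_nonneg (highPow_nonneg hg _ x) (sq_nonneg _)) z
  have hR : 0 ≤ 2 * Λ ^ 2 * k₁ * (m x * a y + m x * singW (x - y) + (m y * a x + m y * singW (x - y)))
      + 2 * k₁ * Λ ^ 2 * (b x * a y + a x * b y + l x * a y + a x * l y) := by
    have h1 := n1 x; have h2 := n1 y; have h3 := n2 x; have h4 := n2 y; have h5 := n3 x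
    have h6 := n3 y; have h7 := n4 x; have h8 := n4 y; have h9 := singW_nonneg (x - y)
    generalize a x = A at *; generalize a y = A' at *; generalize b x = A2 at *
    generalize b y = A3 at *; generalize l x = A4 at *; generalize l y = A5 at *
    generalize m x = A6 at *; generalize m y = A7 at *; generalize singW (x - y) = A8 at *
    clear hl hm ha hb
    positivity
  rcases near_cases hc hρ x y with h | h | h
  · rw [interaction_eq_zero h, interaction_eq_zero (by rwa [norm_sub_rev])]
    linarith
  · rw [interaction, interaction, testField_eq_zero hΨ h.1, testField_eq_zero hΨ h.2]
    simp only [inner_zero_right, mul_zero]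
    linarith
  · obtain ⟨hx, hy, hr0, hrδ⟩ := h
    have hκ0 : 0 < κ := by linarith
    have ax : a x = highPart g κ x := by rw [ha, indicator_of_mem hx]
    have ay : a y = highPart g κ y := by rw [ha, indicator_of_mem hy]
    have bx : b x = a x * ‖gradTrunc g G κ x‖ ^ 2 := by
      rw [hb, ax, indicator_of_mem hx, highPart_mul_norm_sq hκ0]
    have hby : b y = a y * ‖gradTrunc g G κ y‖ ^ 2 := by
      rw [hb, ay, indicator_of_mem hy, highPart_mul_norm_sq hκ0]
    have lx : l x = a x * lnPlus (g x / κ) ^ 2 := by rw [hl, ax, indicator_of_mem hx]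
    have ly : l y = a y * lnPlus (g y / κ) ^ 2 := by rw [hl, ay, indicator_of_mem hy]
    have mx : m x = highPow g κ (3 / 2) x * lnPlus (g x / κ) ^ 2 := by rw [hm, indicator_of_mem hx]
    have my : m y = highPow g κ (3 / 2) y * lnPlus (g y / κ) ^ 2 := by rw [hm, indicator_of_mem hy]
    have t1 := highPart_mul_sq_mul_le hκ hg x y
    have t2 := highPart_mul_sq_mul_le hκ hg y x
    rw [← mx, ← my, ← ax, ← ay, ← lx] at t1
    rw [← mx, ← my, ← ax, ← ay, ← ly] at t2
    have hsing : singW (x - y) = (‖x - y‖ ^ 2)⁻¹ := by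
      rw [singW, indicator_of_mem]
      simp only [Metric.mem_ball, dist_zero_right]
      linarith
    have hq := quadratic_lower_bound (K := radK c (x - y)) (b := c ‖x - y‖)
      (fun u v => by simp [radK, inner_smul_left, inner_smul_right, inner_proj_comm])
      (fun u => by
        simp only [radK, smul_apply, inner_smul_left, conj_trivial]
        exact mul_nonneg (hc.nonneg _) (inner_proj_nonneg _ _))
      ((norm_radK_le _ _).trans (by rw [abs_of_nonneg (hc.nonneg _)]))
      (gradTrunc g G κ x) (gradTrunc g G κ y) (gradient Ψ x) (gradient Ψ y) (Ψ x) (Ψ y)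
      (lnPlus (g x / κ)) (lnPlus (g y / κ)) Λ ‖x - y‖ (lnPlus_nonneg _) (lnPlus_nonneg _)
      (hΨ.grad_le x) (hΨ.grad_le y) (hΨ.lip x y) hr0.le
    have hs := interaction_scalar (Λ := Λ) (n2 x) (n2 y) (n4 x) (n4 y) bx hby lx ly hr0
      (by linarith) (hc.nonneg _) hk (hc.mul_le _ hr0) t1 t2
    rw [interaction_add_swap, hsing, ← ax, ← ay]
    have hh := mul_le_mul_of_nonneg_left hq (mul_nonneg (n2 x) (n2 y))
    rw [mul_neg] at hh
    exact (neg_le_neg hs).trans (by simpa only [testField] using hh)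

lemma integrable_mul_singW {m : E → ℝ} (hm : Integrable m) :
    Integrable (fun p : E × E => m p.1 * singW (p.1 - p.2)) (volume.prod volume) ∧
    ∫ p : E × E, m p.1 * singW (p.1 - p.2) ∂(volume.prod volume) = (∫ x, m x) * singI := by
  have hi : Integrable (fun p : E × E => m p.1 * singW (p.1 - p.2)) (volume.prod volume) := by
    have h1 := (hm.convolution_integrand (ContinuousLinearMap.mul ℝ ℝ) integrable_singW).swap
    refine h1.congr (Eventually.of_forall fun p => ?_)
    have : singW (p.2 - p.1) = singW (p.1 - p.2) := by
      simp only [singW, indicator, Metric.mem_ball, dist_zero_right, norm_sub_rev]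
    simp [this]
  refine ⟨hi, ?_⟩
  rw [integral_prod _ hi]
  have : ∀ x : E, ∫ y, m x * singW (x - y) = m x * singI := fun x => by
    rw [integral_const_mul, integral_sub_left_eq_self singW]
    rfl
  simp only [this]
  rw [integral_mul_const]

/-- The interaction between high values is bounded from below by lower order terms. -/
lemma interaction_lower (hc : IsNear c k₁ δ) (hκ : 1 ≤ κ) (hg : ∀ x, 0 ≤ g x)
    (hgm : AEStronglyMeasurable g) (hGm : AEStronglyMeasurable G)
    (hΨ : IsCut Ψ ρ Λ) (hρ : ρ + δ ≤ ρ') (hδ1 : δ ≤ 1) (hk : 0 ≤ k₁)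
    (hS : IntegrableOn (highPow g κ (5 / 3)) (Metric.ball 0 ρ'))
    (hY : IntegrableOn (fisher g G κ) (Metric.ball 0 ρ')) {V S Y : ℝ}
    (hVd : V = ∫ x in Metric.ball 0 ρ', highPart g κ x)
    (hSd : S = ∫ x in Metric.ball 0 ρ', highPow g κ (5 / 3) x)
    (hYd : Y = ∫ x in Metric.ball 0 ρ', fisher g G κ x) :
    Integrable (interaction c g G κ Ψ) (volume.prod volume) ∧
    -(2 * k₁ * Λ ^ 2 * (144 * S * (2 * V + singI) + V * Y))
      ≤ ∫ p, interaction c g G κ Ψ p ∂(volume.prod volume) := by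
  obtain ⟨iV, -, iL, iM⟩ := integrableOn_truncations hκ hg hgm hS
  set B := Metric.ball (0 : E) ρ'
  have hB : MeasurableSet B := Metric.isOpen_ball.measurableSet
  set a := B.indicator (highPart g κ) with ha
  set b := B.indicator (fisher g G κ) with hb
  set l := B.indicator (fun x => highPart g κ x * lnPlus (g x / κ) ^ 2) with hl
  set m := B.indicator (fun x => highPow g κ (3 / 2) x * lnPlus (g x / κ) ^ 2) with hm
  have ia : Integrable a := iV.integrable_indicator hB
  have ib : Integrable b := hY.integrable_indicator hB
  have il : Integrable l := iL.integrable_indicator hB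
  have im : Integrable m := iM.integrable_indicator hB
  have hja : AEStronglyMeasurable (interaction c g G κ Ψ) (volume.prod volume) := by
    have hT : NullMeasurableSet {x | κ < g x} :=
      nullMeasurableSet_lt aemeasurable_const hgm.aemeasurable
    have m1 : AEStronglyMeasurable (highPart g κ) := hgm.indicator₀ hT
    have m2 : AEStronglyMeasurable (gradTrunc g G κ) :=
      (hgm.aemeasurable.inv.aestronglyMeasurable.smul hGm).indicator₀ hT
    have m3 : AEStronglyMeasurable (testField g G κ Ψ) := by
      have m4 : AEStronglyMeasurable fun x => lnPlus (g x / κ) := by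
        have : Measurable fun r : ℝ => lnPlus (r / κ) := by unfold lnPlus; fun_prop
        exact (this.comp_aemeasurable hgm.aemeasurable).aestronglyMeasurable
      have m5 : AEStronglyMeasurable Ψ := hΨ.contDiff.continuous.aestronglyMeasurable
      exact ((m5.pow 2).smul m2).add (((m4.const_mul 2).mul m5).smul
        (continuous_gradient hΨ.contDiff).aestronglyMeasurable)
    have mK : AEStronglyMeasurable (fun p : E × E => radK c (p.1 - p.2)) (volume.prod volume) :=
      (hc.continuous_radK.comp (by fun_prop : Continuous fun p : E × E =>
        p.1 - p.2)).aestronglyMeasurable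
    refine (m1.comp_fst.mul m1.comp_snd).mul (AEStronglyMeasurable.inner ?_ m3.comp_fst)
    exact (ContinuousLinearMap.id ℝ (E →L[ℝ] E)).aestronglyMeasurable_comp₂ mK
      (m2.comp_fst.sub m2.comp_snd)
  have iba := ib.mul_prod ia
  have iab := ia.mul_prod ib
  have ila := il.mul_prod ia
  have ial := ia.mul_prod il
  have ima := im.mul_prod ia
  obtain ⟨C, hC⟩ := hc.bdd
  have hji : Integrable (interaction c g G κ Ψ) (volume.prod volume) := by
    refine (((iba.add iab).add ila).const_mul (C * (2 + 4 * Λ ^ 2))).mono' hja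
      (Eventually.of_forall fun p => ?_)
    exact interaction_bound hc hκ hg hΨ hρ hC p.1 p.2
  refine ⟨hji, ?_⟩
  obtain ⟨is1, es1⟩ := integrable_mul_singW im
  have is2 : Integrable (fun p : E × E => m p.2 * singW (p.1 - p.2)) (volume.prod volume) := by
    refine is1.swap.congr (Eventually.of_forall fun p => ?_)
    have : singW (p.2 - p.1) = singW (p.1 - p.2) := by
      simp only [singW, indicator, Metric.mem_ball, dist_zero_right, norm_sub_rev]
    simp [this]
  have es2 : ∫ p : E × E, m p.2 * singW (p.1 - p.2) ∂(volume.prod volume) = (∫ x, m x) * singI := by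
    rw [← es1, ← integral_prod_swap]
    refine integral_congr_ae (Eventually.of_forall fun p => ?_)
    have : singW (p.2 - p.1) = singW (p.1 - p.2) := by
      simp only [singW, indicator, Metric.mem_ball, dist_zero_right, norm_sub_rev]
    simp [this]
  have ima2 : Integrable (fun p : E × E => m p.2 * a p.1) (volume.prod volume) := ima.swap
  have ema2 : ∫ p : E × E, m p.2 * a p.1 ∂(volume.prod volume) = (∫ x, m x) * ∫ x, a x := by
    rw [← integral_prod_mul, ← integral_prod_swap]
    rfl
  -- Exchanging v and w does not change the integral, so twice it is the integral of the symmetrized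
  -- integrand, to which the pointwise lower bound applies.
  have hsw : ∫ p : E × E, interaction c g G κ Ψ (p.2, p.1) ∂(volume.prod volume)
      = ∫ p, interaction c g G κ Ψ p ∂(volume.prod volume) :=
    integral_prod_swap (μ := (volume : Measure E)) (ν := volume) (interaction c g G κ Ψ)
  have hswi : Integrable (fun p : E × E => interaction c g G κ Ψ (p.2, p.1)) (volume.prod volume) :=
    hji.swap
  have j1 : Integrable (fun p : E × E => m p.1 * a p.2 + m p.1 * singW (p.1 - p.2))
      (volume.prod volume) := ima.add is1
  have j2 : Integrable (fun p : E × E => m p.2 * a p.1 + m p.2 * singW (p.1 - p.2))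
      (volume.prod volume) := ima2.add is2
  have j3 : Integrable (fun p : E × E => m p.1 * a p.2 + m p.1 * singW (p.1 - p.2)
      + (m p.2 * a p.1 + m p.2 * singW (p.1 - p.2))) (volume.prod volume) := j1.add j2
  have j4 : Integrable (fun p : E × E => b p.1 * a p.2 + a p.1 * b p.2)
      (volume.prod volume) := iba.add iab
  have j5 : Integrable (fun p : E × E => b p.1 * a p.2 + a p.1 * b p.2 + l p.1 * a p.2)
      (volume.prod volume) := j4.add ila
  have j6 : Integrable (fun p : E × E => b p.1 * a p.2 + a p.1 * b p.2 + l p.1 * a p.2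
      + a p.1 * l p.2) (volume.prod volume) := j5.add ial
  have hle := integral_mono (μ := (volume : Measure E).prod volume)
    ((j3.const_mul (2 * Λ ^ 2 * k₁)).add (j6.const_mul (2 * k₁ * Λ ^ 2))).neg (hji.add hswi)
    (fun p => interaction_symm_bound hc hκ hg hΨ hρ hδ1 hk p.1 p.2 ha hb hl hm)
  rw [integral_neg', integral_add' (j3.const_mul (2 * Λ ^ 2 * k₁)) (j6.const_mul (2 * k₁ * Λ ^ 2)),
    integral_add' hji hswi, hsw, integral_const_mul, integral_const_mul, integral_add j1 j2,
    integral_add ima is1, integral_add ima2 is2, integral_add j5 ial, integral_add j4 ila,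
    integral_add iba iab, es1, es2, ema2, integral_prod_mul,
    integral_prod_mul, integral_prod_mul, integral_prod_mul, integral_prod_mul] at hle
  have eV : ∫ x, a x = V := by rw [hVd, ha, integral_indicator hB]
  have eY : ∫ x, b x = Y := by rw [hYd, hb, integral_indicator hB]
  have hSm : ∫ x, m x ≤ 144 * S := by
    rw [hSd, hm, integral_indicator hB, ← integral_const_mul]
    exact integral_mono iM (hS.const_mul 144) fun x => highPow_mul_sq_le hκ
  have hSl : ∫ x, l x ≤ 144 * S := by
    rw [hSd, hl, integral_indicator hB, ← integral_const_mul]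
    exact integral_mono iL (hS.const_mul 144) fun x => highPart_mul_sq_le hκ
  have hV0 : 0 ≤ V := by
    rw [hVd]; exact integral_nonneg fun x => highPart_nonneg hg x
  rw [eV, eY] at hle
  have hI := singI_nonneg
  have q1 : (∫ x, m x) * (V + singI) ≤ 144 * S * (V + singI) := by gcongr
  have q2 : (∫ x, l x) * V ≤ 144 * S * V := by gcongr
  have hkΛ : 0 ≤ k₁ * Λ ^ 2 := by positivity
  nlinarith [mul_le_mul_of_nonneg_left q1 hkΛ, mul_le_mul_of_nonneg_left q2 hkΛ]

end Near

/-! ### The collision operator at a fixed time -/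

section Conv

variable {c d q : ℝ → ℝ} {k₁ δ κ N : ℝ} {g h : E → ℝ}

/-- Both cutoffs equal 1 for r ≥ δ, so the difference is supported in r < δ. There r c(r) ≤ q(r) ≤
q(1), a bound that does not see N. -/
lemma IsProfile.isNear (hq : IsProfile q) (hk : q 1 ≤ k₁) (hδ : 0 < δ) (hδ1 : δ ≤ 1)
    (hN : 1 / δ ≤ N) : IsNear (fun r => cutC q N r - cutC q (1 / δ) r) k₁ δ where
  toIsBddRadial := by
    have hδ' : 0 < 1 / δ := by positivity
    exact (hq.isBddRadial_cutC (hδ'.trans_le hN)).sub (hq.isBddRadial_cutC hδ')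
  nonneg r := by
    have hδ' : 0 < 1 / δ := by positivity
    rcases le_or_gt r 0 with hr | hr
    · rw [cutC_of_lt, cutC_of_lt, sub_zero]
      · exact (mul_nonpos_of_nonneg_of_nonpos hδ'.le hr).trans (by norm_num)
      · exact (mul_nonpos_of_nonneg_of_nonpos (hδ'.trans_le hN).le hr).trans (by norm_num)
    · have h1 : cutoff (1 / δ * r) ≤ cutoff (N * r) := cutoff_mono (by gcongr)
      have h2 := hq.div_nonneg hr
      simp only [cutC]
      nlinarith
  mul_le r hr := by
    have hk0 : 0 ≤ k₁ := (hq.pos 1 one_pos).le.trans hk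
    rcases le_or_gt δ r with h1 | h1
    · have h2 : 1 ≤ 1 / δ * r := by rw [one_div_mul_eq_div, le_div_iff₀ hδ]; linarith
      have h3 : 1 ≤ N * r := h2.trans (by gcongr)
      simp only [cutC, cutoff_eq_one h2, cutoff_eq_one h3, sub_self, mul_zero]
      exact hk0
    · have h2 := hq.div_nonneg hr
      have h3 := cutoff_le_one (N * r)
      have h4 := cutoff_nonneg (1 / δ * r)
      have h5 := hq.le_of_lt_one hr (by linarith)
      simp only [cutC]
      calc _ ≤ r * (1 * (q r / r) - 0 * (q r / r)) := by gcongr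
        _ = q r := by field_simp; ring
        _ ≤ k₁ := h5.trans hk
  zero r hr := by
    have hr0 : 0 < r := hδ.trans_le hr
    have h2 : 1 ≤ 1 / δ * r := by rw [one_div_mul_eq_div, le_div_iff₀ hδ]; linarith
    have h3 : 1 ≤ N * r := h2.trans (by gcongr)
    simp only [cutC, cutoff_eq_one h2, cutoff_eq_one h3, sub_self]

/-- From r c(r) ≤ k₁, both c and c/r are at most k₁/r² on the unit ball. One weight thus serves for
the kernel and for its divergence. -/
lemma IsNear.le_singW (hc : IsNear c k₁ δ) (hδ1 : δ ≤ 1) (hk : 0 ≤ k₁) (z : E) :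
    c ‖z‖ ≤ k₁ * singW z ∧ c ‖z‖ / ‖z‖ ≤ k₁ * singW z := by
  have h0 := mul_nonneg hk (singW_nonneg z)
  rcases (norm_nonneg z).eq_or_lt with hz | hz
  · obtain ⟨a, ha, h⟩ := hc.zero_near
    rw [h ‖z‖ (by linarith), zero_div]
    exact ⟨h0, h0⟩
  rcases le_or_gt δ ‖z‖ with h1 | h1
  · rw [hc.zero _ h1, zero_div]
    exact ⟨h0, h0⟩
  · have h2 : singW z = (‖z‖ ^ 2)⁻¹ := by
      rw [singW, indicator_of_mem]
      simp only [Metric.mem_ball, dist_zero_right]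
      linarith
    have h3 := hc.mul_le _ hz
    rw [h2, ← div_eq_mul_inv, le_div_iff₀ (by positivity), le_div_iff₀ (by positivity)]
    constructor
    · have := hc.nonneg ‖z‖
      nlinarith [mul_nonneg hz.le this]
    · calc _ = ‖z‖ * c ‖z‖ := by field_simp
        _ ≤ _ := h3

lemma integral_singW_sub (v : E) : ∫ w, singW (v - w) = singI :=
  integral_sub_left_eq_self singW volume v

/-- This is how values of g below the level are treated: a bounded density against the locally
integrable singularity gives a bounded matrix, uniformly in the regularization. -/
lemma IsNear.norm_convK_le (hc : IsNear c k₁ δ) (hδ1 : δ ≤ 1) (hk : 0 ≤ k₁)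
    (hh : ∀ x, |h x| ≤ κ) (v : E) : ‖convK c h v‖ ≤ κ * k₁ * singI := by
  have hκ : 0 ≤ κ := (abs_nonneg _).trans (hh 0)
  rw [← integral_singW_sub v, ← integral_const_mul]
  refine norm_integral_le_of_norm_le ((integrable_singW.comp_sub_left v).const_mul _)
    (Eventually.of_forall fun w => ?_)
  rw [norm_smul, mul_assoc]
  refine mul_le_mul (hh w) ?_ (norm_nonneg _) hκ
  refine (norm_radK_le _ _).trans ?_
  rw [abs_of_nonneg (hc.nonneg _)]
  exact (hc.le_singW hδ1 hk _).1

lemma IsNear.norm_convD_le (hc : IsNear c k₁ δ) (hδ1 : δ ≤ 1) (hk : 0 ≤ k₁)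
    (hh : ∀ x, |h x| ≤ κ) (v : E) : ‖convD c h v‖ ≤ 2 * κ * k₁ * singI := by
  have hκ : 0 ≤ κ := (abs_nonneg _).trans (hh 0)
  rw [← integral_singW_sub v, ← integral_const_mul]
  refine norm_integral_le_of_norm_le ((integrable_singW.comp_sub_left v).const_mul _)
    (Eventually.of_forall fun w => ?_)
  rw [norm_smul, show 2 * κ * k₁ * singW (v - w) = κ * (2 * (k₁ * singW (v - w))) by ring]
  refine mul_le_mul (hh w) ?_ (norm_nonneg _) hκ
  refine (norm_radD_le _ _).trans ?_
  rw [abs_of_nonneg (hc.nonneg _)]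
  have := (hc.le_singW hδ1 hk (v - w)).2
  linarith

lemma inner_convK_self_nonneg (hc : IsBddRadial c) (hc0 : ∀ r, 0 ≤ c r) (hh : Integrable h)
    (hh0 : ∀ x, 0 ≤ h x) (v e : E) : 0 ≤ ⟪convK c h v e, e⟫ := by
  rw [hc.convK_apply hh, real_inner_comm, ← integral_inner (hc.integrable_radK_apply hh v e)]
  refine integral_nonneg fun w => ?_
  simp only [radK, smul_apply, inner_smul_right, Pi.zero_apply]
  rw [real_inner_comm]
  exact mul_nonneg (hh0 w) (mul_nonneg (hc0 _) (inner_proj_nonneg _ _))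

lemma inner_convK_comm (hc : IsBddRadial c) (hh : Integrable h) (v e ξ : E) :
    ⟪convK c h v e, ξ⟫ = ⟪e, convK c h v ξ⟫ := by
  rw [hc.convK_apply hh, hc.convK_apply hh, real_inner_comm,
    ← integral_inner (hc.integrable_radK_apply hh v e),
    ← integral_inner (hc.integrable_radK_apply hh v ξ)]
  refine integral_congr_ae (Eventually.of_forall fun w => ?_)
  simp only [radK, smul_apply, inner_smul_right]
  rw [real_inner_comm, inner_proj_comm]

lemma convK_add (hc : IsBddRadial c) (hg : Integrable g) (hh : Integrable h) (v : E) :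
    convK c (fun x => g x + h x) v = convK c g v + convK c h v := by
  rw [convK, convK, convK, ← integral_add (hc.integrable_radK hg v) (hc.integrable_radK hh v)]
  refine integral_congr_ae (Eventually.of_forall fun w => ContinuousLinearMap.ext fun e => ?_)
  simp only [smul_apply, add_apply]
  module

lemma convD_add (hc : IsBddRadial c) (hg : Integrable g) (hh : Integrable h) (v : E) :
    convD c (fun x => g x + h x) v = convD c g v + convD c h v := by
  rw [convD, convD, convD, ← integral_add (hc.integrable_radD hg v) (hc.integrable_radD hh v)]
  exact integral_congr_ae (Eventually.of_forall fun w => add_smul _ _ _)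

lemma convK_sub_coeff (hc : IsBddRadial c) (hd : IsBddRadial d) (hg : Integrable g) (v : E) :
    convK (fun r => c r - d r) g v = convK c g v - convK d g v := by
  rw [convK, convK, convK, ← integral_sub (hc.integrable_radK hg v) (hd.integrable_radK hg v)]
  refine integral_congr_ae (Eventually.of_forall fun w => ContinuousLinearMap.ext fun e => ?_)
  simp only [radK, smul_apply, sub_apply]
  module

lemma convD_sub_coeff (hc : IsBddRadial c) (hd : IsBddRadial d) (hg : Integrable g) (v : E) :
    convD (fun r => c r - d r) g v = convD c g v - convD d g v := by
  rw [convD, convD, convD, ← integral_sub (hc.integrable_radD hg v) (hd.integrable_radD hg v)]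
  refine integral_congr_ae (Eventually.of_forall fun w => ?_)
  simp only [radD, ← smul_sub, ← sub_smul]
  congr 2
  ring

lemma continuous_integral_smul_comp_sub {F : Type*} [NormedAddCommGroup F] [NormedSpace ℝ F]
    (hg : Integrable g) {Φ : E → F} (hΦ : Continuous Φ) {C : ℝ} (hC : ∀ z, ‖Φ z‖ ≤ C) :
    Continuous fun v => ∫ w, g w • Φ (v - w) := by
  refine continuous_of_dominated (bound := fun w => ‖g w‖ * C)
    (fun v => (integrable_smul_comp_sub hg hΦ hC v).aestronglyMeasurable)
    (fun v => Eventually.of_forall fun w => ?_) (hg.norm.mul_const C)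
    (Eventually.of_forall fun w => by fun_prop)
  rw [norm_smul]
  gcongr
  exact hC _

lemma continuous_convK (hc : IsBddRadial c) (hg : Integrable g) : Continuous (convK c g) := by
  obtain ⟨C, hC⟩ := hc.exists_norm_radK_le
  exact continuous_integral_smul_comp_sub hg hc.continuous_radK hC

lemma continuous_convD (hc : IsBddRadial c) (hg : Integrable g) : Continuous (convD c g) := by
  obtain ⟨C, hC⟩ := hc.exists_norm_radD_le
  exact continuous_integral_smul_comp_sub hg hc.contDiff_radD.continuous hC

lemma exists_norm_conv_le (hc : IsBddRadial c) (hg : Integrable g) :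
    ∃ C, ∀ v, ‖convK c g v‖ ≤ C ∧ ‖convD c g v‖ ≤ C := by
  obtain ⟨C, hC⟩ := hc.exists_norm_radK_le
  obtain ⟨C', hC'⟩ := hc.exists_norm_radD_le
  refine ⟨max (∫ w, ‖g w‖ * C) (∫ w, ‖g w‖ * C'), fun v => ⟨le_max_of_le_left ?_,
    le_max_of_le_right ?_⟩⟩
  · refine norm_integral_le_of_norm_le (hg.norm.mul_const C) (Eventually.of_forall fun w => ?_)
    rw [norm_smul]
    gcongr
    exact hC _
  · refine norm_integral_le_of_norm_le (hg.norm.mul_const C') (Eventually.of_forall fun w => ?_)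
    rw [norm_smul]
    gcongr
    exact hC' _

/-- The bounds on the derivative of the regularized kernel in terms of the weight `cutW`. -/
lemma exists_norm_radD_cutC_bound : ∃ D : ℝ, 1 ≤ D ∧ ∀ (q : ℝ → ℝ) (N : ℝ), IsProfile q → 0 < N →
    ∀ z : E, ‖radD (cutC q N) z‖ ≤ 4 * N * cutW q N ‖z‖ ∧
      ‖fderiv ℝ (radD (cutC q N)) z‖ ≤ D * N ^ 2 * cutW q N ‖z‖ := by
  obtain ⟨D, hD1, hD⟩ := exists_deriv_cutC_bound
  refine ⟨8 * (D + 3), by linarith, fun q N hq hN z => ?_⟩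
  have w0 := hq.cutW_nonneg hN (r := ‖z‖)
  have w1 := hq.cutW_div_le hN (r := ‖z‖)
  have c0 := hq.cutC_nonneg hN (r := ‖z‖)
  have c1 := hq.cutC_le_cutW hN (r := ‖z‖)
  have w2 : cutW q N ‖z‖ / ‖z‖ ^ 2 ≤ (2 * N) ^ 2 * cutW q N ‖z‖ := by
    calc _ = cutW q N ‖z‖ / ‖z‖ / ‖z‖ := by rw [sq, div_div]
      _ ≤ 2 * N * cutW q N ‖z‖ / ‖z‖ := by gcongr
      _ = 2 * N * (cutW q N ‖z‖ / ‖z‖) := by ring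
      _ ≤ 2 * N * (2 * N * cutW q N ‖z‖) := by gcongr
      _ = _ := by ring
  constructor
  · refine (norm_radD_le _ _).trans ?_
    rw [abs_of_nonneg c0]
    have : cutC q N ‖z‖ / ‖z‖ ≤ cutW q N ‖z‖ / ‖z‖ := by gcongr
    linarith
  · refine ((hq.isRadial_cutC hN).norm_fderiv_radD_le z).trans ?_
    have e1 : |deriv (cutC q N) ‖z‖| / ‖z‖ ≤ D * ((2 * N) ^ 2 * cutW q N ‖z‖) := by
      rcases (norm_nonneg z).eq_or_lt with hz | hz
      · rw [← hz, div_zero]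
        rw [← hz] at w0
        positivity
      · calc _ ≤ D * (cutW q N ‖z‖ / ‖z‖) / ‖z‖ := by gcongr; exact hD q N _ hq hN hz
          _ = D * (cutW q N ‖z‖ / ‖z‖ ^ 2) := by rw [sq, ← div_div]; ring
          _ ≤ _ := by gcongr
    have e2 : |cutC q N ‖z‖| / ‖z‖ ^ 2 ≤ (2 * N) ^ 2 * cutW q N ‖z‖ := by
      rw [abs_of_nonneg c0]
      refine le_trans ?_ w2
      gcongr
    calc _ ≤ 2 * (D * ((2 * N) ^ 2 * cutW q N ‖z‖) + 3 * ((2 * N) ^ 2 * cutW q N ‖z‖)) := by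
          gcongr
      _ = _ := by ring

lemma contDiff_convD_cutC (hq : IsProfile q) (hN : 0 < N) (hg : Integrable g) :
    ContDiff ℝ 1 (convD (cutC q N) g) ∧
      ∀ v, fderiv ℝ (convD (cutC q N) g) v = ∫ w, g w • fderiv ℝ (radD (cutC q N)) (v - w) := by
  obtain ⟨D, hD1, hD⟩ := exists_norm_radD_cutC_bound
  have hb := hq.isBddRadial_cutC hN
  obtain ⟨C, hC⟩ := hb.exists_norm_radD_le
  have hC' : ∀ z, ‖fderiv ℝ (radD (cutC q N)) z‖
      ≤ D * N ^ 2 * (q (1 / (2 * N)) / (1 / (2 * N))) := fun z => by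
    refine (hD q N hq hN z).2.trans ?_
    gcongr
    exact hq.cutW_le hN
  have hF := hasFDerivAt_integral_smul_comp_sub hg hb.contDiff_radD hC hC'
  have he : ∀ v, fderiv ℝ (convD (cutC q N) g) v
      = ∫ w, g w • fderiv ℝ (radD (cutC q N)) (v - w) := fun v => (hF v).fderiv
  refine ⟨contDiff_one_iff_fderiv.2 ⟨fun v => (hF v).differentiableAt, ?_⟩, he⟩
  rw [funext he]
  exact continuous_integral_smul_comp_sub hg (hb.contDiff_radD.continuous_fderiv one_ne_zero) hC'

/-- The kernel bounds away from the diagonal. -/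
lemma norm_far_le {D : ℝ} (hD1 : 1 ≤ D) (hD : ∀ z : E, ‖radD (cutC q N) z‖ ≤ 4 * N * cutW q N ‖z‖ ∧
      ‖fderiv ℝ (radD (cutC q N)) z‖ ≤ D * N ^ 2 * cutW q N ‖z‖)
    (hq : IsProfile q) (hN : 0 < N) (hg : Integrable g) (hg0 : ∀ x, 0 ≤ g x) {v : E} {W : ℝ}
    (hi : Integrable fun w => g w * cutW q N ‖v - w‖) (hW : ∫ w, g w * cutW q N ‖v - w‖ ≤ W) :
    ‖convK (cutC q N) g v‖ ≤ W ∧ ‖convD (cutC q N) g v‖ ≤ 4 * N * W ∧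
      ‖fderiv ℝ (convD (cutC q N) g) v‖ ≤ D * N ^ 2 * W := by
  refine ⟨?_, ?_, ?_⟩
  · refine (norm_integral_le_of_norm_le hi (Eventually.of_forall fun w => ?_)).trans hW
    rw [norm_smul, Real.norm_of_nonneg (hg0 w)]
    refine mul_le_mul_of_nonneg_left ((norm_radK_le _ _).trans ?_) (hg0 w)
    rw [abs_of_nonneg (hq.cutC_nonneg hN)]
    exact hq.cutC_le_cutW hN
  · refine le_trans ?_ (mul_le_mul_of_nonneg_left hW (by positivity : 0 ≤ 4 * N))
    rw [← integral_const_mul]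
    refine norm_integral_le_of_norm_le (hi.const_mul _) (Eventually.of_forall fun w => ?_)
    rw [norm_smul, Real.norm_of_nonneg (hg0 w), mul_left_comm]
    exact mul_le_mul_of_nonneg_left (hD _).1 (hg0 w)
  · rw [(contDiff_convD_cutC hq hN hg).2]
    refine le_trans ?_ (mul_le_mul_of_nonneg_left hW (by positivity : 0 ≤ D * N ^ 2))
    rw [← integral_const_mul]
    refine norm_integral_le_of_norm_le (hi.const_mul _) (Eventually.of_forall fun w => ?_)
    rw [norm_smul, Real.norm_of_nonneg (hg0 w), mul_left_comm]
    exact mul_le_mul_of_nonneg_left (hD _).2 (hg0 w)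

/-- Integration by parts in the convolution with the divergence of the kernel. -/
lemma inner_convD_eq (hc : IsNear c k₁ δ) {u : E → ℝ} {U : E → E} (hu : HasWeakGrad u U)
    (hui : Integrable u) (v ξ : E) : ⟪convD c u v, ξ⟫ = ∫ w, ⟪radK c (v - w) ξ, U w⟫ := by
  have hΦ : ContDiff ℝ 1 fun w : E => radK c (v - w) ξ :=
    (hc.contDiff_radK_apply ξ).comp (contDiff_const.sub contDiff_id)
  have hs : HasCompactSupport fun w : E => radK c (v - w) ξ := by
    refine HasCompactSupport.intro (isCompact_closedBall v δ) fun w hw => ?_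
    simp only [Metric.mem_closedBall, not_le, dist_eq_norm, norm_sub_rev w v] at hw
    simp [radK, hc.zero _ hw.le]
  have h1 := hu.integral_mul_divg hΦ hs
  rw [convD, real_inner_comm, ← integral_inner (hc.integrable_radD hui v)]
  rw [← neg_eq_iff_eq_neg] at h1
  rw [← h1, ← integral_neg]
  refine integral_congr_ae (Eventually.of_forall fun w => ?_)
  have h2 : divg (fun w => radK c (v - w) ξ) w = -⟪radD c (v - w), ξ⟫ := by
    rw [← hc.divg_radK_apply]
    simp only [divg, ← Finset.sum_neg_distrib]
    refine Finset.sum_congr rfl fun i _ => ?_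
    have hd : HasFDerivAt (fun w : E => radK c (v - w) ξ)
        ((fderiv ℝ (fun z => radK c z ξ) (v - w)).comp (-(ContinuousLinearMap.id ℝ E))) w := by
      have h3 := ((hc.contDiff_radK_apply ξ).differentiable one_ne_zero (v - w)).hasFDerivAt
      exact h3.comp w ((hasFDerivAt_id w).const_sub v)
    rw [hd.fderiv]
    simp
  simp only [h2, inner_smul_right]
  rw [real_inner_comm ξ]
  ring

/-- Completion of a square for a nonnegative symmetric matrix. -/
lemma inner_complete_square {K : E →L[ℝ] E} (hsymm : ∀ x y, ⟪K x, y⟫ = ⟪x, K y⟫)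
    (hnn : ∀ x, 0 ≤ ⟪K x, x⟫) (X p : E) (s L : ℝ) :
    1 / 2 * s ^ 2 * ⟪K X, X⟫ - 2 * L ^ 2 * ⟪K p, p⟫ ≤ ⟪K X, s ^ 2 • X + (2 * L * s) • p⟫ := by
  have h := hnn (s • X + (2 * L) • p)
  have hc : ⟪K p, X⟫ = ⟪K X, p⟫ := by rw [hsymm, real_inner_comm]
  simp only [map_add, map_smul, inner_add_left, inner_add_right, inner_smul_left,
    inner_smul_right, conj_trivial, hc] at h ⊢
  nlinarith

end Conv

/-! ### A lower bound for the entropy production at a fixed time -/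

lemma integrable_inner_of_hasCompactSupport {G Φ : E → E} (hG : LocallyIntegrable G)
    (hΦ : Continuous Φ) (hc : HasCompactSupport Φ) : Integrable fun x => ⟪Φ x, G x⟫ := by
  have h1 := integrable_smul_of_hasCompactSupport hG hΦ.norm hc.norm
  refine h1.mono (hΦ.aestronglyMeasurable.inner hG.aestronglyMeasurable)
    (Eventually.of_forall fun x => ?_)
  rw [norm_smul, norm_norm]
  exact norm_inner_le_norm _ _

section Slice

variable {q : ℝ → ℝ} {k₁ δ κ N ρ ρ' Λ W cc : ℝ} {g : E → ℝ} {G : E → E} {Ψ : E → ℝ}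

/-- The density of the truncated entropy production. -/
def fluxDensity (c : ℝ → ℝ) (g : E → ℝ) (G : E → E) (κ : ℝ) (Ψ : E → ℝ) (v : E) : ℝ :=
  ⟪convK c g v (G v) - g v • convD c g v, testField g G κ Ψ v⟫

lemma testField_of_le (hκ : 0 < κ) (hg : ∀ x, 0 ≤ g x) {x : E} (h : g x ≤ κ) :
    testField g G κ Ψ x = 0 := by
  rw [testField, gradTrunc_of_le h, lnPlus_of_le hκ h (hg x)]
  simp

/-- The test field vanishes where g ≤ κ, and above the level G = g · ∇ln g. The whole density then
factors through g 1_{g>κ}. -/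
lemma fluxDensity_eq {c : ℝ → ℝ} (hκ : 0 < κ) (hg : ∀ x, 0 ≤ g x) (v : E) :
    fluxDensity c g G κ Ψ v = highPart g κ v *
      (⟪convK c g v (gradTrunc g G κ v), testField g G κ Ψ v⟫
        - ⟪convD c g v, testField g G κ Ψ v⟫) := by
  rcases le_or_gt (g v) κ with h | h
  · rw [fluxDensity, testField_of_le hκ hg h]
    simp
  · have h1 : G v = g v • gradTrunc g G κ v := by
      have h2 := highPart_smul_gradTrunc (g := g) (G := G) (x := v) hκ
      rw [highPart_of_lt h, indicator_of_mem (show v ∈ {x | κ < g x} from h)] at h2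
      exact h2.symm
    rw [fluxDensity, h1, map_smul, ← smul_sub, inner_smul_left, inner_sub_left, highPart_of_lt h,
      conj_trivial]

/-- The factor |X| + 1 covers at once the diffusion, linear in X = ∇ln g, and the drift. With
bounded coefficients the flux is dominated by the Fisher density plus g^{5/3}. -/
lemma norm_testField_mul_le (hκ : 1 ≤ κ) (hg : ∀ x, 0 ≤ g x) (hΨ : IsCut Ψ ρ Λ) (hρ : ρ ≤ ρ')
    (v : E) : highPart g κ v * ((‖gradTrunc g G κ v‖ + 1) * ‖testField g G κ Ψ v‖)
      ≤ 2 * (Metric.ball (0 : E) ρ').indicator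
        (fun v => fisher g G κ v + 288 * (Λ ^ 2 + 1) * highPow g κ (5 / 3) v) v := by
  by_cases hv : v ∈ Metric.ball (0 : E) ρ'
  · rw [indicator_of_mem hv, ← highPart_mul_norm_sq (by linarith)]
    have h1 := highPart_le (g := g) (x := v) hκ
    have h2 := highPart_mul_sq_le (g := g) (x := v) hκ
    have h3 := norm_testField_le (g := g) (G := G) (κ := κ) hΨ v
    have h0 := highPart_nonneg (κ := κ) hg v
    set X := ‖gradTrunc g G κ v‖
    set L := lnPlus (g v / κ)
    have hX : 0 ≤ X := norm_nonneg _
    have h4 : (X + 1) * ‖testField g G κ Ψ v‖ ≤ 2 * X ^ 2 + 1 + 4 * (L ^ 2 * Λ ^ 2) := by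
      calc _ ≤ (X + 1) * (X + 2 * L * Λ) := by gcongr
        _ ≤ _ := by nlinarith [sq_nonneg (X + 1 - (X + 2 * L * Λ)), sq_nonneg (X - 1),
              sq_nonneg (X - 2 * L * Λ)]
    have h5 := mul_le_mul_of_nonneg_left h4 h0
    have h6 := mul_le_mul_of_nonneg_right h2 (sq_nonneg Λ)
    have h7 : 0 ≤ highPow g κ (5 / 3) v := highPow_nonneg hg _ v
    nlinarith [mul_nonneg h7 (sq_nonneg Λ)]
  · rw [indicator_of_notMem hv, testField_eq_zero hΨ]
    · simp
    · simp only [Metric.mem_ball, dist_zero_right, not_lt] at hv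
      exact hρ.trans hv

lemma abs_fluxDensity_le {c : ℝ → ℝ} (hκ : 1 ≤ κ) (hg : ∀ x, 0 ≤ g x) (hΨ : IsCut Ψ ρ Λ)
    (hρ : ρ ≤ ρ') {C : ℝ} {v : E} (hK : ‖convK c g v‖ ≤ C) (hD : ‖convD c g v‖ ≤ C) :
    |fluxDensity c g G κ Ψ v| ≤ C * (2 * (Metric.ball (0 : E) ρ').indicator
        (fun v => fisher g G κ v + 288 * (Λ ^ 2 + 1) * highPow g κ (5 / 3) v) v) := by
  have hC : 0 ≤ C := (norm_nonneg _).trans hK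
  refine le_trans ?_ (mul_le_mul_of_nonneg_left (norm_testField_mul_le hκ hg hΨ hρ v) hC)
  have h0 := highPart_nonneg (κ := κ) hg v
  rw [fluxDensity_eq (by linarith) hg, abs_mul, abs_of_nonneg h0, mul_left_comm,
    ← inner_sub_left]
  refine mul_le_mul_of_nonneg_left ?_ h0
  refine (abs_real_inner_le_norm _ _).trans ?_
  rw [← mul_assoc]
  gcongr
  calc _ ≤ ‖convK c g v‖ * ‖gradTrunc g G κ v‖ + ‖convD c g v‖ :=
        (norm_sub_le _ _).trans (by gcongr; exact ContinuousLinearMap.le_opNorm _ _)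
    _ ≤ C * ‖gradTrunc g G κ v‖ + C := by gcongr
    _ = _ := by ring

lemma aestronglyMeasurable_trunc (hgm : AEStronglyMeasurable g) (hGm : AEStronglyMeasurable G)
    (hΨ : IsCut Ψ ρ Λ) : AEStronglyMeasurable (highPart g κ) ∧
      AEStronglyMeasurable (gradTrunc g G κ) ∧ AEStronglyMeasurable (testField g G κ Ψ) := by
  have hT : NullMeasurableSet {x | κ < g x} :=
    nullMeasurableSet_lt aemeasurable_const hgm.aemeasurable
  have m2 : AEStronglyMeasurable (gradTrunc g G κ) :=
    (hgm.aemeasurable.inv.aestronglyMeasurable.smul hGm).indicator₀ hT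
  have m4 : AEStronglyMeasurable fun x => lnPlus (g x / κ) := by
    have : Measurable fun r : ℝ => lnPlus (r / κ) := by unfold lnPlus; fun_prop
    exact (this.comp_aemeasurable hgm.aemeasurable).aestronglyMeasurable
  have m5 : AEStronglyMeasurable Ψ := hΨ.contDiff.continuous.aestronglyMeasurable
  exact ⟨hgm.indicator₀ hT, m2, ((m5.pow 2).smul m2).add (((m4.const_mul 2).mul m5).smul
    (continuous_gradient hΨ.contDiff).aestronglyMeasurable)⟩

lemma integrable_fluxDensity {c : ℝ → ℝ} (hc : IsBddRadial c) (hκ : 1 ≤ κ) (hg : ∀ x, 0 ≤ g x)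
    (hgi : Integrable g) (hGm : AEStronglyMeasurable G) (hΨ : IsCut Ψ ρ Λ) (hρ : ρ ≤ ρ')
    (hS : IntegrableOn (highPow g κ (5 / 3)) (Metric.ball 0 ρ'))
    (hY : IntegrableOn (fisher g G κ) (Metric.ball 0 ρ')) :
    Integrable (fluxDensity c g G κ Ψ) := by
  obtain ⟨C, hC⟩ := exists_norm_conv_le hc hgi
  obtain ⟨m1, m2, m3⟩ := aestronglyMeasurable_trunc (κ := κ) hgi.aestronglyMeasurable hGm hΨ
  have hB : MeasurableSet (Metric.ball (0 : E) ρ') := Metric.isOpen_ball.measurableSet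
  refine Integrable.mono' (((hY.add (hS.const_mul (288 * (Λ ^ 2 + 1)))).integrable_indicator
    hB).const_mul 2 |>.const_mul C) ?_ (Eventually.of_forall fun v => ?_)
  · refine AEStronglyMeasurable.inner (AEStronglyMeasurable.sub ?_ ?_) m3
    · exact (ContinuousLinearMap.id ℝ (E →L[ℝ] E)).aestronglyMeasurable_comp₂
        (continuous_convK hc hgi).aestronglyMeasurable hGm
    · exact hgi.aestronglyMeasurable.smul (continuous_convD hc hgi).aestronglyMeasurable
  · exact abs_fluxDensity_le hκ hg hΨ hρ (hC v).1 (hC v).2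

/-- The interaction between high values, after the integration in the second variable. -/
lemma integral_interaction {c : ℝ → ℝ} (hc : IsNear c k₁ δ) (hκ : 1 ≤ κ) (hg : ∀ x, 0 ≤ g x)
    (hgi : Integrable g) (hG : HasWeakGrad g G) (v : E) :
    ∫ w, interaction c g G κ Ψ (v, w) = highPart g κ v *
      (⟪convK c (highPart g κ) v (gradTrunc g G κ v), testField g G κ Ψ v⟫
        - ⟪convD c (fun x => max (g x - κ) 0) v, testField g G κ Ψ v⟫) := by
  have hκ0 : 0 < κ := by linarith
  have hT : NullMeasurableSet {x | κ < g x} :=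
    nullMeasurableSet_lt aemeasurable_const hgi.aestronglyMeasurable.aemeasurable
  have hhi : Integrable (highPart g κ) := hgi.indicator₀ hT
  have hu := hG.posPart hg κ
  have hui : Integrable fun x => max (g x - κ) 0 := by
    refine hgi.mono hu.locInt.aestronglyMeasurable (Eventually.of_forall fun x => ?_)
    rw [Real.norm_of_nonneg (le_max_right _ _), Real.norm_of_nonneg (hg x)]
    exact max_le (by linarith) (hg x)
  set ξ := testField g G κ Ψ v
  set X := gradTrunc g G κ v
  -- Integration by parts turns the drift generated by (g-κ)₊ into the kernel acting on ∇(g-κ)₊ = g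
  -- 1_{g>κ} ∇ln g. It has the same weights as the diffusion generated by g 1_{g>κ}, and the two
  -- merge into the difference of the logarithmic gradients at v and w.
  rw [inner_convD_eq hc hu hui, hc.convK_apply hhi, real_inner_comm ξ,
    ← integral_inner (hc.integrable_radK_apply hhi v X), ← integral_sub, ← integral_const_mul]
  · refine integral_congr_ae (Eventually.of_forall fun w => ?_)
    simp only [interaction, inner_smul_right]
    rw [← highPart_smul_gradTrunc hκ0, inner_smul_right, map_sub, inner_sub_left,
      real_inner_comm ξ]
    have : ⟪radK c (v - w) ξ, gradTrunc g G κ w⟫ = ⟪radK c (v - w) (gradTrunc g G κ w), ξ⟫ := by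
      simp only [radK, smul_apply, inner_smul_left, inner_smul_right, inner_proj_comm,
        real_inner_comm ξ, conj_trivial]
    rw [this]
    ring
  · exact (hc.integrable_radK_apply hhi v X).const_inner ξ
  · refine integrable_inner_of_hasCompactSupport hu.locIntGrad
      ((hc.contDiff_radK_apply ξ).continuous.comp (by fun_prop)) ?_
    refine HasCompactSupport.intro (isCompact_closedBall v δ) fun w hw => ?_
    simp only [Metric.mem_closedBall, not_le, dist_eq_norm, norm_sub_rev w v] at hw
    simp [radK, hc.zero _ hw.le]

/-- The contribution of the divergence of the regular part of the kernel. -/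
lemma far_drift_lower {D : ℝ} (hD1 : 1 ≤ D)
    (hD : ∀ z : E, ‖radD (cutC q N) z‖ ≤ 4 * N * cutW q N ‖z‖ ∧
      ‖fderiv ℝ (radD (cutC q N)) z‖ ≤ D * N ^ 2 * cutW q N ‖z‖)
    (hq : IsProfile q) (hN : 1 ≤ N) (hκ : 1 ≤ κ) (hΛ : 1 ≤ Λ) (hW1 : 0 ≤ W) (hΨ : IsCut Ψ ρ Λ)
    (hρ : ρ ≤ ρ') (hρ' : ρ' ≤ 1) (hg : ∀ x, 0 ≤ g x) (hgi : Integrable g)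
    (hG : HasWeakGrad g G)
    (hfar : ∀ᵐ v : E, ‖v‖ < 1 → Integrable (fun w => g w * cutW q N ‖v - w‖) ∧
      ∫ w, g w * cutW q N ‖v - w‖ ≤ W)
    (hS : IntegrableOn (highPow g κ (5 / 3)) (Metric.ball 0 ρ')) :
    Integrable (fun v => ⟪(Ψ v ^ 2) • convD (cutC q N) g v, {x | κ < g x}.indicator G v⟫) ∧
    -(30 * D * N ^ 2 * Λ * W * ∫ v in Metric.ball 0 ρ', highPow g κ (5 / 3) v)
      ≤ -∫ v, ⟪(Ψ v ^ 2) • convD (cutC q N) g v, {x | κ < g x}.indicator G v⟫ := by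
  have hN0 : 0 < N := by linarith
  obtain ⟨hD2, -⟩ := contDiff_convD_cutC hq hN0 hgi
  have hu := hG.posPart hg κ
  have hΦ : ContDiff ℝ 1 fun v => (Ψ v ^ 2) • convD (cutC q N) g v := (hΨ.contDiff.pow 2).smul hD2
  have hs : HasCompactSupport fun v => (Ψ v ^ 2) • convD (cutC q N) g v := by
    refine HasCompactSupport.intro (isCompact_closedBall (0 : E) ρ) fun x hx => ?_
    simp only [Metric.mem_closedBall, dist_zero_right, not_le] at hx
    rw [hΨ.zero x hx.le]
    simp
  refine ⟨integrable_inner_of_hasCompactSupport hu.locIntGrad hΦ.continuous hs, ?_⟩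
  -- All derivatives are moved onto the cutoff and the smooth far kernel, so that no gradient of g
  -- remains.
  rw [← hu.integral_mul_divg hΦ hs]
  have hB : MeasurableSet (Metric.ball (0 : E) ρ') := Metric.isOpen_ball.measurableSet
  rw [← integral_indicator hB, ← integral_const_mul, neg_le, ← integral_neg]
  have hbd : ∀ᵐ v : E, ‖-(max (g v - κ) 0 * divg (fun v => (Ψ v ^ 2) • convD (cutC q N) g v) v)‖
      ≤ 30 * D * N ^ 2 * Λ * W *
        (Metric.ball 0 ρ').indicator (fun v => highPow g κ (5 / 3) v) v := by
    filter_upwards [hfar] with v hv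
    by_cases hvB : v ∈ Metric.ball (0 : E) ρ'
    · have hv1 : ‖v‖ < 1 := by
        simp only [Metric.mem_ball, dist_zero_right] at hvB
        linarith
      obtain ⟨-, b1, b2⟩ := norm_far_le hD1 hD hq hN0 hgi hg (hv hv1).1 (hv hv1).2
      have hd : HasFDerivAt (fun v => (Ψ v ^ 2) • convD (cutC q N) g v)
          (Ψ v ^ 2 • fderiv ℝ (convD (cutC q N) g) v
            + ((2 * Ψ v) • fderiv ℝ Ψ v).smulRight (convD (cutC q N) g v)) v := by
        have h1 := (hΨ.contDiff.differentiable one_ne_zero v).hasFDerivAt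
        have h2 : HasFDerivAt (fun v => Ψ v ^ 2) ((2 * Ψ v) • fderiv ℝ Ψ v) v :=
          (h1.pow 2).congr_fderiv (by simp)
        exact h2.smul (hD2.differentiable one_ne_zero v).hasFDerivAt
      have p0 := hΨ.nonneg v
      have p1 := hΨ.le_one v
      have p2 : ‖fderiv ℝ Ψ v‖ ≤ Λ := by
        have h3 := hΨ.grad_le v
        rwa [gradient, LinearIsometryEquiv.norm_map] at h3
      have h4 : |divg (fun v => (Ψ v ^ 2) • convD (cutC q N) g v) v| ≤ 30 * D * N ^ 2 * Λ * W := by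
        refine (abs_divg_le _ _).trans ?_
        rw [hd.fderiv]
        calc _ ≤ 3 * (‖Ψ v ^ 2 • fderiv ℝ (convD (cutC q N) g) v‖
              + ‖((2 * Ψ v) • fderiv ℝ Ψ v).smulRight (convD (cutC q N) g v)‖) := by
              gcongr; exact norm_add_le _ _
          _ = 3 * (Ψ v ^ 2 * ‖fderiv ℝ (convD (cutC q N) g) v‖
              + 2 * Ψ v * ‖fderiv ℝ Ψ v‖ * ‖convD (cutC q N) g v‖) := by
              rw [ContinuousLinearMap.norm_smulRight_apply, norm_smul, norm_smul,
                Real.norm_of_nonneg (by positivity), Real.norm_of_nonneg (by positivity)]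
          _ ≤ 3 * (1 ^ 2 * (D * N ^ 2 * W) + 2 * 1 * Λ * (4 * N * W)) := by gcongr
          _ ≤ _ := by
              have e1 : D * N ^ 2 * W ≤ D * N ^ 2 * W * Λ :=
                le_mul_of_one_le_right (by positivity) hΛ
              have e2 : N * W * Λ ≤ N * W * Λ * (D * N) :=
                le_mul_of_one_le_right (by positivity) (by nlinarith)
              have e3 : 0 ≤ D * N ^ 2 * W * Λ := by positivity
              nlinarith
      rw [indicator_of_mem hvB, norm_neg, norm_mul, Real.norm_of_nonneg (le_max_right _ _),
        mul_comm]
      have h5 := (posPart_le_highPart (by linarith : 0 ≤ κ) hg (x := v)).trans (highPart_le hκ)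
      exact mul_le_mul h4 h5 (le_max_right _ _) (by positivity)
    · have hv1 : ρ ≤ ‖v‖ := by
        simp only [Metric.mem_ball, dist_zero_right, not_lt] at hvB
        exact hρ.trans hvB
      have hd : HasFDerivAt (fun v => (Ψ v ^ 2) • convD (cutC q N) g v)
          (0 : E →L[ℝ] E) v := by
        have h1 := (hΨ.contDiff.differentiable one_ne_zero v).hasFDerivAt
        have h2 := (h1.pow 2).smul (hD2.differentiable one_ne_zero v).hasFDerivAt
        refine h2.congr_fderiv ?_
        rw [hΨ.zero v hv1]
        ext
        simp
      rw [indicator_of_notMem hvB]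
      simp [divg, hd.fderiv]
  exact (le_abs_self _).trans (norm_integral_le_of_norm_le
    ((hS.integrable_indicator hB).const_mul _) hbd)

end Slice

/-! ### Assembling the lower bound of the flux -/

section Slice

variable {q : ℝ → ℝ} {k₁ δ κ N ρ ρ' Λ W cc : ℝ} {g : E → ℝ} {G : E → E} {Ψ : E → ℝ}

/-- The splitting of the entropy production into a regular part, the drift of the regular part,
and the interaction between high values. -/
lemma fluxDensity_split {cf cN : ℝ → ℝ} (hcf : IsBddRadial cf) (hcN : IsBddRadial cN)
    (hc : IsNear (fun r => cN r - cf r) k₁ δ) (hκ : 1 ≤ κ) (hg : ∀ x, 0 ≤ g x)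
    (hgi : Integrable g) (hG : HasWeakGrad g G) (v : E) :
    fluxDensity cN g G κ Ψ v
      + ⟪(Ψ v ^ 2) • convD cf g v, {x | κ < g x}.indicator G v⟫
      - ∫ w, interaction (fun r => cN r - cf r) g G κ Ψ (v, w)
    = highPart g κ v * (⟪convK cf g v (gradTrunc g G κ v), testField g G κ Ψ v⟫
        + ⟪convK (fun r => cN r - cf r) (fun x => g x - highPart g κ x) v (gradTrunc g G κ v),
          testField g G κ Ψ v⟫
        - ⟪convD (fun r => cN r - cf r) (fun x => min (g x) κ) v, testField g G κ Ψ v⟫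
        - ⟪convD cf g v, (2 * lnPlus (g v / κ) * Ψ v) • gradient Ψ v⟫) := by
  have hκ0 : 0 < κ := by linarith
  have hT : NullMeasurableSet {x | κ < g x} :=
    nullMeasurableSet_lt aemeasurable_const hgi.aestronglyMeasurable.aemeasurable
  have hhi : Integrable (highPart g κ) := hgi.indicator₀ hT
  have hli : Integrable fun x => g x - highPart g κ x := hgi.sub hhi
  have hu := hG.posPart hg κ
  have hui : Integrable fun x => max (g x - κ) 0 := by
    refine hgi.mono hu.locInt.aestronglyMeasurable (Eventually.of_forall fun x => ?_)
    rw [Real.norm_of_nonneg (le_max_right _ _), Real.norm_of_nonneg (hg x)]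
    exact max_le (by linarith) (hg x)
  have hmi : Integrable fun x => min (g x) κ := by
    have h1 := hgi.sub hui
    refine h1.congr (Eventually.of_forall fun x => ?_)
    simp only [Pi.sub_apply]
    rcases le_total (g x) κ with h | h
    · rw [max_eq_right (by linarith), min_eq_left h, sub_zero]
    · rw [max_eq_left (by linarith), min_eq_right h]; ring
  -- The near part is split differently in the two coefficients: g = (g - g1_{g>κ}) + g1_{g>κ} in
  -- the diffusion, but g = min(g,κ) + (g-κ)₊ in the drift. The gradient of (g-κ)₊ matches g1_{g>κ}
  -- in the diffusion, while both low parts are bounded by κ.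
  have eK : convK cN g v = convK cf g v
      + (convK (fun r => cN r - cf r) (fun x => g x - highPart g κ x) v
        + convK (fun r => cN r - cf r) (highPart g κ) v) := by
    rw [← convK_add hc.toIsBddRadial hli hhi]
    simp only [sub_add_cancel]
    rw [convK_sub_coeff hcN hcf hgi]
    abel
  have eD : convD cN g v = convD cf g v
      + (convD (fun r => cN r - cf r) (fun x => min (g x) κ) v
        + convD (fun r => cN r - cf r) (fun x => max (g x - κ) 0) v) := by
    rw [← convD_add hc.toIsBddRadial hmi hui]
    have : (fun x => min (g x) κ + max (g x - κ) 0) = g := funext fun x => by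
      rcases le_total (g x) κ with h | h
      · rw [max_eq_right (by linarith), min_eq_left h, add_zero]
      · rw [max_eq_left (by linarith), min_eq_right h]; ring
    rw [this, convD_sub_coeff hcN hcf hgi]
    abel
  rw [fluxDensity_eq hκ0 hg, integral_interaction hc hκ hg hgi hG, eK, eD,
    ← highPart_smul_gradTrunc hκ0]
  simp only [add_apply, inner_add_left, testField, inner_add_right, inner_smul_left,
    inner_smul_right, conj_trivial]
  ring

/-- Bookkeeping: H, HL and HL² are each at most 144 S, and every combination of Λ, N, W that occurs
is at most M = Λ²N²W ≥ 1. -/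
lemma regular_part_scalar {H L S J K Λ N W s : ℝ} (hH : 0 ≤ H) (hS : 0 ≤ S)
    (hJ : 0 ≤ J) (hK : 0 ≤ K) (hΛ : 1 ≤ Λ) (hN : 1 ≤ N) (hW : 1 ≤ W) (hs : s ≤ 1)
    (b1 : H ≤ S) (b2 : H * L ^ 2 ≤ 144 * S) (b3 : H * L ≤ 144 * S) (x : ℝ) :
    1 / 4 * (s * (H * x)) - (1440 + 576 * J + K + 1152 * J) * (Λ ^ 2 * N ^ 2 * W) * S
      ≤ H * (1 / 4 * s * x - 2 * L ^ 2 * (W * Λ ^ 2) - 2 * L ^ 2 * (2 * (J * Λ ^ 2)) - s * K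
        - 2 * L * (4 * J * Λ) - 2 * L * (4 * N * W * Λ)) := by
  set M := Λ ^ 2 * N ^ 2 * W with hM
  have hN2 : 1 ≤ N ^ 2 := one_le_pow₀ hN
  have hΛ2 : 1 ≤ Λ ^ 2 := one_le_pow₀ hΛ
  have m1 : W * Λ ^ 2 ≤ M := by
    calc W * Λ ^ 2 = Λ ^ 2 * 1 * W := by ring
      _ ≤ _ := by rw [hM]; gcongr
  have m2 : Λ ^ 2 ≤ M := by
    calc Λ ^ 2 = Λ ^ 2 * 1 * 1 := by ring
      _ ≤ _ := by rw [hM]; gcongr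
  have m3 : Λ ≤ M := le_trans (by nlinarith) m2
  have m4 : N * W * Λ ≤ M := by
    calc N * W * Λ = Λ * N * W := by ring
      _ ≤ _ := by
        rw [hM]
        gcongr
        · nlinarith
        · nlinarith
  have m0 : 1 ≤ M := hΛ2.trans m2
  have q1 : H * L ^ 2 * (W * Λ ^ 2) ≤ 144 * S * M := by gcongr
  have q2 : H * L ^ 2 * (J * Λ ^ 2) ≤ 144 * S * (J * M) := by gcongr
  have q3 : s * H * K ≤ 1 * S * (K * M) := by
    gcongr
    exact le_mul_of_one_le_right hK m0
  have q4 : H * L * (J * Λ) ≤ 144 * S * (J * M) := by gcongr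
  have q5 : H * L * (N * W * Λ) ≤ 144 * S * M := by gcongr
  clear_value M
  calc _ = 1 / 4 * (s * (H * x)) - 2 * (144 * S * M) - 4 * (144 * S * (J * M)) - 1 * S * (K * M)
        - 8 * (144 * S * (J * M)) - 8 * (144 * S * M) := by ring
    _ ≤ 1 / 4 * (s * (H * x)) - 2 * (H * L ^ 2 * (W * Λ ^ 2)) - 4 * (H * L ^ 2 * (J * Λ ^ 2))
        - s * H * K - 8 * (H * L * (J * Λ)) - 8 * (H * L * (N * W * Λ)) := by linarith
    _ = _ := by ring

/-- Ellipticity of the far part gives cc/2 times Ψ² times the Fisher density. Young's inequality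
spends half of it on the drift created by the low values in the near part; the diffusion of those
values is nonnegative up to ln₊² terms. Everything else is of order g^{5/3}. -/
lemma regular_part_lower {cf cn : ℝ → ℝ} (hcf : IsBddRadial cf) (hcf0 : ∀ r, 0 ≤ cf r)
    (hc : IsNear cn k₁ δ) (hδ1 : δ ≤ 1) (hk : 0 ≤ k₁)
    (hκ : 1 ≤ κ) (hκ2 : κ ≤ 2) (hΛ : 1 ≤ Λ) (hN : 1 ≤ N) (hW : 1 ≤ W) (hΨ : IsCut Ψ ρ Λ)
    (hg : ∀ x, 0 ≤ g x) (hgi : Integrable g) (hcc : 0 < cc) {v : E}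
    (hco : ∀ e : E, cc * ‖e‖ ^ 2 ≤ ⟪convK cf g v e, e⟫) (hK : ‖convK cf g v‖ ≤ W)
    (hD : ‖convD cf g v‖ ≤ 4 * N * W) :
    cc / 4 * (Ψ v ^ 2 * fisher g G κ v) - (1440 + 576 * (k₁ * singI) + 16 * (k₁ * singI) ^ 2 / cc
      + 1152 * (k₁ * singI)) * (Λ ^ 2 * N ^ 2 * W) * highPow g κ (5 / 3) v
    ≤ highPart g κ v * (⟪convK cf g v (gradTrunc g G κ v), testField g G κ Ψ v⟫
        + ⟪convK cn (fun x => g x - highPart g κ x) v (gradTrunc g G κ v), testField g G κ Ψ v⟫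
        - ⟪convD cn (fun x => min (g x) κ) v, testField g G κ Ψ v⟫
        - ⟪convD cf g v, (2 * lnPlus (g v / κ) * Ψ v) • gradient Ψ v⟫) := by
  have hκ0 : 0 < κ := by linarith
  have hT : NullMeasurableSet {x | κ < g x} :=
    nullMeasurableSet_lt aemeasurable_const hgi.aestronglyMeasurable.aemeasurable
  have hhi : Integrable (highPart g κ) := hgi.indicator₀ hT
  have hli : Integrable fun x => g x - highPart g κ x := hgi.sub hhi
  have hl0 : ∀ x, 0 ≤ g x - highPart g κ x ∧ g x - highPart g κ x ≤ κ := fun x => by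
    rcases le_or_gt (g x) κ with h | h
    · rw [highPart_of_le h, sub_zero]; exact ⟨hg x, h⟩
    · rw [highPart_of_lt h, sub_self]; exact ⟨le_rfl, hκ0.le⟩
  set H := highPart g κ v with hH
  set X := gradTrunc g G κ v with hX
  set L := lnPlus (g v / κ) with hL
  set p := gradient Ψ v with hp
  set S := highPow g κ (5 / 3) v with hS
  have hH0 : 0 ≤ H := highPart_nonneg hg v
  have hL0 : 0 ≤ L := lnPlus_nonneg _
  have hS0 : 0 ≤ S := highPow_nonneg hg _ v
  have hpΛ : ‖p‖ ≤ Λ := hΨ.grad_le v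
  have s0 := hΨ.nonneg v
  have s1 := hΨ.le_one v
  have hI := singI_nonneg
  have b1 : H ≤ S := highPart_le hκ
  have b2 : H * L ^ 2 ≤ 144 * S := highPart_mul_sq_le hκ
  have b3 : H * L ≤ 144 * S := highPart_mul_le hκ hg
  have bF : fisher g G κ v = H * ‖X‖ ^ 2 := (highPart_mul_norm_sq hκ0).symm
  have hKe : ∀ (K : E →L[ℝ] E) (B : ℝ), ‖K‖ ≤ B → ⟪K p, p⟫ ≤ B * Λ ^ 2 := fun K B hB => by
    have hB0 := (norm_nonneg K).trans hB
    calc ⟪K p, p⟫ ≤ ‖K p‖ * ‖p‖ := real_inner_le_norm _ _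
      _ ≤ (B * Λ) * Λ := by
          gcongr
          exact (K.le_opNorm _).trans (by gcongr)
      _ = _ := by ring
  -- the regular part of the diffusion
  have t1 : 1 / 2 * Ψ v ^ 2 * (cc * ‖X‖ ^ 2) - 2 * L ^ 2 * (W * Λ ^ 2)
      ≤ ⟪convK cf g v X, testField g G κ Ψ v⟫ := by
    have h1 := inner_complete_square (inner_convK_comm hcf hgi v)
      (inner_convK_self_nonneg hcf hcf0 hgi hg v) X p (Ψ v) L
    have h2 : 1 / 2 * Ψ v ^ 2 * (cc * ‖X‖ ^ 2) ≤ 1 / 2 * Ψ v ^ 2 * ⟪convK cf g v X, X⟫ := by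
      gcongr; exact hco X
    have h3 : 2 * L ^ 2 * ⟪convK cf g v p, p⟫ ≤ 2 * L ^ 2 * (W * Λ ^ 2) := by
      gcongr; exact hKe _ _ hK
    exact le_trans (by linarith) h1
  -- the singular part of the diffusion, low values
  have t2 : -(2 * L ^ 2 * (2 * k₁ * singI * Λ ^ 2))
      ≤ ⟪convK cn (fun x => g x - highPart g κ x) v X, testField g G κ Ψ v⟫ := by
    have h1 := inner_complete_square (inner_convK_comm hc.toIsBddRadial hli v)
      (inner_convK_self_nonneg hc.toIsBddRadial hc.nonneg hli (fun x => (hl0 x).1) v) X p (Ψ v) L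
    have h2 := inner_convK_self_nonneg hc.toIsBddRadial hc.nonneg hli (fun x => (hl0 x).1) v X
    have h3 := hc.norm_convK_le hδ1 hk (h := fun x => g x - highPart g κ x) (κ := 2)
      (fun x => abs_le.2 ⟨by linarith [(hl0 x).1], by linarith [(hl0 x).2]⟩) v
    have h4 := mul_le_mul_of_nonneg_left (hKe _ _ h3) (by positivity : 0 ≤ 2 * L ^ 2)
    have h5 : 0 ≤ 1 / 2 * Ψ v ^ 2 * ⟪convK cn (fun x => g x - highPart g κ x) v X, X⟫ := by
      positivity
    exact le_trans (by linarith) h1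
  -- the singular part of the drift, low values
  have t3 : ⟪convD cn (fun x => min (g x) κ) v, testField g G κ Ψ v⟫
      ≤ Ψ v ^ 2 * (cc / 4 * ‖X‖ ^ 2 + (4 * (k₁ * singI)) ^ 2 / cc)
        + 2 * L * (4 * (k₁ * singI) * Λ) := by
    have h1 := hc.norm_convD_le hδ1 hk (h := fun x => min (g x) κ) (κ := 2)
      (fun x => abs_le.2 ⟨by have := le_min (hg x) hκ0.le; linarith,
        (min_le_right _ _).trans hκ2⟩) v
    set d := convD cn (fun x => min (g x) κ) v
    have h1' : ‖d‖ ≤ 4 * (k₁ * singI) := by linarith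
    rw [testField, inner_add_right, inner_smul_right, inner_smul_right]
    have h2 : ⟪d, X⟫ ≤ cc / 4 * ‖X‖ ^ 2 + (4 * (k₁ * singI)) ^ 2 / cc := by
      calc ⟪d, X⟫ ≤ ‖d‖ * ‖X‖ := real_inner_le_norm _ _
        _ ≤ 4 * (k₁ * singI) * ‖X‖ := by gcongr
        _ ≤ _ := by
            have e : cc / 4 * ‖X‖ ^ 2 + (4 * (k₁ * singI)) ^ 2 / cc - 4 * (k₁ * singI) * ‖X‖
              = (cc * ‖X‖ - 2 * (4 * (k₁ * singI))) ^ 2 / (4 * cc) := by field_simp; ring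
            have : 0 ≤ (cc * ‖X‖ - 2 * (4 * (k₁ * singI))) ^ 2 / (4 * cc) := by positivity
            linarith
    have h3 : 2 * L * Ψ v * ⟪d, p⟫ ≤ 2 * L * 1 * (4 * (k₁ * singI) * Λ) := by
      calc _ ≤ 2 * L * Ψ v * (4 * (k₁ * singI) * Λ) := by
            gcongr
            exact (real_inner_le_norm _ _).trans (by gcongr)
        _ ≤ _ := by gcongr
    have h4 := mul_le_mul_of_nonneg_left h2 (sq_nonneg (Ψ v))
    linarith
  have t4 : ⟪convD cf g v, (2 * L * Ψ v) • p⟫ ≤ 2 * L * (4 * N * W * Λ) := by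
    rw [inner_smul_right]
    calc _ ≤ 2 * L * Ψ v * (4 * N * W * Λ) := by
          gcongr
          exact (real_inner_le_norm _ _).trans (by gcongr)
      _ ≤ 2 * L * 1 * (4 * N * W * Λ) := by gcongr
      _ = _ := by ring
  have hsum : 1 / 4 * Ψ v ^ 2 * (cc * ‖X‖ ^ 2) - 2 * L ^ 2 * (W * Λ ^ 2)
      - 2 * L ^ 2 * (2 * k₁ * singI * Λ ^ 2) - Ψ v ^ 2 * ((4 * (k₁ * singI)) ^ 2 / cc)
      - 2 * L * (4 * (k₁ * singI) * Λ) - 2 * L * (4 * N * W * Λ)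
      ≤ ⟪convK cf g v X, testField g G κ Ψ v⟫
        + ⟪convK cn (fun x => g x - highPart g κ x) v X, testField g G κ Ψ v⟫
        - ⟪convD cn (fun x => min (g x) κ) v, testField g G κ Ψ v⟫
        - ⟪convD cf g v, (2 * L * Ψ v) • p⟫ := by linarith
  refine le_trans ?_ (mul_le_mul_of_nonneg_left hsum hH0)
  rw [bF]
  have e1 : (4 * (k₁ * singI)) ^ 2 / cc = 16 * (k₁ * singI) ^ 2 / cc := by ring
  have e3 : 2 * k₁ * singI * Λ ^ 2 = 2 * ((k₁ * singI) * Λ ^ 2) := by ring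
  rw [e1, e3]
  refine (regular_part_scalar hH0 hS0 (by positivity : 0 ≤ k₁ * singI)
    (by positivity : 0 ≤ 16 * (k₁ * singI) ^ 2 / cc) hΛ hN hW
    (pow_le_one₀ s0 s1 : Ψ v ^ 2 ≤ 1) b1 b2 b3 (cc * ‖X‖ ^ 2)).trans' ?_
  apply le_of_eq
  ring

/-- The lower bound for the truncated entropy production at a fixed time. -/
theorem exists_fluxDensity_lower (k₁ cc : ℝ) (hk : 0 ≤ k₁) (hcc : 0 < cc) :
    ∃ C : ℝ, 0 ≤ C ∧ ∀ (q : ℝ → ℝ) (δ κ N ρ ρ' Λ W : ℝ) (g : E → ℝ) (G : E → E) (Ψ : E → ℝ),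
      IsProfile q → q 1 ≤ k₁ → 0 < δ → δ ≤ 1 → 1 / δ ≤ N → 1 ≤ κ → κ ≤ 2 → 1 ≤ Λ → 1 ≤ W →
      IsCut Ψ ρ Λ → ρ + δ ≤ ρ' → ρ' ≤ 1 → (∀ x, 0 ≤ g x) → Integrable g → HasWeakGrad g G →
      (∀ᵐ v : E, ‖v‖ < 1 → Integrable (fun w => g w * cutW q (1 / δ) ‖v - w‖) ∧
        ∫ w, g w * cutW q (1 / δ) ‖v - w‖ ≤ W) →
      (∀ v e : E, ‖v‖ < 1 → cc * ‖e‖ ^ 2 ≤ ⟪convK (cutC q (1 / δ)) g v e, e⟫) →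
      IntegrableOn (highPow g κ (5 / 3)) (Metric.ball 0 ρ') →
      IntegrableOn (fisher g G κ) (Metric.ball 0 ρ') →
      ∀ V S Y : ℝ, V = ∫ x in Metric.ball 0 ρ', highPart g κ x →
      S = ∫ x in Metric.ball 0 ρ', highPow g κ (5 / 3) x →
      Y = ∫ x in Metric.ball 0 ρ', fisher g G κ x →
      cc / 4 * (∫ x, Ψ x ^ 2 * fisher g G κ x)
        - C * Λ ^ 2 * ((1 / δ) ^ 2 * W * (1 + V) * S + V * Y)
        ≤ ∫ v, fluxDensity (cutC q N) g G κ Ψ v := by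
  obtain ⟨D, hD1, hD⟩ := exists_norm_radD_cutC_bound
  have hI := singI_nonneg
  set C₁ := 1440 + 576 * (k₁ * singI) + 16 * (k₁ * singI) ^ 2 / cc + 1152 * (k₁ * singI) with hC₁
  have hC₁0 : 0 ≤ C₁ := by positivity
  refine ⟨C₁ + 30 * D + 2 * k₁ * (288 + 144 * singI), by positivity, ?_⟩
  intro q δ κ N ρ ρ' Λ W g G Ψ hq hqk hδ hδ1 hN hκ hκ2 hΛ hW hΨ hρ hρ' hg hgi hG hfar hco hS hY
    V S Y hVd hSd hYd
  have hδ' : 1 ≤ 1 / δ := by rw [le_div_iff₀ hδ]; linarith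
  have hδ0 : 0 < 1 / δ := by positivity
  have hN0 : 0 < N := hδ0.trans_le hN
  have hc := hq.isNear hqk hδ hδ1 hN
  have hcf := hq.isBddRadial_cutC hδ0
  have hcN := hq.isBddRadial_cutC hN0
  have hB : MeasurableSet (Metric.ball (0 : E) ρ') := Metric.isOpen_ball.measurableSet
  have hρρ : ρ ≤ ρ' := by linarith
  have hGm := hG.locIntGrad.aestronglyMeasurable
  have i1 := integrable_fluxDensity hcN hκ hg hgi hGm hΨ hρρ hS hY
  obtain ⟨i2, l2⟩ := far_drift_lower hD1 (hD q (1 / δ) hq hδ0) hq hδ' hκ hΛ (by linarith) hΨ hρρ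
    hρ' hg hgi hG hfar hS
  obtain ⟨i3, l3⟩ := interaction_lower hc hκ hg hgi.aestronglyMeasurable hGm hΨ hρ hδ1 hk hS hY
    hVd hSd hYd
  have i3' := i3.integral_prod_left
  have e3 := integral_prod _ i3
  have hTm : NullMeasurableSet {x | κ < g x} :=
    nullMeasurableSet_lt aemeasurable_const hgi.aestronglyMeasurable.aemeasurable
  have hfm : AEStronglyMeasurable (fisher g G κ) :=
    ((hGm.norm.pow 2).div₀ hgi.aestronglyMeasurable).indicator₀ hTm
  have i4 : Integrable fun x => Ψ x ^ 2 * fisher g G κ x := by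
    refine (hY.integrable_indicator hB).mono'
      ((hΨ.contDiff.continuous.aestronglyMeasurable.pow 2).mul hfm)
      (Eventually.of_forall fun x => ?_)
    have hf0 := fisher_nonneg (G := G) (κ := κ) hg x
    rw [Real.norm_of_nonneg (by positivity)]
    by_cases hx : x ∈ Metric.ball (0 : E) ρ'
    · rw [indicator_of_mem hx]
      exact mul_le_of_le_one_left hf0 (pow_le_one₀ (hΨ.nonneg x) (hΨ.le_one x))
    · rw [indicator_of_notMem hx, hΨ.zero x]
      · simp
      · simp only [Metric.mem_ball, dist_zero_right, not_lt] at hx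
        exact hρρ.trans hx
  have i5 := (hS.integrable_indicator hB).const_mul (C₁ * (Λ ^ 2 * (1 / δ) ^ 2 * W))
  have key : ∀ᵐ v : E, cc / 4 * (Ψ v ^ 2 * fisher g G κ v)
        - C₁ * (Λ ^ 2 * (1 / δ) ^ 2 * W) * (Metric.ball (0 : E) ρ').indicator
          (fun v => highPow g κ (5 / 3) v) v
      ≤ fluxDensity (cutC q N) g G κ Ψ v
        + ⟪(Ψ v ^ 2) • convD (cutC q (1 / δ)) g v, {x | κ < g x}.indicator G v⟫
        - ∫ w, interaction (fun r => cutC q N r - cutC q (1 / δ) r) g G κ Ψ (v, w) := by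
    filter_upwards [hfar] with v hv
    rw [fluxDensity_split hcf hcN hc hκ hg hgi hG]
    by_cases hvB : v ∈ Metric.ball (0 : E) ρ'
    · have hv1 : ‖v‖ < 1 := by
        simp only [Metric.mem_ball, dist_zero_right] at hvB
        linarith
      obtain ⟨b0, b1, -⟩ := norm_far_le hD1 (hD q (1 / δ) hq hδ0) hq hδ0 hgi hg (hv hv1).1
        (hv hv1).2
      rw [indicator_of_mem hvB]
      exact regular_part_lower hcf (fun r => hq.cutC_nonneg hδ0) hc hδ1 hk hκ hκ2 hΛ hδ' hW hΨ hg
        hgi hcc (fun e => hco v e hv1) b0 b1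
    · have hv1 : ρ ≤ ‖v‖ := by
        simp only [Metric.mem_ball, dist_zero_right, not_lt] at hvB
        exact hρρ.trans hvB
      rw [indicator_of_notMem hvB, testField_eq_zero hΨ hv1, hΨ.zero v hv1]
      simp
  -- The pointwise estimate concerns the flux plus the far drift minus the interaction. Those two
  -- extra integrals are controlled by `l2` and `l3`, leaving a bound on the flux alone.
  have hle := integral_mono_ae ((i4.const_mul (cc / 4)).sub i5) ((i1.add i2).sub i3') key
  rw [integral_sub' (i4.const_mul (cc / 4)) i5, integral_sub' (i1.add i2) i3',
    integral_add' i1 i2, integral_const_mul, integral_const_mul, integral_indicator hB, ← hSd,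
    ← e3] at hle
  rw [← hSd] at l2
  have hV0 : 0 ≤ V := by rw [hVd]; exact integral_nonneg fun x => highPart_nonneg hg x
  have hS0 : 0 ≤ S := by rw [hSd]; exact integral_nonneg fun x => highPow_nonneg hg _ x
  have hY0 : 0 ≤ Y := by rw [hYd]; exact integral_nonneg fun x => fisher_nonneg hg x
  set P := (1 / δ) ^ 2 * W with hP
  have hP1 : 1 ≤ P := one_le_mul_of_one_le_of_one_le (one_le_pow₀ hδ') hW
  have a1 : C₁ * (Λ ^ 2 * (1 / δ) ^ 2 * W) * S ≤ C₁ * (Λ ^ 2 * (P * (1 + V) * S)) := by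
    have : P * S ≤ P * (1 + V) * S := by
      have : 0 ≤ P * V * S := by positivity
      linarith
    calc _ = C₁ * (Λ ^ 2 * (P * S)) := by rw [hP]; ring
      _ ≤ _ := by gcongr
  have a2 : 30 * D * (1 / δ) ^ 2 * Λ * W * S ≤ 30 * D * (Λ ^ 2 * (P * (1 + V) * S)) := by
    have : P * S ≤ P * (1 + V) * S := by
      have : 0 ≤ P * V * S := by positivity
      linarith
    calc _ = 30 * D * (Λ * (P * S)) := by rw [hP]; ring
      _ ≤ _ := by
        gcongr
        nlinarith
  have a3 : 2 * k₁ * Λ ^ 2 * (144 * S * (2 * V + singI) + V * Y)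
      ≤ 2 * k₁ * (288 + 144 * singI) * (Λ ^ 2 * (P * (1 + V) * S + V * Y)) := by
    have h1 : 144 * S * (2 * V + singI) ≤ (288 + 144 * singI) * (1 * (1 + V) * S) := by
      have : 0 ≤ S * V * singI := by positivity
      have : 0 ≤ S * V := by positivity
      nlinarith
    have h2 : V * Y ≤ (288 + 144 * singI) * (V * Y) :=
      le_mul_of_one_le_left (by positivity) (by linarith)
    calc _ = 2 * k₁ * (Λ ^ 2 * (144 * S * (2 * V + singI) + V * Y)) := by ring
      _ ≤ 2 * k₁ * (Λ ^ 2 * ((288 + 144 * singI) * (1 * (1 + V) * S)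
          + (288 + 144 * singI) * (V * Y))) := by gcongr
      _ ≤ 2 * k₁ * (Λ ^ 2 * ((288 + 144 * singI) * (P * (1 + V) * S)
          + (288 + 144 * singI) * (V * Y))) := by gcongr
      _ = _ := by ring
  have a4 : 0 ≤ (C₁ + 30 * D) * (Λ ^ 2 * (V * Y)) := by positivity
  linarith

end Slice

/-! ### Coercivity of the diffusion matrix -/

/-- In an orthonormal basis starting with e, the set lies in a box of half-sides R, σ, σ centred at
v, since |v-w|² - ⟨v-w,e⟩² is the squared distance from w to the line through v. -/
lemma volume_tube_le {e v : E} (he : ‖e‖ = 1) {R σ : ℝ} (hR : 0 ≤ R) (hσ : 0 ≤ σ) :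
    volume {w : E | ‖v - w‖ ≤ R ∧ ‖v - w‖ ^ 2 - ⟪v - w, e⟫ ^ 2 < σ ^ 2}
      ≤ ENNReal.ofReal (8 * R * σ ^ 2) := by
  have ho : Orthonormal ℝ (({0} : Set (Fin 3)).domRestrict fun _ => e) :=
    ⟨fun i => he, fun i j hij => (hij (Subsingleton.elim i j)).elim⟩
  obtain ⟨b, hb⟩ := ho.exists_orthonormalBasis_extension_of_card_eq (𝕜 := ℝ) (E := E) (by simp)
  have hb0 : b 0 = e := hb 0 rfl
  have hmp : MeasurePreserving (fun w : E => (b.repr (v - w)).ofLp) :=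
    (PiLp.volume_preserving_ofLp (Fin 3)).comp
      (b.measurePreserving_repr.comp (Measure.measurePreserving_sub_left volume v))
  set lo : Fin 3 → ℝ := ![-R, -σ, -σ]
  set hi : Fin 3 → ℝ := ![R, σ, σ]
  have hsub : {w : E | ‖v - w‖ ≤ R ∧ ‖v - w‖ ^ 2 - ⟪v - w, e⟫ ^ 2 < σ ^ 2}
      ⊆ (fun w : E => (b.repr (v - w)).ofLp) ⁻¹' Icc lo hi := by
    rintro w ⟨h1, h2⟩
    set y := b.repr (v - w) with hy
    have hn : ‖v - w‖ ^ 2 = y 0 ^ 2 + y 1 ^ 2 + y 2 ^ 2 := by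
      rw [← b.repr.norm_map, EuclideanSpace.norm_sq_eq, Fin.sum_univ_three]
      simp [hy]
    have h0 : ⟪v - w, e⟫ = y 0 := by
      rw [hy, b.repr_apply_apply, hb0, real_inner_comm]
    have hR2 : ‖v - w‖ ^ 2 ≤ R ^ 2 := by gcongr
    rw [h0] at h2
    have a0 : |y 0| ≤ R := abs_le_of_sq_le_sq (by nlinarith) hR
    have a1 : |y 1| ≤ σ := abs_le_of_sq_le_sq (by nlinarith) hσ
    have a2 : |y 2| ≤ σ := abs_le_of_sq_le_sq (by nlinarith) hσ
    rw [abs_le] at a0 a1 a2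
    refine ⟨fun i => ?_, fun i => ?_⟩ <;> fin_cases i
    exacts [a0.1, a1.1, a2.1, a0.2, a1.2, a2.2]
  refine (measure_mono hsub).trans ?_
  rw [hmp.measure_preimage measurableSet_Icc.nullMeasurableSet, Real.volume_Icc_pi,
    Fin.prod_univ_three]
  simp only [lo, hi, Matrix.cons_val_zero, Matrix.cons_val_one, Matrix.cons_val]
  rw [← ENNReal.ofReal_mul (by linarith), ← ENNReal.ofReal_mul (by nlinarith)]
  apply ENNReal.ofReal_le_ofReal
  apply le_of_eq
  ring

lemma integrable_exp_neg_norm_sq : Integrable fun v : E => Real.exp (-‖v‖ ^ 2) := by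
  have h := (GaussianFourier.integrable_cexp_neg_mul_sq_norm_add (V := E) (b := 1) (by simp) 0 0).norm
  refine h.congr (Eventually.of_forall fun v => ?_)
  simp only [Complex.norm_exp]
  norm_cast
  simp

/-- The positive part of the entropy is controlled by the entropy and the energy. -/
lemma entropy_posPart_le {x a : ℝ} (hx : 0 ≤ x) (ha : 0 ≤ a) :
    max (x * Real.log x) 0 ≤ x * Real.log x + x * a + Real.exp (-a) := by
  have h : 0 ≤ x * Real.log x + x * a + Real.exp (-a) := by
    rcases hx.eq_or_lt with h0 | h0
    · rw [← h0]; simp [Real.exp_nonneg]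
    · have h1 := Real.add_one_le_exp (-a - Real.log x)
      have h2 : Real.exp (-a) = x * Real.exp (-a - Real.log x) := by
        rw [Real.exp_sub, Real.exp_log h0]; field_simp
      rw [h2]
      nlinarith
  refine max_le ?_ h
  have h1 := mul_nonneg hx ha
  linarith [Real.exp_nonneg (-a)]

/-- The mass is not concentrated near lines. -/
lemma exists_coercive_set (m₀ E₀ H₀ ρ₀ : ℝ) (hm : 0 < m₀) (hρ : 0 ≤ ρ₀) :
    ∃ R σ : ℝ, 1 ≤ R ∧ 0 < σ ∧ σ ≤ 1 ∧ ∀ f : E → ℝ, (∀ x, 0 ≤ f x) → Integrable f →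
      m₀ ≤ ∫ x, f x → Integrable (fun x => f x * ‖x‖ ^ 2) → ∫ x, f x * ‖x‖ ^ 2 ≤ E₀ →
      Integrable (fun x => f x * Real.log (f x)) → ∫ x, f x * Real.log (f x) ≤ H₀ →
      ∀ v e : E, ‖v‖ ≤ ρ₀ → ‖e‖ = 1 →
        m₀ / 2 ≤ ∫ w in {w | ‖v - w‖ ≤ R ∧ σ ^ 2 ≤ ‖v - w‖ ^ 2 - ⟪v - w, e⟫ ^ 2}, f w := by
  set Cg := ∫ v : E, Real.exp (-‖v‖ ^ 2) with hCg
  have hCg0 : 0 ≤ Cg := integral_nonneg fun _ => Real.exp_nonneg _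
  set Hp := |H₀| + |E₀| + Cg with hHp
  have hHp0 : 0 ≤ Hp := by positivity
  -- Three losses of at most m₀/8 each are arranged. The energy makes the mass outside the ball of
  -- radius r small; the entropy makes the mass where f > e^l small; and σ is chosen so that e^l
  -- times the volume of the tube is small. At least 5m₀/8 is left.
  set r := 1 + 8 * |E₀| / m₀ with hr
  have hr1 : 1 ≤ r := by rw [hr]; have : 0 ≤ 8 * |E₀| / m₀ := by positivity
                         linarith
  set l := 8 * Hp / m₀ + 1 with hl
  have hl0 : 0 < l := by positivity
  set R := ρ₀ + r with hR
  have hR1 : 1 ≤ R := by linarith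
  set K := Real.exp l with hK
  have hK0 : 0 < K := Real.exp_pos _
  set σ := min 1 (m₀ / (64 * R * K)) with hσd
  have hσ0 : 0 < σ := by positivity
  have hσ1 : σ ≤ 1 := min_le_left _ _
  have hσK : K * (8 * R * σ ^ 2) ≤ m₀ / 8 := by
    have h1 : σ ^ 2 ≤ σ := by nlinarith
    have h2 : σ ≤ m₀ / (64 * R * K) := min_le_right _ _
    calc _ ≤ K * (8 * R * (m₀ / (64 * R * K))) := by gcongr; linarith
      _ = m₀ / 8 := by field_simp; norm_num
  refine ⟨R, σ, hR1, hσ0, hσ1, ?_⟩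
  intro f hf hfi hmass hei hen hhi hen' v e hv he
  set A := {w : E | ‖v - w‖ ≤ R ∧ σ ^ 2 ≤ ‖v - w‖ ^ 2 - ⟪v - w, e⟫ ^ 2} with hA
  set T := {w : E | ‖v - w‖ ≤ R ∧ ‖v - w‖ ^ 2 - ⟪v - w, e⟫ ^ 2 < σ ^ 2} with hT
  have hc1 : Measurable fun w : E => ‖v - w‖ := by fun_prop
  have hc2 : Measurable fun w : E => ‖v - w‖ ^ 2 - ⟪v - w, e⟫ ^ 2 :=
    Continuous.measurable (by fun_prop)
  have hAm : MeasurableSet A :=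
    (measurableSet_le hc1 measurable_const).inter (measurableSet_le measurable_const hc2)
  have hTm : MeasurableSet T :=
    (measurableSet_le hc1 measurable_const).inter (measurableSet_lt hc2 measurable_const)
  have hTv := volume_tube_le (v := v) he (by linarith : 0 ≤ R) hσ0.le
  have hTfin : volume T ≠ ⊤ := (hTv.trans_lt ENNReal.ofReal_lt_top).ne
  set P := fun w : E => f w * Real.log (f w) + f w * ‖w‖ ^ 2 + Real.exp (-‖w‖ ^ 2) with hPd
  have hPi : Integrable P := (hhi.add hei).add integrable_exp_neg_norm_sq
  have hPle : ∫ w, P w ≤ Hp := by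
    have e1 : ∫ w, P w = (∫ w, f w * Real.log (f w)) + (∫ w, f w * ‖w‖ ^ 2) + Cg := by
      have i1 : Integrable fun w => f w * Real.log (f w) + f w * ‖w‖ ^ 2 := hhi.add hei
      rw [hPd, integral_add i1 integrable_exp_neg_norm_sq, integral_add hhi hei]
    rw [e1, hHp]
    linarith [le_abs_self H₀, le_abs_self E₀]
  have hP : ∀ w, max (f w * Real.log (f w)) 0 ≤ P w := fun w => by
    have := entropy_posPart_le (hf w) (sq_nonneg ‖w‖)
    exact this
  have hP0 : ∀ w, 0 ≤ P w := fun w => (le_max_right _ _).trans (hP w)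
  have key : ∀ w, f w ≤ A.indicator f w + (r ^ 2)⁻¹ * (f w * ‖w‖ ^ 2)
      + (T.indicator (fun _ => K) w + l⁻¹ * P w) := fun w => by
    have n1 : 0 ≤ (r ^ 2)⁻¹ * (f w * ‖w‖ ^ 2) := by have := hf w; positivity
    have n2 : 0 ≤ l⁻¹ * P w := by have := hP0 w; positivity
    have n3 : 0 ≤ T.indicator (fun _ => K) w := indicator_nonneg (fun _ _ => hK0.le) w
    have n4 : 0 ≤ A.indicator f w := indicator_nonneg (fun _ _ => hf _) w
    by_cases hwR : ‖v - w‖ ≤ R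
    · by_cases hwσ : σ ^ 2 ≤ ‖v - w‖ ^ 2 - ⟪v - w, e⟫ ^ 2
      · rw [indicator_of_mem (show w ∈ A from ⟨hwR, hwσ⟩)]
        linarith
      · rw [indicator_of_mem (show w ∈ T from ⟨hwR, not_le.1 hwσ⟩)]
        rcases le_or_gt (f w) K with h | h
        · linarith
        · have h1 : l ≤ Real.log (f w) := by
            rw [← Real.log_exp l]
            exact Real.log_le_log hK0 h.le
          have h2 : f w * l ≤ P w := le_trans (by gcongr; exact hf w)
            ((le_max_left _ _).trans (hP w))
          have h3 : f w ≤ l⁻¹ * P w := by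
            rw [inv_mul_eq_div, le_div_iff₀ hl0]
            exact h2
          linarith
    · have h1 : r ≤ ‖w‖ := by
        have := norm_sub_le v w
        push Not at hwR
        linarith
      have h2 : f w ≤ (r ^ 2)⁻¹ * (f w * ‖w‖ ^ 2) := by
        rw [inv_mul_eq_div, le_div_iff₀ (by positivity)]
        have := hf w
        gcongr
      linarith
  have i1 := hfi.indicator hAm
  have i2 := hei.const_mul (r ^ 2)⁻¹
  have i3 : Integrable (T.indicator fun _ => K) := (integrable_indicator_iff hTm).2
    (integrableOn_const hTfin)
  have i4 := hPi.const_mul l⁻¹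
  have j1 : Integrable fun w => A.indicator f w + (r ^ 2)⁻¹ * (f w * ‖w‖ ^ 2) := i1.add i2
  have j2 : Integrable fun w => T.indicator (fun _ => K) w + l⁻¹ * P w := i3.add i4
  have hle := integral_mono hfi (j1.add j2) key
  rw [integral_add' j1 j2, integral_add i1 i2, integral_add i3 i4, integral_const_mul,
    integral_const_mul, integral_indicator hAm, integral_indicator hTm, setIntegral_const,
    smul_eq_mul] at hle
  have hvT : volume.real T ≤ 8 * R * σ ^ 2 := by
    refine ENNReal.toReal_le_of_le_ofReal (by positivity) hTv
  have q1 : volume.real T * K ≤ m₀ / 8 := by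
    calc _ ≤ (8 * R * σ ^ 2) * K := by gcongr
      _ ≤ _ := by linarith
  have q2 : (r ^ 2)⁻¹ * ∫ x, f x * ‖x‖ ^ 2 ≤ m₀ / 8 := by
    rw [inv_mul_eq_div, div_le_iff₀ (by positivity)]
    have h1 : m₀ * r = m₀ + 8 * |E₀| := by rw [hr]; field_simp
    have h2 : r ≤ r ^ 2 := by nlinarith
    have h3 := mul_le_mul_of_nonneg_left h2 hm.le
    have h4 := le_abs_self E₀
    nlinarith
  have q3 : l⁻¹ * ∫ w, P w ≤ m₀ / 8 := by
    rw [inv_mul_eq_div, div_le_iff₀ hl0]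
    have h1 : m₀ / 8 * l = Hp + m₀ / 8 := by rw [hl]; field_simp
    linarith
  linarith

lemma integral_comp_affine {F : Type*} [NormedAddCommGroup F] [NormedSpace ℝ F] (φ : E → F)
    {ε : ℝ} (hε : 0 < ε) (v₀ : E) : ∫ w, φ (v₀ + ε • w) = (ε ^ 3)⁻¹ • ∫ w, φ w := by
  rw [Measure.integral_comp_smul volume (fun w => φ (v₀ + w)) ε,
    integral_add_left_eq_self φ v₀]
  simp [abs_of_pos hε]

lemma integrable_comp_affine {F : Type*} [NormedAddCommGroup F] {φ : E → F}
    {ε : ℝ} (hε : 0 < ε) (v₀ : E) (h : Integrable φ) : Integrable fun w => φ (v₀ + ε • w) :=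
  (h.comp_add_left v₀).comp_smul hε.ne'

/-- The diffusion matrix of the regularized kernel is uniformly elliptic. -/
lemma coercive_of_mass {k : ℝ → ℝ} (hk : IsCollisionKernel k) {m R σ δ ε : ℝ} (hR : 1 ≤ R)
    (hσ : 0 < σ) (hε : 0 < ε) (hε1 : ε ≤ 1) (hδ : 0 < δ) (hδσ : δ ≤ σ) {f : E → ℝ}
    (hf : ∀ x, 0 ≤ f x) (hfi : Integrable f) {v₀ v : E}
    (hm : ∀ e : E, ‖e‖ = 1 → m ≤ ∫ w in {w | ‖(v₀ + ε • v) - w‖ ≤ R ∧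
      σ ^ 2 ≤ ‖(v₀ + ε • v) - w‖ ^ 2 - ⟪(v₀ + ε • v) - w, e⟫ ^ 2}, f w) (e : E) :
    (k 1 / R ^ 3 * σ ^ 2 * m) * ‖e‖ ^ 2
      ≤ ⟪convK (cutC (fun r => k (ε * r)) (1 / δ)) (fun w => ε ^ 2 * f (v₀ + ε • w)) v e, e⟫ := by
  have hq := hk.isProfile_scaled hε
  have hδ0 : 0 < 1 / δ := by positivity
  have hc := hq.isBddRadial_cutC hδ0
  set g := fun w => ε ^ 2 * f (v₀ + ε • w) with hg
  have hgi : Integrable g := (integrable_comp_affine hε v₀ hfi).const_mul _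
  have hg0 : ∀ x, 0 ≤ g x := fun x => mul_nonneg (sq_nonneg _) (hf _)
  have hk1 := hk.pos 1 one_pos
  have unit : ∀ e : E, ‖e‖ = 1 → k 1 / R ^ 3 * σ ^ 2 * m
      ≤ ⟪convK (cutC (fun r => k (ε * r)) (1 / δ)) g v e, e⟫ := fun e he => by
    set z₀ := v₀ + ε • v with hz₀
    set A := {w : E | ‖z₀ - w‖ ≤ R ∧ σ ^ 2 ≤ ‖z₀ - w‖ ^ 2 - ⟪z₀ - w, e⟫ ^ 2} with hA
    have hc1 : Measurable fun w : E => ‖z₀ - w‖ := by fun_prop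
    have hc2 : Measurable fun w : E => ‖z₀ - w‖ ^ 2 - ⟪z₀ - w, e⟫ ^ 2 :=
      Continuous.measurable (by fun_prop)
    have hAm : MeasurableSet A :=
      (measurableSet_le hc1 measurable_const).inter (measurableSet_le measurable_const hc2)
    have h1 : ∫ w, A.indicator f (v₀ + ε • w) = (ε ^ 3)⁻¹ * ∫ w in A, f w := by
      rw [integral_comp_affine _ hε, integral_indicator hAm, smul_eq_mul]
    have h2 := integrable_comp_affine hε v₀ (hfi.indicator hAm)
    rw [hc.convK_apply hgi, real_inner_comm, ← integral_inner (hc.integrable_radK_apply hgi v e)]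
    -- The powers of ε balance: ε² comes with the scaled density and one ε from k(εr)/r = ε ·
    -- k(εr)/(εr), against ε⁻³ from the change of variables. The ellipticity constant is independent
    -- of ε.
    have h3 : ∀ w, ε ^ 3 * (k 1 / R ^ 3 * σ ^ 2) * A.indicator f (v₀ + ε • w)
        ≤ ⟪e, g w • radK (cutC (fun r => k (ε * r)) (1 / δ)) (v - w) e⟫ := fun w => by
      simp only [radK, smul_apply, inner_smul_right]
      rw [real_inner_comm]
      by_cases hw : v₀ + ε • w ∈ A
      · rw [indicator_of_mem hw]
        obtain ⟨a1, a2⟩ := hw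
        have hz : z₀ - (v₀ + ε • w) = ε • (v - w) := by rw [hz₀, smul_sub]; abel
        rw [hz, norm_smul, Real.norm_of_nonneg hε.le, inner_smul_left, conj_trivial] at a2
        rw [hz, norm_smul, Real.norm_of_nonneg hε.le] at a1
        rw [inner_proj_self, he]
        set r := ‖v - w‖ with hr
        set s := ⟪v - w, e⟫
        have hεr : 0 < ε * r := by
          by_contra hn
          have h5 : ε * r = 0 := le_antisymm (not_lt.1 hn) (by positivity)
          rw [h5] at a2
          nlinarith [sq_nonneg (ε * s), pow_pos hσ 2]
        have hr0 : 0 < r := by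
          by_contra hn
          nlinarith [norm_nonneg (v - w)]
        have hσr : σ ≤ ε * r := by
          by_contra hn
          push Not at hn
          nlinarith [sq_nonneg (ε * s)]
        -- In unscaled variables the points of A are at distance at least σ, so here r ≥ σ/ε ≥ σ ≥
        -- δ, and removing the near part of the kernel loses nothing.
        have hcut : cutoff (1 / δ * r) = 1 := cutoff_eq_one (by
          rw [one_div_mul_eq_div, le_div_iff₀ hδ]
          nlinarith)
        -- Below distance 1 the monotonicity of k(s)/s is used, above it that of k, together with s
        -- ≤ R. Only the value k(1) enters.
        have hkr : k 1 / R ≤ k (ε * r) / (ε * r) := by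
          rcases le_total (ε * r) 1 with h | h
          · have h6 := hk.anti (show ε * r ∈ Ioi 0 from hεr) (mem_Ioi.2 (one_pos : (0 : ℝ) < 1)) h
            simp only [div_one] at h6
            exact (div_le_self hk1.le hR).trans h6
          · have h6 := hk.mono (mem_Ioi.2 (one_pos : (0 : ℝ) < 1)) (show ε * r ∈ Ioi 0 from hεr) h
            exact div_le_div₀ (hk1.le.trans h6) h6 hεr a1
        have hfr : σ ^ 2 / R ^ 2 ≤ 1 ^ 2 - (r ^ 2)⁻¹ * s ^ 2 := by
          have e1 : 1 ^ 2 - (r ^ 2)⁻¹ * s ^ 2 = ((ε * r) ^ 2 - (ε * s) ^ 2) / (ε * r) ^ 2 := by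
            field_simp
          rw [e1]
          exact div_le_div₀ ((sq_nonneg σ).trans a2) a2 (by positivity) (by gcongr)
        have hf0 := hf (v₀ + ε • w)
        simp only [hg, cutC, hcut, one_mul]
        calc _ = ε ^ 3 * f (v₀ + ε • w) * ((k 1 / R) * (σ ^ 2 / R ^ 2)) := by ring
          _ ≤ ε ^ 3 * f (v₀ + ε • w) * ((k (ε * r) / (ε * r)) * (1 ^ 2 - (r ^ 2)⁻¹ * s ^ 2)) := by
              have : 0 ≤ k (ε * r) / (ε * r) := le_trans (by positivity) hkr
              gcongr
          _ = _ := by field_simp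
      · rw [indicator_of_notMem hw, mul_zero]
        exact mul_nonneg (hg0 w) (mul_nonneg (hq.cutC_nonneg hδ0) (inner_proj_nonneg _ _))
    have h4 := integral_mono (h2.const_mul (ε ^ 3 * (k 1 / R ^ 3 * σ ^ 2)))
      ((hc.integrable_radK_apply hgi v e).const_inner e) h3
    rw [integral_const_mul, h1] at h4
    refine le_trans ?_ h4
    calc _ ≤ k 1 / R ^ 3 * σ ^ 2 * ∫ w in A, f w := by
          gcongr
          exact hm e he
      _ = _ := by field_simp
  rcases eq_or_ne e 0 with rfl | he
  · simp
  · have he0 : 0 < ‖e‖ := norm_pos_iff.2 he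
    have h := unit (‖e‖⁻¹ • e) (by rw [norm_smul, norm_inv, norm_norm, inv_mul_cancel₀ he0.ne'])
    rw [map_smul, inner_smul_left, inner_smul_right, conj_trivial, ← mul_assoc] at h
    calc _ ≤ (‖e‖⁻¹ * ‖e‖⁻¹ * ⟪convK (cutC (fun r => k (ε * r)) (1 / δ)) g v e, e⟫) * ‖e‖ ^ 2 := by
          gcongr
      _ = _ := by field_simp

/-! ### Weak gradients in velocity and their time slices -/

lemma volume_restrict_slab (I : Set ℝ) :
    (volume : Measure (ℝ × E)).restrict (I ×ˢ univ) = (volume.restrict I).prod volume := by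
  rw [Measure.volume_eq_prod, ← Measure.prod_restrict, Measure.restrict_univ]

lemma ae_restrict_of_locally {I : Set ℝ} (hI : IsOpen I) {P : ℝ → Prop}
    (h : ∀ c d, Icc c d ⊆ I → ∀ᵐ t ∂volume.restrict (Icc c d), P t) :
    ∀ᵐ t ∂volume.restrict I, P t := by
  rw [ae_restrict_iff' hI.measurableSet, ae_iff]
  refine measure_null_of_locally_null _ fun x hx => ?_
  simp only [mem_ofPred_eq, Classical.not_imp] at hx
  obtain ⟨c, d, -, hn, hs⟩ := exists_Icc_mem_subset_of_mem_nhds (hI.mem_nhds hx.1)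
  refine ⟨{t | ¬(t ∈ Icc c d → P t)}, ?_, ?_⟩
  · filter_upwards [mem_nhdsWithin_of_mem_nhds hn, self_mem_nhdsWithin] with t h1 h2
    simp only [Classical.not_imp] at h2 ⊢
    exact ⟨h1, h2.2⟩
  · rw [← ae_iff, ← ae_restrict_iff' measurableSet_Icc]
    exact h c d hs

lemma locallyIntegrableOn_slab_iff {F : Type*} [NormedAddCommGroup F] {I : Set ℝ} (hI : IsOpen I)
    {u : ℝ × E → F} : LocallyIntegrableOn u (I ×ˢ univ) ↔ ∀ (c d R : ℝ), Icc c d ⊆ I →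
      IntegrableOn u (Icc c d ×ˢ Metric.closedBall (0 : E) R) := by
  constructor
  · intro h c d R hcd
    exact h.integrableOn_compact_subset (prod_mono hcd (subset_univ _))
      (isCompact_Icc.prod (isCompact_closedBall _ _))
  · rintro h ⟨t, v⟩ ⟨ht, -⟩
    obtain ⟨c, d, -, hn, hs⟩ := exists_Icc_mem_subset_of_mem_nhds (hI.mem_nhds ht)
    refine ⟨Icc c d ×ˢ Metric.closedBall (0 : E) (‖v‖ + 1), mem_nhdsWithin_of_mem_nhds ?_,
      h c d _ hs⟩
    refine prod_mem_nhds hn ?_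
    refine mem_of_superset (Metric.isOpen_ball.mem_nhds (?_ : v ∈ Metric.ball (0 : E) (‖v‖ + 1)))
      Metric.ball_subset_closedBall
    simp

lemma exists_Icc_of_isCompact {I K : Set ℝ} (hI : I.OrdConnected) (hK : IsCompact K)
    (hKI : K ⊆ I) : ∃ c d, Icc c d ⊆ I ∧ K ⊆ Icc c d := by
  rcases K.eq_empty_or_nonempty with rfl | hne
  · exact ⟨1, 0, by simp, by simp⟩
  · refine ⟨sInf K, sSup K, hI.out (hKI (hK.sInf_mem hne)) (hKI (hK.sSup_mem hne)), fun x hx => ?_⟩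
    exact ⟨csInf_le hK.bddBelow hx, le_csSup hK.bddAbove hx⟩

lemma ae_locallyIntegrable_slice {F : Type*} [NormedAddCommGroup F] {I : Set ℝ} (hI : IsOpen I)
    {u : ℝ → E → F} (hu : LocallyIntegrableOn (fun p : ℝ × E => u p.1 p.2) (I ×ˢ univ)) :
    ∀ᵐ t ∂volume.restrict I, LocallyIntegrable (u t) := by
  refine ae_restrict_of_locally hI fun c d hcd => ?_
  have h : ∀ n : ℕ, ∀ᵐ t ∂volume.restrict (Icc c d),
      IntegrableOn (u t) (Metric.closedBall (0 : E) n) := fun n => by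
    have h1 := (locallyIntegrableOn_slab_iff hI).1 hu c d n hcd
    rw [IntegrableOn, Measure.volume_eq_prod, ← Measure.prod_restrict] at h1
    exact h1.prod_right_ae
  filter_upwards [ae_all_iff.2 h] with t ht
  intro x
  obtain ⟨n, hn⟩ := exists_nat_gt ‖x‖
  refine ⟨Metric.closedBall 0 n, mem_of_superset (Metric.isOpen_ball.mem_nhds (?_ :
    x ∈ Metric.ball (0 : E) n)) Metric.ball_subset_closedBall, ht n⟩
  simpa using hn

/-- Testing with products θ(t)ψ(v) and Fubini reduce the identity to the fundamental lemma of the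
calculus of variations in time. The exceptional null set of times depends on ψ. -/
lemma HasWeakGradV.ae_integral_eq {I : Set ℝ} (hI : IsOpen I) (hIo : I.OrdConnected)
    {u : ℝ → E → ℝ} {G : ℝ → E → E} (h : HasWeakGradV I u G) {ψ : E → ℝ} (hψ : ContDiff ℝ ∞ ψ)
    (hc : HasCompactSupport ψ) : ∀ᵐ t ∂volume.restrict I,
      ∫ v, u t v • gradient ψ v = -∫ v, ψ v • G t v := by
  obtain ⟨hu, hG, ht⟩ := h
  obtain ⟨R, hR⟩ := hc.isCompact.isBounded.subset_closedBall (0 : E)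
  have hψ1 : Continuous (gradient ψ) := continuous_gradient (hψ.of_le (by simp))
  have hz : ∀ v ∉ Metric.closedBall (0 : E) R, ψ v = 0 ∧ gradient ψ v = 0 := fun v hv => by
    have h1 : v ∉ tsupport ψ := fun h => hv (hR h)
    refine ⟨image_eq_zero_of_notMem_tsupport h1, ?_⟩
    rw [gradient, fderiv_of_notMem_tsupport ℝ h1, map_zero]
  have i1 : ∀ c d, Icc c d ⊆ I →
      IntegrableOn (fun p : ℝ × E => u p.1 p.2 • gradient ψ p.2) (Icc c d ×ˢ univ) :=
    fun c d hcd => by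
      have h1 := (locallyIntegrableOn_slab_iff hI).1 hu c d R hcd
      have hcK : ContinuousOn (fun p : ℝ × E => gradient ψ p.2)
        (Icc c d ×ˢ Metric.closedBall (0 : E) R) := by fun_prop
      refine (h1.smul_continuousOn hcK (isCompact_Icc.prod
        (isCompact_closedBall _ _))).of_forall_sdiff_eq_zero
        (measurableSet_Icc.prod MeasurableSet.univ) fun p hp => ?_
      rw [(hz p.2 fun hv => hp.2 ⟨hp.1.1, hv⟩).2, smul_zero]
  have i2 : ∀ c d, Icc c d ⊆ I →
      IntegrableOn (fun p : ℝ × E => ψ p.2 • G p.1 p.2) (Icc c d ×ˢ univ) :=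
    fun c d hcd => by
      have h1 := (locallyIntegrableOn_slab_iff hI).1 hG c d R hcd
      have hcK : ContinuousOn (fun p : ℝ × E => ψ p.2)
        (Icc c d ×ˢ Metric.closedBall (0 : E) R) := hψ.continuous.comp_continuousOn (by fun_prop)
      refine (h1.continuousOn_smul hcK (isCompact_Icc.prod
        (isCompact_closedBall _ _))).of_forall_sdiff_eq_zero
        (measurableSet_Icc.prod MeasurableSet.univ) fun p hp => ?_
      rw [(hz p.2 fun hv => hp.2 ⟨hp.1.1, hv⟩).1, zero_smul]
  have j1 : ∀ c d, Icc c d ⊆ I → IntegrableOn (fun t => ∫ v, u t v • gradient ψ v) (Icc c d) :=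
    fun c d hcd => by
      have h1 := i1 c d hcd
      rw [IntegrableOn, volume_restrict_slab] at h1
      exact h1.integral_prod_left
  have j2 : ∀ c d, Icc c d ⊆ I → IntegrableOn (fun t => ∫ v, ψ v • G t v) (Icc c d) :=
    fun c d hcd => by
      have h1 := i2 c d hcd
      rw [IntegrableOn, volume_restrict_slab] at h1
      exact h1.integral_prod_left
  have hloc : LocallyIntegrableOn
      (fun t => (∫ v, u t v • gradient ψ v) + ∫ v, ψ v • G t v) I := fun t htI => by
    obtain ⟨c, d, -, hn, hs⟩ := exists_Icc_mem_subset_of_mem_nhds (hI.mem_nhds htI)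
    exact ⟨Icc c d, mem_nhdsWithin_of_mem_nhds hn, (j1 c d hs).add (j2 c d hs)⟩
  have hzero := hI.ae_eq_zero_of_integral_contDiff_smul_eq_zero (μ := volume) hloc ?_
  · rw [ae_restrict_iff' hI.measurableSet]
    filter_upwards [hzero] with t ht htI
    exact eq_neg_of_add_eq_zero_left (ht htI)
  intro θ hθ hθc hθI
  obtain ⟨c, d, hcd, hK⟩ := exists_Icc_of_isCompact hIo hθc hθI
  have hθz : ∀ t ∉ Icc c d, θ t = 0 := fun t ht => image_eq_zero_of_notMem_tsupport fun h => ht (hK h)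
  have hT := ht (fun p => θ p.1 * ψ p.2) ((hθ.comp contDiff_fst).mul (hψ.comp contDiff_snd)) ?_ ?_
  · have hgr : ∀ p : ℝ × E, gradient (fun v => θ p.1 * ψ v) p.2 = θ p.1 • gradient ψ p.2 :=
      fun p => by
        rw [gradient_mul' (differentiableAt_const _) ((hψ.differentiable (by simp)) p.2)]
        simp [gradient]
    simp only [hgr] at hT
    have hsub : Icc c d ×ˢ (univ : Set E) ⊆ I ×ˢ univ := prod_mono hcd Subset.rfl
    have k1 : IntegrableOn (fun p : ℝ × E => θ p.1 • (u p.1 p.2 • gradient ψ p.2))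
        (I ×ˢ univ) := by
      refine IntegrableOn.of_forall_sdiff_eq_zero (s := Icc c d ×ˢ univ) ?_
        (hI.measurableSet.prod MeasurableSet.univ) fun p hp => ?_
      · obtain ⟨C, hC⟩ := hθ.continuous.bounded_above_of_compact_support hθc
        exact (i1 c d hcd).bdd_smul C (hθ.continuous.comp continuous_fst).aestronglyMeasurable
          (Eventually.of_forall fun p => hC p.1)
      · rw [hθz p.1 fun h => hp.2 ⟨h, trivial⟩, zero_smul]
    have k2 : IntegrableOn (fun p : ℝ × E => θ p.1 • (ψ p.2 • G p.1 p.2)) (I ×ˢ univ) := by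
      refine IntegrableOn.of_forall_sdiff_eq_zero (s := Icc c d ×ˢ univ) ?_
        (hI.measurableSet.prod MeasurableSet.univ) fun p hp => ?_
      · obtain ⟨C, hC⟩ := hθ.continuous.bounded_above_of_compact_support hθc
        exact (i2 c d hcd).bdd_smul C (hθ.continuous.comp continuous_fst).aestronglyMeasurable
          (Eventually.of_forall fun p => hC p.1)
      · rw [hθz p.1 fun h => hp.2 ⟨h, trivial⟩, zero_smul]
    have e1 : ∫ p in I ×ˢ (univ : Set E), u p.1 p.2 • (θ p.1 • gradient ψ p.2)
        = ∫ t in I, θ t • ∫ v, u t v • gradient ψ v := by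
      rw [Measure.volume_eq_prod] at k1 ⊢
      have := setIntegral_prod _ k1
      simp only [Measure.restrict_univ, integral_smul] at this ⊢
      rw [← this]
      refine integral_congr_ae (Eventually.of_forall fun p => smul_comm _ _ _)
    have e2 : ∫ p in I ×ˢ (univ : Set E), (θ p.1 * ψ p.2) • G p.1 p.2
        = ∫ t in I, θ t • ∫ v, ψ v • G t v := by
      rw [Measure.volume_eq_prod] at k2 ⊢
      have := setIntegral_prod _ k2
      simp only [Measure.restrict_univ, integral_smul] at this ⊢
      rw [← this]
      refine integral_congr_ae (Eventually.of_forall fun p => mul_smul _ _ _)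
    rw [e1, e2] at hT
    have hrestr : ∀ w : ℝ → E, ∫ t in I, θ t • w t = ∫ t, θ t • w t := fun w =>
      setIntegral_eq_integral_of_forall_compl_eq_zero fun t ht => by
        rw [hθz t fun h => ht (hcd h), zero_smul]
    rw [hrestr, hrestr] at hT
    have l1 : ∀ w : ℝ → E, IntegrableOn w (Icc c d) → Integrable fun t => θ t • w t := fun w hw => by
      rw [← integrableOn_univ]
      refine IntegrableOn.of_forall_sdiff_eq_zero (s := Icc c d) ?_ MeasurableSet.univ fun p hp => ?_
      · obtain ⟨C, hC⟩ := hθ.continuous.bounded_above_of_compact_support hθc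
        exact hw.bdd_smul C hθ.continuous.aestronglyMeasurable (Eventually.of_forall hC)
      · rw [hθz p hp.2, zero_smul]
    simp only [smul_add]
    rw [integral_add (l1 _ (j1 c d hcd)) (l1 _ (j2 c d hcd)), hT, neg_add_cancel]
  · refine HasCompactSupport.intro (hθc.isCompact.prod hc.isCompact) fun p hp => ?_
    by_cases h1 : p.1 ∈ tsupport θ
    · have h2 : p.2 ∉ tsupport ψ := fun h2 => hp ⟨h1, h2⟩
      simp [image_eq_zero_of_notMem_tsupport h2]
    · simp [image_eq_zero_of_notMem_tsupport h1]
  · have h1 : tsupport (fun p : ℝ × E => θ p.1 * ψ p.2) ⊆ tsupport θ ×ˢ univ := by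
      refine closure_minimal (fun p hp => ⟨?_, trivial⟩)
        ((isClosed_tsupport θ).prod isClosed_univ)
      exact subset_tsupport _ (left_ne_zero_of_mul hp)
    exact h1.trans (prod_mono hθI Subset.rfl)

/-- The time slices of a weak gradient in velocity are weak gradients. -/
theorem HasWeakGradV.ae_hasWeakGrad {I : Set ℝ} (hI : IsOpen I) (hIo : I.OrdConnected)
    {u : ℝ → E → ℝ} {G : ℝ → E → E} (h : HasWeakGradV I u G) :
    ∀ᵐ t ∂volume.restrict I, HasWeakGrad (u t) (G t) := by
  have h1 := ae_locallyIntegrable_slice hI h.1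
  have h2 := ae_locallyIntegrable_slice hI h.2.1
  -- Countably many tests suffice, namely mollifiers centred at a dense sequence, so the exceptional
  -- sets of times add up to a null set.
  have h3 : ∀ n i : ℕ, ∀ᵐ t ∂volume.restrict I,
      ∫ y, u t y • gradient (fun y => molK n (TopologicalSpace.denseSeq E i - y)) y
        = -∫ y, molK n (TopologicalSpace.denseSeq E i - y) • G t y := fun n i => by
    refine h.ae_integral_eq hI hIo ((molK_contDiff n).comp (contDiff_const.sub contDiff_id)) ?_
    exact (molK_hasCompactSupport n).comp_homeomorph
      (Homeomorph.subLeft (TopologicalSpace.denseSeq E i))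
  filter_upwards [h1, h2, ae_all_iff.2 fun n => ae_all_iff.2 (h3 n)] with t a1 a2 a3
  refine HasWeakGrad.of_dense a1 a2 (TopologicalSpace.denseRange_denseSeq E) ?_
  rintro n _ ⟨i, rfl⟩
  exact a3 n i

/-- A locally integrable family of weak gradients is a weak gradient in velocity. -/
theorem hasWeakGradV_of_ae {I : Set ℝ} (hI : IsOpen I) (hIo : I.OrdConnected)
    {u : ℝ → E → ℝ} {G : ℝ → E → E}
    (hu : LocallyIntegrableOn (fun p : ℝ × E => u p.1 p.2) (I ×ˢ univ))
    (hG : LocallyIntegrableOn (fun p : ℝ × E => G p.1 p.2) (I ×ˢ univ))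
    (h : ∀ᵐ t ∂volume.restrict I, HasWeakGrad (u t) (G t)) : HasWeakGradV I u G := by
  refine ⟨hu, hG, fun φ hφ hc hI' => ?_⟩
  obtain ⟨c, d, hcd, hK⟩ := exists_Icc_of_isCompact hIo (hc.isCompact.image continuous_fst)
    (by rintro _ ⟨p, hp, rfl⟩; exact (hI' hp).1)
  obtain ⟨R, hR⟩ := (hc.isCompact.image continuous_snd).isBounded.subset_closedBall (0 : E)
  have hφ1 : ContDiff ℝ 1 φ := hφ.of_le (by simp)
  have hgr : ∀ p : ℝ × E, gradient (fun v => φ (p.1, v)) p.2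
      = (InnerProductSpace.toDual ℝ E).symm
        ((fderiv ℝ φ p).comp (ContinuousLinearMap.inr ℝ ℝ E)) := fun p => by
    have h1 : HasFDerivAt (fun v => φ (p.1, v))
        ((fderiv ℝ φ p).comp (ContinuousLinearMap.inr ℝ ℝ E)) p.2 :=
      (hφ1.differentiable one_ne_zero p).hasFDerivAt.comp p.2 (hasFDerivAt_prodMk_right p.1 p.2)
    rw [gradient, h1.fderiv]
  have hcg : Continuous fun p : ℝ × E => gradient (fun v => φ (p.1, v)) p.2 := by
    rw [funext hgr]
    exact (InnerProductSpace.toDual ℝ E).symm.continuous.comp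
      ((hφ1.continuous_fderiv one_ne_zero).clm_comp continuous_const)
  have hz : ∀ p ∉ Icc c d ×ˢ Metric.closedBall (0 : E) R,
      φ p = 0 ∧ gradient (fun v => φ (p.1, v)) p.2 = 0 := fun p hp => by
    have h1 : p ∉ tsupport φ := fun h => hp ⟨hK ⟨p, h, rfl⟩, hR ⟨p, h, rfl⟩⟩
    refine ⟨image_eq_zero_of_notMem_tsupport h1, ?_⟩
    rw [hgr, fderiv_of_notMem_tsupport ℝ h1, ContinuousLinearMap.zero_comp, map_zero]
  have hcomp : IsCompact (Icc c d ×ˢ Metric.closedBall (0 : E) R) :=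
    isCompact_Icc.prod (isCompact_closedBall _ _)
  have k1 : IntegrableOn (fun p : ℝ × E => u p.1 p.2 • gradient (fun v => φ (p.1, v)) p.2)
      (I ×ˢ univ) := by
    refine (((locallyIntegrableOn_slab_iff hI).1 hu c d R hcd).smul_continuousOn hcg.continuousOn
      hcomp).of_forall_sdiff_eq_zero (hI.measurableSet.prod MeasurableSet.univ) fun p hp => ?_
    rw [(hz p hp.2).2, smul_zero]
  have k2 : IntegrableOn (fun p : ℝ × E => φ p • G p.1 p.2) (I ×ˢ univ) := by
    refine (((locallyIntegrableOn_slab_iff hI).1 hG c d R hcd).continuousOn_smul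
      hφ.continuous.continuousOn
      hcomp).of_forall_sdiff_eq_zero (hI.measurableSet.prod MeasurableSet.univ) fun p hp => ?_
    rw [(hz p hp.2).1, zero_smul]
  rw [Measure.volume_eq_prod] at k1 k2 ⊢
  rw [setIntegral_prod _ k1, setIntegral_prod _ k2, ← integral_neg]
  refine integral_congr_ae ?_
  filter_upwards [h] with t ht
  simp only [Measure.restrict_univ]
  refine ht.integral_smul_gradient (hφ1.comp (contDiff_const.prodMk contDiff_id)) ?_
  refine HasCompactSupport.intro (isCompact_closedBall (0 : E) R) fun v hv => ?_
  exact (hz (t, v) fun h => hv h.2).1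

/-- Two functions which agree on almost all slices agree almost everywhere. -/
lemma ae_slab_of_ae_ae {F : Type*} [NormedAddCommGroup F] {I : Set ℝ} {G H : ℝ × E → F}
    (hG : AEStronglyMeasurable G (volume.restrict (I ×ˢ univ)))
    (hH : AEStronglyMeasurable H (volume.restrict (I ×ˢ univ)))
    (h : ∀ᵐ t ∂volume.restrict I, (fun v => G (t, v)) =ᵐ[volume] fun v => H (t, v)) :
    G =ᵐ[volume.restrict (I ×ˢ univ)] H := by
  rw [volume_restrict_slab] at *
  have hm : AEMeasurable (fun p => ‖G p - H p‖ₑ) ((volume.restrict I).prod volume) :=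
    (hG.sub hH).enorm
  have h0 : ∫⁻ p, ‖G p - H p‖ₑ ∂((volume.restrict I).prod volume) = 0 := by
    rw [lintegral_prod _ hm]
    rw [lintegral_eq_zero_of_ae_eq_zero]
    filter_upwards [h] with t ht
    refine lintegral_eq_zero_of_ae_eq_zero ?_
    filter_upwards [ht] with v hv
    simp [hv]
  rw [lintegral_eq_zero_iff' hm] at h0
  filter_upwards [h0] with p hp
  simpa [sub_eq_zero] using hp

/-- `gradV` is an arbitrary choice among weak gradients. Once any candidate is exhibited, uniqueness
on almost every slice identifies the two a.e. -/
lemma HasWeakGradV.gradV_ae_eq {I : Set ℝ} (hI : IsOpen I) (hIo : I.OrdConnected)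
    {u : ℝ → E → ℝ} {G : ℝ → E → E} (h : HasWeakGradV I u G) :
    (fun p : ℝ × E => gradV I u p.1 p.2) =ᵐ[volume.restrict (I ×ˢ univ)] fun p => G p.1 p.2 := by
  have he : ∃ G, HasWeakGradV I u G := ⟨G, h⟩
  have h' : HasWeakGradV I u (gradV I u) := by
    rw [gradV, dif_pos he]
    exact he.choose_spec
  have hms : MeasurableSet (I ×ˢ (univ : Set E)) := hI.measurableSet.prod MeasurableSet.univ
  refine ae_slab_of_ae_ae h'.2.1.aestronglyMeasurable h.2.1.aestronglyMeasurable ?_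
  filter_upwards [h.ae_hasWeakGrad hI hIo, h'.ae_hasWeakGrad hI hIo] with t h1 h2
  exact h2.ae_unique h1

/-! ### Consequences of the definition of H-solutions -/

section HSolution

variable {k : ℝ → ℝ} {T m₀ M₀ E₀ H₀ : ℝ} {fin : E → ℝ} {f : ℝ → E → ℝ}

lemma hasWeakGradV_gradV {I : Set ℝ} {u : ℝ → E → ℝ} (h : ∃ G, HasWeakGradV I u G) :
    HasWeakGradV I u (gradV I u) := by
  rw [gradV, dif_pos h]
  exact h.choose_spec

/-- The bounds on mass, energy and entropy at almost every time. -/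
lemma IsHSolution.ae_bounds (hf : IsHSolution k T fin f) (hin : HydroBounds m₀ M₀ E₀ H₀ fin) :
    ∀ᵐ t ∂volume.restrict (Ioo 0 T), (∀ v, 0 ≤ f t v) ∧ Integrable (f t) ∧ m₀ ≤ ∫ v, f t v ∧
      ∫ v, f t v ≤ M₀ ∧ Integrable (fun v => f t v * ‖v‖ ^ 2) ∧ ∫ v, f t v * ‖v‖ ^ 2 ≤ E₀ ∧
      Integrable (fun v => f t v * Real.log (f t v)) ∧ ∫ v, f t v * Real.log (f t v) ≤ H₀ := by
  filter_upwards [hf.conservation, hf.entropy, ae_restrict_mem measurableSet_Ioo] with t h1 h2 ht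
  obtain ⟨a1, a2, a3, -, a5⟩ := h1
  refine ⟨hf.nonneg t ⟨ht.1.le, ht.2⟩, a1, ?_, ?_, a2, ?_, h2.1, h2.2.trans ?_⟩
  · rw [a3]; exact hin.le_mass
  · rw [a3]; exact hin.mass_le
  · rw [a5]
    simp only [mul_comm (fin _)]
    exact hin.energy_le
  · refine le_trans ?_ hin.entropy_le
    refine integral_mono_ae ?_ hin.integrable_entropy (Eventually.of_forall fun v => ?_)
    · refine hin.integrable_entropy.mono ((hin.measurable.mul
        (Real.measurable_log.comp hin.measurable)).aestronglyMeasurable)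
        (Eventually.of_forall fun v => ?_)
      simp
    · exact mul_le_mul_of_nonneg_left (le_abs_self _) (hin.nonneg v)

/-- The control of the gradient of `√f` by the dissipation at one pair of velocities. -/
lemma gradient_le_dissipF (hk : IsCollisionKernel k) {t : ℝ} (hf0 : ∀ v, 0 ≤ f t v) {v w e : E}
    {R : ℝ} (hz : ‖v - w‖ ≤ R) (he : ‖e‖ = 1) {y : E} (hy : y = √(f t v) • gradLog T f t v)
    (hye : y = ‖y‖ • e) :
    ‖y‖ * (f t w * (‖v - w‖ ^ 2 - ⟪v - w, e⟫ ^ 2))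
      ≤ (R ^ 2 * √(R / k R)) * (√(f t w) * ‖dissipF k T f (t, v, w)‖)
        + R ^ 2 * √(f t v) * ‖gradV (Ioo 0 T) f t w‖ := by
  have hR0 : 0 ≤ R := (norm_nonneg _).trans hz
  rcases eq_or_ne (v - w) 0 with h0 | h0
  · rw [h0]
    simp only [norm_zero, inner_zero_left]
    have : 0 ≤ (R ^ 2 * √(R / k R)) * (√(f t w) * ‖dissipF k T f (t, v, w)‖)
        + R ^ 2 * √(f t v) * ‖gradV (Ioo 0 T) f t w‖ := by positivity
    simpa using this
  set z := v - w with hzd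
  have hr : 0 < ‖z‖ := norm_pos_iff.2 h0
  have hR : 0 < R := hr.trans_le hz
  set u := √(f t v * f t w) • (gradLog T f t v - gradLog T f t w) with hu
  have hF : ‖dissipF k T f (t, v, w)‖ = √(k ‖z‖ / ‖z‖) * ‖proj z u‖ := by
    have : dissipF k T f (t, v, w) = √(k ‖z‖ / ‖z‖) • proj z u := by
      rw [dissipF, dissipField, kernelSqrt, smul_apply]
    rw [this, norm_smul, Real.norm_of_nonneg (Real.sqrt_nonneg _)]
  have hone : 1 ≤ √(R / k R) * √(k ‖z‖ / ‖z‖) := by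
    have hkR := hk.pos R hR
    rw [← Real.sqrt_mul (by positivity), Real.one_le_sqrt]
    have h1 : k R / R ≤ k ‖z‖ / ‖z‖ := hk.anti (mem_Ioi.2 hr) (mem_Ioi.2 hR) hz
    calc (1 : ℝ) = R / k R * (k R / R) := by field_simp
      _ ≤ _ := by gcongr
  have hPu : ‖proj z u‖ ≤ √(R / k R) * ‖dissipF k T f (t, v, w)‖ := by
    rw [hF, ← mul_assoc]
    exact le_mul_of_one_le_left (norm_nonneg _) hone
  have hG : ‖f t w • gradLog T f t w‖ ≤ ‖gradV (Ioo 0 T) f t w‖ := by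
    rw [gradLog, smul_smul, norm_smul]
    refine mul_le_of_le_one_left (norm_nonneg _) ?_
    rcases eq_or_ne (f t w) 0 with h | h
    · simp [h]
    · simp [h]
  -- F only sees the projection of u = √(f(v)f(w))(∇ln f(v) - ∇ln f(w)). Solving for the gradient at
  -- v and pairing the projection with the direction e of y gives the factor |z|² - ⟨z,e⟩² = |z|²
  -- Π(z)e·e. The gradient at w enters only through f∇ln f, which |∇f| dominates.
  have hid : f t w • y = √(f t w) • u + √(f t v) • (f t w • gradLog T f t w) := by
    have key : ∀ (a s : ℝ) (X Y : E),
        (s * s) • (a • X) = s • ((a * s) • (X - Y)) + a • ((s * s) • Y) := fun a s X Y => by module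
    have h1 := key (√(f t v)) (√(f t w)) (gradLog T f t v) (gradLog T f t w)
    rw [Real.mul_self_sqrt (hf0 w), ← Real.sqrt_mul (hf0 v), ← hu, ← hy] at h1
    exact h1
  clear_value u
  have hq : ‖y‖ * (f t w * (‖z‖ ^ 2 - ⟪z, e⟫ ^ 2)) = ‖z‖ ^ 2 * ⟪proj z (f t w • y), e⟫ := by
    nth_rw 2 [hye]
    rw [map_smul, map_smul, inner_smul_left, inner_smul_left, inner_proj_self, he]
    simp only [conj_trivial]
    field_simp
  rw [hq, hid, map_add, map_smul (proj z) (√(f t w)), map_smul (proj z) (√(f t v)), inner_add_left, inner_smul_left, inner_smul_left,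
    conj_trivial, conj_trivial]
  have h1 : ⟪proj z u, e⟫ ≤ √(R / k R) * ‖dissipF k T f (t, v, w)‖ := by
    refine (real_inner_le_norm _ _).trans ?_
    rw [he, mul_one]
    exact hPu
  have h2 : ⟪proj z (f t w • gradLog T f t w), e⟫ ≤ ‖gradV (Ioo 0 T) f t w‖ := by
    refine (real_inner_le_norm _ _).trans ?_
    rw [he, mul_one]
    exact (norm_proj_apply_le _ _).trans hG
  have hzR : ‖z‖ ^ 2 ≤ R ^ 2 := by gcongr
  calc _ ≤ ‖z‖ ^ 2 * (√(f t w) * (√(R / k R) * ‖dissipF k T f (t, v, w)‖)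
        + √(f t v) * ‖gradV (Ioo 0 T) f t w‖) := by gcongr
    _ ≤ R ^ 2 * (√(f t w) * (√(R / k R) * ‖dissipF k T f (t, v, w)‖)
        + √(f t v) * ‖gradV (Ioo 0 T) f t w‖) := by gcongr
    _ = _ := by ring

/-- The control of the gradient of `√f` by the dissipation. -/
lemma exists_gradient_sqrt_le (hk : IsCollisionKernel k) (hm₀ : 0 < m₀) (ρ : ℝ) (hρ : 0 ≤ ρ)
    (E₀ H₀ : ℝ) :
    ∃ (C : NNReal) (R : ℝ), ∀ (T : ℝ) (f : ℝ → E → ℝ) (t : ℝ), (∀ v, 0 ≤ f t v) →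
      Integrable (f t) → m₀ ≤ ∫ v, f t v → Integrable (fun v => f t v * ‖v‖ ^ 2) →
      ∫ v, f t v * ‖v‖ ^ 2 ≤ E₀ → Integrable (fun v => f t v * Real.log (f t v)) →
      ∫ v, f t v * Real.log (f t v) ≤ H₀ →
      AEStronglyMeasurable (gradV (Ioo 0 T) f t) → ∀ v : E, ‖v‖ ≤ ρ →
      ‖√(f t v) • gradLog T f t v‖ₑ ≤ C * (∫⁻ w, ‖f t w‖ₑ)
        + (C * ‖√(f t v)‖ₑ * (∫⁻ w in Metric.closedBall 0 R, ‖gradV (Ioo 0 T) f t w‖ₑ)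
        + C * ∫⁻ w, ‖dissipF k T f (t, v, w)‖ₑ ^ 2) := by
  obtain ⟨R, σ, hR1, hσ, hσ1, hco⟩ := exists_coercive_set m₀ E₀ H₀ ρ hm₀ hρ
  have hR0 : 0 < R := by linarith
  set c := m₀ / 2 * σ ^ 2 with hc
  have hc0 : 0 < c := by positivity
  set b := R ^ 2 * √(R / k R) with hb
  have hb0 : 0 ≤ b := by positivity
  clear_value b
  set C := max (b / c) (R ^ 2 / c) with hC
  have hC0 : 0 ≤ C := le_max_of_le_left (by positivity)
  refine ⟨C.toNNReal, R + ρ, ?_⟩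
  intro T f t hf0 hfi hm hei he hhi hh hGm v hv
  set y := √(f t v) • gradLog T f t v with hy
  rcases eq_or_ne y 0 with h0 | h0
  · rw [h0]; simp
  have hy0 : 0 < ‖y‖ := norm_pos_iff.2 h0
  -- The set of good w depends on the direction of the unknown gradient, but its mass is bounded
  -- below uniformly in e. Averaging over it gives a bound for |y| itself.
  set e := ‖y‖⁻¹ • y with hed
  have he1 : ‖e‖ = 1 := by rw [hed, norm_smul, norm_inv, norm_norm, inv_mul_cancel₀ hy0.ne']
  have hye : y = ‖y‖ • e := by rw [hed, smul_smul, mul_inv_cancel₀ hy0.ne', one_smul]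
  set A := {w : E | ‖v - w‖ ≤ R ∧ σ ^ 2 ≤ ‖v - w‖ ^ 2 - ⟪v - w, e⟫ ^ 2} with hA
  have hc1 : Measurable fun w : E => ‖v - w‖ := by fun_prop
  have hc2 : Measurable fun w : E => ‖v - w‖ ^ 2 - ⟪v - w, e⟫ ^ 2 :=
    Continuous.measurable (by fun_prop)
  have hAm : MeasurableSet A :=
    (measurableSet_le hc1 measurable_const).inter (measurableSet_le measurable_const hc2)
  have hmA : m₀ / 2 ≤ ∫ w in A, f t w := hco (f t) hf0 hfi hm hei he hhi hh v e hv he1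
  have hpt : ∀ w ∈ A, ENNReal.ofReal (‖y‖ * σ ^ 2 * f t w) ≤
      ENNReal.ofReal b * ‖f t w‖ₑ + (ENNReal.ofReal (R ^ 2) * ‖√(f t v)‖ₑ
        * (Metric.closedBall (0 : E) (R + ρ)).indicator
          (fun w => ‖gradV (Ioo 0 T) f t w‖ₑ) w
        + ENNReal.ofReal b * ‖dissipF k T f (t, v, w)‖ₑ ^ 2) := fun w hw => by
    have h1 := gradient_le_dissipF (T := T) hk hf0 hw.1 he1 hy hye
    rw [← hb] at h1
    have hwB : w ∈ Metric.closedBall (0 : E) (R + ρ) := by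
      have h2 := norm_sub_le v (v - w)
      rw [sub_sub_cancel] at h2
      simp only [Metric.mem_closedBall, dist_zero_right]
      linarith [hw.1]
    rw [indicator_of_mem hwB]
    have h2 : ‖y‖ * σ ^ 2 * f t w ≤ b * f t w + (R ^ 2 * √(f t v) * ‖gradV (Ioo 0 T) f t w‖
        + b * ‖dissipF k T f (t, v, w)‖ ^ 2) := by
      have h3 : √(f t w) * ‖dissipF k T f (t, v, w)‖
          ≤ f t w + ‖dissipF k T f (t, v, w)‖ ^ 2 := by
        have h4 := Real.sq_sqrt (hf0 w)
        nlinarith [sq_nonneg (√(f t w) - ‖dissipF k T f (t, v, w)‖), sq_nonneg (√(f t w)),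
          sq_nonneg ‖dissipF k T f (t, v, w)‖]
      have h5 := mul_le_mul_of_nonneg_left h3 hb0
      have h6 : ‖y‖ * (f t w * σ ^ 2) ≤ ‖y‖ * (f t w * (‖v - w‖ ^ 2 - ⟪v - w, e⟫ ^ 2)) := by
        have := hf0 w
        have := hw.2
        gcongr
      linarith
    refine (ENNReal.ofReal_le_ofReal h2).trans (le_of_eq ?_)
    have := hf0 w
    rw [ENNReal.ofReal_add (by positivity) (by positivity), ENNReal.ofReal_add (by positivity)
      (by positivity), ENNReal.ofReal_mul hb0,
      ENNReal.ofReal_mul (p := R ^ 2 * √(f t v)) (by positivity),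
      ENNReal.ofReal_mul (p := R ^ 2) (by positivity), ENNReal.ofReal_mul hb0, ofReal_norm,
      ENNReal.ofReal_pow (norm_nonneg _), ofReal_norm,
      Real.enorm_of_nonneg (hf0 w), Real.enorm_of_nonneg (Real.sqrt_nonneg _)]
  have hint : ENNReal.ofReal (‖y‖ * c) ≤ ∫⁻ w in A, ENNReal.ofReal (‖y‖ * σ ^ 2 * f t w) := by
    rw [← ofReal_integral_eq_lintegral_ofReal ((hfi.const_mul _).integrableOn)
      (Eventually.of_forall fun w => mul_nonneg (by positivity) (hf0 w)), integral_const_mul]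
    apply ENNReal.ofReal_le_ofReal
    calc ‖y‖ * c = ‖y‖ * σ ^ 2 * (m₀ / 2) := by rw [hc]; ring
      _ ≤ _ := by gcongr
  have hfm : AEMeasurable (fun w => ENNReal.ofReal b * ‖f t w‖ₑ) :=
    hfi.aestronglyMeasurable.enorm.const_mul _
  have hgm : AEMeasurable (fun w => ENNReal.ofReal (R ^ 2) * ‖√(f t v)‖ₑ
        * (Metric.closedBall (0 : E) (R + ρ)).indicator
          (fun w => ‖gradV (Ioo 0 T) f t w‖ₑ) w) :=
    ((hGm.enorm.indicator Metric.isClosed_closedBall.measurableSet)).const_mul _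
  have htot : ENNReal.ofReal (‖y‖ * c) ≤ ENNReal.ofReal b * (∫⁻ w, ‖f t w‖ₑ)
      + (ENNReal.ofReal (R ^ 2) * ‖√(f t v)‖ₑ
        * (∫⁻ w in Metric.closedBall 0 (R + ρ), ‖gradV (Ioo 0 T) f t w‖ₑ)
        + ENNReal.ofReal b * ∫⁻ w, ‖dissipF k T f (t, v, w)‖ₑ ^ 2) := by
    refine hint.trans ((setLIntegral_mono' hAm hpt).trans ((setLIntegral_le_lintegral _ _).trans ?_))
    rw [lintegral_add_left' hfm, lintegral_add_left' hgm,
      lintegral_const_mul' _ _ ENNReal.ofReal_ne_top,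
      lintegral_const_mul' _ _ (ENNReal.mul_ne_top ENNReal.ofReal_ne_top enorm_ne_top),
      lintegral_const_mul' _ _ ENNReal.ofReal_ne_top,
      lintegral_indicator Metric.isClosed_closedBall.measurableSet]
  have hC1 : ENNReal.ofReal b ≤ C.toNNReal * ENNReal.ofReal c := by
    rw [← ENNReal.ofReal, ← ENNReal.ofReal_mul hC0]
    apply ENNReal.ofReal_le_ofReal
    calc b = b / c * c := by field_simp
      _ ≤ _ := by gcongr; exact le_max_left _ _
  have hC2 : ENNReal.ofReal (R ^ 2) ≤ C.toNNReal * ENNReal.ofReal c := by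
    rw [← ENNReal.ofReal, ← ENNReal.ofReal_mul hC0]
    apply ENNReal.ofReal_le_ofReal
    calc R ^ 2 = R ^ 2 / c * c := by field_simp
      _ ≤ _ := by gcongr; exact le_max_right _ _
  have hcc : ENNReal.ofReal c ≠ 0 := by simpa using hc0
  rw [← ENNReal.mul_le_mul_iff_left hcc ENNReal.ofReal_ne_top, ← ofReal_norm,
    ← ENNReal.ofReal_mul (norm_nonneg _)]
  refine htot.trans ?_
  calc _ ≤ (C.toNNReal * ENNReal.ofReal c) * (∫⁻ w, ‖f t w‖ₑ)
      + ((C.toNNReal * ENNReal.ofReal c) * ‖√(f t v)‖ₑ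
        * (∫⁻ w in Metric.closedBall 0 (R + ρ), ‖gradV (Ioo 0 T) f t w‖ₑ)
        + (C.toNNReal * ENNReal.ofReal c) * ∫⁻ w, ‖dissipF k T f (t, v, w)‖ₑ ^ 2) := by gcongr
    _ = _ := by ring

end HSolution

lemma locallyIntegrableOn_slab_mono {F F' : Type*} [NormedAddCommGroup F] [NormedAddCommGroup F']
    {I : Set ℝ} (hI : IsOpen I) {u : ℝ × E → F} {w : ℝ × E → F'}
    (hu : LocallyIntegrableOn u (I ×ˢ univ))
    (hm : AEStronglyMeasurable w (volume.restrict (I ×ˢ univ)))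
    (h : ∀ᵐ p ∂volume.restrict (I ×ˢ univ), ‖w p‖ ≤ ‖u p‖) :
    LocallyIntegrableOn w (I ×ˢ univ) := by
  rw [locallyIntegrableOn_slab_iff hI] at hu ⊢
  intro c d R hcd
  have hsub : Icc c d ×ˢ Metric.closedBall (0 : E) R ⊆ I ×ˢ univ :=
    prod_mono hcd (subset_univ _)
  exact Integrable.mono (hu c d R hcd) (hm.mono_set hsub)
    (ae_restrict_of_ae_restrict_of_subset hsub h)

lemma HasWeakGradV.posPart {I : Set ℝ} (hI : IsOpen I) (hIo : I.OrdConnected)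
    {u : ℝ → E → ℝ} {G : ℝ → E → E} (h : HasWeakGradV I u G) (hu : ∀ t ∈ I, ∀ v, 0 ≤ u t v)
    {κ : ℝ} (hκ : 0 ≤ κ) : HasWeakGradV I (fun t v => max (u t v - κ) 0)
      (fun t => {v | κ < u t v}.indicator (G t)) := by
  have hms : MeasurableSet (I ×ˢ (univ : Set E)) := hI.measurableSet.prod MeasurableSet.univ
  have hum := h.1.aestronglyMeasurable
  have hGm := h.2.1.aestronglyMeasurable
  have hT : NullMeasurableSet {p : ℝ × E | κ < u p.1 p.2} (volume.restrict (I ×ˢ univ)) :=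
    nullMeasurableSet_lt aemeasurable_const hum.aemeasurable
  refine hasWeakGradV_of_ae hI hIo (locallyIntegrableOn_slab_mono hI h.1 ?_ ?_)
    (locallyIntegrableOn_slab_mono hI h.2.1 (hGm.indicator₀ hT)
      (Eventually.of_forall fun p => ?_)) ?_
  · exact ((hum.aemeasurable.sub_const κ).max aemeasurable_const).aestronglyMeasurable
  · filter_upwards [ae_restrict_mem hms] with p hp
    have h0 := hu p.1 hp.1 p.2
    rw [Real.norm_of_nonneg (le_max_right _ _), Real.norm_of_nonneg h0]
    exact max_le (by linarith) h0
  · exact norm_indicator_le_norm_self (s := {p : ℝ × E | κ < u p.1 p.2})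
      (fun p : ℝ × E => G p.1 p.2) p
  · filter_upwards [h.ae_hasWeakGrad hI hIo, ae_restrict_mem hI.measurableSet] with t ht htI
    exact ht.posPart (hu t htI) κ

/-! ### Weak differentiability of the square root of a solution -/

section HSolution

variable {k : ℝ → ℝ} {T m₀ M₀ E₀ H₀ : ℝ} {fin : E → ℝ} {f : ℝ → E → ℝ}

lemma IsHSolution.lintegral_dissipF_lt_top (hf : IsHSolution k T fin f) :
    ∫⁻ t in Ioo 0 T, ∫⁻ v, ∫⁻ w, ‖dissipF k T f (t, v, w)‖ₑ ^ 2 < ⊤ := by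
  have h := hf.dissipation
  have hv : (volume : Measure (ℝ × E × E)).restrict (Ioo 0 T ×ˢ (univ ×ˢ univ))
      = (volume.restrict (Ioo 0 T)).prod (volume.prod volume) := by
    rw [Measure.volume_eq_prod, ← Measure.prod_restrict, univ_prod_univ, Measure.restrict_univ,
      Measure.volume_eq_prod]
  rw [hv] at h
  have hm : AEMeasurable (fun p => ‖dissipF k T f p‖ₑ ^ 2)
      ((volume.restrict (Ioo 0 T)).prod (volume.prod volume)) :=
    h.aestronglyMeasurable.enorm.pow_const 2
  have hlt := (eLpNorm_lt_top_iff_lintegral_rpow_enorm_lt_top (by norm_num) (by norm_num)).1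
    h.eLpNorm_lt_top
  simp only [ENNReal.toReal_ofNat, ENNReal.rpow_ofNat] at hlt
  rw [lintegral_prod _ hm] at hlt
  refine lt_of_eq_of_lt ?_ hlt
  refine lintegral_congr_ae ?_
  filter_upwards [h.aestronglyMeasurable.prodMk_left] with t ht
  rw [lintegral_prod _ (ht.enorm.pow_const 2)]

/-- The gradient of `√f` is locally integrable. -/
lemma IsHSolution.locallyIntegrableOn_gradient_sqrt (hf : IsHSolution k T fin f)
    (hk : IsCollisionKernel k) (hin : HydroBounds m₀ M₀ E₀ H₀ fin) (hm₀ : 0 < m₀) :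
    LocallyIntegrableOn (fun p : ℝ × E => (√(f p.1 p.2))⁻¹ • gradV (Ioo 0 T) f p.1 p.2)
      (Ioo 0 T ×ˢ univ) := by
  have hW := hasWeakGradV_gradV hf.hasGrad
  have hsl := hW.ae_hasWeakGrad isOpen_Ioo ordConnected_Ioo
  have hum := hW.1.aestronglyMeasurable
  have hGm := hW.2.1.aestronglyMeasurable
  rw [locallyIntegrableOn_slab_iff isOpen_Ioo]
  intro c d ρ hcd
  set B := Metric.closedBall (0 : E) ρ with hB
  have hBm : MeasurableSet B := Metric.isClosed_closedBall.measurableSet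
  have hsub : Icc c d ×ˢ B ⊆ Ioo 0 T ×ˢ univ := prod_mono hcd (subset_univ _)
  have hym : AEStronglyMeasurable
      (fun p : ℝ × E => (√(f p.1 p.2))⁻¹ • gradV (Ioo 0 T) f p.1 p.2)
      (volume.restrict (Icc c d ×ˢ B)) :=
    ((hum.aemeasurable.sqrt.inv.aestronglyMeasurable.smul hGm)).mono_set hsub
  refine ⟨hym, ?_⟩
  obtain ⟨C, R, hC⟩ := exists_gradient_sqrt_le hk hm₀ (max ρ 0) (le_max_right _ _) E₀ H₀
  set J := Icc c d
  have hJ : volume.restrict J ≤ volume.restrict (Ioo 0 T) := Measure.restrict_mono hcd le_rfl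
  have hpr : (volume : Measure (ℝ × E)).restrict (J ×ˢ B)
      = (volume.restrict J).prod (volume.restrict B) := by
    rw [Measure.volume_eq_prod, Measure.prod_restrict]
  rw [HasFiniteIntegral, hpr, lintegral_prod _ (by rw [← hpr]; exact hym.enorm)]
  set gB : ℝ → ℝ≥0∞ := fun t => ∫⁻ w in Metric.closedBall 0 R, ‖gradV (Ioo 0 T) f t w‖ₑ with hgB
  set Fm : ℝ → ℝ≥0∞ := fun t => ∫⁻ v, ∫⁻ w, ‖dissipF k T f (t, v, w)‖ₑ ^ 2
  set K : ℝ≥0∞ := volume B + ENNReal.ofReal M₀ with hK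
  have hVB : volume B ≠ ⊤ := measure_closedBall_lt_top.ne
  have hpr2 : (volume : Measure (ℝ × E)).restrict (J ×ˢ Metric.closedBall (0 : E) R)
      = (volume.restrict J).prod (volume.restrict (Metric.closedBall 0 R)) := by
    rw [Measure.volume_eq_prod, Measure.prod_restrict]
  have hGi := (locallyIntegrableOn_slab_iff isOpen_Ioo).1 hW.2.1 c d R hcd
  rw [IntegrableOn, hpr2] at hGi
  have hgm : AEMeasurable gB (volume.restrict J) :=
    hGi.aestronglyMeasurable.enorm.lintegral_prod_right'
  have hgfin : ∫⁻ t in J, gB t < ⊤ := by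
    have h1 := hGi.2
    rwa [HasFiniteIntegral, lintegral_prod _ hGi.aestronglyMeasurable.enorm] at h1
  -- The pointwise bound is integrated over v in the ball: the mass is at most M₀, √f ≤ 1 + f, and
  -- ∇f is integrable on a larger ball. The last term integrates in time to the square of the L²
  -- norm of F.
  have hbd : ∀ᵐ t ∂volume.restrict J,
      ∫⁻ v in B, ‖(√(f t v))⁻¹ • gradV (Ioo 0 T) f t v‖ₑ
        ≤ (C * ENNReal.ofReal M₀ * volume B + C * K * gB t) + C * Fm t := by
    filter_upwards [ae_mono hJ (hf.ae_bounds hin), ae_mono hJ hsl] with t ht hs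
    obtain ⟨a1, a2, a3, a4, a5, a6, a7, a8⟩ := ht
    have hfM : ∫⁻ w, ‖f t w‖ₑ ≤ ENNReal.ofReal M₀ := by
      rw [← ofReal_integral_norm_eq_lintegral_enorm a2]
      apply ENNReal.ofReal_le_ofReal
      simp only [Real.norm_of_nonneg (a1 _)]
      exact a4
    have hm1 : AEMeasurable (fun v => ‖√(f t v)‖ₑ) (volume.restrict B) :=
      a2.aestronglyMeasurable.aemeasurable.sqrt.enorm.restrict
    have hpt : ∀ v ∈ B, ‖(√(f t v))⁻¹ • gradV (Ioo 0 T) f t v‖ₑ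
        ≤ C * ENNReal.ofReal M₀ + (C * gB t * ‖√(f t v)‖ₑ
          + C * ∫⁻ w, ‖dissipF k T f (t, v, w)‖ₑ ^ 2) := fun v hv => by
      have h1 := hC T f t a1 a2 a3 a5 a6 a7 a8 hs.locIntGrad.aestronglyMeasurable v
        (by
          simp only [hB, Metric.mem_closedBall, dist_zero_right] at hv
          exact hv.trans (le_max_left _ _))
      have h2 : √(f t v) • gradLog T f t v = (√(f t v))⁻¹ • gradV (Ioo 0 T) f t v := by
        rw [gradLog, smul_smul, ← div_eq_mul_inv, Real.sqrt_div_self]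
      rw [h2] at h1
      refine h1.trans ?_
      rw [mul_right_comm]
      gcongr
    have hsq : ∫⁻ v in B, ‖√(f t v)‖ₑ ≤ K := by
      calc _ ≤ ∫⁻ v in B, (1 + ‖f t v‖ₑ) := by
            refine lintegral_mono fun v => ?_
            rw [Real.enorm_of_nonneg (Real.sqrt_nonneg _), Real.enorm_of_nonneg (a1 v),
              ← ENNReal.ofReal_one, ← ENNReal.ofReal_add zero_le_one (a1 v)]
            apply ENNReal.ofReal_le_ofReal
            have := Real.sq_sqrt (a1 v)
            nlinarith [sq_nonneg (√(f t v) - 1), Real.sqrt_nonneg (f t v)]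
        _ = volume B + ∫⁻ v in B, ‖f t v‖ₑ := by
            rw [lintegral_add_left measurable_const]
            simp
        _ ≤ _ := by
            rw [hK]
            gcongr
            exact (setLIntegral_le_lintegral _ _).trans hfM
    refine (setLIntegral_mono' hBm hpt).trans ?_
    by_cases hgt : gB t = ⊤
    · rcases eq_or_ne C 0 with hC0 | hC0
      · simp [hC0]
      · have hK0 : (C : ℝ≥0∞) * K * gB t = ⊤ ∨ K = 0 := by
          rcases eq_or_ne K 0 with h | h
          · exact Or.inr h
          · left
            rw [hgt]
            exact ENNReal.mul_top (mul_ne_zero (by simpa using hC0) h)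
        rcases hK0 with h | h
        · rw [h]; simp
        · have hv0 : volume B = 0 := (add_eq_zero.1 (hK ▸ h)).1
          rw [Measure.restrict_eq_zero.2 hv0]
          simp
    rw [lintegral_add_left measurable_const, lintegral_add_left' (hm1.const_mul _),
      lintegral_const, Measure.restrict_apply_univ, lintegral_const_mul' _ _
      (ENNReal.mul_ne_top ENNReal.coe_ne_top hgt), lintegral_const_mul' _ _ ENNReal.coe_ne_top,
      ← add_assoc]
    have e1 : C * gB t * ∫⁻ v in B, ‖√(f t v)‖ₑ ≤ C * K * gB t := by
      calc _ ≤ C * gB t * K := mul_le_mul_right hsq _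
        _ = _ := by ring
    exact add_le_add (add_le_add le_rfl e1)
      (mul_le_mul_right (setLIntegral_le_lintegral _ _) _)
  refine (lintegral_mono_ae hbd).trans_lt ?_
  have hKt : K ≠ ⊤ := ENNReal.add_ne_top.2 ⟨hVB, ENNReal.ofReal_ne_top⟩
  have hFm : ∫⁻ t in J, Fm t < ⊤ := (lintegral_mono' hJ le_rfl).trans_lt
    hf.lintegral_dissipF_lt_top
  have hm2 : AEMeasurable (fun t => C * ENNReal.ofReal M₀ * volume B + C * K * gB t)
      (volume.restrict J) := aemeasurable_const.add (hgm.const_mul _)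
  rw [lintegral_add_left' hm2,
    lintegral_add_left measurable_const, lintegral_const, Measure.restrict_apply_univ,
    lintegral_const_mul' _ _ (ENNReal.mul_ne_top ENNReal.coe_ne_top hKt),
    lintegral_const_mul' _ _ ENNReal.coe_ne_top]
  refine ENNReal.add_lt_top.2 ⟨ENNReal.add_lt_top.2 ⟨?_, ?_⟩, ?_⟩
  · exact ENNReal.mul_lt_top (ENNReal.mul_lt_top (ENNReal.mul_lt_top ENNReal.coe_lt_top
      ENNReal.ofReal_lt_top) hVB.lt_top) measure_Icc_lt_top
  · exact ENNReal.mul_lt_top (ENNReal.mul_lt_top ENNReal.coe_lt_top hKt.lt_top) hgfin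
  · exact ENNReal.mul_lt_top ENNReal.coe_lt_top hFm

end HSolution

section HSolution

variable {k : ℝ → ℝ} {T m₀ M₀ E₀ H₀ : ℝ} {fin : E → ℝ} {f : ℝ → E → ℝ}

/-- `gradV` defaults to zero where no weak gradient exists, so a smallness assumption on ∇√f says
nothing until √f is known to be weakly differentiable. This provides the actual gradient ∇f/(2√f).
-/
lemma IsHSolution.hasWeakGradV_sqrt (hf : IsHSolution k T fin f)
    (hk : IsCollisionKernel k) (hin : HydroBounds m₀ M₀ E₀ H₀ fin) (hm₀ : 0 < m₀) :
    HasWeakGradV (Ioo 0 T) (fun t v => √(f t v))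
      (fun t v => (2 * √(f t v))⁻¹ • gradV (Ioo 0 T) f t v) := by
  have hW := hasWeakGradV_gradV hf.hasGrad
  have hL := hf.locallyIntegrableOn_gradient_sqrt hk hin hm₀
  have hum := hW.1.aestronglyMeasurable
  have h1 : LocallyIntegrableOn (fun _ : ℝ × E => (1 : ℝ)) (Ioo 0 T ×ˢ univ) :=
    (locallyIntegrable_const 1).locallyIntegrableOn _
  refine hasWeakGradV_of_ae isOpen_Ioo ordConnected_Ioo ?_ ?_ ?_
  · refine locallyIntegrableOn_slab_mono isOpen_Ioo (h1.add hW.1)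
      hum.aemeasurable.sqrt.aestronglyMeasurable ?_
    filter_upwards [ae_restrict_mem (measurableSet_Ioo.prod MeasurableSet.univ)] with p hp
    have h0 := hf.nonneg p.1 (Ioo_subset_Ico_self hp.1) p.2
    simp only [Pi.add_apply]
    rw [Real.norm_of_nonneg (Real.sqrt_nonneg _), Real.norm_of_nonneg (by linarith)]
    nlinarith [Real.sq_sqrt h0, sq_nonneg (√(f p.1 p.2) - 1), Real.sqrt_nonneg (f p.1 p.2)]
  · refine locallyIntegrableOn_slab_mono isOpen_Ioo hL
      ((hum.aemeasurable.sqrt.const_mul 2).inv.aestronglyMeasurable.smul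
        hW.2.1.aestronglyMeasurable) (Eventually.of_forall fun p => ?_)
    rw [norm_smul, norm_smul, mul_inv, norm_mul]
    norm_num
    have := mul_nonneg (inv_nonneg.2 (abs_nonneg (√(f p.1 p.2))))
      (norm_nonneg (gradV (Ioo 0 T) f p.1 p.2))
    nlinarith
  · filter_upwards [hW.ae_hasWeakGrad isOpen_Ioo ordConnected_Ioo,
      ae_locallyIntegrable_slice
        (u := fun t v => (√(f t v))⁻¹ • gradV (Ioo 0 T) f t v) isOpen_Ioo hL, ae_restrict_mem measurableSet_Ioo] with t h2 h3 ht
    exact h2.sqrt (hf.nonneg t (Ioo_subset_Ico_self ht)) h3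

end HSolution

/-! ### Parabolic rescaling -/

section Rescale

variable {ε t₀ : ℝ} {v₀ : E}

/-- The map `(s, v) ↦ (t₀ + ε² s, v₀ + ε v)`. -/
def rescale (hε : ε ≠ 0) (t₀ : ℝ) (v₀ : E) : ℝ × E ≃ₜ ℝ × E where
  toFun p := (t₀ + ε ^ 2 * p.1, v₀ + ε • p.2)
  invFun p := ((ε ^ 2)⁻¹ * (p.1 - t₀), ε⁻¹ • (p.2 - v₀))
  left_inv p := by
    ext1
    · simp [hε]
    · simp [smul_smul, hε]
  right_inv p := by
    ext1
    · simp [hε]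
    · simp [smul_smul, hε]
  continuous_toFun := by fun_prop
  continuous_invFun := by fun_prop

lemma rescale_apply (hε : ε ≠ 0) (p : ℝ × E) :
    rescale hε t₀ v₀ p = (t₀ + ε ^ 2 * p.1, v₀ + ε • p.2) := rfl

lemma map_time (hε : 0 < ε) (t₀ : ℝ) :
    Measure.map (fun s : ℝ => t₀ + ε ^ 2 * s) volume = ENNReal.ofReal (ε ^ 2)⁻¹ • volume := by
  have h : (fun s : ℝ => t₀ + ε ^ 2 * s) = (fun s => t₀ + s) ∘ fun s => ε ^ 2 * s := rfl
  rw [h, ← Measure.map_map (by fun_prop) (by fun_prop), Real.map_volume_mul_left (by positivity),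
    Measure.map_smul, map_add_left_eq_self, abs_of_pos (by positivity)]

lemma map_space (hε : 0 < ε) (v₀ : E) :
    Measure.map (fun v : E => v₀ + ε • v) volume = ENNReal.ofReal (ε ^ 3)⁻¹ • volume := by
  have h : (fun v : E => v₀ + ε • v) = (fun v => v₀ + v) ∘ fun v => ε • v := rfl
  rw [h, ← Measure.map_map (by fun_prop) (by fun_prop), Measure.map_addHaar_smul _ hε.ne',
    Measure.map_smul, map_add_left_eq_self, abs_of_pos (by positivity)]
  simp

lemma map_rescale (hε : 0 < ε) : Measure.map (rescale hε.ne' t₀ v₀) volume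
    = ENNReal.ofReal (ε ^ 5)⁻¹ • (volume : Measure (ℝ × E)) := by
  have h : (rescale hε.ne' t₀ v₀ : ℝ × E → ℝ × E)
      = Prod.map (fun s : ℝ => t₀ + ε ^ 2 * s) (fun v : E => v₀ + ε • v) := rfl
  rw [h, Measure.volume_eq_prod, ← Measure.map_prod_map _ _ (by fun_prop) (by fun_prop),
    map_time hε, map_space hε, Measure.prod_smul_left, Measure.prod_smul_right, smul_smul,
    ← ENNReal.ofReal_mul (by positivity)]
  congr 2
  field_simp

lemma map_restrict_rescale (hε : 0 < ε) (A : Set (ℝ × E)) :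
    Measure.map (rescale hε.ne' t₀ v₀) (volume.restrict (rescale hε.ne' t₀ v₀ ⁻¹' A))
    = ENNReal.ofReal (ε ^ 5)⁻¹ • volume.restrict A := by
  rw [← (rescale hε.ne' t₀ v₀).measurableEmbedding.restrict_map, map_rescale hε,
    Measure.restrict_smul]

lemma quasiMeasurePreserving_rescale (hε : 0 < ε) (A : Set (ℝ × E)) :
    Measure.QuasiMeasurePreserving (rescale hε.ne' t₀ v₀)
      (volume.restrict (rescale hε.ne' t₀ v₀ ⁻¹' A)) (volume.restrict A) :=
  ⟨(rescale hε.ne' t₀ v₀).continuous.measurable, by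
    rw [map_restrict_rescale hε]; exact Measure.smul_absolutelyContinuous⟩

lemma quasiMeasurePreserving_time (hε : 0 < ε) (t₀ : ℝ) {A : Set ℝ} (hA : MeasurableSet A) :
    Measure.QuasiMeasurePreserving (fun s : ℝ => t₀ + ε ^ 2 * s)
      (volume.restrict ((fun s : ℝ => t₀ + ε ^ 2 * s) ⁻¹' A)) (volume.restrict A) :=
  ⟨by fun_prop, by
    rw [← Measure.restrict_map (by fun_prop) hA, map_time hε, Measure.restrict_smul]
    exact Measure.smul_absolutelyContinuous⟩

lemma setIntegral_rescale {F : Type*} [NormedAddCommGroup F] [NormedSpace ℝ F] (hε : 0 < ε)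
    (φ : ℝ × E → F) (A : Set (ℝ × E)) :
    ∫ p in A, φ p = ε ^ 5 • ∫ p in rescale hε.ne' t₀ v₀ ⁻¹' A, φ (rescale hε.ne' t₀ v₀ p) := by
  rw [← (rescale hε.ne' t₀ v₀).measurableEmbedding.integral_map, map_restrict_rescale hε,
    integral_smul_measure, ENNReal.toReal_ofReal (by positivity), smul_smul,
    mul_inv_cancel₀ (by positivity), one_smul]

lemma integrableOn_rescale {F : Type*} [NormedAddCommGroup F] (hε : 0 < ε)
    {φ : ℝ × E → F} {A : Set (ℝ × E)} (h : IntegrableOn φ A) :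
    IntegrableOn (fun p => φ (rescale hε.ne' t₀ v₀ p)) (rescale hε.ne' t₀ v₀ ⁻¹' A) := by
  have h1 : Integrable φ (Measure.map (rescale hε.ne' t₀ v₀)
      (volume.restrict (rescale hε.ne' t₀ v₀ ⁻¹' A))) := by
    rw [map_restrict_rescale hε]
    exact h.smul_measure ENNReal.ofReal_ne_top
  exact (rescale hε.ne' t₀ v₀).measurableEmbedding.integrable_map_iff.1 h1

lemma preimage_rescale_prod_univ (hε : ε ≠ 0) (J : Set ℝ) :
    rescale hε t₀ v₀ ⁻¹' (J ×ˢ univ) = ((fun s : ℝ => t₀ + ε ^ 2 * s) ⁻¹' J) ×ˢ univ := by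
  ext p
  simp [rescale_apply]

lemma HasWeakGrad.comp_affine {u : E → ℝ} {G : E → E} (h : HasWeakGrad u G) (hε : 0 < ε)
    (v₀ : E) (c : ℝ) : HasWeakGrad (fun v => c * u (v₀ + ε • v))
      (fun v => (c * ε) • G (v₀ + ε • v)) := by
  have hloc : ∀ {F : Type} [NormedAddCommGroup F] [NormedSpace ℝ F] {w : E → F},
      LocallyIntegrable w → ∀ a : ℝ, LocallyIntegrable fun v => a • w (v₀ + ε • v) := by
    intro F _ _ w hw a
    refine LocallyIntegrable.smul (MeasureTheory.locallyIntegrable_iff.2 fun K hK => ?_) a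
    have hK' : IsCompact ((fun v : E => v₀ + ε • v) '' K) := hK.image (by fun_prop)
    have h1 := integrable_comp_affine hε v₀
      ((hw.integrableOn_isCompact hK').integrable_indicator hK'.measurableSet)
    refine (h1.integrableOn (s := K)).congr_fun (fun v hv => ?_) hK.measurableSet
    exact indicator_of_mem (mem_image_of_mem _ hv) _
  refine HasWeakGrad.of_smooth (hloc h.locInt c) (hloc h.locIntGrad _) fun ψ hψ hc => ?_
  set χ : E → ℝ := fun x => ψ (ε⁻¹ • (x - v₀)) with hχ
  have hχs : ContDiff ℝ ∞ χ := hψ.comp (by fun_prop)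
  have hinv : ∀ v : E, ε⁻¹ • (v₀ + ε • v - v₀) = v := fun v => by
    rw [add_sub_cancel_left, smul_smul, inv_mul_cancel₀ hε.ne', one_smul]
  have hχc : HasCompactSupport χ := by
    refine HasCompactSupport.intro (hc.isCompact.image
      (show Continuous fun v : E => v₀ + ε • v by fun_prop)) fun x hx => ?_
    refine image_eq_zero_of_notMem_tsupport (f := ψ) fun hx2 => hx ⟨_, hx2, ?_⟩
    simp only
    rw [smul_smul, mul_inv_cancel₀ hε.ne', one_smul, add_sub_cancel]
  have hgr : ∀ v, gradient ψ v = ε • gradient χ (v₀ + ε • v) := fun v => by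
    have h1 : HasGradientAt ψ (gradient ψ v) v :=
      (hψ.differentiable (by simp) v).hasGradientAt
    have h2 : HasFDerivAt (fun x : E => ε⁻¹ • (x - v₀)) (ε⁻¹ • ContinuousLinearMap.id ℝ E)
        (v₀ + ε • v) := ((hasFDerivAt_id _).sub_const v₀).const_smul ε⁻¹
    have h3 : HasGradientAt χ (ε⁻¹ • gradient ψ v) (v₀ + ε • v) := by
      rw [hasGradientAt_iff_hasFDerivAt] at h1 ⊢
      have h4 : HasFDerivAt ψ (InnerProductSpace.toDual ℝ E (gradient ψ v))
          (ε⁻¹ • (v₀ + ε • v - v₀)) := by rwa [hinv]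
      refine (h4.comp (v₀ + ε • v) h2).congr_fderiv ?_
      ext x
      simp
    rw [h3.gradient, smul_smul, mul_inv_cancel₀ hε.ne', one_smul]
  have h1 := h.integral_smul_gradient (hχs.of_le (by simp)) hχc
  have e1 : ∀ v, (c * u (v₀ + ε • v)) • gradient ψ v
      = (c * ε) • (fun x => u x • gradient χ x) (v₀ + ε • v) := fun v => by
    rw [hgr, smul_smul, smul_smul]
    congr 1
    ring
  have e2 : ∀ v, ψ v • (c * ε) • G (v₀ + ε • v)
      = (c * ε) • (fun x => χ x • G x) (v₀ + ε • v) := fun v => by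
    simp only [hχ, hinv]
    rw [smul_comm]
  simp only [e1, e2]
  rw [integral_smul, integral_smul, integral_comp_affine (fun x => u x • gradient χ x) hε,
    integral_comp_affine (fun x => χ x • G x) hε, h1]
  simp

lemma HasWeakGradV.rescale {I : Set ℝ} (hI : IsOpen I) (hIo : I.OrdConnected)
    {u : ℝ → E → ℝ} {G : ℝ → E → E} (h : HasWeakGradV I u G) (hε : 0 < ε) (t₀ : ℝ) (v₀ : E)
    (c : ℝ) : HasWeakGradV {s | t₀ + ε ^ 2 * s ∈ I}
      (fun s v => c * u (t₀ + ε ^ 2 * s) (v₀ + ε • v))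
      (fun s v => (c * ε) • G (t₀ + ε ^ 2 * s) (v₀ + ε • v)) := by
  have hI' : IsOpen {s : ℝ | t₀ + ε ^ 2 * s ∈ I} := hI.preimage (by fun_prop)
  have hIo' : OrdConnected {s : ℝ | t₀ + ε ^ 2 * s ∈ I} := by
    refine ⟨fun x hx y hy z hz => hIo.out hx hy ⟨?_, ?_⟩⟩
    · have := hz.1; gcongr
    · have := hz.2; gcongr
  have hloc : ∀ {F : Type} [NormedAddCommGroup F] [NormedSpace ℝ F] {w : ℝ × E → F},
      LocallyIntegrableOn w (I ×ˢ univ) → ∀ a : ℝ,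
      LocallyIntegrableOn (fun p => a • w (Landau.rescale hε.ne' t₀ v₀ p))
        ({s | t₀ + ε ^ 2 * s ∈ I} ×ˢ univ) := by
    intro F _ _ w hw a
    rw [locallyIntegrableOn_slab_iff hI] at hw
    rw [locallyIntegrableOn_slab_iff hI']
    intro c d R hcd
    rcases le_or_gt c d with hle | hlt
    · have h1 := hw (t₀ + ε ^ 2 * c) (t₀ + ε ^ 2 * d) (‖v₀‖ + ε * R)
        (hIo.out (hcd ⟨le_rfl, hle⟩) (hcd ⟨hle, le_rfl⟩))
      refine Integrable.smul a (IntegrableOn.mono_set (integrableOn_rescale (t₀ := t₀) (v₀ := v₀)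
        hε h1) ?_)
      rintro ⟨s, v⟩ ⟨⟨hs1, hs2⟩, hv⟩
      simp only [Metric.mem_closedBall, dist_zero_right] at hv
      refine ⟨⟨?_, ?_⟩, ?_⟩
      · simp only [rescale_apply]; gcongr
      · simp only [rescale_apply]; gcongr
      · simp only [rescale_apply, Metric.mem_closedBall, dist_zero_right]
        refine (norm_add_le _ _).trans ?_
        rw [norm_smul, Real.norm_of_nonneg hε.le]
        gcongr
    · rw [Icc_eq_empty (by linarith), empty_prod]
      exact integrableOn_empty
  refine hasWeakGradV_of_ae hI' hIo' (hloc h.1 c) (hloc h.2.1 (c * ε)) ?_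
  filter_upwards [(quasiMeasurePreserving_time hε t₀ hI.measurableSet).ae
    (h.ae_hasWeakGrad hI hIo)] with s hs
  exact hs.comp_affine hε v₀ c

end Rescale

/-! ### The kernel, the coefficients and the test functions under rescaling -/

section Kernel

variable {k : ℝ → ℝ} {ε t₀ : ℝ} {v₀ : E}

lemma proj_smul {ε : ℝ} (hε : ε ≠ 0) (z : E) : proj (ε • z) = proj z := by
  ext1 e
  rw [proj_apply, proj_apply, norm_smul, inner_smul_left, smul_smul, mul_pow, Real.norm_eq_abs,
    sq_abs]
  congr 2
  by_cases hz : z = 0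
  · simp [hz]
  · have : ‖z‖ ≠ 0 := norm_ne_zero_iff.2 hz
    simp only [conj_trivial]
    field_simp

/-- The projection is homogeneous of degree zero, 1/|z| gives ε⁻¹, and the profile and the cutoff
parameter become k(ε·) and nε. -/
lemma kernelCut_smul (hε : 0 < ε) (n : ℕ) (z : E) : kernelCut k n (ε • z)
    = ε⁻¹ • radK (cutC (fun r => k (ε * r)) (n * ε)) z := by
  rw [kernelCut, kernel, radK, cutC, proj_smul hε.ne', norm_smul, Real.norm_of_nonneg hε.le,
    smul_smul, smul_smul, mul_assoc]
  congr 1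
  rw [← div_div, mul_comm ε⁻¹, div_right_comm]
  simp only [div_eq_mul_inv]
  ring

/-- The Jacobian ε³ and the factor ε⁻¹ from the kernel combine into ε². This is why the
normalization f_ε = ε² f keeps the form of the equation. -/
lemma diffMatrix_rescale (hε : 0 < ε) (n : ℕ) (f : ℝ → E → ℝ) (t : ℝ) (v : E) :
    diffMatrix k n f t (v₀ + ε • v)
      = convK (cutC (fun r => k (ε * r)) (n * ε)) (fun w => ε ^ 2 * f t (v₀ + ε • w)) v := by
  have h := integral_comp_affine (fun w => f t w • kernelCut k n (v₀ + ε • v - w)) hε v₀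
  have h2 : ∀ w : E, v₀ + ε • v - (v₀ + ε • w) = ε • (v - w) := fun w => by
    rw [smul_sub]; abel
  simp only [h2, kernelCut_smul hε] at h
  rw [diffMatrix, convK]
  have h3 : ∀ w : E, (ε ^ 2 * f t (v₀ + ε • w)) • radK (cutC (fun r => k (ε * r)) (n * ε)) (v - w)
      = ε ^ 3 • (f t (v₀ + ε • w) • (ε⁻¹ • radK (cutC (fun r => k (ε * r)) (n * ε)) (v - w))) :=
    fun w => by
      rw [smul_smul, smul_smul]
      congr 1
      field_simp
  simp only [h3]
  rw [integral_smul, h, smul_smul, mul_inv_cancel₀ (by positivity), one_smul]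

lemma fderiv_comp_affine_inv {F : Type*} [NormedAddCommGroup F] [NormedSpace ℝ F] (φ : E → F)
    (hε : 0 < ε) (v₀ v : E) :
    fderiv ℝ (fun x => φ (ε⁻¹ • (x - v₀))) (v₀ + ε • v) = ε⁻¹ • fderiv ℝ φ v := by
  have h1 := fderiv_comp_sub (𝕜 := ℝ) (f := fun y : E => φ (ε⁻¹ • y)) (x := v₀ + ε • v) v₀
  rw [h1, fderiv_comp_smul, add_sub_cancel_left, smul_smul, inv_mul_cancel₀ hε.ne', one_smul]

lemma matDiv_diffMatrix_rescale (hk : IsCollisionKernel k) (hε : 0 < ε) {n : ℕ} (hn : 0 < n)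
    {f : ℝ → E → ℝ} {t : ℝ} (hf : Integrable fun w => ε ^ 2 * f t (v₀ + ε • w)) (v : E) :
    matDiv (diffMatrix k n f t) (v₀ + ε • v) = ε⁻¹ •
      convD (cutC (fun r => k (ε * r)) (n * ε)) (fun w => ε ^ 2 * f t (v₀ + ε • w)) v := by
  have hn' : (0 : ℝ) < n * ε := by positivity
  set c := cutC (fun r => k (ε * r)) (n * ε)
  set g := fun w => ε ^ 2 * f t (v₀ + ε • w) with hg
  have h1 : diffMatrix k n f t = fun x => convK c g (ε⁻¹ • (x - v₀)) := by
    funext x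
    rw [← diffMatrix_rescale hε, smul_smul, mul_inv_cancel₀ hε.ne', one_smul, add_sub_cancel]
  rw [← ((hk.isProfile_scaled hε).isBddRadial_cutC hn').matDiv_convK hf, h1, matDiv, matDiv,
    Finset.smul_sum]
  refine Finset.sum_congr rfl fun i _ => ?_
  rw [fderiv_comp_affine_inv (fun u => convK c g u (EuclideanSpace.single i 1)) hε]
  rfl

lemma gradient_comp_affine_inv (φ : E → ℝ) (hε : 0 < ε) (v₀ v : E) :
    gradient (fun x => φ (ε⁻¹ • (x - v₀))) (v₀ + ε • v) = ε⁻¹ • gradient φ v := by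
  rw [gradient, gradient, fderiv_comp_affine_inv φ hε, map_smul]

lemma gradient_sq_const_mul {ψ : E → ℝ} (hψ : ContDiff ℝ 1 ψ) (c : ℝ) (v : E) :
    gradient (fun x => (c * ψ x) ^ 2) v = (c ^ 2 * (2 * ψ v)) • gradient ψ v := by
  have h1 : HasFDerivAt ψ (fderiv ℝ ψ v) v := (hψ.differentiable one_ne_zero v).hasFDerivAt
  have h2 := (h1.const_mul c).pow 2
  rw [gradient, h2.fderiv, gradient, ← map_smul]
  congr 1
  ext x
  simp
  ring

lemma hPlus_rescale {κ lam x : ℝ} (hε : 0 < ε) (h : ε ^ 2 * κ = lam) :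
    hPlus κ x = (ε ^ 2)⁻¹ * hPlus lam (ε ^ 2 * x) := by
  have h2 : ε ^ 2 ≠ 0 := by positivity
  subst h
  rw [hPlus, hPlus, mul_div_mul_left _ _ h2, ← mul_sub,
    show max (ε ^ 2 * (x - κ)) 0 = ε ^ 2 * max (x - κ) 0 by
      rw [mul_max_of_nonneg _ _ (by positivity), mul_zero]]
  field_simp

/-- The rescaled test function. -/
def liftTest (ε t₀ : ℝ) (v₀ : E) (χ : ℝ → ℝ) (ψ : E → ℝ) (p : ℝ × E) : ℝ :=
  χ ((ε ^ 2)⁻¹ * (p.1 - t₀)) * ψ (ε⁻¹ • (p.2 - v₀))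

lemma liftTest_rescale (hε : ε ≠ 0) (χ : ℝ → ℝ) (ψ : E → ℝ) (s : ℝ) (v : E) :
    liftTest ε t₀ v₀ χ ψ (t₀ + ε ^ 2 * s, v₀ + ε • v) = χ s * ψ v := by
  simp [liftTest, smul_smul, hε]

lemma contDiff_liftTest {χ : ℝ → ℝ} {ψ : E → ℝ} (hχ : ContDiff ℝ ∞ χ) (hψ : ContDiff ℝ ∞ ψ) :
    ContDiff ℝ ∞ (liftTest ε t₀ v₀ χ ψ) := by
  unfold liftTest
  exact (hχ.comp (by fun_prop)).mul (hψ.comp (by fun_prop))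

lemma tsupport_liftTest (hε : 0 < ε) (χ : ℝ → ℝ) (ψ : E → ℝ) :
    tsupport (liftTest ε t₀ v₀ χ ψ) ⊆ rescale hε.ne' t₀ v₀ '' (tsupport χ ×ˢ tsupport ψ) := by
  have hcl : IsClosed (rescale hε.ne' t₀ v₀ '' (tsupport χ ×ˢ tsupport ψ)) :=
    (rescale hε.ne' t₀ v₀).isClosedMap _ ((isClosed_tsupport _).prod (isClosed_tsupport _))
  refine closure_minimal (fun p hp => ?_) hcl
  refine ⟨(rescale hε.ne' t₀ v₀).symm p, ⟨subset_tsupport _ ?_, subset_tsupport _ ?_⟩,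
    (rescale hε.ne' t₀ v₀).apply_symm_apply p⟩
  · exact left_ne_zero_of_mul hp
  · exact right_ne_zero_of_mul hp

lemma hasCompactSupport_liftTest (hε : 0 < ε) {χ : ℝ → ℝ} {ψ : E → ℝ} (hχ : HasCompactSupport χ)
    (hψ : HasCompactSupport ψ) : HasCompactSupport (liftTest ε t₀ v₀ χ ψ) :=
  ((hχ.isCompact.prod hψ.isCompact).image (rescale hε.ne' t₀ v₀).continuous).of_isClosed_subset
    (isClosed_tsupport _) (tsupport_liftTest hε χ ψ)

lemma gradient_liftTest (hε : 0 < ε) (χ : ℝ → ℝ) {ψ : E → ℝ} (hψ : ContDiff ℝ 1 ψ) (s : ℝ)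
    (v : E) : gradient (fun x => liftTest ε t₀ v₀ χ ψ (t₀ + ε ^ 2 * s, x) ^ 2) (v₀ + ε • v)
      = ε⁻¹ • (χ s ^ 2 * (2 * ψ v)) • gradient ψ v := by
  have h := gradient_comp_affine_inv (fun y => (χ s * ψ y) ^ 2) hε v₀ v
  rw [gradient_sq_const_mul hψ] at h
  rw [← h]
  congr 1
  funext x
  simp [liftTest, hε.ne']

lemma deriv_liftTest (hε : 0 < ε) {χ : ℝ → ℝ} (hχ : ContDiff ℝ 1 χ) (ψ : E → ℝ) (s : ℝ)
    (v : E) : deriv (fun t => liftTest ε t₀ v₀ χ ψ (t, v₀ + ε • v) ^ 2) (t₀ + ε ^ 2 * s)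
      = (ε ^ 2)⁻¹ * (deriv (fun s => χ s ^ 2) s * ψ v ^ 2) := by
  have h1 : HasDerivAt (fun s => χ s ^ 2) (deriv (fun s => χ s ^ 2) s) s :=
    ((hχ.pow 2).differentiable one_ne_zero s).hasDerivAt
  have h2 : HasDerivAt (fun t : ℝ => (ε ^ 2)⁻¹ * (t - t₀)) (ε ^ 2)⁻¹ (t₀ + ε ^ 2 * s) := by
    simpa using ((hasDerivAt_id (t₀ + ε ^ 2 * s)).sub_const t₀).const_mul (ε ^ 2)⁻¹
  have e : (ε ^ 2)⁻¹ * (t₀ + ε ^ 2 * s - t₀) = s := by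
    rw [add_sub_cancel_left, inv_mul_cancel_left₀ (by positivity)]
  rw [← e] at h1
  have h3 := (HasDerivAt.comp (h₂ := fun s => χ s ^ 2) (h := fun t => (ε ^ 2)⁻¹ * (t - t₀))
    (t₀ + ε ^ 2 * s) h1 h2).mul_const (ψ v ^ 2)
  rw [e] at h3
  have h4 : (fun t => liftTest ε t₀ v₀ χ ψ (t, v₀ + ε • v) ^ 2)
      = fun t => ((fun s => χ s ^ 2) ∘ fun t => (ε ^ 2)⁻¹ * (t - t₀)) t * ψ v ^ 2 := by
    funext t
    simp [liftTest, smul_smul, hε.ne', mul_pow]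
  rw [h4, h3.deriv]
  ring

end Kernel

/-! ### The entropy flux in rescaled variables -/

section Flux

variable {k : ℝ → ℝ} {T M₀ E₀ H₀ m₀ ε t₀ : ℝ} {v₀ : E} {fin : E → ℝ} {f : ℝ → E → ℝ}

/-- The rescaled gradient of a solution. -/
def scaledGrad (T ε t₀ : ℝ) (v₀ : E) (f : ℝ → E → ℝ) (s : ℝ) (v : E) : E :=
  ε ^ 3 • gradV (Ioo 0 T) f (t₀ + ε ^ 2 * s) (v₀ + ε • v)

/-- The flux of the truncated entropy in the rescaled variables. -/
lemma IsHSolution.entropyFlux_rescale (hf : IsHSolution k T fin f)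
    (hk : IsCollisionKernel k) (hin : HydroBounds m₀ M₀ E₀ H₀ fin) (hε : 0 < ε) {κ lam : ℝ}
    (hκ : 0 ≤ κ) (hlam : ε ^ 2 * κ = lam) (χ : ℝ → ℝ) {ψ : E → ℝ}
    (hψ : ContDiff ℝ 1 ψ) {s₁ s₂ : ℝ} (h₁ : 0 < t₀ + ε ^ 2 * s₁) (h₂ : t₀ + ε ^ 2 * s₂ < T)
    {n : ℕ} (hn : 0 < n) :
    entropyFlux k T κ f (fun p => liftTest ε t₀ v₀ χ ψ p ^ 2) (t₀ + ε ^ 2 * s₁)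
        (t₀ + ε ^ 2 * s₂) n
      = ε * ∫ p in Icc s₁ s₂ ×ˢ (univ : Set E), χ p.1 ^ 2 *
          fluxDensity (cutC (fun r => k (ε * r)) (n * ε)) (scaled ε t₀ v₀ f p.1)
            (scaledGrad T ε t₀ v₀ f p.1) lam ψ p.2 := by
  have hW := hasWeakGradV_gradV hf.hasGrad
  -- The weak gradient of (f-κ)₊ in the flux is an abstract choice, replaced a.e. by 1_{f>κ}∇f.
  have hP := (hW.posPart isOpen_Ioo ordConnected_Ioo
    (fun t ht v => hf.nonneg t (Ioo_subset_Ico_self ht) v) hκ).gradV_ae_eq isOpen_Ioo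
    ordConnected_Ioo
  have hI : ∀ᵐ t ∂volume.restrict (Ioo 0 T), Integrable (f t) := by
    filter_upwards [hf.ae_bounds hin] with t ht using ht.2.1
  have hsub : (fun s : ℝ => t₀ + ε ^ 2 * s) ⁻¹' Icc (t₀ + ε ^ 2 * s₁) (t₀ + ε ^ 2 * s₂)
      = Icc s₁ s₂ := by
    ext s
    have : 0 < ε ^ 2 := by positivity
    simp [this]
  rw [entropyFlux, setIntegral_rescale (t₀ := t₀) (v₀ := v₀) hε, preimage_rescale_prod_univ,
    hsub, smul_eq_mul]
  have hJ : volume.restrict (Icc s₁ s₂ ×ˢ (univ : Set E))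
      ≤ volume.restrict (rescale hε.ne' t₀ v₀ ⁻¹' (Ioo 0 T ×ˢ univ)) := by
    refine Measure.restrict_mono ?_ le_rfl
    rw [preimage_rescale_prod_univ]
    refine prod_mono (fun s hs => ⟨h₁.trans_le ?_, lt_of_le_of_lt ?_ h₂⟩) le_rfl
    · exact add_le_add_right (mul_le_mul_of_nonneg_left hs.1 (sq_nonneg ε)) _
    · exact add_le_add_right (mul_le_mul_of_nonneg_left hs.2 (sq_nonneg ε)) _
  have hI2 : ∀ᵐ p ∂(volume : Measure (ℝ × E)).restrict (Ioo 0 T ×ˢ univ), Integrable (f p.1) := by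
    rw [volume_restrict_slab]
    exact Measure.quasiMeasurePreserving_fst.ae hI
  have a1 := ae_mono hJ ((quasiMeasurePreserving_rescale (t₀ := t₀) (v₀ := v₀) hε _).ae hP)
  have a2 := ae_mono hJ ((quasiMeasurePreserving_rescale (t₀ := t₀) (v₀ := v₀) hε _).ae hI2)
  -- The flux vector scales as ε⁻³ and the test field as ε⁻¹. Against the Jacobian ε⁵ of the
  -- parabolic change of variables this leaves one factor ε, also found in the other terms of the
  -- entropy inequality.
  have key : ∀ᵐ p ∂volume.restrict (Icc s₁ s₂ ×ˢ (univ : Set E)),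
      ⟪diffMatrix k n f (rescale hε.ne' t₀ v₀ p).1 (rescale hε.ne' t₀ v₀ p).2
          (gradV (Ioo 0 T) f (rescale hε.ne' t₀ v₀ p).1 (rescale hε.ne' t₀ v₀ p).2)
        - f (rescale hε.ne' t₀ v₀ p).1 (rescale hε.ne' t₀ v₀ p).2 •
          matDiv (diffMatrix k n f (rescale hε.ne' t₀ v₀ p).1) (rescale hε.ne' t₀ v₀ p).2,
        liftTest ε t₀ v₀ χ ψ (rescale hε.ne' t₀ v₀ p) ^ 2 •
          ((f (rescale hε.ne' t₀ v₀ p).1 (rescale hε.ne' t₀ v₀ p).2)⁻¹ •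
            gradV (Ioo 0 T) (fun t v => max (f t v - κ) 0) (rescale hε.ne' t₀ v₀ p).1
              (rescale hε.ne' t₀ v₀ p).2)
          + lnPlus (f (rescale hε.ne' t₀ v₀ p).1 (rescale hε.ne' t₀ v₀ p).2 / κ) •
            gradient (fun v => liftTest ε t₀ v₀ χ ψ ((rescale hε.ne' t₀ v₀ p).1, v) ^ 2)
              (rescale hε.ne' t₀ v₀ p).2⟫
      = (ε ^ 4)⁻¹ * (χ p.1 ^ 2 *
          fluxDensity (cutC (fun r => k (ε * r)) (n * ε)) (scaled ε t₀ v₀ f p.1)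
            (scaledGrad T ε t₀ v₀ f p.1) lam ψ p.2) := by
    filter_upwards [a1, a2] with p b1 b2
    obtain ⟨s, v⟩ := p
    simp only [rescale_apply] at b1 b2 ⊢
    have hgi : Integrable fun w => ε ^ 2 * f (t₀ + ε ^ 2 * s) (v₀ + ε • w) :=
      (integrable_comp_affine hε v₀ b2).const_mul _
    rw [b1, liftTest_rescale hε.ne', gradient_liftTest hε χ hψ, diffMatrix_rescale hε,
      matDiv_diffMatrix_rescale hk hε hn hgi]
    have e1 : scaled ε t₀ v₀ f s = fun w => ε ^ 2 * f (t₀ + ε ^ 2 * s) (v₀ + ε • w) := rfl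
    have hL : f (t₀ + ε ^ 2 * s) (v₀ + ε • v) / κ = scaled ε t₀ v₀ f s v / lam := by
      rw [e1, ← hlam, mul_div_mul_left _ _ (by positivity)]
    have hT : (f (t₀ + ε ^ 2 * s) (v₀ + ε • v))⁻¹ •
        {v | κ < f (t₀ + ε ^ 2 * s) v}.indicator (gradV (Ioo 0 T) f (t₀ + ε ^ 2 * s)) (v₀ + ε • v)
        = ε⁻¹ • gradTrunc (scaled ε t₀ v₀ f s) (scaledGrad T ε t₀ v₀ f s) lam v := by
      have hiff : lam < scaled ε t₀ v₀ f s v ↔ κ < f (t₀ + ε ^ 2 * s) (v₀ + ε • v) := by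
        rw [e1, ← hlam]
        exact mul_lt_mul_iff_right₀ (by positivity)
      unfold gradTrunc
      by_cases h : κ < f (t₀ + ε ^ 2 * s) (v₀ + ε • v)
      · rw [indicator_of_mem (show v₀ + ε • v ∈ {v | κ < f (t₀ + ε ^ 2 * s) v} from h),
          indicator_of_mem (show v ∈ {x | lam < scaled ε t₀ v₀ f s x} from hiff.2 h)]
        simp only [scaled, scaledGrad, smul_smul]
        congr 1
        field_simp
      · rw [indicator_of_notMem (show v₀ + ε • v ∉ {v | κ < f (t₀ + ε ^ 2 * s) v} from h),
          indicator_of_notMem (show v ∉ {x | lam < scaled ε t₀ v₀ f s x} from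
            fun h' => h (hiff.1 h'))]
        simp
    rw [hT, hL, fluxDensity, testField]
    have hG : gradV (Ioo 0 T) f (t₀ + ε ^ 2 * s) (v₀ + ε • v)
        = (ε ^ 3)⁻¹ • scaledGrad T ε t₀ v₀ f s v := by
      rw [scaledGrad, smul_smul, inv_mul_cancel₀ (by positivity), one_smul]
    have hF : f (t₀ + ε ^ 2 * s) (v₀ + ε • v) = (ε ^ 2)⁻¹ * scaled ε t₀ v₀ f s v := by
      rw [scaled, inv_mul_cancel_left₀ (by positivity)]
    rw [hG, hF, ← e1, map_smul]
    set K := convK (cutC (fun r => k (ε * r)) (n * ε)) (scaled ε t₀ v₀ f s) v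
      (scaledGrad T ε t₀ v₀ f s v)
    set D := convD (cutC (fun r => k (ε * r)) (n * ε)) (scaled ε t₀ v₀ f s) v
    set X := gradTrunc (scaled ε t₀ v₀ f s) (scaledGrad T ε t₀ v₀ f s) lam v
    set L := lnPlus (scaled ε t₀ v₀ f s v / lam)
    have x1 : (ε ^ 3)⁻¹ • K - ((ε ^ 2)⁻¹ * scaled ε t₀ v₀ f s v) • ε⁻¹ • D
        = (ε ^ 3)⁻¹ • (K - scaled ε t₀ v₀ f s v • D) := by
      rw [smul_sub, smul_smul, smul_smul]
      congr 2
      field_simp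
    have x2 : (χ s * ψ v) ^ 2 • ε⁻¹ • X + L • ε⁻¹ • (χ s ^ 2 * (2 * ψ v)) • gradient ψ v
        = (ε⁻¹ * χ s ^ 2) • (ψ v ^ 2 • X + (2 * L * ψ v) • gradient ψ v) := by
      module
    rw [x1, x2, inner_smul_left, inner_smul_right]
    simp only [conj_trivial]
    field_simp
  rw [integral_congr_ae key, integral_const_mul, ← mul_assoc]
  congr 1
  field_simp

end Flux

/-! ### The long-range weight and the class of rescaled solutions -/

lemma IsProfile.measurable_cutW {q : ℝ → ℝ} (hq : IsProfile q) {N : ℝ} (hN : 0 < N) :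
    Measurable (cutW q N) := by
  have h1 : cutW q N = ({r : ℝ | 1 / 2 ≤ N * r}).piecewise (fun r => q r / r) fun _ => 0 := by
    funext r
    simp only [cutW, piecewise, mem_ofPred_eq]
  rw [h1]
  refine ContinuousOn.measurable_piecewise ?_ continuousOn_const
    (measurableSet_le measurable_const (by fun_prop))
  refine (hq.contDiffOn.continuousOn.div continuousOn_id fun r hr => ne_of_gt hr).mono ?_
  exact fun r hr => pos_of_half_le hN hr

/-- The long-range weight of a function with few high values is controlled by its part outside
the unit ball. -/
lemma IsProfile.integral_cutW_le {q : ℝ → ℝ} (hq : IsProfile q) {k₁ δ Z : ℝ} (hk : q 1 ≤ k₁)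
    (hδ : 0 < δ) (hZ : 0 ≤ Z) {h : E → ℝ} (h0 : ∀ w, 0 ≤ h w)
    (hm : AEMeasurable h) {v : E} (hv : ‖v‖ < 1)
    (hfar : ∫⁻ w, ENNReal.ofReal
      (h w * (Metric.ball (0 : E) 1)ᶜ.indicator (fun z => q ‖z‖ / ‖z‖) (v - w)) ≤ ENNReal.ofReal Z)
    (hloc : ∫⁻ w in Metric.ball (0 : E) 2, ENNReal.ofReal (max (h w - 1) 0) ≤ 1) :
    Integrable (fun w => h w * cutW q (1 / δ) ‖v - w‖) ∧
      ∫ w, h w * cutW q (1 / δ) ‖v - w‖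
        ≤ Z + 2 * k₁ / δ * (volume.real (Metric.ball (0 : E) 2) + 1) := by
  have hδ' : (0 : ℝ) < 1 / δ := by positivity
  have hk0 : 0 < k₁ := (hq.pos 1 one_pos).trans_le hk
  set B := Metric.ball (0 : E) 2 with hB
  have hBm : MeasurableSet B := Metric.isOpen_ball.measurableSet
  have hBfin : volume B ≠ ⊤ := measure_ball_lt_top.ne
  have hpt : ∀ w, ENNReal.ofReal (h w * cutW q (1 / δ) ‖v - w‖)
      ≤ ENNReal.ofReal
        (h w * (Metric.ball (0 : E) 1)ᶜ.indicator (fun z => q ‖z‖ / ‖z‖) (v - w))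
      + B.indicator (fun w => ENNReal.ofReal (2 * k₁ / δ)
          * (1 + ENNReal.ofReal (max (h w - 1) 0))) w := fun w => by
    -- At distance at least 1 the weight is part of the long-range term. At smaller distance w lies
    -- in B₂, the weight is at most 2k₁/δ because |v-w| ≥ δ/2 on its support, and h ≤ 1 + (h-1)₊.
    rcases le_or_gt 1 ‖v - w‖ with h1 | h1
    · refine le_add_right (ENNReal.ofReal_le_ofReal (mul_le_mul_of_nonneg_left ?_ (h0 w)))
      rw [indicator_of_mem (by simpa using h1)]
      unfold cutW
      split_ifs
      · exact le_rfl
      · exact hq.div_nonneg (by linarith)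
    · have hw : w ∈ B := by
        rw [hB, Metric.mem_ball, dist_zero_right]
        calc ‖w‖ = ‖v - (v - w)‖ := by rw [sub_sub_cancel]
          _ ≤ ‖v‖ + ‖v - w‖ := norm_sub_le _ _
          _ < 2 := by linarith
      refine le_add_left ?_
      rw [indicator_of_mem hw, ← ENNReal.ofReal_one, ← ENNReal.ofReal_add zero_le_one
        (le_max_right _ _), ← ENNReal.ofReal_mul (by positivity)]
      apply ENNReal.ofReal_le_ofReal
      rw [mul_comm]
      have hc : cutW q (1 / δ) ‖v - w‖ ≤ 2 * k₁ / δ := by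
        unfold cutW
        split_ifs with h2
        · have hr := pos_of_half_le hδ' h2
          have h3 : δ / 2 ≤ ‖v - w‖ := by
            rw [one_div_mul_eq_div, le_div_iff₀ hδ] at h2
            linarith
          calc q ‖v - w‖ / ‖v - w‖ ≤ k₁ / (δ / 2) := by
                gcongr
                exact (hq.le_of_lt_one hr h1.le).trans hk
            _ = _ := by field_simp
        · positivity
      have hh : h w ≤ 1 + max (h w - 1) 0 := by
        have := le_max_left (h w - 1) 0
        linarith
      exact mul_le_mul hc hh (h0 w) (by positivity)
  have hm2 : AEMeasurable (fun w => B.indicator (fun w => ENNReal.ofReal (2 * k₁ / δ)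
      * (1 + ENNReal.ofReal (max (h w - 1) 0))) w) :=
    ((((hm.sub_const 1).max aemeasurable_const).ennreal_ofReal.const_add 1).const_mul _).indicator
      hBm
  have hle : ∫⁻ w, ENNReal.ofReal (h w * cutW q (1 / δ) ‖v - w‖) ≤ ENNReal.ofReal
      (Z + 2 * k₁ / δ * (volume.real B + 1)) := by
    refine (lintegral_mono hpt).trans ?_
    rw [lintegral_add_right' _ hm2, lintegral_indicator hBm,
      lintegral_const_mul' _ _ ENNReal.ofReal_ne_top, lintegral_add_left measurable_const,
      ENNReal.ofReal_add hZ (by positivity), ENNReal.ofReal_mul (by positivity),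
      ENNReal.ofReal_add (by positivity) zero_le_one, ofReal_measureReal]
    gcongr
    · simp
    · simpa using hloc
  have hmeas : AEStronglyMeasurable (fun w => h w * cutW q (1 / δ) ‖v - w‖) :=
    (hm.mul ((hq.measurable_cutW hδ').comp (by fun_prop : Measurable fun w : E => ‖v - w‖)
      ).aemeasurable).aestronglyMeasurable
  have hnn : ∀ w, 0 ≤ h w * cutW q (1 / δ) ‖v - w‖ := fun w =>
    mul_nonneg (h0 w) (hq.cutW_nonneg hδ')
  refine ⟨⟨hmeas, ?_⟩, ?_⟩
  · rw [hasFiniteIntegral_iff_ofReal (Eventually.of_forall hnn)]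
    exact hle.trans_lt ENNReal.ofReal_lt_top
  · rw [integral_eq_lintegral_of_nonneg_ae (Eventually.of_forall hnn) hmeas]
    exact ENNReal.toReal_le_of_le_ofReal (by positivity) hle

/-- The properties of rescaled solutions that are used in the De Giorgi iteration. -/
structure IsScaledSolution (q : ℝ → ℝ) (ε b M cc σ W : ℝ) (g : ℝ → E → ℝ) (G : ℝ → E → E) :
    Prop where
  profile : IsProfile q
  aesm : AEStronglyMeasurable (fun p : ℝ × E => g p.1 p.2) (volume.restrict (Ioo (-4) b ×ˢ univ))
  aesm_grad : AEStronglyMeasurable (fun p : ℝ × E => G p.1 p.2)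
    (volume.restrict (Ioo (-4) b ×ˢ univ))
  nonneg : ∀ s ∈ Ioo (-4) b, ∀ v, 0 ≤ g s v
  slice : ∀ᵐ s ∂volume.restrict (Ioo (-4) b),
    Integrable (g s) ∧ ∫ v, g s v ≤ M ∧ HasWeakGrad (g s) (G s)
  coercive : ∀ᵐ s ∂volume.restrict (Ioo (-4) b), ∀ (δ : ℝ) (v e : E), 0 < δ → δ ≤ σ → ‖v‖ < 1 →
    cc * ‖e‖ ^ 2 ≤ ⟪convK (cutC q (1 / δ)) (g s) v e, e⟫
  far : ∀ᵐ s ∂volume.restrict (Ioc (-1) 0), ∀ᵐ v : E, ∀ δ : ℝ, 0 < δ → δ ≤ 1 → ‖v‖ < 1 →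
    Integrable (fun w => g s w * cutW q (1 / δ) ‖v - w‖) ∧
      ∫ w, g s w * cutW q (1 / δ) ‖v - w‖ ≤ W / δ
  entropy : ∀ (χ : ℝ → ℝ) (ψ : E → ℝ), ContDiff ℝ ∞ χ → ContDiff ℝ ∞ ψ → HasCompactSupport χ →
    HasCompactSupport ψ → tsupport χ ⊆ Ioo (-4) b → ∀ κ : ℚ, 1 ≤ ε ^ 2 * (κ : ℝ) →
    ∃ N : Set ℝ, volume N = 0 ∧ ∀ s₁ ∈ Ioo (-4) b \ N, ∀ s₂ ∈ Ioo (-4) b \ N, s₁ < s₂ →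
      ∃ D : ℝ, Tendsto (fun n : ℕ => ∫ p in Icc s₁ s₂ ×ˢ (univ : Set E), χ p.1 ^ 2 *
          fluxDensity (cutC q (n * ε)) (g p.1) (G p.1) (ε ^ 2 * κ) ψ p.2) atTop (𝓝 D) ∧
        ∫ v, hPlus (ε ^ 2 * κ) (g s₂ v) * (χ s₂ * ψ v) ^ 2 ≤
          (∫ v, hPlus (ε ^ 2 * κ) (g s₁ v) * (χ s₁ * ψ v) ^ 2)
          + (∫ p in Icc s₁ s₂ ×ˢ (univ : Set E),
              hPlus (ε ^ 2 * κ) (g p.1 p.2) * (deriv (fun s => χ s ^ 2) p.1 * ψ p.2 ^ 2))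
          - D

section Flux

variable {k : ℝ → ℝ} {T M₀ E₀ H₀ m₀ ε t₀ : ℝ} {v₀ : E} {fin : E → ℝ} {f : ℝ → E → ℝ}

/-- Pure change of variables, each term carrying the same factor ε. As ε < 1, a scaled level ε²κ ≥ 1
forces κ ≥ 1, so the inequality is available at κ; and 4ε² ≤ t₀ keeps scaled times above -4 inside
(0,T). -/
lemma IsSuitable.entropy_rescale (hf : IsSuitable k T fin f)
    (hk : IsCollisionKernel k) (hin : HydroBounds m₀ M₀ E₀ H₀ fin) (hε : 0 < ε) (hε1 : ε < 1)
    (h4 : 4 * ε ^ 2 ≤ t₀) {χ : ℝ → ℝ} {ψ : E → ℝ} (hχ : ContDiff ℝ ∞ χ) (hψ : ContDiff ℝ ∞ ψ)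
    (hχc : HasCompactSupport χ) (hψc : HasCompactSupport ψ)
    (hχs : tsupport χ ⊆ Ioo (-4) ((T - t₀) / ε ^ 2)) (κ : ℚ) (hκ : 1 ≤ ε ^ 2 * (κ : ℝ)) :
    ∃ N : Set ℝ, volume N = 0 ∧ ∀ s₁ ∈ Ioo (-4) ((T - t₀) / ε ^ 2) \ N,
      ∀ s₂ ∈ Ioo (-4) ((T - t₀) / ε ^ 2) \ N, s₁ < s₂ →
      ∃ D : ℝ, Tendsto (fun n : ℕ => ∫ p in Icc s₁ s₂ ×ˢ (univ : Set E), χ p.1 ^ 2 *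
          fluxDensity (cutC (fun r => k (ε * r)) (n * ε)) (scaled ε t₀ v₀ f p.1)
            (scaledGrad T ε t₀ v₀ f p.1) (ε ^ 2 * κ) ψ p.2) atTop (𝓝 D) ∧
        ∫ v, hPlus (ε ^ 2 * κ) (scaled ε t₀ v₀ f s₂ v) * (χ s₂ * ψ v) ^ 2 ≤
          (∫ v, hPlus (ε ^ 2 * κ) (scaled ε t₀ v₀ f s₁ v) * (χ s₁ * ψ v) ^ 2)
          + (∫ p in Icc s₁ s₂ ×ˢ (univ : Set E),
              hPlus (ε ^ 2 * κ) (scaled ε t₀ v₀ f p.1 p.2)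
                * (deriv (fun s => χ s ^ 2) p.1 * ψ p.2 ^ 2))
          - D := by
  have he2 : 0 < ε ^ 2 := by positivity
  have htime : ∀ s ∈ Ioo (-4) ((T - t₀) / ε ^ 2), t₀ + ε ^ 2 * s ∈ Ioo 0 T := fun s hs => by
    have h1 := mul_lt_mul_of_pos_left hs.1 he2
    have h2 := mul_lt_mul_of_pos_left hs.2 he2
    rw [mul_div_cancel₀ _ he2.ne'] at h2
    constructor <;> linarith
  have hκ1 : (1 : ℝ) ≤ κ := by
    have : ε ^ 2 ≤ 1 := pow_le_one₀ hε.le hε1.le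
    have h0 : (0 : ℝ) ≤ κ := by
      by_contra hneg
      nlinarith [mul_neg_of_pos_of_neg he2 (not_le.1 hneg)]
    nlinarith
  have hs : tsupport (liftTest ε t₀ v₀ χ ψ) ⊆ Ioo 0 T ×ˢ univ := by
    refine (tsupport_liftTest hε χ ψ).trans ?_
    rintro _ ⟨p, hp, rfl⟩
    exact ⟨htime _ (hχs hp.1), mem_univ _⟩
  obtain ⟨N, hN, h⟩ := hf.localEntropy (liftTest ε t₀ v₀ χ ψ) (contDiff_liftTest hχ hψ)
    (hasCompactSupport_liftTest hε hχc hψc) hs κ (by exact_mod_cast hκ1)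
  refine ⟨(fun s => t₀ + ε ^ 2 * s) ⁻¹' N, ?_, fun s₁ hs₁ s₂ hs₂ hlt => ?_⟩
  · have := (quasiMeasurePreserving_time hε t₀ MeasurableSet.univ).preimage_null
      (s := N) (by simpa using hN)
    simpa using this
  · obtain ⟨D, hD, hle⟩ := h (t₀ + ε ^ 2 * s₁) ⟨htime _ hs₁.1, hs₁.2⟩ (t₀ + ε ^ 2 * s₂)
      ⟨htime _ hs₂.1, hs₂.2⟩ (by gcongr)
    refine ⟨ε⁻¹ * D, ?_, ?_⟩
    · refine (hD.const_mul ε⁻¹).congr' ?_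
      filter_upwards [eventually_gt_atTop 0] with n hn
      rw [hf.toIsHSolution.entropyFlux_rescale hk hin hε (by linarith) rfl χ
        (hψ.of_le (by simp)) (htime _ hs₁.1).1 (htime _ hs₂.1).2 hn,
        inv_mul_cancel_left₀ hε.ne']
    · have hterm : ∀ s, ∫ v, hPlus κ (f (t₀ + ε ^ 2 * s) v)
            * liftTest ε t₀ v₀ χ ψ (t₀ + ε ^ 2 * s, v) ^ 2
          = ε * ∫ v, hPlus (ε ^ 2 * κ) (scaled ε t₀ v₀ f s v) * (χ s * ψ v) ^ 2 := fun s => by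
        have h1 := integral_comp_affine (fun v => hPlus κ (f (t₀ + ε ^ 2 * s) v)
            * liftTest ε t₀ v₀ χ ψ (t₀ + ε ^ 2 * s, v) ^ 2) hε v₀
        have h2 : ∫ v, hPlus κ (f (t₀ + ε ^ 2 * s) (v₀ + ε • v))
            * liftTest ε t₀ v₀ χ ψ (t₀ + ε ^ 2 * s, v₀ + ε • v) ^ 2
            = (ε ^ 2)⁻¹ * ∫ v, hPlus (ε ^ 2 * κ) (scaled ε t₀ v₀ f s v) * (χ s * ψ v) ^ 2 := by
          rw [← integral_const_mul]
          congr 1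
          funext v
          rw [liftTest_rescale hε.ne', hPlus_rescale hε rfl, mul_assoc]
          rfl
        rw [h2, smul_eq_mul] at h1
        rw [← mul_right_inj' (show (ε ^ 3)⁻¹ ≠ 0 by positivity), ← h1, ← mul_assoc]
        congr 1
        field_simp
      have hprod : ∫ p in Icc (t₀ + ε ^ 2 * s₁) (t₀ + ε ^ 2 * s₂) ×ˢ (univ : Set E),
            hPlus κ (f p.1 p.2) * deriv (fun s => liftTest ε t₀ v₀ χ ψ (s, p.2) ^ 2) p.1
          = ε * ∫ p in Icc s₁ s₂ ×ˢ (univ : Set E),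
              hPlus (ε ^ 2 * κ) (scaled ε t₀ v₀ f p.1 p.2)
                * (deriv (fun s => χ s ^ 2) p.1 * ψ p.2 ^ 2) := by
        have hsub : (fun s : ℝ => t₀ + ε ^ 2 * s) ⁻¹' Icc (t₀ + ε ^ 2 * s₁) (t₀ + ε ^ 2 * s₂)
            = Icc s₁ s₂ := by
          ext s
          simp [he2]
        rw [setIntegral_rescale (t₀ := t₀) (v₀ := v₀) hε, preimage_rescale_prod_univ, hsub]
        rw [smul_eq_mul, ← integral_const_mul, ← integral_const_mul]
        congr 1
        funext p
        rw [rescale_apply, hPlus_rescale hε rfl,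
          deriv_liftTest hε (hχ.of_le (by simp) : ContDiff ℝ 1 χ)]
        simp only [scaled]
        field_simp
      rw [hterm, hterm, hprod] at hle
      have h5 := mul_le_mul_of_nonneg_left hle (inv_nonneg.2 hε.le)
      rw [mul_sub, mul_add, inv_mul_cancel_left₀ hε.ne', inv_mul_cancel_left₀ hε.ne',
        inv_mul_cancel_left₀ hε.ne'] at h5
      exact h5

end Flux

/-- The bounds for the values above the level `lam`: on the mass, at almost all times, and on
the Fisher information. -/
def LevelBound (g : ℝ → E → ℝ) (G : ℝ → E → E) (r lam U : ℝ) : Prop :=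
  (∀ᵐ s ∂volume.restrict (Ioc (-r ^ 2) 0),
    ∫⁻ v in Metric.ball (0 : E) r, ENNReal.ofReal (max (g s v - lam) 0) ≤ ENNReal.ofReal U) ∧
  ∫⁻ p in Ioc (-r ^ 2) 0 ×ˢ Metric.ball (0 : E) r,
    ENNReal.ofReal (fisher (g p.1) (G p.1) lam p.2) ≤ ENNReal.ofReal U

/-! ### The rescaled solution and the start of the iteration -/

section Init

variable {k : ℝ → ℝ} {T M₀ E₀ H₀ m₀ ε t₀ : ℝ} {v₀ : E} {fin : E → ℝ} {f : ℝ → E → ℝ}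

/-- Ellipticity is used at the points v₀ + εv, of norm at most ρ + 1. The mass bound of the scaled
function blows up as ε → 0, but it serves only for integrability. The quantitative constants are the
ellipticity constant, σ and the far bound, which is Z plus a multiple of k(1). -/
lemma IsSuitable.isScaledSolution (hf : IsSuitable k T fin f) (hk : IsCollisionKernel k)
    (hin : HydroBounds m₀ M₀ E₀ H₀ fin) (hε : 0 < ε) (hε1 : ε < 1)
    (h4 : 4 * ε ^ 2 ≤ t₀) (ht₀ : t₀ < T) {ρ R σ Z : ℝ} (hv₀ : ‖v₀‖ = ρ) (hR : 1 ≤ R) (hσ : 0 < σ)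
    (hco : ∀ f : E → ℝ, (∀ x, 0 ≤ f x) → Integrable f →
      m₀ ≤ ∫ x, f x → Integrable (fun x => f x * ‖x‖ ^ 2) → ∫ x, f x * ‖x‖ ^ 2 ≤ E₀ →
      Integrable (fun x => f x * Real.log (f x)) → ∫ x, f x * Real.log (f x) ≤ H₀ →
      ∀ v e : E, ‖v‖ ≤ ρ + 1 → ‖e‖ = 1 →
        m₀ / 2 ≤ ∫ w in {w | ‖v - w‖ ≤ R ∧ σ ^ 2 ≤ ‖v - w‖ ^ 2 - ⟪v - w, e⟫ ^ 2}, f w)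
    (hZ : 0 ≤ Z) (hfar : essSup (longRange k ε (scaled ε t₀ v₀ f))
      (volume.restrict (cylinder 1 0 0)) ≤ ENNReal.ofReal Z)
    (hloc : localQuantity (scaledTimes ε t₀ T) (scaled ε t₀ v₀ f) ≤ 1) :
    IsScaledSolution (fun r => k (ε * r)) ε ((T - t₀) / ε ^ 2) (ε ^ 2 * ((ε ^ 3)⁻¹ * M₀))
      (k 1 / R ^ 3 * σ ^ 2 * (m₀ / 2)) σ
      (Z + 2 * k 1 * (volume.real (Metric.ball (0 : E) 2) + 1))
      (scaled ε t₀ v₀ f) (scaledGrad T ε t₀ v₀ f) := by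
  have he2 : 0 < ε ^ 2 := by positivity
  set b := (T - t₀) / ε ^ 2 with hb
  have hb0 : 0 < b := div_pos (by linarith) he2
  have hq := hk.isProfile_scaled hε
  have htime : Ioo (-4) b ⊆ (fun s : ℝ => t₀ + ε ^ 2 * s) ⁻¹' Ioo 0 T := fun s hs => by
    have h1 := mul_lt_mul_of_pos_left hs.1 he2
    have h2 := mul_lt_mul_of_pos_left hs.2 he2
    rw [hb, mul_div_cancel₀ _ he2.ne'] at h2
    constructor <;> simp only <;> linarith
  have hW := hasWeakGradV_gradV hf.hasGrad
  have hIoc : Ioc (-1 : ℝ) 0 ⊆ Ioo (-4) b := fun s hs =>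
    ⟨by linarith [hs.1], hs.2.trans_lt hb0⟩
  have hJ : volume.restrict (Ioo (-4) b ×ˢ (univ : Set E))
      ≤ volume.restrict (rescale hε.ne' t₀ v₀ ⁻¹' (Ioo 0 T ×ˢ univ)) := by
    refine Measure.restrict_mono ?_ le_rfl
    rw [preimage_rescale_prod_univ]
    exact prod_mono htime le_rfl
  have hbd : ∀ᵐ s ∂volume.restrict (Ioo (-4) b), _ :=
    ae_mono (Measure.restrict_mono htime le_rfl)
      ((quasiMeasurePreserving_time hε t₀ measurableSet_Ioo).ae (hf.toIsHSolution.ae_bounds hin))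
  have hsl : ∀ᵐ s ∂volume.restrict (Ioo (-4) b), _ :=
    ae_mono (Measure.restrict_mono htime le_rfl)
      ((quasiMeasurePreserving_time hε t₀ measurableSet_Ioo).ae
        (hW.ae_hasWeakGrad isOpen_Ioo ordConnected_Ioo))
  refine ⟨hq, ?_, ?_, ?_, ?_, ?_, ?_, ?_⟩
  · exact ((hW.1.aestronglyMeasurable.comp_quasiMeasurePreserving
      (quasiMeasurePreserving_rescale (t₀ := t₀) (v₀ := v₀) hε _)).mono_measure hJ).const_mul _
  · have h := (hW.2.1.aestronglyMeasurable.comp_quasiMeasurePreserving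
      (quasiMeasurePreserving_rescale (t₀ := t₀) (v₀ := v₀) hε _)).mono_measure hJ
    exact h.const_smul (ε ^ 3)
  · exact fun s hs v => mul_nonneg he2.le (hf.nonneg _ (Ioo_subset_Ico_self (htime hs)) _)
  · filter_upwards [hbd, hsl] with s h1 h2
    obtain ⟨a1, a2, a3, a4, -⟩ := h1
    refine ⟨(integrable_comp_affine hε v₀ a2).const_mul _, ?_, ?_⟩
    · simp only [scaled]
      rw [integral_const_mul, integral_comp_affine _ hε, smul_eq_mul]
      gcongr
    · have h3 := h2.comp_affine hε v₀ (ε ^ 2)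
      rwa [← pow_succ] at h3
  · filter_upwards [hbd] with s h1 δ v e hδ hδσ hv
    obtain ⟨a1, a2, a3, a4, a5, a6, a7, a8⟩ := h1
    refine coercive_of_mass hk hR hσ hε hε1.le hδ hδσ a1 a2 (fun e he => ?_) e
    refine hco _ a1 a2 a3 a5 a6 a7 a8 _ e ?_ he
    refine (norm_add_le _ _).trans ?_
    rw [norm_smul, Real.norm_of_nonneg hε.le, hv₀]
    nlinarith [norm_nonneg v]
  · have h1 : ∀ᵐ p ∂(volume.restrict (Ioc (-1 : ℝ) 0)).prod
        (volume.restrict (Metric.ball (0 : E) 1)),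
        longRange k ε (scaled ε t₀ v₀ f) p ≤ ENNReal.ofReal Z := by
      rw [Measure.prod_restrict, ← Measure.volume_eq_prod]
      have h2 : cylinder 1 0 (0 : E) = Ioc (-1 : ℝ) 0 ×ˢ Metric.ball (0 : E) 1 := by
        simp [cylinder]
      rw [h2] at hfar
      filter_upwards [ENNReal.ae_le_essSup (μ := volume.restrict
        (Ioc (-1 : ℝ) 0 ×ˢ Metric.ball (0 : E) 1)) (longRange k ε (scaled ε t₀ v₀ f))] with p hp
      exact hp.trans hfar
    have h2 : ∀ᵐ s ∂volume.restrict (Ioc (-4 : ℝ) 0),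
        ∫⁻ v in Metric.ball (0 : E) 2, ENNReal.ofReal (max (scaled ε t₀ v₀ f s v - 1) 0) ≤ 1 := by
      filter_upwards [ENNReal.ae_le_essSup (μ := volume.restrict (Ioc (-4 : ℝ) 0))
        (fun t => ∫⁻ v in Metric.ball (0 : E) 2,
          ENNReal.ofReal (max (scaled ε t₀ v₀ f t v - 1) 0))] with s hs
      exact hs.trans (le_self_add.trans hloc)
    filter_upwards [Measure.ae_ae_of_ae_prod h1,
      ae_mono (Measure.restrict_mono (Ioc_subset_Ioc_left (by norm_num)) le_rfl) h2,
      ae_mono (Measure.restrict_mono hIoc le_rfl) hbd] with s a1 a2 a3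
    rw [ae_restrict_iff' Metric.isOpen_ball.measurableSet] at a1
    filter_upwards [a1] with v hv δ hδ hδ1 hv1
    obtain ⟨c1, c2⟩ := hq.integral_cutW_le (k₁ := k 1) (h := scaled ε t₀ v₀ f s) (v := v)
      (by
        simp only [mul_one]
        exact hk.mono hε (mem_Ioi.2 one_pos) hε1.le) hδ hZ
      (fun w => mul_nonneg he2.le (a3.1 _))
      ((integrable_comp_affine hε v₀ a3.2.1).const_mul _).aestronglyMeasurable.aemeasurable hv1
      (hv (by simpa using hv1)) a2
    refine ⟨c1, c2.trans ?_⟩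
    have h6 : 2 * k 1 / δ * (volume.real (Metric.ball (0 : E) 2) + 1)
        = 2 * k 1 * (volume.real (Metric.ball (0 : E) 2) + 1) / δ := by ring
    rw [add_div, h6]
    linarith [le_div_self hZ hδ hδ1]
  · exact fun χ ψ h1 h2 h3 h4' h5 κ h6 =>
      hf.entropy_rescale hk hin hε hε1 h4 h1 h2 h3 h4' h5 κ h6

/-- Above level 1, |∇g|²/g = 4|∇√g|²; hence the factor 4. The chosen gradient of √g is first
identified with the rescaled ∇f/(2√f). -/
lemma IsSuitable.levelBound_one (hf : IsSuitable k T fin f) (hk : IsCollisionKernel k)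
    (hin : HydroBounds m₀ M₀ E₀ H₀ fin) (hm₀ : 0 < m₀) (hε : 0 < ε)
    (h4 : 4 * ε ^ 2 ≤ t₀) (ht₀ : t₀ < T) {U : ℝ} (hU : 0 ≤ U)
    (hloc : localQuantity (scaledTimes ε t₀ T) (scaled ε t₀ v₀ f) ≤ ENNReal.ofReal U) :
    LevelBound (scaled ε t₀ v₀ f) (scaledGrad T ε t₀ v₀ f) 1 1 (4 * U) := by
  have he2 : 0 < ε ^ 2 := by positivity
  have h14 : Ioc (-1 ^ 2 : ℝ) 0 ⊆ Ioc (-4 : ℝ) 0 := Ioc_subset_Ioc_left (by norm_num)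
  have hUU : ENNReal.ofReal U ≤ ENNReal.ofReal (4 * U) := ENNReal.ofReal_le_ofReal (by linarith)
  constructor
  · filter_upwards [ae_mono (Measure.restrict_mono h14 le_rfl)
      (ENNReal.ae_le_essSup (μ := volume.restrict (Ioc (-4 : ℝ) 0))
        (fun t => ∫⁻ v in Metric.ball (0 : E) 2,
          ENNReal.ofReal (max (scaled ε t₀ v₀ f t v - 1) 0)))] with s hs
    refine (lintegral_mono_set (Metric.ball_subset_ball one_le_two)).trans ?_
    exact hs.trans (le_self_add.trans (hloc.trans hUU))
  · have hS := (hf.toIsHSolution.hasWeakGradV_sqrt hk hin hm₀).rescale isOpen_Ioo ordConnected_Ioo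
      hε t₀ v₀ ε
    have hst : {s | t₀ + ε ^ 2 * s ∈ Ioo 0 T} = scaledTimes ε t₀ T := rfl
    have hop : IsOpen (scaledTimes ε t₀ T) := isOpen_Ioo.preimage (by fun_prop)
    have hoc : (scaledTimes ε t₀ T).OrdConnected := by
      refine ⟨fun x hx y hy z hz => ordConnected_Ioo.out hx hy ⟨?_, ?_⟩⟩
      · have := hz.1; gcongr
      · have := hz.2; gcongr
    have hsq : (fun (s : ℝ) (v : E) => ε * √(f (t₀ + ε ^ 2 * s) (v₀ + ε • v)))
        = fun s v => √(scaled ε t₀ v₀ f s v) := by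
      funext s v
      rw [scaled, Real.sqrt_mul he2.le, Real.sqrt_sq hε.le]
    rw [hst, hsq] at hS
    have hae := hS.gradV_ae_eq hop hoc
    have hsub : Ioc (-4 : ℝ) 0 ×ˢ Metric.ball (0 : E) 2 ⊆ scaledTimes ε t₀ T ×ˢ univ := by
      refine prod_mono (fun s hs => ?_) (subset_univ _)
      have h1 := mul_lt_mul_of_pos_left hs.1 he2
      have h2 := mul_le_mul_of_nonneg_left hs.2 he2.le
      constructor <;> linarith
    have hae2 := ae_mono (Measure.restrict_mono hsub le_rfl) hae
    have hcyl : cylinder 2 0 (0 : E) = Ioc (-4 : ℝ) 0 ×ˢ Metric.ball (0 : E) 2 := by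
      simp [cylinder]
      norm_num
    have hms : MeasurableSet (Ioc (-4 : ℝ) 0 ×ˢ Metric.ball (0 : E) 2) :=
      measurableSet_Ioc.prod Metric.isOpen_ball.measurableSet
    have h2 : ∫⁻ p in Ioc (-4 : ℝ) 0 ×ˢ Metric.ball (0 : E) 2,
        ENNReal.ofReal (fisher (scaled ε t₀ v₀ f p.1) (scaledGrad T ε t₀ v₀ f p.1) 1 p.2)
        ≤ ENNReal.ofReal 4 * ∫⁻ p in cylinder 2 0 0,
          {p : ℝ × E | 1 ≤ scaled ε t₀ v₀ f p.1 p.2}.indicator (fun p =>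
          ‖gradV (scaledTimes ε t₀ T) (fun t v => √(scaled ε t₀ v₀ f t v)) p.1 p.2‖ₑ ^ 2) p := by
      rw [hcyl, ← lintegral_const_mul' _ _ ENNReal.ofReal_ne_top]
      refine lintegral_mono_ae ?_
      filter_upwards [hae2] with p hp
      simp only [fisher]
      by_cases h : 1 < scaled ε t₀ v₀ f p.1 p.2
      · rw [indicator_of_mem (show p.2 ∈ {x | 1 < scaled ε t₀ v₀ f p.1 x} from h),
          indicator_of_mem (show p ∈ {p : ℝ × E | 1 ≤ scaled ε t₀ v₀ f p.1 p.2} from h.le)]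
        rw [hp, ← ofReal_norm, ← ENNReal.ofReal_pow (norm_nonneg _),
          ← ENNReal.ofReal_mul (by norm_num)]
        apply ENNReal.ofReal_le_ofReal
        have hF : 0 < f (t₀ + ε ^ 2 * p.1) (v₀ + ε • p.2) := by
          have h0 : 0 < ε ^ 2 * f (t₀ + ε ^ 2 * p.1) (v₀ + ε • p.2) :=
            one_pos.trans h
          exact (mul_pos_iff_of_pos_left he2).1 h0
        simp only [scaledGrad, scaled, norm_smul, norm_mul, norm_inv, norm_pow,
          Real.norm_of_nonneg hε.le, Real.norm_of_nonneg (Real.sqrt_nonneg _), mul_pow, inv_pow,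
          Real.sq_sqrt hF.le]
        norm_num
        apply le_of_eq
        field_simp
      · rw [indicator_of_notMem (show p.2 ∉ {x | 1 < scaled ε t₀ v₀ f p.1 x} from h)]
        simp
    refine (lintegral_mono_set (Set.prod_mono h14 (Metric.ball_subset_ball one_le_two))).trans
      (h2.trans ?_)
    rw [ENNReal.ofReal_mul (by norm_num)]
    gcongr
    exact le_add_self.trans hloc

end Init

/-! ### Cutoff functions -/

/-- Every nonpositive point is a global minimum. This covers the boundary value u = 0, so cutoffs
have zero gradient on the closed exterior of their ball. -/
lemma deriv_smoothTransition_of_nonpos {u : ℝ} (hu : u ≤ 0) :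
    deriv Real.smoothTransition u = 0 := by
  apply IsLocalMin.deriv_eq_zero
  refine Eventually.of_forall fun y => ?_
  rw [Real.smoothTransition.zero_of_nonpos hu]
  exact Real.smoothTransition.nonneg y

/-- The cutoff is a function of (r₂² - |x|²)/(r₂² - r₁²), smooth also at the origin. Its gradient is
at most 2C r₂/((r₂-r₁)(r₂+r₁)) ≤ 2C/(r₂-r₁). -/
lemma exists_space_cutoff : ∃ C : ℝ, 1 ≤ C ∧ ∀ r₁ r₂ : ℝ, 0 < r₁ → r₁ < r₂ → ∃ ψ : E → ℝ,
    ContDiff ℝ ∞ ψ ∧ HasCompactSupport ψ ∧ IsCut ψ r₂ (C / (r₂ - r₁)) ∧ ∀ x, ‖x‖ < r₁ → ψ x = 1 := by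
  obtain ⟨C, hC1, hC⟩ := exists_smoothTransition_deriv_bound
  refine ⟨2 * C, by linarith, fun r₁ r₂ h1 h12 => ?_⟩
  set d := r₂ ^ 2 - r₁ ^ 2 with hd
  have hd0 : 0 < d := by rw [hd]; nlinarith
  have h21 : 0 < r₂ - r₁ := by linarith
  set u : E → ℝ := fun x => (r₂ ^ 2 - ‖x‖ ^ 2) / d with hu
  have hus : ContDiff ℝ ∞ u := (contDiff_const.sub (contDiff_norm_sq ℝ)).div_const d
  set ψ : E → ℝ := fun x => Real.smoothTransition (u x) with hψ
  have hψs : ContDiff ℝ ∞ ψ := Real.smoothTransition.contDiff.comp hus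
  have hneg : ∀ x, r₂ ≤ ‖x‖ → u x ≤ 0 := fun x hx =>
    div_nonpos_of_nonpos_of_nonneg (by nlinarith) hd0.le
  have hzero : ∀ x, r₂ ≤ ‖x‖ → ψ x = 0 := fun x hx =>
    Real.smoothTransition.zero_of_nonpos (hneg x hx)
  have hgr : ∀ x, gradient ψ x = (deriv Real.smoothTransition (u x) * (-(2 / d))) • x := fun x => by
    have e1 : HasFDerivAt u ((-(2 / d)) • innerSL ℝ x) x := by
      have := ((hasStrictFDerivAt_norm_sq x).hasFDerivAt.const_sub (r₂ ^ 2)).mul_const d⁻¹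
      refine this.congr_fderiv ?_
      ext y
      simp
      ring
    have e2 := ((Real.smoothTransition.contDiff (n := 1)).differentiable one_ne_zero
      (u x)).hasDerivAt.comp_hasFDerivAt x e1
    refine HasGradientAt.gradient ?_
    rw [hasGradientAt_iff_hasFDerivAt]
    refine e2.congr_fderiv ?_
    ext y
    simp
    ring
  have hgz : ∀ x, r₂ ≤ ‖x‖ → gradient ψ x = 0 := fun x hx => by
    rw [hgr, deriv_smoothTransition_of_nonpos (hneg x hx), zero_mul, zero_smul]
  have hgle : ∀ x, ‖gradient ψ x‖ ≤ 2 * C / (r₂ - r₁) := fun x => by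
    rcases le_or_gt r₂ ‖x‖ with hx | hx
    · rw [hgz x hx, norm_zero]
      positivity
    · rw [hgr, norm_smul, norm_mul, norm_neg, Real.norm_of_nonneg (show 0 ≤ 2 / d by positivity)]
      calc _ ≤ C * (2 / d) * r₂ := by
            gcongr
            exact hC _
        _ ≤ _ := by
            rw [mul_assoc, mul_comm 2 C, mul_div_assoc]
            refine mul_le_mul_of_nonneg_left ?_ (by linarith)
            rw [div_mul_eq_mul_div, div_le_div_iff₀ hd0 h21]
            have : d = (r₂ - r₁) * (r₂ + r₁) := by rw [hd]; ring
            rw [this]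
            nlinarith [mul_pos h21 h1]
  refine ⟨ψ, hψs, HasCompactSupport.intro (isCompact_closedBall (0 : E) r₂) fun x hx => ?_,
    ⟨hψs.of_le (by simp), fun x => Real.smoothTransition.nonneg _,
      fun x => Real.smoothTransition.le_one _, hzero, hgz, hgle, fun x y => ?_⟩, fun x hx => ?_⟩
  · simp only [Metric.mem_closedBall, dist_zero_right, not_le] at hx
    exact hzero x hx.le
  · refine convex_univ.norm_image_sub_le_of_norm_fderiv_le (𝕜 := ℝ)
      (fun z _ => hψs.differentiable (by simp) z) (fun z _ => ?_) (mem_univ y) (mem_univ x)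
    have := hgle z
    rwa [gradient, LinearIsometryEquiv.norm_map] at this
  · refine Real.smoothTransition.one_of_one_le ?_
    rw [hu]
    simp only
    rw [le_div_iff₀ hd0]
    nlinarith [norm_nonneg x]

/-- A rise between a and c is multiplied by a descent between b/4 and b/2. The descent only provides
compact support: it takes place at positive times and is invisible for s ≤ 0. -/
lemma exists_time_cutoff : ∃ C : ℝ, 1 ≤ C ∧ ∀ a c b : ℝ, -4 < a → a < c → 0 < b →
    ∃ χ : ℝ → ℝ, ContDiff ℝ ∞ χ ∧ HasCompactSupport χ ∧ tsupport χ ⊆ Ioo (-4) b ∧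
      (∀ s, 0 ≤ χ s) ∧ (∀ s, χ s ≤ 1) ∧ (∀ s ≤ a, χ s = 0) ∧ (∀ s ∈ Icc c 0, χ s = 1) ∧
      (∀ s ≤ 0, |deriv (fun s => χ s ^ 2) s| ≤ C / (c - a)) ∧
      ∀ s ≤ a, s ≤ 0 → deriv (fun s => χ s ^ 2) s = 0 := by
  obtain ⟨C, hC1, hC⟩ := exists_smoothTransition_deriv_bound
  refine ⟨2 * C, by linarith, fun a c b h4 hac hb => ?_⟩
  have hca : 0 < c - a := by linarith
  set S := Real.smoothTransition
  set χ : ℝ → ℝ := fun s => S ((s - a) / (c - a)) * S ((b / 2 - s) / (b / 4)) with hχ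
  have hs : ContDiff ℝ ∞ χ :=
    (Real.smoothTransition.contDiff.comp (by fun_prop)).mul
      (Real.smoothTransition.contDiff.comp (by fun_prop))
  have hz1 : ∀ s ≤ a, χ s = 0 := fun s hsa => by
    have : S ((s - a) / (c - a)) = 0 := Real.smoothTransition.zero_of_nonpos
      (div_nonpos_of_nonpos_of_nonneg (by linarith) hca.le)
    simp only [hχ, this, zero_mul]
  have hz2 : ∀ s, b / 2 ≤ s → χ s = 0 := fun s hsb => by
    have : S ((b / 2 - s) / (b / 4)) = 0 := Real.smoothTransition.zero_of_nonpos
      (div_nonpos_of_nonpos_of_nonneg (by linarith) (by linarith))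
    simp only [hχ, this, mul_zero]
  have hsupp : tsupport χ ⊆ Icc a (b / 2) := by
    refine closure_minimal (fun s h => ⟨?_, ?_⟩) isClosed_Icc
    · by_contra hlt
      exact h (hz1 s (not_le.1 hlt).le)
    · by_contra hlt
      exact h (hz2 s (not_le.1 hlt).le)
  have hone : ∀ s ≤ b / 4, χ s = S ((s - a) / (c - a)) := fun s hsb => by
    have : S ((b / 2 - s) / (b / 4)) = 1 := Real.smoothTransition.one_of_one_le (by
      rw [le_div_iff₀ (by linarith)]; linarith)
    simp only [hχ, this, mul_one]
  have hder : ∀ s ≤ 0, deriv (fun s => χ s ^ 2) s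
      = 2 * S ((s - a) / (c - a)) * (deriv S ((s - a) / (c - a)) * (1 / (c - a))) := fun s hs0 => by
    have e1 : (fun s => χ s ^ 2) =ᶠ[𝓝 s] fun s => S ((s - a) / (c - a)) ^ 2 := by
      filter_upwards [gt_mem_nhds (show s < b / 4 by linarith)] with y hy
      rw [hone y hy.le]
    have e2 : HasDerivAt (fun s : ℝ => (s - a) / (c - a)) (1 / (c - a)) s :=
      ((hasDerivAt_id s).sub_const a).div_const _
    have e3 : HasDerivAt (fun s => S ((s - a) / (c - a))) _ s :=
      HasDerivAt.comp (h₂ := S) (h := fun s => (s - a) / (c - a)) s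
        ((Real.smoothTransition.contDiff (n := 1)).differentiable one_ne_zero _).hasDerivAt e2
    rw [e1.deriv_eq]
    refine (e3.pow 2).deriv.trans ?_
    simp [S]
  have h0 : ∀ s, 0 ≤ χ s := fun s =>
    mul_nonneg (Real.smoothTransition.nonneg _) (Real.smoothTransition.nonneg _)
  refine ⟨χ, hs, isCompact_Icc.of_isClosed_subset (isClosed_tsupport _) hsupp,
    hsupp.trans fun s h => ⟨by linarith [h.1], by linarith [h.2]⟩, h0,
    fun s => mul_le_one₀ (Real.smoothTransition.le_one _) (Real.smoothTransition.nonneg _)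
      (Real.smoothTransition.le_one _), hz1, fun s h => ?_, fun s h => ?_, fun s h h' => ?_⟩
  · rw [hone s (by linarith [h.2])]
    exact Real.smoothTransition.one_of_one_le (by rw [le_div_iff₀ hca]; linarith [h.1])
  · rw [hder s h, abs_mul, abs_mul, abs_mul, abs_of_nonneg (Real.smoothTransition.nonneg _),
      abs_of_pos (one_div_pos.2 hca), abs_two]
    calc _ ≤ 2 * 1 * (C * (1 / (c - a))) := by
          gcongr
          · exact Real.smoothTransition.le_one _
          · exact hC _
      _ = _ := by ring
  · have h5 : S ((s - a) / (c - a)) = 0 := Real.smoothTransition.zero_of_nonpos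
      (div_nonpos_of_nonpos_of_nonneg (by linarith) hca.le)
    rw [hder s h', h5, mul_zero, zero_mul]

/-! ### Gain of integrability -/

/-- √x - √λ ≥ (x-λ)/(2√x), and x - λ ≥ θx/2 when x exceeds λ + θ, because the levels stay below 2.
-/
lemma sqrt_sub_sqrt_ge {x lam lam₁ θ : ℝ} (hlam : 0 ≤ lam) (hθ : 0 < θ) (h1 : lam + θ ≤ lam₁)
    (h2 : lam₁ ≤ 2) (hx : lam₁ < x) : θ / 4 * √x ≤ √x - √lam := by
  have hx0 : 0 < x := by linarith
  have a1 := Real.sq_sqrt hx0.le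
  have a2 := Real.sq_sqrt hlam
  have a3 : √lam ≤ √x := Real.sqrt_le_sqrt (by linarith)
  have a4 := Real.sqrt_pos.2 hx0
  have a5 := Real.sqrt_nonneg lam
  have a6 : θ * x / 2 ≤ x - lam := by nlinarith
  have a7 : x - lam ≤ (√x - √lam) * (2 * √x) := by nlinarith
  by_contra hneg
  push Not at hneg
  nlinarith [mul_lt_mul_of_pos_right hneg (show 0 < 2 * √x by linarith)]

/-- Local Sobolev inequality for (√h - √λ)₊, whose square is at most (h-λ)₊ and whose squared
gradient is at most the Fisher density. Above λ₁ ≥ λ + θ this function is at least (θ/4)√h, and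
(√h)^{10/3} = h^{5/3}. The exponent 10/3 of θ/4 ≤ 1 is rounded up to 4. -/
lemma lintegral_highPow_le {C : NNReal} (hC : ∀ (y : E → ℝ) (H : E → E), HasWeakGrad y H →
    ∀ (χ : E → ℝ) (B : Set E) (Λ : NNReal), ContDiff ℝ 1 χ → HasCompactSupport χ →
    MeasurableSet B → (∀ x, |χ x| ≤ 1) → (∀ x, ‖gradient χ x‖ ≤ Λ) → (∀ x ∉ B, χ x = 0) →
    (∀ x ∉ B, gradient χ x = 0) →
    ∫⁻ x, ‖χ x * y x‖ₑ ^ (10 / 3 : ℝ) ≤ C * (∫⁻ x in B, ‖y x‖ₑ ^ 2) ^ (2 / 3 : ℝ) *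
      ((∫⁻ x in B, ‖H x‖ₑ ^ 2) + Λ ^ 2 * ∫⁻ x in B, ‖y x‖ₑ ^ 2))
    {h : E → ℝ} {H : E → E} (hh : HasWeakGrad h H) (h0 : ∀ x, 0 ≤ h x)
    {lam lam₁ θ r U : ℝ} {Λ : NNReal} (hlam : 1 ≤ lam) (hθ : 0 < θ) (h1 : lam + θ ≤ lam₁)
    (h2 : lam₁ ≤ 2) {ψ : E → ℝ} (hψ : IsCut ψ r Λ) (hψc : HasCompactSupport ψ)
    (hψ1 : ∀ x, ‖x‖ < r - θ → ψ x = 1)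
    (hU : ∫⁻ v in Metric.ball (0 : E) r, ENNReal.ofReal (max (h v - lam) 0) ≤ ENNReal.ofReal U) :
    ENNReal.ofReal ((θ / 4) ^ 4) *
        ∫⁻ v in Metric.ball (0 : E) (r - θ), ENNReal.ofReal (highPow h lam₁ (5 / 3) v)
      ≤ C * ENNReal.ofReal U ^ (2 / 3 : ℝ) *
        ((∫⁻ v in Metric.ball (0 : E) r, ENNReal.ofReal (fisher h H lam v))
          + Λ ^ 2 * ENNReal.ofReal U) := by
  have hl0 : 0 < lam := by linarith
  have hB : MeasurableSet (Metric.ball (0 : E) r) := Metric.isOpen_ball.measurableSet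
  have hout : ∀ x ∉ Metric.ball (0 : E) r, r ≤ ‖x‖ := fun x hx => by simpa using hx
  have key := hC _ _ (hh.sqrt_sub h0 hl0) ψ (Metric.ball 0 r) Λ hψ.contDiff hψc hB
    (fun x => by rw [abs_of_nonneg (hψ.nonneg x)]; exact hψ.le_one x) hψ.grad_le
    (fun x hx => hψ.zero x (hout x hx)) (fun x hx => hψ.grad_zero x (hout x hx))
  have hy : ∫⁻ x in Metric.ball (0 : E) r, ‖max (√(h x) - √lam) 0‖ₑ ^ 2 ≤ ENNReal.ofReal U := by
    refine le_trans (lintegral_mono fun x => ?_) hU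
    rw [Real.enorm_of_nonneg (le_max_right _ _), ← ENNReal.ofReal_pow (le_max_right _ _)]
    apply ENNReal.ofReal_le_ofReal
    have a1 := Real.sq_sqrt (h0 x)
    have a2 := Real.sq_sqrt hl0.le
    have a3 := Real.sqrt_nonneg lam
    rcases le_total (√(h x) - √lam) 0 with h3 | h3
    · rw [max_eq_right h3]
      simp
    · rw [max_eq_left h3]
      exact le_max_of_le_left (by nlinarith)
  have hH : ∫⁻ x in Metric.ball (0 : E) r,
      ‖{x | lam < h x}.indicator (fun x => (2 * √(h x))⁻¹ • H x) x‖ₑ ^ 2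
      ≤ ∫⁻ v in Metric.ball (0 : E) r, ENNReal.ofReal (fisher h H lam v) := by
    refine lintegral_mono fun x => ?_
    unfold fisher
    by_cases hx : lam < h x
    · rw [indicator_of_mem (show x ∈ {x | lam < h x} from hx),
        indicator_of_mem (show x ∈ {x | lam < h x} from hx), ← ofReal_norm,
        ← ENNReal.ofReal_pow (norm_nonneg _)]
      apply ENNReal.ofReal_le_ofReal
      have hx0 : 0 < h x := hl0.trans hx
      rw [norm_smul, norm_inv, norm_mul, Real.norm_of_nonneg (Real.sqrt_nonneg _), mul_pow, inv_pow,
        mul_pow, Real.sq_sqrt hx0.le, Real.norm_two, mul_inv, div_eq_inv_mul]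
      have : 0 ≤ (h x)⁻¹ * ‖H x‖ ^ 2 := by positivity
      norm_num
      nlinarith
    · rw [indicator_of_notMem (show x ∉ {x | lam < h x} from hx)]
      simp
  have hlow : ENNReal.ofReal ((θ / 4) ^ 4) *
        ∫⁻ v in Metric.ball (0 : E) (r - θ), ENNReal.ofReal (highPow h lam₁ (5 / 3) v)
      ≤ ∫⁻ x, ‖ψ x * max (√(h x) - √lam) 0‖ₑ ^ (10 / 3 : ℝ) := by
    rw [← lintegral_const_mul' _ _ ENNReal.ofReal_ne_top]
    refine le_trans (setLIntegral_mono' Metric.isOpen_ball.measurableSet fun x hx => ?_)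
      (setLIntegral_le_lintegral _ _)
    rw [hψ1 x (by simpa using hx), one_mul]
    unfold highPow
    by_cases hx1 : lam₁ < h x
    · rw [indicator_of_mem (show x ∈ {x | lam₁ < h x} from hx1),
        Real.enorm_of_nonneg (le_max_right _ _), ENNReal.ofReal_rpow_of_nonneg (le_max_right _ _)
        (by norm_num), ← ENNReal.ofReal_mul (by positivity)]
      apply ENNReal.ofReal_le_ofReal
      have e1 := sqrt_sub_sqrt_ge hl0.le hθ h1 h2 hx1
      have e2 : θ / 4 ≤ 1 := by linarith
      calc (θ / 4) ^ 4 * h x ^ (5 / 3 : ℝ)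
          ≤ (θ / 4) ^ (10 / 3 : ℝ) * h x ^ (5 / 3 : ℝ) := by
            have e3 := h0 x
            gcongr
            rw [← Real.rpow_natCast]
            exact Real.rpow_le_rpow_of_exponent_ge (by positivity) e2 (by norm_num)
        _ = (θ / 4 * √(h x)) ^ (10 / 3 : ℝ) := by
            rw [Real.mul_rpow (by positivity) (Real.sqrt_nonneg _), Real.sqrt_eq_rpow,
              ← Real.rpow_mul (h0 x)]
            norm_num
        _ ≤ _ := by
            refine Real.rpow_le_rpow (by positivity) (e1.trans (le_max_left _ _)) (by norm_num)
    · rw [indicator_of_notMem (show x ∉ {x | lam₁ < h x} from hx1)]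
      simp
  refine hlow.trans (key.trans ?_)
  gcongr

lemma IsScaledSolution.aemeasurable_highPow {q : ℝ → ℝ} {ε b M cc σ W : ℝ} {g : ℝ → E → ℝ}
    {G : ℝ → E → E} (hs : IsScaledSolution q ε b M cc σ W g G) (lam p : ℝ) {A : Set (ℝ × E)}
    (hA : A ⊆ Ioo (-4) b ×ˢ univ) :
    AEMeasurable (fun x : ℝ × E => highPow (g x.1) lam p x.2) (volume.restrict A) ∧
    AEMeasurable (fun x : ℝ × E => fisher (g x.1) (G x.1) lam x.2) (volume.restrict A) ∧
    AEMeasurable (fun x : ℝ × E => highPart (g x.1) lam x.2) (volume.restrict A) := by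
  have hg := (hs.aesm.mono_set hA).aemeasurable
  have hG := (hs.aesm_grad.mono_set hA).norm.aemeasurable
  have hT : NullMeasurableSet {x : ℝ × E | lam < g x.1 x.2} (volume.restrict A) :=
    nullMeasurableSet_lt aemeasurable_const hg
  exact ⟨(hg.pow_const p).indicator₀ hT, ((hG.pow_const 2).div hg).indicator₀ hT, hg.indicator₀ hT⟩

/-- Integrating in time, the L² factor contributes U^{2/3} and the gradient factor U(1 + D²/θ²), on
an interval of length at most 1. The power θ⁻⁶ is θ⁻⁴ from the change of level times θ⁻² from the
spatial cutoff. -/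
lemma exists_gain : ∃ K : ℝ, 0 ≤ K ∧ ∀ (q : ℝ → ℝ) (ε b M cc σ W : ℝ) (g : ℝ → E → ℝ)
    (G : ℝ → E → E), IsScaledSolution q ε b M cc σ W g G → 0 < b →
    ∀ r θ lam lam₁ U : ℝ, 0 < θ → θ < r → r ≤ 1 → 1 ≤ lam → lam + θ ≤ lam₁ → lam₁ ≤ 2 → 0 ≤ U →
    LevelBound g G r lam U →
    ∫⁻ p in Ioc (-r ^ 2) 0 ×ˢ Metric.ball (0 : E) (r - θ),
      ENNReal.ofReal (highPow (g p.1) lam₁ (5 / 3) p.2)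
        ≤ ENNReal.ofReal (K * (1 / θ) ^ 6 * U ^ (5 / 3 : ℝ)) := by
  obtain ⟨C, hC⟩ := exists_local_sobolev_const
  obtain ⟨D, hD1, hD⟩ := exists_space_cutoff
  refine ⟨C * 256 * (1 + D ^ 2), by positivity, fun q ε b M cc σ W g G hs hb r θ lam lam₁ U hθ hθr
    hr hlam h1 h2 hU0 hU => ?_⟩
  obtain ⟨ψ, hψs, hψc, hψ, hψ1⟩ := hD (r - θ) r (by linarith) (by linarith)
  rw [sub_sub_cancel] at hψ
  have hDθ : 0 ≤ D / θ := by positivity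
  set Λ : NNReal := ⟨D / θ, hDθ⟩ with hΛ
  have hψ' : IsCut ψ r Λ := hψ
  set J := Ioc (-r ^ 2) (0 : ℝ) with hJ
  have hr0 : 0 < r := by linarith
  have hJs : J ⊆ Ioo (-4) b := fun s hs => ⟨by nlinarith [hs.1], hs.2.trans_lt hb⟩
  have hA : J ×ˢ Metric.ball (0 : E) r ⊆ Ioo (-4) b ×ˢ univ := Set.prod_mono hJs (subset_univ _)
  have hsub : J ×ˢ Metric.ball (0 : E) (r - θ) ⊆ J ×ˢ Metric.ball (0 : E) r :=
    Set.prod_mono le_rfl (Metric.ball_subset_ball (by linarith))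
  have hpr : ∀ ρ : ℝ, (volume : Measure (ℝ × E)).restrict (J ×ˢ Metric.ball (0 : E) ρ)
      = (volume.restrict J).prod (volume.restrict (Metric.ball 0 ρ)) := fun ρ => by
    rw [Measure.volume_eq_prod, Measure.prod_restrict]
  have m1 := (hs.aemeasurable_highPow lam₁ (5 / 3) (hsub.trans hA)).1.ennreal_ofReal
  have m2 := (hs.aemeasurable_highPow lam 0 hA).2.1.ennreal_ofReal
  have hF := hU.2
  rw [hpr] at m1 m2 hF ⊢
  rw [lintegral_prod _ m1]
  rw [lintegral_prod _ m2] at hF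
  have hsl : ∀ᵐ s ∂volume.restrict J, ENNReal.ofReal ((θ / 4) ^ 4) *
        ∫⁻ v in Metric.ball (0 : E) (r - θ), ENNReal.ofReal (highPow (g s) lam₁ (5 / 3) v)
      ≤ C * ENNReal.ofReal U ^ (2 / 3 : ℝ) *
        ((∫⁻ v in Metric.ball (0 : E) r, ENNReal.ofReal (fisher (g s) (G s) lam v))
          + Λ ^ 2 * ENNReal.ofReal U) := by
    filter_upwards [hU.1, ae_mono (Measure.restrict_mono hJs le_rfl) hs.slice,
      ae_restrict_mem measurableSet_Ioc] with s a1 a2 a3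
    exact lintegral_highPow_le hC a2.2.2 (hs.nonneg s (hJs a3)) hlam hθ h1 h2 hψ' hψc hψ1 a1
  have hθ4 : 0 < (θ / 4) ^ 4 := by positivity
  have hmain : ENNReal.ofReal ((θ / 4) ^ 4) * ∫⁻ s in J,
      ∫⁻ v in Metric.ball (0 : E) (r - θ), ENNReal.ofReal (highPow (g s) lam₁ (5 / 3) v)
      ≤ C * ENNReal.ofReal U ^ (2 / 3 : ℝ) *
        (ENNReal.ofReal U + Λ ^ 2 * ENNReal.ofReal U) := by
    rw [← lintegral_const_mul' _ _ ENNReal.ofReal_ne_top]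
    refine (lintegral_mono_ae hsl).trans ?_
    rw [lintegral_const_mul' _ _ (ENNReal.mul_ne_top ENNReal.coe_ne_top
      (ENNReal.rpow_ne_top_of_nonneg (by norm_num) ENNReal.ofReal_ne_top)),
      lintegral_add_right _ measurable_const, lintegral_const, Measure.restrict_apply_univ, hJ,
      Real.volume_Ioc]
    refine mul_le_mul_right (add_le_add hF (mul_le_of_le_one_right zero_le ?_)) _
    rw [ENNReal.ofReal_le_one]
    nlinarith
  have hΛ' : (Λ : ℝ≥0∞) ^ 2 = ENNReal.ofReal ((D / θ) ^ 2) := by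
    rw [ENNReal.ofReal_pow hDθ]
    congr 1
    exact (ENNReal.ofReal_eq_coe_nnreal hDθ).symm
  rw [hΛ', ENNReal.ofReal_rpow_of_nonneg hU0 (by norm_num), ← ENNReal.ofReal_mul (by positivity),
    ← ENNReal.ofReal_add hU0 (by positivity), ← ENNReal.ofReal_coe_nnreal,
    ← ENNReal.ofReal_mul (by positivity), ← ENNReal.ofReal_mul (by positivity)] at hmain
  have hθ1 : θ ≤ 1 := by linarith
  refine (ENNReal.mul_le_mul_iff_right (ENNReal.ofReal_pos.2 hθ4).ne' ENNReal.ofReal_ne_top).1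
    (hmain.trans ?_)
  rw [← ENNReal.ofReal_mul hθ4.le]
  apply ENNReal.ofReal_le_ofReal
  have hUU : U ^ (5 / 3 : ℝ) = U ^ (2 / 3 : ℝ) * U := by
    rcases hU0.eq_or_lt with h | h
    · rw [← h]
      simp
    · rw [← Real.rpow_add_one h.ne']
      norm_num
  rw [hUU]
  have e1 : 1 + (D / θ) ^ 2 ≤ (1 + D ^ 2) * (1 / θ) ^ 2 := by
    have : 1 ≤ (1 / θ) ^ 2 := one_le_pow₀ ((one_le_div hθ).2 hθ1)
    rw [div_eq_mul_one_div D, mul_pow]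
    linarith
  calc (C : ℝ) * U ^ (2 / 3 : ℝ) * (U + (D / θ) ^ 2 * U)
      = C * U ^ (2 / 3 : ℝ) * U * (1 + (D / θ) ^ 2) := by ring
    _ ≤ C * U ^ (2 / 3 : ℝ) * U * ((1 + D ^ 2) * (1 / θ) ^ 2) := by gcongr
    _ = _ := by
        field_simp
        ring

lemma IsBddRadial.exists_norm_conv_le_mul {c : ℝ → ℝ} (hc : IsBddRadial c) :
    ∃ C, 0 ≤ C ∧ ∀ h : E → ℝ, (∀ w, 0 ≤ h w) → Integrable h → ∀ v,
      ‖convK c h v‖ ≤ C * ∫ w, h w ∧ ‖convD c h v‖ ≤ C * ∫ w, h w := by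
  obtain ⟨C, hC⟩ := hc.exists_norm_radK_le
  obtain ⟨C', hC'⟩ := hc.exists_norm_radD_le
  refine ⟨max C C', ((norm_nonneg _).trans (hC 0)).trans (le_max_left _ _),
    fun h h0 hi v => ⟨?_, ?_⟩⟩
  all_goals
    rw [mul_comm, ← integral_mul_const]
    refine norm_integral_le_of_norm_le (hi.mul_const _) (Eventually.of_forall fun w => ?_)
    rw [norm_smul, Real.norm_of_nonneg (h0 w)]
    refine mul_le_mul_of_nonneg_left ?_ (h0 w)
  · exact (hC _).trans (le_max_left _ _)
  · exact (hC' _).trans (le_max_right _ _)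

/-! ### The flux on time slabs -/

namespace IsScaledSolution

variable {q : ℝ → ℝ} {ε b M cc σ W : ℝ} {g : ℝ → E → ℝ} {G : ℝ → E → E}

lemma aestronglyMeasurable_conv (hs : IsScaledSolution q ε b M cc σ W g G) {J : Set ℝ}
    (hJ : J ⊆ Ioo (-4) b) {F : Type*} [NormedAddCommGroup F] [NormedSpace ℝ F]
    [FiniteDimensional ℝ F] {K : E → F} (hK : Continuous K) :
    AEStronglyMeasurable (fun p : ℝ × E => ∫ w, g p.1 w • K (p.2 - w))
      (volume.restrict (J ×ˢ univ)) := by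
  have hg := hs.aesm.mono_set (Set.prod_mono hJ (subset_refl univ))
  rw [volume_restrict_slab] at hg ⊢
  have h1 : AEStronglyMeasurable (fun x : (ℝ × E) × E => g x.1.1 x.2)
      (((volume.restrict J).prod volume).prod volume) :=
    hg.comp_quasiMeasurePreserving
      (MeasureTheory.QuasiMeasurePreserving.prodMap Measure.quasiMeasurePreserving_fst
        (Measure.QuasiMeasurePreserving.id _))
  have h2 : Continuous fun x : (ℝ × E) × E => K (x.1.2 - x.2) := hK.comp (by fun_prop)
  exact (h1.smul h2.aestronglyMeasurable).integral_prod_right'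

lemma aestronglyMeasurable_fluxDensity (hs : IsScaledSolution q ε b M cc σ W g G) {J : Set ℝ}
    (hJ : J ⊆ Ioo (-4) b) {c : ℝ → ℝ} (hc : IsBddRadial c) {κ : ℝ} {ψ : E → ℝ} {ρ Λ : ℝ}
    (hψ : IsCut ψ ρ Λ) :
    AEStronglyMeasurable (fun p : ℝ × E => fluxDensity c (g p.1) (G p.1) κ ψ p.2)
      (volume.restrict (J ×ˢ univ)) := by
  have hA := Set.prod_mono hJ (subset_refl (univ : Set E))
  have hg := hs.aesm.mono_set hA
  have hG := hs.aesm_grad.mono_set hA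
  have hT : NullMeasurableSet {p : ℝ × E | κ < g p.1 p.2} (volume.restrict (J ×ˢ univ)) :=
    nullMeasurableSet_lt aemeasurable_const hg.aemeasurable
  have m2 : AEStronglyMeasurable (fun p : ℝ × E => gradTrunc (g p.1) (G p.1) κ p.2)
      (volume.restrict (J ×ˢ univ)) :=
    (hg.aemeasurable.inv.aestronglyMeasurable.smul hG).indicator₀ hT
  have m4 : AEStronglyMeasurable (fun p : ℝ × E => lnPlus (g p.1 p.2 / κ))
      (volume.restrict (J ×ˢ univ)) := by
    have : Measurable fun r : ℝ => lnPlus (r / κ) := by unfold lnPlus; fun_prop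
    exact (this.comp_aemeasurable hg.aemeasurable).aestronglyMeasurable
  have m5 : Continuous fun p : ℝ × E => ψ p.2 := hψ.contDiff.continuous.comp continuous_snd
  have m6 : Continuous fun p : ℝ × E => gradient ψ p.2 :=
    (continuous_gradient hψ.contDiff).comp continuous_snd
  have mT : AEStronglyMeasurable (fun p : ℝ × E => testField (g p.1) (G p.1) κ ψ p.2)
      (volume.restrict (J ×ˢ univ)) :=
    ((m5.pow 2).aestronglyMeasurable.smul m2).add
      (((m4.const_mul 2).mul m5.aestronglyMeasurable).smul m6.aestronglyMeasurable)
  refine AEStronglyMeasurable.inner (AEStronglyMeasurable.sub ?_ ?_) mT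
  · exact (ContinuousLinearMap.id ℝ (E →L[ℝ] E)).aestronglyMeasurable_comp₂
      (hs.aestronglyMeasurable_conv hJ hc.continuous_radK) hG
  · exact hg.smul (hs.aestronglyMeasurable_conv hJ hc.contDiff_radD.continuous)

/-- The flux is integrable on time slabs where the Fisher information is integrable. -/
lemma integrableOn_flux (hs : IsScaledSolution q ε b M cc σ W g G) {J : Set ℝ}
    (hJm : MeasurableSet J) (hJ : J ⊆ Ioo (-4) b) {c : ℝ → ℝ} (hc : IsBddRadial c) {κ : ℝ}
    (hκ : 1 ≤ κ) {ψ : E → ℝ} {ρ ρ' Λ : ℝ} (hψ : IsCut ψ ρ Λ) (hρ : ρ ≤ ρ') {χ : ℝ → ℝ}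
    (hχc : Continuous χ) (hχ0 : ∀ s, 0 ≤ χ s) (hχ1 : ∀ s, χ s ≤ 1)
    (hS : IntegrableOn (fun p : ℝ × E => highPow (g p.1) κ (5 / 3) p.2) (J ×ˢ Metric.ball 0 ρ'))
    (hY : IntegrableOn (fun p : ℝ × E => fisher (g p.1) (G p.1) κ p.2)
      (J ×ˢ Metric.ball 0 ρ')) :
    IntegrableOn (fun p : ℝ × E => χ p.1 ^ 2 * fluxDensity c (g p.1) (G p.1) κ ψ p.2)
      (J ×ˢ univ) := by
  obtain ⟨C, hC0, hC⟩ := hc.exists_norm_conv_le_mul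
  have hB : MeasurableSet (univ ×ˢ Metric.ball (0 : E) ρ' : Set (ℝ × E)) :=
    MeasurableSet.univ.prod Metric.isOpen_ball.measurableSet
  have hdom : IntegrableOn ((univ ×ˢ Metric.ball (0 : E) ρ' : Set (ℝ × E)).indicator
      fun p => (C * M) * (2 * (fisher (g p.1) (G p.1) κ p.2
        + 288 * (Λ ^ 2 + 1) * highPow (g p.1) κ (5 / 3) p.2))) (J ×ˢ univ) := by
    rw [IntegrableOn, integrable_indicator_iff hB, IntegrableOn, Measure.restrict_restrict hB,
      prod_inter_prod, univ_inter, inter_univ]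
    exact ((hY.add (hS.const_mul _)).const_mul 2).const_mul (C * M)
  refine Integrable.mono' hdom ?_ ?_
  · exact ((hχc.comp continuous_fst).pow 2).aestronglyMeasurable.mul
      (hs.aestronglyMeasurable_fluxDensity hJ hc hψ)
  · have hsl : ∀ᵐ p ∂(volume : Measure (ℝ × E)).restrict (J ×ˢ univ),
        p.1 ∈ J ∧ Integrable (g p.1) ∧ ∫ v, g p.1 v ≤ M := by
      rw [volume_restrict_slab]
      have h1 : ∀ᵐ s ∂volume.restrict J, s ∈ J ∧ Integrable (g s) ∧ ∫ v, g s v ≤ M := by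
        filter_upwards [ae_mono (Measure.restrict_mono hJ le_rfl) hs.slice, ae_restrict_mem hJm]
          with s a1 a2 using ⟨a2, a1.1, a1.2.1⟩
      exact Measure.quasiMeasurePreserving_fst.ae h1
    filter_upwards [hsl] with p hp
    have h0 := hs.nonneg p.1 (hJ hp.1)
    have hCM : C * ∫ w, g p.1 w ≤ C * M := mul_le_mul_of_nonneg_left hp.2.2 hC0
    have h1 := abs_fluxDensity_le (G := G p.1) hκ h0 hψ hρ
      ((hC _ h0 hp.2.1 p.2).1.trans hCM) ((hC _ h0 hp.2.1 p.2).2.trans hCM)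
    rw [norm_mul, Real.norm_eq_abs, Real.norm_eq_abs, abs_of_nonneg (sq_nonneg _)]
    refine (mul_le_of_le_one_left (abs_nonneg _) (pow_le_one₀ (hχ0 _) (hχ1 _))).trans
      (h1.trans_eq ?_)
    by_cases hv : p.2 ∈ Metric.ball (0 : E) ρ'
    · rw [indicator_of_mem hv, indicator_of_mem (show p ∈ univ ×ˢ Metric.ball (0 : E) ρ' from
        ⟨mem_univ _, hv⟩)]
    · rw [indicator_of_notMem hv, indicator_of_notMem (fun h => hv h.2)]
      simp

/-- The lower bound for the flux on a time slab. -/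
lemma le_integral_flux (hs : IsScaledSolution q ε b M cc σ W g G) {k₁ C : ℝ} (hC0 : 0 ≤ C)
    (hC : ∀ (q : ℝ → ℝ) (δ κ N ρ ρ' Λ W : ℝ) (g : E → ℝ) (G : E → E) (Ψ : E → ℝ),
      IsProfile q → q 1 ≤ k₁ → 0 < δ → δ ≤ 1 → 1 / δ ≤ N → 1 ≤ κ → κ ≤ 2 → 1 ≤ Λ → 1 ≤ W →
      IsCut Ψ ρ Λ → ρ + δ ≤ ρ' → ρ' ≤ 1 → (∀ x, 0 ≤ g x) → Integrable g → HasWeakGrad g G →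
      (∀ᵐ v : E, ‖v‖ < 1 → Integrable (fun w => g w * cutW q (1 / δ) ‖v - w‖) ∧
        ∫ w, g w * cutW q (1 / δ) ‖v - w‖ ≤ W) →
      (∀ v e : E, ‖v‖ < 1 → cc * ‖e‖ ^ 2 ≤ ⟪convK (cutC q (1 / δ)) g v e, e⟫) →
      IntegrableOn (highPow g κ (5 / 3)) (Metric.ball 0 ρ') →
      IntegrableOn (fisher g G κ) (Metric.ball 0 ρ') →
      ∀ V S Y : ℝ, V = ∫ x in Metric.ball 0 ρ', highPart g κ x →
      S = ∫ x in Metric.ball 0 ρ', highPow g κ (5 / 3) x →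
      Y = ∫ x in Metric.ball 0 ρ', fisher g G κ x →
      cc / 4 * (∫ x, Ψ x ^ 2 * fisher g G κ x)
        - C * Λ ^ 2 * ((1 / δ) ^ 2 * W * (1 + V) * S + V * Y)
        ≤ ∫ v, fluxDensity (cutC q N) g G κ Ψ v)
    (hk : q 1 ≤ k₁) {δ κ N ρ ρ' Λ V₀ : ℝ} (hδ : 0 < δ) (hδ1 : δ ≤ 1) (hδσ : δ ≤ σ)
    (hN : 1 / δ ≤ N) (hκ : 1 ≤ κ) (hκ2 : κ ≤ 2) (hΛ : 1 ≤ Λ) (hW : 1 ≤ W) (hV₀ : 0 ≤ V₀)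
    {ψ : E → ℝ} (hψ : IsCut ψ ρ Λ) (hρ : ρ + δ ≤ ρ') (hρ' : ρ' ≤ 1) {χ : ℝ → ℝ}
    (hχc : Continuous χ) (hχ0 : ∀ s, 0 ≤ χ s) (hχ1 : ∀ s, χ s ≤ 1)
    {J : Set ℝ} (hJm : MeasurableSet J) (hJ : J ⊆ Ioo (-4) b) (hJ1 : J ⊆ Ioc (-1) 0)
    (hS : IntegrableOn (fun p : ℝ × E => highPow (g p.1) κ (5 / 3) p.2) (J ×ˢ Metric.ball 0 ρ'))
    (hY : IntegrableOn (fun p : ℝ × E => fisher (g p.1) (G p.1) κ p.2)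
      (J ×ˢ Metric.ball 0 ρ'))
    (hV : ∀ᵐ s ∂volume.restrict J, ∫ v in Metric.ball (0 : E) ρ', highPart (g s) κ v ≤ V₀) :
    cc / 4 * (∫ p in J ×ˢ Metric.ball (0 : E) ρ',
        χ p.1 ^ 2 * (ψ p.2 ^ 2 * fisher (g p.1) (G p.1) κ p.2))
      - C * Λ ^ 2 * ((1 / δ) ^ 2 * (W / δ) * (1 + V₀)
          * (∫ p in J ×ˢ Metric.ball (0 : E) ρ', highPow (g p.1) κ (5 / 3) p.2)
        + V₀ * ∫ p in J ×ˢ Metric.ball (0 : E) ρ', fisher (g p.1) (G p.1) κ p.2)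
      ≤ ∫ p in J ×ˢ (univ : Set E),
          χ p.1 ^ 2 * fluxDensity (cutC q N) (g p.1) (G p.1) κ ψ p.2 := by
  have hN0 : 0 < N := (one_div_pos.2 hδ).trans_le hN
  have hρρ : ρ ≤ ρ' := by linarith
  have hfl := hs.integrableOn_flux hJm hJ (hs.profile.isBddRadial_cutC hN0) hκ hψ hρρ hχc hχ0 hχ1
    hS hY
  have hYχ : IntegrableOn (fun p : ℝ × E =>
      χ p.1 ^ 2 * (ψ p.2 ^ 2 * fisher (g p.1) (G p.1) κ p.2)) (J ×ˢ Metric.ball 0 ρ') := by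
    have hm : AEStronglyMeasurable (fun p : ℝ × E =>
        χ p.1 ^ 2 * (ψ p.2 ^ 2 * fisher (g p.1) (G p.1) κ p.2))
        (volume.restrict (J ×ˢ Metric.ball 0 ρ')) :=
      ((hχc.comp continuous_fst).pow 2).aestronglyMeasurable.mul
        (((hψ.contDiff.continuous.comp continuous_snd).pow 2).aestronglyMeasurable.mul
          hY.aestronglyMeasurable)
    refine Integrable.mono hY hm (Eventually.of_forall fun p => ?_)
    rw [norm_mul, norm_mul, norm_pow, norm_pow, Real.norm_of_nonneg (hχ0 _),
      Real.norm_of_nonneg (hψ.nonneg _)]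
    have h1 := pow_le_one₀ (n := 2) (hχ0 p.1) (hχ1 p.1)
    have h2 := pow_le_one₀ (n := 2) (hψ.nonneg p.2) (hψ.le_one p.2)
    refine (mul_le_of_le_one_left (by positivity) h1).trans
      (mul_le_of_le_one_left (norm_nonneg _) h2)
  have hpr : (volume : Measure (ℝ × E)).restrict (J ×ˢ Metric.ball (0 : E) ρ')
      = (volume.restrict J).prod (volume.restrict (Metric.ball 0 ρ')) := by
    rw [Measure.volume_eq_prod, Measure.prod_restrict]
  rw [IntegrableOn, hpr] at hS hY hYχ
  rw [IntegrableOn, volume_restrict_slab] at hfl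
  rw [hpr, volume_restrict_slab, integral_prod _ hYχ, integral_prod _ hS, integral_prod _ hY,
    integral_prod _ hfl]
  have iP := hYχ.integral_prod_left.const_mul (cc / 4)
  have iS := hS.integral_prod_left.const_mul ((1 / δ) ^ 2 * (W / δ) * (1 + V₀))
  have iY := hY.integral_prod_left.const_mul V₀
  have iE := (iS.add iY).const_mul (C * Λ ^ 2)
  refine le_trans (le_of_eq ?_) (integral_mono_ae (iP.sub iE) hfl.integral_prod_left ?_)
  · rw [integral_sub' iP iE, integral_const_mul, integral_const_mul, integral_add' iS iY,
      integral_const_mul, integral_const_mul]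
  filter_upwards [ae_mono (Measure.restrict_mono hJ le_rfl) hs.slice,
    ae_mono (Measure.restrict_mono hJ le_rfl) hs.coercive,
    ae_mono (Measure.restrict_mono hJ1 le_rfl) hs.far, hV, hS.prod_right_ae, hY.prod_right_ae,
    ae_restrict_mem hJm] with s a1 a2 a3 a4 a5 a6 a7
  have h0 := hs.nonneg s (hJ a7)
  have hWδ : 1 ≤ W / δ := by rw [le_div_iff₀ hδ]; linarith
  have key := hC q δ κ N ρ ρ' Λ (W / δ) (g s) (G s) ψ hs.profile hk hδ hδ1 hN hκ hκ2 hΛ hWδ hψ hρ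
    hρ' h0 a1.1 a1.2.2
    (by filter_upwards [a3] with v hv hv1 using hv δ hδ hδ1 hv1)
    (fun v e hv => a2 δ v e hδ hδσ hv) a5 a6 _ _ _ rfl rfl rfl
  have hψb : ∫ x, ψ x ^ 2 * fisher (g s) (G s) κ x
      = ∫ x in Metric.ball (0 : E) ρ', ψ x ^ 2 * fisher (g s) (G s) κ x := by
    refine (setIntegral_eq_integral_of_forall_compl_eq_zero fun x hx => ?_).symm
    rw [hψ.zero x (hρρ.trans (by simpa using hx))]
    simp
  rw [hψb] at key
  simp only [Pi.sub_apply, Pi.add_apply, integral_const_mul]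
  set P := ∫ x in Metric.ball (0 : E) ρ', ψ x ^ 2 * fisher (g s) (G s) κ x
  set S := ∫ x in Metric.ball (0 : E) ρ', highPow (g s) κ (5 / 3) x
  set Y := ∫ x in Metric.ball (0 : E) ρ', fisher (g s) (G s) κ x
  set V := ∫ x in Metric.ball (0 : E) ρ', highPart (g s) κ x
  set F := ∫ v, fluxDensity (cutC q N) (g s) (G s) κ ψ v
  have hS0 : 0 ≤ S := integral_nonneg fun x => highPow_nonneg h0 _ x
  have hY0 : 0 ≤ Y := integral_nonneg fun x => fisher_nonneg h0 x
  have hχs0 := sq_nonneg (χ s)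
  have hχs := pow_le_one₀ (n := 2) (hχ0 s) (hχ1 s)
  have herr : C * Λ ^ 2 * ((1 / δ) ^ 2 * (W / δ) * (1 + V) * S + V * Y)
      ≤ C * Λ ^ 2 * ((1 / δ) ^ 2 * (W / δ) * (1 + V₀) * S + V₀ * Y) := by
    have : 0 ≤ W / δ := by linarith
    gcongr
  set e1 := C * Λ ^ 2 * ((1 / δ) ^ 2 * (W / δ) * (1 + V) * S + V * Y)
  set e2 := C * Λ ^ 2 * ((1 / δ) ^ 2 * (W / δ) * (1 + V₀) * S + V₀ * Y) with he2
  have he20 : 0 ≤ e2 := by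
    rw [he2]
    have : 0 ≤ W / δ := by linarith
    positivity
  clear_value e1 e2
  -- The error is nonnegative and subtracted, so the weight χ² ≤ 1 may be put in front of it at no
  -- cost.
  calc cc / 4 * (χ s ^ 2 * P) - e2 ≤ cc / 4 * (χ s ^ 2 * P) - χ s ^ 2 * e2 := by
        nlinarith
    _ ≤ χ s ^ 2 * (cc / 4 * P - e1) := by nlinarith
    _ ≤ χ s ^ 2 * F := by gcongr

end IsScaledSolution

/-- Nonnegativity is ln y ≥ 1 - 1/y at y = x/κ. The upper bound absorbs the logarithm into the power
5/3. -/
lemma hPlus_nonneg_le {g : E → ℝ} {κ : ℝ} (hκ : 1 ≤ κ) (hg : ∀ x, 0 ≤ g x) (x : E) :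
    0 ≤ hPlus κ (g x) ∧ hPlus κ (g x) ≤ 144 * highPow g κ (5 / 3) x := by
  have hκ0 : 0 < κ := by linarith
  have h1 := highPart_mul_le (g := g) (x := x) hκ hg
  rcases le_or_gt (g x) κ with h | h
  · have h2 : hPlus κ (g x) = 0 := by
      rw [hPlus, lnPlus_of_le hκ0 h (hg x), max_eq_right (by linarith)]
      simp
    rw [h2]
    exact ⟨le_rfl, mul_nonneg (by norm_num) (highPow_nonneg hg _ _)⟩
  · rw [highPart_of_lt h] at h1
    have hx0 : 0 < g x := hκ0.trans h
    rw [hPlus, max_eq_left (by linarith : 0 ≤ g x - κ)]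
    refine ⟨?_, by linarith⟩
    have h3 : 1 - κ / g x ≤ lnPlus (g x / κ) := by
      have := Real.one_sub_inv_le_log_of_pos (div_pos hx0 hκ0)
      rw [inv_div] at this
      exact this.trans (le_max_left _ _)
    have h4 := mul_le_mul_of_nonneg_left h3 hx0.le
    rw [mul_sub, mul_one, mul_div_cancel₀ _ hx0.ne'] at h4
    linarith

/-- Splitting ln(x/κ) at κ₂, the slope of the entropy density beyond κ₂ is at least ln(κ₂/κ) ≥ 1 -
κ/κ₂ ≥ 2θ/κ₂ ≥ θ, as κ₂ ≤ 2. A gap between levels thus turns the entropy into control of the mass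
above κ₂. -/
lemma mul_max_le_hPlus {κ κ₂ θ x : ℝ} (hκ : 0 < κ) (hθ : 0 < θ) (h1 : κ + 2 * θ ≤ κ₂)
    (h2 : κ₂ ≤ 2) (hx : κ₂ < x) : θ * (x - κ₂) ≤ hPlus κ x := by
  have hκ2 : 0 < κ₂ := by linarith
  have hx0 : 0 < x := by linarith
  have e1 : Real.log (x / κ) = Real.log (x / κ₂) + Real.log (κ₂ / κ) := by
    rw [Real.log_div hx0.ne' hκ.ne', Real.log_div hx0.ne' hκ2.ne', Real.log_div hκ2.ne' hκ.ne']
    ring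
  have e2 : 1 - κ₂ / x ≤ Real.log (x / κ₂) := by
    have := Real.one_sub_inv_le_log_of_pos (div_pos hx0 hκ2)
    rwa [inv_div] at this
  have e3 : 1 - κ / κ₂ ≤ Real.log (κ₂ / κ) := by
    have := Real.one_sub_inv_le_log_of_pos (div_pos hκ2 hκ)
    rwa [inv_div] at this
  have e4 : θ ≤ 1 - κ / κ₂ := by
    rw [le_sub_comm, div_le_iff₀ hκ2]
    nlinarith
  have e5 := mul_le_mul_of_nonneg_left e2 hx0.le
  rw [mul_sub, mul_one, mul_div_cancel₀ _ hx0.ne'] at e5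
  have e6 := mul_le_mul_of_nonneg_left e3 hκ2.le
  rw [mul_sub, mul_one, mul_div_cancel₀ _ hκ2.ne'] at e6
  have e7 : x * Real.log (x / κ) ≤ x * lnPlus (x / κ) :=
    mul_le_mul_of_nonneg_left (le_max_left _ _) hx0.le
  rw [hPlus, max_eq_left (by linarith : 0 ≤ x - κ)]
  have e8 : θ * (x - κ₂) ≤ Real.log (κ₂ / κ) * (x - κ₂) :=
    mul_le_mul_of_nonneg_right (e4.trans e3) (by linarith)
  rw [e1] at e7
  nlinarith

lemma fisher_anti {g : E → ℝ} {G : E → E} {κ κ' : ℝ} (h : κ ≤ κ') (hg : ∀ x, 0 ≤ g x) (x : E) :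
    fisher g G κ' x ≤ fisher g G κ x :=
  indicator_le_indicator_of_subset (fun _ hx => h.trans_lt hx)
    (fun x => div_nonneg (sq_nonneg _) (hg x)) x

/-! ### The local energy inequality -/

namespace IsScaledSolution

variable {q : ℝ → ℝ} {ε b M cc σ W : ℝ} {g : ℝ → E → ℝ} {G : ℝ → E → E}

/-- The contribution of the time derivative of the cutoff to the entropy inequality. -/
lemma integral_hPlus_le (hs : IsScaledSolution q ε b M cc σ W g G) {κ r ρ' Cχ : ℝ} (hκ : 1 ≤ κ)
    (hb : 0 < b) (hr : r ^ 2 ≤ 1) {χ : ℝ → ℝ} {ψ : E → ℝ} (hψ0 : ∀ x, 0 ≤ ψ x) (hψ1 : ∀ x, ψ x ≤ 1)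
    (hψ : ∀ x, ρ' ≤ ‖x‖ → ψ x = 0)
    (hχ : ∀ s ≤ 0, |deriv (fun s => χ s ^ 2) s| ≤ Cχ)
    (hχ0 : ∀ s ≤ -r ^ 2, deriv (fun s => χ s ^ 2) s = 0)
    (hS : IntegrableOn (fun p : ℝ × E => highPow (g p.1) κ (5 / 3) p.2)
      (Ioc (-r ^ 2) 0 ×ˢ Metric.ball 0 ρ')) {s₁ s₂ : ℝ} (h1 : -4 < s₁) (h2 : s₂ ≤ 0) :
    ∫ p in Icc s₁ s₂ ×ˢ (univ : Set E), hPlus κ (g p.1 p.2)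
        * (deriv (fun s => χ s ^ 2) p.1 * ψ p.2 ^ 2)
      ≤ 144 * Cχ * ∫ p in Ioc (-r ^ 2) 0 ×ˢ Metric.ball (0 : E) ρ',
          highPow (g p.1) κ (5 / 3) p.2 := by
  set A := Ioc (-r ^ 2) (0 : ℝ) ×ˢ Metric.ball (0 : E) ρ' with hA
  have hAm : MeasurableSet A := measurableSet_Ioc.prod Metric.isOpen_ball.measurableSet
  have hms : MeasurableSet (Icc s₁ s₂ ×ˢ (univ : Set E)) := measurableSet_Icc.prod MeasurableSet.univ
  have hCχ : 0 ≤ Cχ := (abs_nonneg _).trans (hχ 0 le_rfl)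
  have hI := ((integrable_indicator_iff hAm).2 hS).const_mul (144 * Cχ)
  have hnn : ∀ p : ℝ × E, p.1 ∈ Ioo (-4) b → 0 ≤ highPow (g p.1) κ (5 / 3) p.2 := fun p hp =>
    highPow_nonneg (hs.nonneg p.1 hp) _ _
  refine (Real.le_norm_self _).trans ((norm_integral_le_of_norm_le hI.integrableOn ?_).trans ?_)
  · filter_upwards [ae_restrict_mem hms] with p hp
    have hpI : p.1 ∈ Ioo (-4) b := ⟨h1.trans_le hp.1.1, (hp.1.2.trans h2).trans_lt hb⟩
    by_cases hpA : p ∈ A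
    · rw [indicator_of_mem hpA, norm_mul, norm_mul, norm_pow, Real.norm_of_nonneg (hψ0 _),
        Real.norm_of_nonneg (hPlus_nonneg_le hκ (hs.nonneg p.1 hpI) p.2).1]
      have e1 := (hPlus_nonneg_le hκ (hs.nonneg p.1 hpI) p.2).2
      have e2 := hχ p.1 hpA.1.2
      have e3 := pow_le_one₀ (n := 2) (hψ0 p.2) (hψ1 p.2)
      have e4 := hnn p hpI
      calc _ ≤ 144 * highPow (g p.1) κ (5 / 3) p.2 * (Cχ * 1) := by
            gcongr
            exact e2
        _ = _ := by ring
    · rw [indicator_of_notMem hpA]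
      have : deriv (fun s => χ s ^ 2) p.1 * ψ p.2 ^ 2 = 0 := by
        by_cases hv : ρ' ≤ ‖p.2‖
        · rw [hψ _ hv]
          simp
        · rw [hχ0, zero_mul]
          by_contra hr
          exact hpA ⟨⟨not_le.1 hr, hp.1.2.trans h2⟩, by simpa using hv⟩
      rw [this]
      simp
  · rw [integral_const_mul]
    refine mul_le_mul_of_nonneg_left ?_ (by positivity)
    rw [setIntegral_indicator hAm]
    refine setIntegral_mono_set hS ?_ (Eventually.of_forall inter_subset_right)
    filter_upwards [ae_restrict_mem hAm] with p hp
    exact hnn p ⟨by linarith [hp.1.1], hp.1.2.trans_lt hb⟩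

/-- The local energy inequality, for a lower bound `L` of the flux. -/
lemma energy_le (hs : IsScaledSolution q ε b M cc σ W g G) {κ r ρ' Cχ : ℝ} (hκ : 1 ≤ κ)
    (hb : 0 < b) (hr : r ^ 2 ≤ 1) {χ : ℝ → ℝ} {ψ : E → ℝ} (hψ0 : ∀ x, 0 ≤ ψ x)
    (hψ1 : ∀ x, ψ x ≤ 1) (hψ : ∀ x, ρ' ≤ ‖x‖ → ψ x = 0)
    (hχ : ∀ s ≤ 0, |deriv (fun s => χ s ^ 2) s| ≤ Cχ)
    (hχ0 : ∀ s ≤ -r ^ 2, deriv (fun s => χ s ^ 2) s = 0) (hχz : ∀ s ≤ -r ^ 2, χ s = 0)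
    (hS : IntegrableOn (fun p : ℝ × E => highPow (g p.1) κ (5 / 3) p.2)
      (Ioc (-r ^ 2) 0 ×ˢ Metric.ball 0 ρ')) {s₁ s₂ D L : ℝ} (h1 : -4 < s₁) (h1r : s₁ ≤ -r ^ 2)
    (h2 : s₂ ≤ 0)
    (hD : Tendsto (fun n : ℕ => ∫ p in Icc s₁ s₂ ×ˢ (univ : Set E), χ p.1 ^ 2 *
      fluxDensity (cutC q (n * ε)) (g p.1) (G p.1) κ ψ p.2) atTop (𝓝 D))
    (hle : ∫ v, hPlus κ (g s₂ v) * (χ s₂ * ψ v) ^ 2 ≤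
      (∫ v, hPlus κ (g s₁ v) * (χ s₁ * ψ v) ^ 2)
      + (∫ p in Icc s₁ s₂ ×ˢ (univ : Set E),
        hPlus κ (g p.1 p.2) * (deriv (fun s => χ s ^ 2) p.1 * ψ p.2 ^ 2)) - D)
    (hL : ∀ᶠ n : ℕ in atTop, L ≤ ∫ p in Ioc (-r ^ 2) s₂ ×ˢ (univ : Set E), χ p.1 ^ 2 *
      fluxDensity (cutC q (n * ε)) (g p.1) (G p.1) κ ψ p.2) :
    (∫ v, hPlus κ (g s₂ v) * (χ s₂ * ψ v) ^ 2) + L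
      ≤ 144 * Cχ * ∫ p in Ioc (-r ^ 2) 0 ×ˢ Metric.ball (0 : E) ρ',
          highPow (g p.1) κ (5 / 3) p.2 := by
  -- Before time -r² the cutoff χ vanishes, so the flux on [s₁,s₂] is that on (-r²,s₂]. A lower
  -- bound valid for all large n passes to the limit D.
  have hLD : L ≤ D := by
    refine ge_of_tendsto hD ?_
    filter_upwards [hL] with n hn
    refine hn.trans_eq (setIntegral_eq_of_subset_of_forall_sdiff_eq_zero
      (measurableSet_Icc.prod MeasurableSet.univ)
      (Set.prod_mono (fun s hs => ⟨h1r.trans hs.1.le, hs.2⟩) le_rfl) fun p hp => ?_).symm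
    have : p.1 ≤ -r ^ 2 := by
      by_contra hlt
      exact hp.2 ⟨⟨not_le.1 hlt, hp.1.1.2⟩, mem_univ _⟩
    rw [hχz _ this]
    simp
  have h3 := hs.integral_hPlus_le hκ hb hr hψ0 hψ1 hψ hχ hχ0 hS h1 h2
  have h4 : ∫ v, hPlus κ (g s₁ v) * (χ s₁ * ψ v) ^ 2 = 0 := by
    rw [hχz _ h1r]
    simp
  linarith

end IsScaledSolution

/-! ### One step of the iteration -/

lemma integrable_of_lintegral_ofReal_le {α : Type*} [MeasurableSpace α] {μ : Measure α}
    {φ : α → ℝ} {A : ℝ} (hm : AEMeasurable φ μ) (h0 : ∀ᵐ x ∂μ, 0 ≤ φ x) (hA : 0 ≤ A)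
    (h : ∫⁻ x, ENNReal.ofReal (φ x) ∂μ ≤ ENNReal.ofReal A) :
    Integrable φ μ ∧ ∫ x, φ x ∂μ ≤ A := by
  refine ⟨⟨hm.aestronglyMeasurable, ?_⟩, ?_⟩
  · rw [hasFiniteIntegral_iff_ofReal h0]
    exact h.trans_lt ENNReal.ofReal_lt_top
  · rw [integral_eq_lintegral_of_nonneg_ae h0 hm.aestronglyMeasurable]
    exact ENNReal.toReal_le_of_le_ofReal hA h

/-- The entropy on the support of ψ dominates the mass above the next level on the smaller ball, at
the cost of a factor 1/θ. -/
lemma lintegral_max_le_hPlus {h : E → ℝ} (h0 : ∀ x, 0 ≤ h x) (hm : AEMeasurable h)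
    {κ κ₂ θ r₁ ρ' : ℝ} (hκ : 1 ≤ κ) (hθ : 0 < θ) (h1 : κ + 2 * θ ≤ κ₂) (h2 : κ₂ ≤ 2)
    (hS : IntegrableOn (highPow h κ (5 / 3)) (Metric.ball 0 ρ')) {ψ : E → ℝ} (hψc : Continuous ψ)
    (hψ0 : ∀ x, 0 ≤ ψ x) (hψ1 : ∀ x, ψ x ≤ 1) (hψ : ∀ x, ρ' ≤ ‖x‖ → ψ x = 0)
    (hψr : ∀ x, ‖x‖ < r₁ → ψ x = 1) :
    ∫⁻ v in Metric.ball (0 : E) r₁, ENNReal.ofReal (max (h v - κ₂) 0)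
      ≤ ENNReal.ofReal (θ⁻¹ * ∫ v, hPlus κ (h v) * (1 * ψ v) ^ 2) := by
  have hB : MeasurableSet (Metric.ball (0 : E) ρ') := Metric.isOpen_ball.measurableSet
  have hnn : ∀ v, 0 ≤ hPlus κ (h v) * (1 * ψ v) ^ 2 := fun v =>
    mul_nonneg (hPlus_nonneg_le hκ h0 v).1 (sq_nonneg _)
  have hI : Integrable fun v => hPlus κ (h v) * (1 * ψ v) ^ 2 := by
    refine Integrable.mono' ((integrable_indicator_iff hB).2 (hS.const_mul 144)) ?_
      (Eventually.of_forall fun v => ?_)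
    · have h3 : Measurable (hPlus κ) := by unfold hPlus lnPlus; fun_prop
      exact ((h3.comp_aemeasurable hm).mul
        (((continuous_const.mul hψc).pow 2).measurable.aemeasurable)).aestronglyMeasurable
    · rw [Real.norm_of_nonneg (hnn v)]
      by_cases hv : v ∈ Metric.ball (0 : E) ρ'
      · rw [indicator_of_mem hv, one_mul]
        exact (mul_le_of_le_one_right (hPlus_nonneg_le hκ h0 v).1
          (pow_le_one₀ (hψ0 v) (hψ1 v))).trans (hPlus_nonneg_le hκ h0 v).2
      · rw [indicator_of_notMem hv, hψ v (by simpa using hv)]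
        simp
  rw [← integral_const_mul, ofReal_integral_eq_lintegral_ofReal (hI.const_mul _)
    (Eventually.of_forall fun v => mul_nonneg (inv_nonneg.2 hθ.le) (hnn v))]
  refine le_trans (setLIntegral_mono' Metric.isOpen_ball.measurableSet fun v hv => ?_)
    (setLIntegral_le_lintegral _ _)
  apply ENNReal.ofReal_le_ofReal
  rw [hψr v (by simpa using hv), one_mul, one_pow, mul_one]
  refine max_le ?_ (mul_nonneg (inv_nonneg.2 hθ.le) (hPlus_nonneg_le hκ h0 v).1)
  rcases le_or_gt (h v) κ₂ with h3 | h3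
  · exact (by linarith : h v - κ₂ ≤ 0).trans
      (mul_nonneg (inv_nonneg.2 hθ.le) (hPlus_nonneg_le hκ h0 v).1)
  · rw [inv_mul_eq_div, le_div_iff₀ hθ, mul_comm]
    exact mul_max_le_hPlus (by linarith) hθ h1 h2 h3

/-- Count of powers of t = 1/θ, with δ = σθ/2: the time cutoff gives t²·t⁶. The flux error gives t²
from the spatial cutoff, t³ from δ⁻³, t⁶ from the gain and one more from 1 + 2tU ≤ 3t, in all t¹².
The product of mass and Fisher information is of order U² ≤ U^{5/3}, since U ≤ 1. -/
lemma step_scalar {Kg Cs D Dt σ θ W U : ℝ} (hKg : 0 ≤ Kg) (hCs : 0 ≤ Cs) (hDt : 0 ≤ Dt)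
    (hσ : 0 < σ) (hθ : 0 < θ) (hθ1 : θ ≤ 1) (hW : 1 ≤ W) (hU : 0 ≤ U) (hU1 : U ≤ 1) :
    144 * (Dt / θ ^ 2) * (Kg * (1 / θ) ^ 6 * U ^ (5 / 3 : ℝ))
      + Cs * (2 * D / θ) ^ 2 * ((1 / (σ * θ / 2)) ^ 2 * (W / (σ * θ / 2)) * (1 + 2 / θ * U)
        * (Kg * (1 / θ) ^ 6 * U ^ (5 / 3 : ℝ)) + 2 / θ * U * U)
      ≤ (144 * Dt * Kg + 4 * Cs * D ^ 2 * (24 * Kg / σ ^ 3 + 2)) * (1 / θ) ^ 12 * W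
        * U ^ (5 / 3 : ℝ) := by
  obtain ⟨t, ht⟩ : ∃ t, t = 1 / θ := ⟨_, rfl⟩
  have ht1 : 1 ≤ t := by rw [ht]; exact (one_le_div hθ).2 hθ1
  have hθt : θ = 1 / t := by rw [ht]; field_simp
  have ht0 : 0 < t := by linarith
  obtain ⟨u, hu⟩ : ∃ u, u = U ^ (5 / 3 : ℝ) := ⟨_, rfl⟩
  have hu0 : 0 ≤ u := hu ▸ Real.rpow_nonneg hU _
  have hUu : U * U ≤ u := by
    rw [hu, ← sq, ← Real.rpow_natCast]
    rcases hU.eq_or_lt with h | h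
    · rw [← h]; norm_num
    · exact Real.rpow_le_rpow_of_exponent_ge h hU1 (by norm_num)
  rw [← ht, ← hu]
  have e1 : 144 * (Dt / θ ^ 2) * (Kg * t ^ 6 * u) ≤ 144 * Dt * Kg * t ^ 12 * W * u := by
    calc _ = 144 * Dt * Kg * t ^ 8 * 1 * u := by rw [hθt]; field_simp
      _ ≤ _ := by gcongr; norm_num
  have e2 : (1 / (σ * θ / 2)) ^ 2 * (W / (σ * θ / 2)) * (1 + 2 / θ * U) * (Kg * t ^ 6 * u)
      ≤ 24 * Kg / σ ^ 3 * t ^ 10 * W * u := by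
    calc _ = 8 * Kg / σ ^ 3 * t ^ 9 * W * u * (1 + 2 * t * U) := by rw [hθt]; field_simp; norm_num; ring
      _ ≤ 8 * Kg / σ ^ 3 * t ^ 9 * W * u * (t + 2 * t * 1) := by gcongr
      _ = _ := by ring
  have e3 : 2 / θ * U * U ≤ 2 * t ^ 10 * W * u := by
    calc _ = 2 * t * 1 * (U * U) := by rw [hθt]; field_simp
      _ ≤ 2 * t ^ 10 * W * u := by
        gcongr
        exact le_self_pow₀ ht1 (by norm_num)
  have e4 : Cs * (2 * D / θ) ^ 2 = 4 * Cs * D ^ 2 * t ^ 2 := by rw [hθt]; field_simp; norm_num; ring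
  calc _ ≤ 144 * Dt * Kg * t ^ 12 * W * u + 4 * Cs * D ^ 2 * t ^ 2 *
        (24 * Kg / σ ^ 3 * t ^ 10 * W * u + 2 * t ^ 10 * W * u) := by
        rw [e4]
        gcongr
    _ = _ := by ring

/-- The conclusion on the Fisher information, from energy bounds at almost all times. -/
lemma lintegral_slab_le_of_forall {φ : ℝ × E → ℝ≥0∞} {N : Set ℝ} (hN : volume N = 0) {c : ℝ}
    {B : Set E} {A : ℝ≥0∞}
    (h : ∀ s < 0, s ∉ N → ∫⁻ p in Ioc c s ×ˢ B, φ p ≤ A) :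
    ∫⁻ p in Ioc c 0 ×ˢ B, φ p ≤ A := by
  have hd : Dense (Nᶜ : Set ℝ) := Measure.dense_of_ae (μ := volume) (measure_eq_zero_iff_ae_notMem.1 hN)
  -- The final time 0 may be exceptional; it is approached from below by admissible times, and the
  -- integrals converge monotonically.
  obtain ⟨u, hu1, hu2, hu3⟩ := hd.exists_seq_strictMono_tendsto (0 : ℝ)
  have hU : ⋃ n, Ioc c (u n) ×ˢ B = Ioo c 0 ×ˢ B := by
    rw [← iUnion_prod_const]
    congr 1
    ext s
    simp only [mem_iUnion, mem_Ioc, mem_Ioo]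
    refine ⟨fun ⟨n, h1, h2⟩ => ⟨h1, h2.trans_lt (hu2 n).1⟩, fun ⟨h1, h2⟩ => ?_⟩
    obtain ⟨n, hn⟩ := (hu3.eventually (lt_mem_nhds h2)).exists
    exact ⟨n, h1, hn.le⟩
  have hae : (Ioc c 0 ×ˢ B : Set (ℝ × E)) =ᵐ[volume] Ioo c 0 ×ˢ B := by
    rw [Measure.volume_eq_prod]
    exact Measure.set_prod_ae_eq Ioo_ae_eq_Ioc.symm (ae_eq_refl B)
  rw [setLIntegral_congr hae, ← hU, setLIntegral_iUnion_of_directed]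
  · exact iSup_le fun n => h _ (hu2 n).1 (hu2 n).2
  · refine Monotone.directed_le fun m n hmn => Set.prod_mono (Ioc_subset_Ioc_right ?_) le_rfl
    exact hu1.monotone hmn

/-- One step of the De Giorgi iteration. -/
theorem exists_step (k₁ cc σ : ℝ) (hk : 0 ≤ k₁) (hcc : 0 < cc) (hσ : 0 < σ) (hσ1 : σ ≤ 1) :
    ∃ K : ℝ, 1 ≤ K ∧ ∀ (q : ℝ → ℝ) (ε b M W : ℝ) (g : ℝ → E → ℝ) (G : ℝ → E → E),
      IsScaledSolution q ε b M cc σ W g G → 0 < ε → 0 < b → q 1 ≤ k₁ → 1 ≤ W →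
      ∀ r θ lam U : ℝ, 0 < θ → 4 * θ ≤ r → r ≤ 1 → 1 ≤ lam → lam + 4 * θ ≤ 2 → 0 ≤ U → U ≤ 1 →
      LevelBound g G r lam U →
      LevelBound g G (r - 2 * θ) (lam + 4 * θ) (K * (1 / θ) ^ 13 * W * U ^ (5 / 3 : ℝ)) := by
  obtain ⟨Kg, hKg, hgain⟩ := exists_gain
  obtain ⟨Cs, hCs, hflux⟩ := exists_fluxDensity_lower k₁ cc hk hcc
  obtain ⟨D, hD1, hD⟩ := exists_space_cutoff
  obtain ⟨Dt, hDt1, hDt⟩ := exists_time_cutoff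
  set K₀ := 144 * Dt * Kg + 4 * Cs * D ^ 2 * (24 * Kg / σ ^ 3 + 2) with hK₀
  have hK₀0 : 0 ≤ K₀ := by positivity
  refine ⟨1 + (1 + 4 / cc) * K₀, le_add_of_nonneg_right (by positivity),
    fun q ε b M W g G hs hε hb hq hW r θ lam U hθ hθr hr hlam hlam2 hU0 hU1 hLB => ?_⟩
  have hθ1 : θ ≤ 1 := by linarith
  have he2 : 0 < ε ^ 2 := by positivity
  -- The entropy inequality holds at rational levels only. The working level lies between λ+θ, as
  -- needed for the gain of integrability, and λ+2θ, which leaves a gap 2θ to the final level.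
  obtain ⟨κ, hκ1, hκ2⟩ := exists_rat_btwn
    (show (lam + θ) / ε ^ 2 < (lam + 2 * θ) / ε ^ 2 by gcongr; linarith)
  rw [div_lt_iff₀' he2] at hκ1
  rw [lt_div_iff₀' he2] at hκ2
  obtain ⟨lam₁, hlam₁⟩ : ∃ x : ℝ, x = ε ^ 2 * κ := ⟨_, rfl⟩
  rw [← hlam₁] at hκ1 hκ2
  have h1lam : 1 ≤ lam₁ := by linarith
  set J := Ioc (-r ^ 2) (0 : ℝ) with hJ
  set B := Metric.ball (0 : E) (r - θ) with hB
  have hr2 : r ^ 2 ≤ 1 := pow_le_one₀ (by linarith) hr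
  have hJb : J ⊆ Ioo (-4) b := fun s h => ⟨by linarith [h.1], h.2.trans_lt hb⟩
  have hJ1 : J ⊆ Ioc (-1) 0 := Ioc_subset_Ioc_left (by linarith)
  have hJm : MeasurableSet J := measurableSet_Ioc
  have hBm : MeasurableSet B := Metric.isOpen_ball.measurableSet
  have hJB : J ×ˢ B ⊆ Ioo (-4) b ×ˢ univ := Set.prod_mono hJb (subset_univ _)
  have hBr : B ⊆ Metric.ball 0 r := Metric.ball_subset_ball (by linarith)
  have hnn : ∀ᵐ p ∂volume.restrict (J ×ˢ B), p.1 ∈ Ioo (-4) b := by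
    filter_upwards [ae_restrict_mem (hJm.prod hBm)] with p hp using hJb hp.1
  obtain ⟨hm1, hm2, -⟩ := hs.aemeasurable_highPow lam₁ (5 / 3) hJB
  set A := Kg * (1 / θ) ^ 6 * U ^ (5 / 3 : ℝ) with hA
  have hA0 : 0 ≤ A := by positivity
  obtain ⟨hS, hSA⟩ := integrable_of_lintegral_ofReal_le hm1
    (hnn.mono fun p hp => highPow_nonneg (hs.nonneg _ hp) _ _) hA0
    (hgain q ε b M cc σ W g G hs hb r θ lam lam₁ U hθ (by linarith) hr hlam hκ1.le (by linarith)
      hU0 hLB)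
  obtain ⟨hY, hYU⟩ := integrable_of_lintegral_ofReal_le hm2
    (hnn.mono fun p hp => fisher_nonneg (hs.nonneg _ hp) _) hU0 (by
      refine le_trans ?_ hLB.2
      refine (lintegral_mono_ae ?_).trans (lintegral_mono_set (Set.prod_mono le_rfl hBr))
      filter_upwards [hnn] with p hp
      exact ENNReal.ofReal_le_ofReal (fisher_anti (by linarith) (hs.nonneg _ hp) _))
  set V₀ := 2 / θ * U with hV₀
  have hV00 : 0 ≤ V₀ := by positivity
  -- Above λ₁ > λ + θ one has g ≤ (2/θ)(g-λ), so the mass of the high values is at most 2U/θ.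
  have hV : ∀ᵐ s ∂volume.restrict J, ∫ v in B, highPart (g s) lam₁ v ≤ V₀ := by
    filter_upwards [hLB.1, ae_mono (Measure.restrict_mono hJb le_rfl) hs.slice,
      ae_restrict_mem hJm] with s a1 a2 a3
    have h0 := hs.nonneg s (hJb a3)
    have hT : NullMeasurableSet {x | lam₁ < g s x} :=
      nullMeasurableSet_lt aemeasurable_const a2.1.aestronglyMeasurable.aemeasurable
    refine (integrable_of_lintegral_ofReal_le
      (a2.1.aestronglyMeasurable.indicator₀ hT).aemeasurable.restrict
      (Eventually.of_forall fun v => highPart_nonneg h0 v) hV00 ?_).2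
    calc ∫⁻ v in B, ENNReal.ofReal (highPart (g s) lam₁ v)
        ≤ ∫⁻ v in Metric.ball (0 : E) r,
          ENNReal.ofReal (2 / θ) * ENNReal.ofReal (max (g s v - lam) 0) := by
          refine (lintegral_mono fun v => ?_).trans (lintegral_mono_set hBr)
          rw [← ENNReal.ofReal_mul (by positivity)]
          apply ENNReal.ofReal_le_ofReal
          rcases le_or_gt (g s v) lam₁ with h | h
          · rw [highPart, indicator_of_notMem (show v ∉ {x | lam₁ < g s x} from not_lt.2 h)]
            positivity
          · rw [highPart_of_lt h, max_eq_left (by linarith), div_mul_eq_mul_div, le_div_iff₀ hθ]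
            linarith [mul_nonneg hθ.le (sub_nonneg.2 hlam2), sq_nonneg θ,
              mul_nonneg (by linarith : 0 ≤ g s v - lam - θ) (by linarith : 0 ≤ 2 - θ)]
      _ ≤ _ := by
          rw [lintegral_const_mul' _ _ ENNReal.ofReal_ne_top, hV₀,
            ENNReal.ofReal_mul (by positivity)]
          gcongr
  -- Nested radii: estimates are available on r-θ, ψ is supported in r-3θ/2 and equals 1 on r-2θ.
  -- The margin θ/2 is room for the near kernel, whose range is δ ≤ θ/2.
  obtain ⟨ψ, hψs, hψc, hψ, hψ1⟩ := hD (r - 2 * θ) (r - 3 / 2 * θ) (by linarith) (by linarith)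
  have hΛe : D / (r - 3 / 2 * θ - (r - 2 * θ)) = 2 * D / θ := by
    rw [show r - 3 / 2 * θ - (r - 2 * θ) = θ / 2 by ring]
    field_simp
  rw [hΛe] at hψ
  have hψz : ∀ x, r - θ ≤ ‖x‖ → ψ x = 0 := fun x hx => hψ.zero x (by linarith)
  -- The time cutoff rises between -(r-θ)² and -(r-2θ)², a gap of at least θ² because 4θ ≤ r.
  set c := -(r - 2 * θ) ^ 2 with hc
  set a := -(r - θ) ^ 2 with ha
  have hac : θ ^ 2 ≤ c - a := by rw [hc, ha]; linarith [mul_nonneg hθ.le (sub_nonneg.2 hθr), sq_nonneg θ]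
  have hac0 : 0 < c - a := lt_of_lt_of_le (by positivity) hac
  have har : -r ^ 2 ≤ a := by rw [ha]; linarith [mul_nonneg hθ.le (sub_nonneg.2 hθr), sq_nonneg θ]
  have hc0 : c ≤ 0 := neg_nonpos.2 (sq_nonneg _)
  obtain ⟨χ, hχs, hχc, hχt, hχ0, hχ1, hχa, hχc1, hχd, hχd0⟩ :=
    hDt a c b (by linarith) (by linarith) hb
  have hχd' : ∀ s ≤ 0, |deriv (fun s => χ s ^ 2) s| ≤ Dt / θ ^ 2 := fun s h =>
    (hχd s h).trans (by gcongr)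
  obtain ⟨N, hN, hent⟩ := hs.entropy χ ψ hχs hψs hχc hψc hχt κ (by rw [← hlam₁]; exact h1lam)
  rw [← hlam₁] at hent
  -- An admissible starting time before -r², where χ vanishes, so the initial entropy term
  -- disappears.
  obtain ⟨s₁, hs₁, hs₁N⟩ : ∃ s₁ ∈ Ioo (-4 : ℝ) (-r ^ 2), s₁ ∉ N := by
    have hd : Dense (Nᶜ : Set ℝ) :=
      Measure.dense_of_ae (μ := volume) (measure_eq_zero_iff_ae_notMem.1 hN)
    obtain ⟨z, hz1, hz2⟩ := hd.exists_between (show (-4 : ℝ) < -r ^ 2 by linarith)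
    exact ⟨z, hz2, hz1⟩
  -- At most σ for the ellipticity, and at most θ/2 to fit between the support of ψ and the ball of
  -- radius r-θ.
  set δ := σ * θ / 2 with hδ
  have hδ0 : 0 < δ := by positivity
  have hδθ : δ ≤ θ / 2 := by linarith [mul_le_mul_of_nonneg_right hσ1 hθ.le]
  have hδσ : δ ≤ σ := by linarith [mul_le_mul_of_nonneg_left hθ1 hσ.le]
  set Er := Cs * (2 * D / θ) ^ 2 * ((1 / δ) ^ 2 * (W / δ) * (1 + V₀) * A + V₀ * U) with hEr
  set R := K₀ * (1 / θ) ^ 12 * W * U ^ (5 / 3 : ℝ) with hR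
  have hR0 : 0 ≤ R := by positivity
  set X : ℝ → ℝ := fun s => ∫ v, hPlus lam₁ (g s v) * (χ s * ψ v) ^ 2 with hX
  set P : ℝ → ℝ := fun s => ∫ p in Ioc (-r ^ 2) s ×ˢ B,
    χ p.1 ^ 2 * (ψ p.2 ^ 2 * fisher (g p.1) (G p.1) lam₁ p.2) with hP
  -- The energy estimate at almost every final time: entropy at time s plus the weighted Fisher
  -- information up to s. Both halves of the new level bound are read off from it.
  have hgood : ∀ s ∈ Ioo (-r ^ 2) 0, s ∉ N → X s + cc / 4 * P s ≤ R := by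
    intro s hsI hsN
    have hsb : s ∈ Ioo (-4) b := ⟨by linarith [hsI.1], hsI.2.trans hb⟩
    obtain ⟨D', hD', hle⟩ := hent s₁ ⟨⟨hs₁.1, by linarith [hs₁.2]⟩, hs₁N⟩ s ⟨hsb, hsN⟩
      (hs₁.2.trans hsI.1)
    have hsubJ : Ioc (-r ^ 2) s ⊆ J := Ioc_subset_Ioc_right hsI.2.le
    have hsubA : Ioc (-r ^ 2) s ×ˢ B ⊆ J ×ˢ B := Set.prod_mono hsubJ le_rfl
    have hL : ∀ᶠ n : ℕ in atTop, cc / 4 * P s - Er ≤ ∫ p in Ioc (-r ^ 2) s ×ˢ (univ : Set E),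
        χ p.1 ^ 2 * fluxDensity (cutC q (n * ε)) (g p.1) (G p.1) lam₁ ψ p.2 := by
      filter_upwards [(tendsto_natCast_atTop_atTop.atTop_mul_const hε).eventually_ge_atTop
        (1 / δ)] with n hn
      have key := hs.le_integral_flux (ρ' := r - θ) hCs hflux hq hδ0 (by linarith) hδσ hn h1lam
        (by linarith) ((one_le_div hθ).2 (by linarith)) hW hV00 hψ (by linarith) (by linarith)
        hχs.continuous hχ0 hχ1 measurableSet_Ioc (hsubJ.trans hJb) (hsubJ.trans hJ1)
        (IntegrableOn.mono_set hS hsubA) (IntegrableOn.mono_set hY hsubA)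
        (ae_mono (Measure.restrict_mono hsubJ le_rfl) hV)
      refine le_trans ?_ key
      have i1 : ∫ p in Ioc (-r ^ 2) s ×ˢ B, highPow (g p.1) lam₁ (5 / 3) p.2 ≤ A :=
        (setIntegral_mono_set hS (hnn.mono fun p hp => highPow_nonneg (hs.nonneg _ hp) _ _)
          (Eventually.of_forall hsubA)).trans hSA
      have i2 : ∫ p in Ioc (-r ^ 2) s ×ˢ B, fisher (g p.1) (G p.1) lam₁ p.2 ≤ U :=
        (setIntegral_mono_set hY (hnn.mono fun p hp => fisher_nonneg (hs.nonneg _ hp) _)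
          (Eventually.of_forall hsubA)).trans hYU
      rw [hEr]
      exact sub_le_sub_left (mul_le_mul_of_nonneg_left (add_le_add
        (mul_le_mul_of_nonneg_left i1 (by positivity))
        (mul_le_mul_of_nonneg_left i2 hV00)) (by positivity)) _
    have h3 := hs.energy_le (ρ' := r - θ) h1lam hb hr2 hψ.nonneg hψ.le_one hψz hχd'
      (fun s h => hχd0 s (h.trans har) (h.trans (neg_nonpos.2 (sq_nonneg _)))) (fun s h => hχa s (h.trans har)) hS
      hs₁.1 hs₁.2.le hsI.2.le hD' hle hL
    have h4 := mul_le_mul_of_nonneg_left hSA (show 0 ≤ 144 * (Dt / θ ^ 2) by positivity)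
    have h5 := step_scalar (D := D) hKg hCs (by linarith : 0 ≤ Dt) hσ hθ hθ1 hW hU0 hU1
    have h6 : X s + (cc / 4 * P s - Er) ≤ R - Er := h3.trans (h4.trans (le_sub_iff_add_le.2 h5))
    linarith
  have hX0 : ∀ s ∈ Ioo (-r ^ 2) 0, 0 ≤ X s := fun s hsI =>
    integral_nonneg fun v => mul_nonneg (hPlus_nonneg_le h1lam
      (hs.nonneg s (hJb ⟨hsI.1, hsI.2.le⟩)) v).1 (sq_nonneg _)
  have hP0 : ∀ s ≤ 0, 0 ≤ P s := fun s hs0 =>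
    setIntegral_nonneg (measurableSet_Ioc.prod hBm) fun p hp => mul_nonneg (sq_nonneg _)
      (mul_nonneg (sq_nonneg _) (fisher_nonneg
        (hs.nonneg p.1 (hJb ⟨hp.1.1, hp.1.2.trans hs0⟩)) _))
  have hcr : -r ^ 2 < c := by linarith
  -- Passing from entropy to mass costs the last 1/θ, whence the power 13.
  have hfin : ∀ x : ℝ, 0 ≤ x → x ≤ (1 / θ) * (1 + 4 / cc) →
      x * R ≤ (1 + (1 + 4 / cc) * K₀) * (1 / θ) ^ 13 * W * U ^ (5 / 3 : ℝ) := fun x hx0 hx => by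
    have h6 : 0 ≤ (1 / θ) ^ 13 * W * U ^ (5 / 3 : ℝ) := by positivity
    calc x * R ≤ (1 / θ) * (1 + 4 / cc) * R := by gcongr
      _ = (1 + 4 / cc) * K₀ * ((1 / θ) ^ 13 * W * U ^ (5 / 3 : ℝ)) := by rw [hR]; ring
      _ ≤ (1 + (1 + 4 / cc) * K₀) * ((1 / θ) ^ 13 * W * U ^ (5 / 3 : ℝ)) := by linarith
      _ = _ := by ring
  have ht1 : 1 ≤ 1 / θ := (one_le_div hθ).2 hθ1
  have hcc4 : 0 < 4 / cc := by positivity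
  have h11 : θ⁻¹ ≤ 1 / θ * (1 + 4 / cc) := by
    rw [one_div]
    exact le_mul_of_one_le_right (by positivity) (by linarith)
  constructor
  · rw [show -(r - 2 * θ) ^ 2 = c from rfl]
    have hsub : Ioc c 0 ⊆ J := Ioc_subset_Ioc_left hcr.le
    have hN' : ∀ᵐ s ∂volume.restrict (Ioc c 0), s ∉ N ∧ s ≠ 0 := by
      refine ae_restrict_of_ae ?_
      filter_upwards [measure_eq_zero_iff_ae_notMem.1 hN,
        measure_eq_zero_iff_ae_notMem.1 (measure_singleton (0 : ℝ))] with s h1 h2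
      exact ⟨h1, h2⟩
    have hS' := hS
    rw [Measure.volume_eq_prod, ← Measure.prod_restrict] at hS'
    filter_upwards [hN', ae_restrict_mem measurableSet_Ioc,
      ae_mono (Measure.restrict_mono hsub le_rfl) hS'.prod_right_ae,
      ae_mono (Measure.restrict_mono (hsub.trans hJb) le_rfl) hs.slice] with s b1 b2 b3 b4
    have hsI : s ∈ Ioo (-r ^ 2) 0 := ⟨hcr.trans b2.1, lt_of_le_of_ne b2.2 b1.2⟩
    have h0 := hs.nonneg s (hJb (hsub b2))
    refine (lintegral_max_le_hPlus (ρ' := r - θ) h0 b4.1.aestronglyMeasurable.aemeasurable h1lam hθ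
      (by linarith) hlam2 b3 hψs.continuous hψ.nonneg hψ.le_one hψz hψ1).trans ?_
    apply ENNReal.ofReal_le_ofReal
    have h7 := hgood s hsI b1.1
    have h8 : X s ≤ R := by
      have := mul_nonneg (show 0 ≤ cc / 4 by positivity) (hP0 s b2.2)
      linarith
    have h9 : X s = ∫ v, hPlus lam₁ (g s v) * (1 * ψ v) ^ 2 := by
      rw [hX]
      simp only [hχc1 s ⟨b2.1.le, b2.2⟩]
    rw [← h9]
    exact (mul_le_mul_of_nonneg_left h8 (by positivity)).trans
      (hfin _ (by positivity) h11)
  · rw [show -(r - 2 * θ) ^ 2 = c from rfl]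
    refine lintegral_slab_le_of_forall hN fun s hs0 hsN => ?_
    rcases le_or_gt s c with hsc | hsc
    · rw [Ioc_eq_empty (not_lt.2 hsc), empty_prod]
      simp
    have hsI : s ∈ Ioo (-r ^ 2) 0 := ⟨hcr.trans hsc, hs0⟩
    have hsubA : Ioc (-r ^ 2) s ×ˢ B ⊆ J ×ˢ B :=
      Set.prod_mono (Ioc_subset_Ioc_right hs0.le) le_rfl
    have hm : MeasurableSet (Ioc c s ×ˢ Metric.ball (0 : E) (r - 2 * θ)) :=
      measurableSet_Ioc.prod Metric.isOpen_ball.measurableSet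
    have h10 : ∫⁻ p in Ioc c s ×ˢ Metric.ball (0 : E) (r - 2 * θ),
        ENNReal.ofReal (fisher (g p.1) (G p.1) (lam + 4 * θ) p.2) ≤ ENNReal.ofReal (P s) := by
      have hYs : IntegrableOn (fun p : ℝ × E =>
          χ p.1 ^ 2 * (ψ p.2 ^ 2 * fisher (g p.1) (G p.1) lam₁ p.2)) (Ioc (-r ^ 2) s ×ˢ B) := by
        refine Integrable.mono (IntegrableOn.mono_set hY hsubA)
          (((hχs.continuous.comp continuous_fst).pow 2).aestronglyMeasurable.mul
            (((hψs.continuous.comp continuous_snd).pow 2).aestronglyMeasurable.mul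
              (IntegrableOn.mono_set hY hsubA).aestronglyMeasurable))
          (Eventually.of_forall fun p => ?_)
        rw [norm_mul, norm_mul, norm_pow, norm_pow, Real.norm_of_nonneg (hχ0 _),
          Real.norm_of_nonneg (hψ.nonneg _)]
        exact (mul_le_of_le_one_left (by positivity) (pow_le_one₀ (hχ0 p.1) (hχ1 p.1))).trans
          (mul_le_of_le_one_left (norm_nonneg _) (pow_le_one₀ (hψ.nonneg p.2) (hψ.le_one p.2)))
      rw [hP]
      simp only
      rw [ofReal_integral_eq_lintegral_ofReal hYs ?_]
      · refine (setLIntegral_mono' hm fun p hp => ?_).trans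
          (lintegral_mono_set (Set.prod_mono (Ioc_subset_Ioc_left hcr.le)
            (Metric.ball_subset_ball (by linarith))))
        apply ENNReal.ofReal_le_ofReal
        rw [hχc1 p.1 ⟨hp.1.1.le, hp.1.2.trans hs0.le⟩, hψ1 p.2 (by simpa using hp.2), one_pow,
          one_mul, one_mul]
        exact fisher_anti (by linarith)
          (hs.nonneg p.1 (hJb ⟨hcr.trans hp.1.1, hp.1.2.trans hs0.le⟩)) _
      · filter_upwards [ae_mono (Measure.restrict_mono hsubA le_rfl) hnn] with p hp
        exact mul_nonneg (sq_nonneg _) (mul_nonneg (sq_nonneg _)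
          (fisher_nonneg (hs.nonneg _ hp) _))
    refine h10.trans (ENNReal.ofReal_le_ofReal ?_)
    have h7 := hgood s hsI hsN
    have h8 : P s ≤ 4 / cc * R := by
      have := hX0 s hsI
      rw [div_mul_eq_mul_div, le_div_iff₀ hcc]
      linarith
    refine h8.trans (hfin _ hcc4.le ?_)
    exact (le_add_of_nonneg_left zero_le_one).trans (le_mul_of_one_le_left (by positivity) ht1)

/-! ### Iteration and conclusion -/

lemma LevelBound.mono {g : ℝ → E → ℝ} {G : ℝ → E → E} {r lam U U' : ℝ}
    (h : LevelBound g G r lam U) (hU : U ≤ U') : LevelBound g G r lam U' :=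
  ⟨h.1.mono fun _ hs => hs.trans (ENNReal.ofReal_le_ofReal hU),
    h.2.trans (ENNReal.ofReal_le_ofReal hU)⟩

/-- At every stage the mass above λ₀ on the smallest cylinder is at most U n, so it vanishes for
almost every time. Only the mass half of the level bound is used. -/
lemma ae_le_of_levelBound {g : ℝ → E → ℝ} {G : ℝ → E → E} {r₀ lam₀ : ℝ} (hr₀ : 0 ≤ r₀)
    (hm : AEStronglyMeasurable (fun p : ℝ × E => g p.1 p.2) (volume.restrict (cylinder r₀ 0 0)))
    {r lam U : ℕ → ℝ} (h : ∀ n, LevelBound g G (r n) (lam n) (U n)) (hr : ∀ n, r₀ ≤ r n)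
    (hlam : ∀ n, lam n ≤ lam₀) (hU : Tendsto U atTop (𝓝 0)) :
    ∀ᵐ p ∂volume.restrict (cylinder r₀ 0 0), g p.1 p.2 ≤ lam₀ := by
  rw [cylinder, zero_sub] at hm ⊢
  have hM : AEMeasurable (fun p : ℝ × E => ENNReal.ofReal (max (g p.1 p.2 - lam₀) 0))
      (volume.restrict (Ioc (-r₀ ^ 2) 0 ×ˢ Metric.ball (0 : E) r₀)) :=
    ((hm.aemeasurable.sub_const _).max aemeasurable_const).ennreal_ofReal
  have hz : ∀ᵐ s ∂volume.restrict (Ioc (-r₀ ^ 2) 0),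
      ∫⁻ v in Metric.ball (0 : E) r₀, ENNReal.ofReal (max (g s v - lam₀) 0) = 0 := by
    have h1 : ∀ n, ∀ᵐ s ∂volume.restrict (Ioc (-r₀ ^ 2) 0),
        ∫⁻ v in Metric.ball (0 : E) r₀, ENNReal.ofReal (max (g s v - lam₀) 0)
          ≤ ENNReal.ofReal (U n) := fun n => by
      have h2 : -(r n) ^ 2 ≤ -r₀ ^ 2 := neg_le_neg (pow_le_pow_left₀ hr₀ (hr n) 2)
      filter_upwards [ae_mono (Measure.restrict_mono (Ioc_subset_Ioc_left h2) le_rfl) (h n).1]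
        with s hs
      refine le_trans ?_ hs
      refine (lintegral_mono fun v => ENNReal.ofReal_le_ofReal ?_).trans
        (lintegral_mono_set (Metric.ball_subset_ball (hr n)))
      exact max_le_max (by linarith [hlam n]) le_rfl
    filter_upwards [ae_all_iff.2 h1] with s hs
    have h3 := ENNReal.tendsto_ofReal hU
    rw [ENNReal.ofReal_zero] at h3
    exact le_antisymm (ge_of_tendsto' h3 hs) zero_le
  have h0 : ∫⁻ p in Ioc (-r₀ ^ 2) 0 ×ˢ Metric.ball (0 : E) r₀,
      ENNReal.ofReal (max (g p.1 p.2 - lam₀) 0) = 0 := by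
    rw [Measure.volume_eq_prod, ← Measure.prod_restrict] at hM ⊢
    rw [lintegral_prod _ hM, lintegral_congr_ae hz, lintegral_zero]
  filter_upwards [(lintegral_eq_zero_iff' hM).1 h0] with p hp
  have h4 : max (g p.1 p.2 - lam₀) 0 ≤ 0 := ENNReal.ofReal_eq_zero.1 hp
  linarith [le_max_left (g p.1 p.2 - lam₀) 0]

/-- The iteration of the gain estimate of `exists_step`. -/
lemma levelBound_iterate {g : ℝ → E → ℝ} {G : ℝ → E → E} {K W x : ℝ}
    (hx : 0 ≤ x) (hx1 : x ≤ 1) (hsmall : K * 8 ^ 13 * W * x ^ 2 ≤ (1 / 2) ^ 21)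
    (hstep : ∀ r θ lam U : ℝ, 0 < θ → 4 * θ ≤ r → r ≤ 1 → 1 ≤ lam → lam + 4 * θ ≤ 2 → 0 ≤ U →
      U ≤ 1 → LevelBound g G r lam U →
      LevelBound g G (r - 2 * θ) (lam + 4 * θ) (K * (1 / θ) ^ 13 * W * U ^ (5 / 3 : ℝ)))
    (h0 : LevelBound g G 1 1 (x ^ 3)) (n : ℕ) :
    LevelBound g G (1 / 2 + 1 / 2 * (1 / 2) ^ n) (2 - (1 / 2) ^ n)
      ((x * ((1 / 2) ^ 7) ^ n) ^ 3) := by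
  induction n with
  | zero =>
    have e1 : (1 / 2 + 1 / 2 * (1 / 2) ^ 0 : ℝ) = 1 := by norm_num
    have e2 : (2 - (1 / 2) ^ 0 : ℝ) = 1 := by norm_num
    rw [e1, e2, pow_zero, mul_one]
    exact h0
  | succ n ih =>
    obtain ⟨y, hy⟩ : ∃ y : ℝ, y = (1 / 2) ^ n := ⟨_, rfl⟩
    have hy0 : 0 < y := by rw [hy]; positivity
    have hy1 : y ≤ 1 := by rw [hy]; exact pow_le_one₀ (by norm_num) (by norm_num)
    have e7 : ((1 / 2 : ℝ) ^ 7) ^ n = y ^ 7 := by rw [hy, pow_right_comm]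
    have e7' : ((1 / 2 : ℝ) ^ 7) ^ (n + 1) = y ^ 7 * (1 / 2) ^ 7 := by rw [pow_succ, e7]
    rw [e7, ← hy] at ih
    rw [e7', pow_succ, ← hy]
    have hz0 : 0 ≤ x * y ^ 7 := by positivity
    have hz1 : x * y ^ 7 ≤ 1 := mul_le_one₀ hx1 (by positivity) (pow_le_one₀ hy0.le hy1)
    -- With θ = y/8 and y = 2⁻ⁿ, the losses 2θ = y/4 and 4θ = y/2 halve the distances to the
    -- limiting radius 1/2 and level 2.
    have key := hstep (1 / 2 + 1 / 2 * y) (y / 8) (2 - y) ((x * y ^ 7) ^ 3) (by positivity)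
      (by linarith) (by linarith) (by linarith) (by linarith) (by positivity)
      (pow_le_one₀ hz0 hz1) ih
    have e3 : 1 / 2 + 1 / 2 * y - 2 * (y / 8) = 1 / 2 + 1 / 2 * (y * (1 / 2)) := by ring
    have e4 : 2 - y + 4 * (y / 8) = 2 - y * (1 / 2) := by ring
    rw [e3, e4] at key
    refine key.mono ?_
    have e5 : ((x * y ^ 7) ^ 3) ^ (5 / 3 : ℝ) = (x * y ^ 7) ^ 5 := by
      rw [← Real.rpow_natCast, ← Real.rpow_mul hz0, ← Real.rpow_natCast]
      norm_num
    -- Writing the bound as a cube turns the power 5/3 into a fifth power. Then y³⁵ · y⁻¹³ = y²¹ ·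
    -- y, the extra y ≤ 1 is discarded, and the smallness of W x² supplies the factor 2⁻²¹ = (2⁻⁷)³
    -- of the next stage.
    calc K * (1 / (y / 8)) ^ 13 * W * ((x * y ^ 7) ^ 3) ^ (5 / 3 : ℝ)
        = (K * 8 ^ 13 * W * x ^ 2) * (x ^ 3 * y ^ 21 * y) := by
          rw [e5]
          field_simp
      _ ≤ (1 / 2) ^ 21 * (x ^ 3 * y ^ 21 * 1) := by gcongr
      _ = (x * (y ^ 7 * (1 / 2) ^ 7)) ^ 3 := by ring

end Landau

end

/-! ### The De Giorgi lemma: choice of the threshold -/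

theorem mainTheorem5 (m₀ M₀ E₀ H₀ : ℝ) (hm₀ : 0 < m₀) (hM₀ : m₀ < M₀) (hE₀ : 0 < E₀) (hH₀ : 0 < H₀)
    (δ₀ R₀ : ℝ) (hδ₀ : 0 < δ₀) (hδ₀' : δ₀ < 1) (hR₀ : 0 < R₀)
    (ρ : ℝ) (hρ : 0 ≤ ρ) (kδ k₁ kR : ℝ) :
    ∃ η : ℝ, 0 < η ∧ η < 1 ∧
      ∀ k : ℝ → ℝ, Landau.IsCollisionKernel k → k δ₀ = kδ → k 1 = k₁ → k R₀ = kR →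
      ∀ (T : ℝ) (fin : Landau.E → ℝ) (f : ℝ → Landau.E → ℝ), 0 < T →
        Landau.HydroBounds m₀ M₀ E₀ H₀ fin → Landau.IsSuitable k T fin f →
      ∀ (t₀ : ℝ) (v₀ : Landau.E) (ε : ℝ), 0 < t₀ → t₀ < T → ‖v₀‖ = ρ →
        0 < ε → ε < 1 → 4 * ε ^ 2 ≤ t₀ →
      ∀ Z : ℝ, 1 ≤ Z →
        essSup (Landau.longRange k ε (Landau.scaled ε t₀ v₀ f))
          (volume.restrict (Landau.cylinder 1 0 0)) ≤ ENNReal.ofReal Z →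
        Landau.localQuantity (Landau.scaledTimes ε t₀ T) (Landau.scaled ε t₀ v₀ f)
          ≤ ENNReal.ofReal (η * Z ^ (-(3 / 2) : ℝ)) →
        ∀ᵐ p ∂(volume.restrict (Landau.cylinder (1 / 2) 0 0)),
          Landau.scaled ε t₀ v₀ f p.1 p.2 ≤ 2 := by
  -- A nonpositive prescribed value at 1 is never attained by an admissible kernel, and any η will
  -- do.
  rcases le_or_gt k₁ 0 with hk₁ | hk₁
  · refine ⟨1 / 2, by norm_num, by norm_num, fun k hk _ h1 => ?_⟩
    exact absurd (h1 ▸ hk.pos 1 one_pos) (not_lt.2 hk₁)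
  -- Non-concentration is required at the points v₀ + εv with |v| < 1; hence the radius ρ + 1.
  obtain ⟨R, σ, hR, hσ, hσ1, hco⟩ :=
    Landau.exists_coercive_set m₀ E₀ H₀ (ρ + 1) hm₀ (by linarith)
  obtain ⟨K, hK, hstep⟩ := Landau.exists_step k₁ (k₁ / R ^ 3 * σ ^ 2 * (m₀ / 2)) σ hk₁.le
    (by positivity) hσ hσ1
  set C₀ := 1 + 2 * k₁ * (volume.real (Metric.ball (0 : Landau.E) 2) + 1) with hC₀
  have hC₀1 : 1 ≤ C₀ := le_add_of_nonneg_right (by positivity)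
  set L := K * 8 ^ 13 * C₀ with hL
  have hL1 : 1 ≤ L := one_le_mul_of_one_le_of_one_le
    (one_le_mul_of_one_le_of_one_le hK (by norm_num)) hC₀1
  -- Chosen so that Lξ² = 2⁻²²/L ≤ 2⁻²¹, the smallness required by the iteration.
  set ξ := (1 / 2 : ℝ) ^ 11 / L with hξ
  have hξ0 : 0 < ξ := by positivity
  have hξ1 : ξ ≤ 1 := (div_le_one (by positivity)).2 (le_trans (by norm_num) hL1)
  have hξ3 : ξ ^ 3 ≤ 1 := pow_le_one₀ hξ0.le hξ1
  have hLξ : L * ξ ^ 2 ≤ (1 / 2) ^ 21 := by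
    have h1 : L * ξ ^ 2 = (1 / 2) ^ 22 / L := by rw [hξ]; field_simp
    rw [h1]
    exact (div_le_self (by positivity) hL1).trans (by norm_num)
  -- The division by 4 compensates the factor 4 between |∇√g|² and the Fisher density.
  refine ⟨ξ ^ 3 / 4, by positivity, by linarith, ?_⟩
  intro k hk _ h1 _ T fin f _ hin hf t₀ v₀ ε _ ht₀ hv₀ hε hε1 h4 Z hZ hfar hloc
  have hZ0 : 0 < √Z := Real.sqrt_pos.2 (by linarith)
  have hZ1 : 1 ≤ √Z := Real.one_le_sqrt.2 hZ
  -- The initial bound is then x³ = ξ³ Z^{-3/2}. As W ≤ C₀Z, the product W x² is at most C₀ξ²,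
  -- independently of Z.
  set x := ξ / √Z with hx
  have hx0 : 0 ≤ x := by positivity
  have hx1 : x ≤ 1 := (div_le_one hZ0).2 (hξ1.trans hZ1)
  have hx3 : ξ ^ 3 / 4 * Z ^ (-(3 / 2) : ℝ) = x ^ 3 / 4 := by
    have h2 : Z ^ (-(3 / 2) : ℝ) = (√Z ^ 3)⁻¹ := by
      rw [Real.rpow_neg (by linarith), Real.sqrt_eq_rpow, ← Real.rpow_natCast,
        ← Real.rpow_mul (by linarith)]
      norm_num
    rw [h2, hx]
    field_simp
  rw [hx3] at hloc
  have hx31 : x ^ 3 ≤ 1 := pow_le_one₀ hx0 hx1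
  have hs := hf.isScaledSolution hk hin hε hε1 h4 ht₀ hv₀ hR hσ hco (by linarith) hfar
    (hloc.trans (ENNReal.ofReal_le_one.2 (by linarith)))
  have h0 := hf.levelBound_one hk hin hm₀ hε h4 ht₀ (by positivity) hloc
  have e4 : 4 * (x ^ 3 / 4) = x ^ 3 := by ring
  rw [e4] at h0
  rw [h1] at hs
  set W := Z + 2 * k₁ * (volume.real (Metric.ball (0 : Landau.E) 2) + 1) with hW
  have hb : 0 < (T - t₀) / ε ^ 2 := div_pos (by linarith) (by positivity)
  have hW1 : 1 ≤ W := hZ.trans (le_add_of_nonneg_right (by positivity))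
  have hWZ : W ≤ C₀ * Z := by
    rw [hW, hC₀, add_mul, one_mul]
    exact add_le_add_right (le_mul_of_one_le_right (by positivity) hZ) _
  have hsmall : K * 8 ^ 13 * W * x ^ 2 ≤ (1 / 2) ^ 21 := by
    have h2 : K * 8 ^ 13 * (C₀ * Z) * x ^ 2 = L * ξ ^ 2 := by
      rw [hx, div_pow, Real.sq_sqrt (by linarith), hL]
      field_simp
    exact (by gcongr : K * 8 ^ 13 * W * x ^ 2 ≤ K * 8 ^ 13 * (C₀ * Z) * x ^ 2).trans
      (h2.le.trans hLξ)
  have hq : k (ε * 1) ≤ k₁ := by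
    rw [← h1, mul_one]
    exact hk.mono (mem_Ioi.2 hε) (mem_Ioi.2 one_pos) hε1.le
  refine Landau.ae_le_of_levelBound (by norm_num) (hs.aesm.mono_measure
      (Measure.restrict_mono ?_ le_rfl))
    (Landau.levelBound_iterate hx0 hx1 hsmall
      (hstep _ ε _ _ W _ _ hs hε hb hq hW1) h0) (fun n => ?_) (fun n => ?_) ?_
  · rintro ⟨s, v⟩ ⟨h2, -⟩
    exact ⟨⟨by norm_num at h2; linarith [h2.1], h2.2.trans_lt hb⟩, mem_univ _⟩
  · linarith [show (0 : ℝ) < (1 / 2) ^ n by positivity]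
  · linarith [show (0 : ℝ) < (1 / 2) ^ n by positivity]
  · have h2 : Tendsto (fun n : ℕ => ((1 / 2 : ℝ) ^ 7) ^ n) atTop (𝓝 0) :=
      tendsto_pow_atTop_nhds_zero_of_lt_one (by positivity) (by norm_num)
    simpa using (h2.const_mul x).pow 3
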